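/- **Setting.** All algorithms and adversaries are (strict) probabilistic polynomial time in the security parameter $\ell$; *negligible* means smaller than every inverse polynomial in $\ell$. The system is built from a digital signature scheme $\mathsf{DS}$, Pedersen commitments $\mathsf{Com}(m,r)=g^m h^r$ in a cyclic group of prime order $q$, a keyed function $\mathsf{PRF}$ with $n(\ell)$-bit outputs, and an ORAM protocol with $N=N(\ell)$ blocks (polynomially many) of $2\ell$ bits, whose clients keep nothing but a key between accesses. An ORAM access that the client completes replaces the database $\mathsf{DB}$ by a new version; an access that is broken off or rejected by the client (output $\bot$) leaves the current version unchanged. A server *rewinds* $\mathsf{DB}$ if some reply of it differs from the honest reply computed from the current version but equals the one computed from an earlier version. *Setup.* Generate $(\mathbb G,q,g,h)$, an ORAM key and initial database $(sk,\mathsf{DB})$, a PRF key $K$, and a signing key pair $(sk_{RS},pk_{RS})$ of the registration station. *Registration* of a household with budget $bud<2^\ell$. The registration station sends the next free identifier $id_H<N$ and $sk_{RS}$; the card signs a random $r\in\mathbb Z_q$ with $sk_{RS}$ and aborts if this does not verify under $pk_{RS}$; it receives $bud$, writes the record $bud\,\|\,0$ (balance and counter, $\ell$ bits each) into block $id_H$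 by an ORAM write, and stores $(sk_{RS},pk_{RS},sk,K,id_H)$. All cards of a household have this same state. *Spend.* The card receives $price$ and a reclaim period $\varepsilon$ from the vendor, who also acts as ORAM server; it reads $balance\,\|\,ctr$ from block $id_H$ and aborts if $price>balance$; it increments $ctr$, draws $r\in\mathbb Z_q$ uniformly and sets $Com=g^{price}h^r$, $\tau=\mathsf{PRF}_K(id_H\|ctr)$, $\sigma=\mathsf{Sign}(sk_{RS},\tau\|\varepsilon\|Com)$; it writes $(balance-price)\,\|\,ctr$ into block $id_H$, then sends $\pi=(\sigma,\tau,Com,r)$ and outputs $(\mathsf{success},price,\varepsilon)$. It aborts with $\bot$ if one of the ORAM accesses returns $\bot$. **Experiment $\mathsf{Exp}_{\mathcal A,b}(1^\ell)$**, $b\in\{0,1\}$. After the setup, $\mathcal A$ receives $(\mathbb G,q,g,h)$, $sk_{RS}$, $pk_{RS}$ and $\mathsf{DB}$. It has two oracles, called one after the other: (i) register an honest household with a budget and unused card identifiers of its choice, executed by the honest registration station on the current database; $\mathcal A$ receives the new card identifiers and the full transcript; (ii) run $\mathsf{Spend}$ with a registered card of its choice, $\mathcal A$ playing a malicious vendor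 (and ORAM server) who may send arbitrary messages or break off. Then $\mathcal A$ outputs two identifiers $t_0,t_1$ of registered cards, a price and a period $\varepsilon$ (otherwise the experiment returns $\bot$). Now $\mathcal A$ runs $\mathsf{Spend}$ with card $t_b$; then it may again use the oracles, but not spend with cards of the households of $t_0,t_1$; then it runs $\mathsf{Spend}$ with card $t_{1-b}$. If one of these two transactions does not succeed with the announced price and period, the experiment returns $\bot$. Finally $\mathcal A$ may use the oracles without restriction and outputs a guess $b'$, which is the result of the experiment. Let $$\mathsf{Adv}_{\mathcal A}(\ell)=\bigl|\Pr[\mathsf{Exp}_{\mathcal A,0}(1^\ell)=1]-\Pr[\mathsf{Exp}_{\mathcal A,1}(1^\ell)=1]\bigr|.$$ **Assumptions.** In the *ORAM game* with bit $\beta$ the adversary plays a malicious server: it gets the initial database, adaptively chooses pairs of reads or pairs of writes, the client executes the $\beta$-th component of each with the adversary as the server (who may send arbitrary messages or break off), and the adversary sees the client's messages and whether the client accepts. The ORAM is - *oblivious* if for every adversary the probabilities, for $\beta=0$ and $\beta=1$, that it outputs $1$ without ever having rewound the database differ by a negligible amount; - *integrity-protected* if for every adversary, in both games, the probability that the client accepts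 an access in which some reply was not the honest one from the current database, while no rewinding has occurred so far, is negligible; - *correct* if for every adversary, in both games, the probability is negligible that (before any rewinding and any violation of integrity) an access is rejected by the client although all replies so far were honest, or an honestly served read returns something other than the value last written to its block. The PRF is *secure* if no adversary distinguishes oracle access to $\mathsf{PRF}_K$ for a random key $K$ from oracle access to a uniformly random function with values in $\{0,1\}^{n(\ell)}$ with non-negligible advantage. **Theorem.** If the ORAM is correct, integrity-protected and oblivious and the PRF is secure, then the system provides unlinkability against vendors that do not rewind the database: for every probabilistic polynomial-time adversary $\mathcal A$ that, in $\mathsf{Exp}_{\mathcal A,0}$ and in $\mathsf{Exp}_{\mathcal A,1}$, rewinds the database with at most negligible probability, $\mathsf{Adv}_{\mathcal A}(\ell)$ is negligible. -/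

import Mathlib

namespace AidWallet

/-! ### Strings, a machine model with a cost measure, polynomial time -/

/-- The data on which all algorithms work: finite binary trees with natural numbers (in binary)
at the leaves. They serve as the strings, tuples and lists of the protocol. -/
inductive Val : Type
  | nat (n : ℕ) : Val
  | pair (a b : Val) : Val
  deriving DecidableEq

/-- Length of a value: one unit per node plus the number of binary digits at the leaves. -/
def Val.size : Val → ℕ
  | .nat n => 1 + Nat.size n
  | .pair a b => 1 + a.size + b.size

def Val.fst : Val → Val
  | .pair a _ => a
  | .nat _ => .nat 0

def Val.snd : Val → Val
  | .pair _ b => b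
  | .nat _ => .nat 0

/-- A list of values as one value. -/
def Val.list : List Val → Val
  | [] => .nat 0
  | v :: vs => .pair v (Val.list vs)

/-- The list of naturals that a value codes. -/
def Val.toNats : Val → List ℕ
  | .pair (.nat n) v => n :: v.toNats
  | _ => []

/-- The string `1^ℓ` (the number whose binary expansion is `ℓ` ones). -/
def ones (ℓ : ℕ) : Val := .nat (2 ^ ℓ - 1)

/-- Primitive instructions. -/
inductive Prim : Type
  | fst | snd | isNat | size | add | sub | mul | div | mod | le | eq

def Prim.eval : Prim → Val → Val
  | .fst, v => v.fst
  | .snd, v => v.snd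
  | .isNat, .nat _ => .nat 1
  | .size, v => .nat v.size
  | .add, .pair (.nat a) (.nat b) => .nat (a + b)
  | .sub, .pair (.nat a) (.nat b) => .nat (a - b)
  | .mul, .pair (.nat a) (.nat b) => .nat (a * b)
  | .div, .pair (.nat a) (.nat b) => .nat (a / b)
  | .mod, .pair (.nat a) (.nat b) => .nat (a % b)
  | .le, .pair (.nat a) (.nat b) => .nat (if a ≤ b then 1 else 0)
  | .eq, .pair a b => .nat (if a = b then 1 else 0)
  | _, _ => .nat 0

/-- Programs: primitives, sequencing, tupling, branching, and unbounded loops. -/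
inductive Code : Type
  | id : Code
  | const (v : Val) : Code
  | prim (p : Prim) : Code
  | comp (g f : Code) : Code
  | pair (f g : Code) : Code
  | ite (c f g : Code) : Code
  | loop (f : Code) : Code

/-- `Runs c v w t`: program `c` on input `v` halts with output `w` at cost `t`. Every instruction
is charged for the length of what it reads and writes. `loop f` repeats `f`, whose output is a flag
paired with the new loop state, until the flag is `0`. -/
inductive Runs : Code → Val → Val → ℕ → Prop
  | id (v : Val) : Runs .id v v (1 + v.size)
  | const (w v : Val) : Runs (.const w) v w (1 + w.size)
  | prim (p : Prim) (v : Val) : Runs (.prim p) v (p.eval v) (1 + v.size + (p.eval v).size)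
  | comp {f g : Code} {v w u : Val} {s t : ℕ} :
      Runs f v w s → Runs g w u t → Runs (.comp g f) v u (1 + s + t)
  | pair {f g : Code} {v a b : Val} {s t : ℕ} :
      Runs f v a s → Runs g v b t → Runs (.pair f g) v (.pair a b) (1 + s + t)
  | ite_true {c f g : Code} {v k w : Val} {s t : ℕ} :
      Runs c v k s → k ≠ .nat 0 → Runs f v w t → Runs (.ite c f g) v w (1 + s + t)
  | ite_false {c f g : Code} {v w : Val} {s t : ℕ} :
      Runs c v (.nat 0) s → Runs g v w t → Runs (.ite c f g) v w (1 + s + t)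
  | loop_stop {f : Code} {v w : Val} {s : ℕ} :
      Runs f v (.pair (.nat 0) w) s → Runs (.loop f) v w (1 + s)
  | loop_next {f : Code} {v k w u : Val} {s t : ℕ} :
      Runs f v (.pair k w) s → k ≠ .nat 0 → Runs (.loop f) w u t → Runs (.loop f) v u (1 + s + t)

/-- The polynomial bounds `n ^ d + d`. -/
def polyBound (d n : ℕ) : ℕ := n ^ d + d

/-- `f` is computed by a program in time polynomial in the length of the input. -/
def PolyTime (f : Val → Val) : Prop :=
  ∃ (c : Code) (d : ℕ), ∀ v, ∃ t, t ≤ polyBound d v.size ∧ Runs c v (f v) t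

/-- `f ℓ` (written in binary) can be computed from `1^ℓ` in polynomial time. -/
def PolyComputable (f : ℕ → ℕ) : Prop :=
  ∃ F : Val → Val, PolyTime F ∧ ∀ ℓ, F (ones ℓ) = .nat (f ℓ)

/-- Negligible: smaller than every inverse polynomial. -/
def Negligible (f : ℕ → ℝ) : Prop :=
  Asymptotics.SuperpolynomialDecay Filter.atTop (fun ℓ : ℕ => (ℓ : ℝ)) f

/-! ### Probabilistic algorithms, adversaries, games -/

/-- The uniform distribution on `{0, …, m}`. -/
noncomputable def unif (m : ℕ) : PMF ℕ := (PMF.uniformOfFintype (Fin (m + 1))).map Fin.val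

/-- A probabilistic polynomial-time algorithm: a polynomial-time function of `1^ℓ`, the input and
a coin that is uniform on `{0, …, coins ℓ}`. -/
structure RandAlg where
  coins : ℕ → ℕ
  run : Val → Val
  coins_poly : PolyComputable coins
  run_poly : PolyTime run

/-- Output on input `x` with coin `r`. -/
def RandAlg.out (R : RandAlg) (ℓ : ℕ) (x : Val) (r : ℕ) : Val :=
  R.run (.pair (ones ℓ) (.pair x (.nat r)))

noncomputable def RandAlg.sample (R : RandAlg) (ℓ : ℕ) (x : Val) : PMF Val :=
  (unif (R.coins ℓ)).map (R.out ℓ x)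

/-- A (strict) probabilistic polynomial-time adversary: an interactive machine whose transition
function is polynomial-time, and which is activated at most `ℓ ^ deg + deg` times with state and
message together of length at most `ℓ ^ deg + deg`. -/
structure Adversary where
  step : Val → Val
  step_poly : PolyTime step
  deg : ℕ

/-- One activation: from the state and the message received to the new state and the message
sent. -/
def Adversary.activate (A : Adversary) (ℓ : ℕ) (st msg : Val) : Val × Val :=
  let v := A.step (.pair (ones ℓ) (.pair st msg))
  if v.size ≤ polyBound A.deg ℓ then (v.fst, v.snd) else (.nat 0, .nat 0)

/-- A challenger: a first message to the adversary and a randomized answer to each message. -/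
structure Game where
  State : Type
  start : PMF (State × Val)
  respond : State → Val → PMF (State × Val)

/-- `n` further activations of the adversary. A message `(0, m)` is a request of the adversary for
a fresh random number, uniform on `{0, …, m}`; all others go to the challenger. -/
noncomputable def Game.play (G : Game) (A : Adversary) (ℓ : ℕ) :
    ℕ → G.State → Val → Val → PMF G.State
  | 0, s, _, _ => PMF.pure s
  | n + 1, s, st, msg =>
    match A.activate ℓ st msg with
    | (st', .pair (.nat 0) (.nat m)) => (unif m).bind fun x => G.play A ℓ n s st' (.nat x)
    | (st', a) => (G.respond s a).bind fun p => G.play A ℓ n p.1 st' p.2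

/-- Distribution of the final state of the challenger. -/
noncomputable def Game.run (G : Game) (A : Adversary) (ℓ : ℕ) : PMF G.State :=
  G.start.bind fun p => G.play A ℓ (polyBound A.deg ℓ) p.1 (.nat 0) p.2

/-- Probability that the final state of the challenger satisfies `E`. -/
noncomputable def Game.prob (G : Game) (A : Adversary) (ℓ : ℕ) (E : G.State → Bool) : ℝ :=
  ((G.run A ℓ).map E true).toReal

/-! ### Digital signatures and Pedersen commitments -/

/-- Key generation outputs `(sk, pk)`; signing takes `(sk, m)`; verification takes
`(1^ℓ, (pk, (m, σ)))` and accepts with a nonzero output. -/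
structure SignatureScheme where
  keygen : RandAlg
  sign : RandAlg
  verif : Val → Val
  verif_poly : PolyTime verif

def SignatureScheme.accepts (D : SignatureScheme) (ℓ : ℕ) (pk m σ : Val) : Bool :=
  D.verif (.pair (ones ℓ) (.pair pk (.pair m σ))) != .nat 0

/-- Pedersen commitments: `gen` outputs the description `pp` of a cyclic group of prime order `q`
with two generators `g`, `h`; the commitment to `m` with randomness `r` is `g ^ m * h ^ r`. -/
structure Pedersen where
  gen : RandAlg
  Grp : Val → Type
  inst : ∀ pp, CommGroup (Grp pp)
  q : Val → ℕ
  g : ∀ pp, Grp pp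
  h : ∀ pp, Grp pp
  /-- The string that represents a group element. -/
  enc : ∀ pp, Grp pp → Val
  enc_injective : ∀ pp, Function.Injective (enc pp)
  q_prime : ∀ ℓ, ∀ pp ∈ (gen.sample ℓ (.nat 0)).support, (q pp).Prime
  card_eq : ∀ ℓ, ∀ pp ∈ (gen.sample ℓ (.nat 0)).support, Nat.card (Grp pp) = q pp
  g_gen : ∀ ℓ, ∀ pp ∈ (gen.sample ℓ (.nat 0)).support, Subgroup.zpowers (g pp) = ⊤
  h_gen : ∀ ℓ, ∀ pp ∈ (gen.sample ℓ (.nat 0)).support, Subgroup.zpowers (h pp) = ⊤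
  q_poly : ∃ F, PolyTime F ∧
    ∀ ℓ, ∀ pp ∈ (gen.sample ℓ (.nat 0)).support, F pp = .nat (q pp)
  commit_poly : ∃ F, PolyTime F ∧
    ∀ ℓ, ∀ pp ∈ (gen.sample ℓ (.nat 0)).support, ∀ m r : ℕ,
      F (.pair pp (.pair (.nat m) (.nat r))) = enc pp (g pp ^ m * h pp ^ r)

attribute [instance] Pedersen.inst

def Pedersen.commit (C : Pedersen) (pp : Val) (m r : ℕ) : Val :=
  C.enc pp (C.g pp ^ m * C.h pp ^ r)

/-- A uniform element of `ℤ_q`, as a number in `{0, …, q - 1}`. -/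
noncomputable def Pedersen.scalar (C : Pedersen) (pp : Val) : PMF ℕ := unif (C.q pp - 1)

/-! ### Pseudorandom functions -/

/-- A keyed function with outputs of `outLen ℓ` bits. `eval` takes `(1^ℓ, (K, x))`. -/
structure PRF where
  keygen : RandAlg
  eval : Val → Val
  eval_poly : PolyTime eval
  outLen : ℕ → ℕ
  outLen_poly : PolyComputable fun ℓ => 2 ^ outLen ℓ
  eval_range : ∀ ℓ K x, ∃ y < 2 ^ outLen ℓ, eval (.pair (ones ℓ) (.pair K x)) = .nat y

def PRF.apply (F : PRF) (ℓ : ℕ) (K x : Val) : Val := F.eval (.pair (ones ℓ) (.pair K x))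

structure PRFState where
  key : Val
  /-- The values of the random function that have been drawn so far. -/
  table : Val → Option Val
  guess : Option Bool

/-- The oracle answers with the keyed function (`ideal = false`) or with a random function
(`ideal = true`), whose values are drawn when they are first asked for.
Messages of the adversary: `(1, x)` asks for the value at `x`, `(2, g)` is the final guess. -/
noncomputable def PRF.game (F : PRF) (ideal : Bool) (ℓ : ℕ) : Game where
  State := PRFState
  start := (F.keygen.sample ℓ (.nat 0)).map fun K => (⟨K, fun _ => none, none⟩, .nat 0)
  respond s a :=
    match s.guess, a with
    | none, .pair (.nat 1) x =>
      if ideal then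
        match s.table x with
        | some y => PMF.pure (s, y)
        | none => (unif (2 ^ F.outLen ℓ - 1)).map fun y =>
            ({ s with table := Function.update s.table x (some (.nat y)) }, .nat y)
      else PMF.pure (s, F.apply ℓ s.key x)
    | none, .pair (.nat 2) (.nat g) => PMF.pure ({ s with guess := some (g != 0) }, .nat 0)
    | _, _ => PMF.pure (s, .nat 0)

/-- The PRF is secure: no probabilistic polynomial-time adversary tells it from a random
function with more than negligible advantage. -/
def PRF.Secure (F : PRF) : Prop :=
  ∀ A : Adversary, Negligible fun ℓ =>
    |(F.game false ℓ).prob A ℓ (fun s => s.guess == some true) -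
      (F.game true ℓ).prob A ℓ (fun s => s.guess == some true)|

/-! ### Oblivious RAM -/

/-- Operations of a client: read block `b`, or write `d` into block `b`. -/
inductive Op : Type
  | read (b : ℕ) : Op
  | write (b d : ℕ) : Op

def Op.toVal : Op → Val
  | .read b => .pair (.nat 0) (.nat b)
  | .write b d => .pair (.nat 1) (.pair (.nat b) (.nat d))

/-- An ORAM protocol with `N ℓ` blocks at security parameter `ℓ`.
* `init` takes `1^N` and outputs `(sk, DB)`.
* `client` is the next-message function of the client (`Read` and `Write`). It takes
  `(sk, (op, replies))`, the server's replies so far with the latest first, and a coin that is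
  drawn once per access. Output `(0, c)`: send `c` and wait for a reply; `(1, (c, out))`: send the
  last message `c` and finish with output `out`; anything else: stop with `⊥`.
* `serve` is the server: from `(1^ℓ, (DB, c))` to `(DB', reply)`.
Clients keep nothing but `sk` between accesses. The client sends at most `ℓ ^ deg + deg`
messages, and messages of the client and the database have length at most `ℓ ^ deg + deg`. -/
structure ORAM (N : ℕ → ℕ) where
  init : RandAlg
  client : RandAlg
  serve : Val → Val
  serve_poly : PolyTime serve
  cap_poly : PolyComputable fun ℓ => 2 ^ N ℓ - 1
  deg : ℕ
  init_bound : ∀ ℓ, ∀ v ∈ (init.sample ℓ (ones (N ℓ))).support, v.size ≤ polyBound deg ℓ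
  client_bound : ∀ ℓ x r, (client.out ℓ x r).size ≤ polyBound deg ℓ
  serve_bound : ∀ ℓ db c, db.size ≤ polyBound deg ℓ → c.size ≤ polyBound deg ℓ →
    (serve (.pair (ones ℓ) (.pair db c))).fst.size ≤ polyBound deg ℓ

section Access
variable {N : ℕ → ℕ}

/-- The honest server's reply to `c` and its next database. -/
def ORAM.reply (O : ORAM N) (ℓ : ℕ) (db c : Val) : Val :=
  (O.serve (.pair (ones ℓ) (.pair db c))).snd

def ORAM.nextDB (O : ORAM N) (ℓ : ℕ) (db c : Val) : Val :=
  (O.serve (.pair (ones ℓ) (.pair db c))).fst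

/-- The database left by the completed accesses, and all its earlier versions. -/
structure Store where
  db : Val
  old : List Val

/-- An access that is under way. `db` is the current database as the honest server would have it
at this point of the access, and `stale` holds what the honest server would have if it had started
the access from an earlier version. `tampered`: some reply was not the honest one. -/
structure Access where
  op : Op
  coin : ℕ
  replies : List Val
  db : Val
  stale : List Val
  tampered : Bool

inductive AccessResult : Type
  /-- The client has sent `c` and waits for a reply. -/
  | wait (a : Access) (c : Val) : AccessResult
  /-- The client has sent its last message `c` and finished with output `out`. -/
  | done (db c out : Val) (tampered : Bool) : AccessResult
  /-- The client has stopped with `⊥`. -/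
  | fail (tampered : Bool) : AccessResult

def Access.new (op : Op) (coin : ℕ) (S : Store) : Access := ⟨op, coin, [], S.db, S.old, false⟩

/-- The next move of the client. -/
def ORAM.move (O : ORAM N) (ℓ : ℕ) (sk : Val) (a : Access) : AccessResult :=
  if polyBound O.deg ℓ ≤ a.replies.length then .fail a.tampered
  else
    match O.client.out ℓ (.pair sk (.pair a.op.toVal (Val.list a.replies))) a.coin with
    | .pair (.nat 0) c => .wait a c
    | .pair (.nat 1) (.pair c out) => .done (O.nextDB ℓ a.db c) c out a.tampered
    | _ => .fail a.tampered

/-- The client, having sent `c`, receives the reply `m`. -/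
def ORAM.receive (O : ORAM N) (ℓ : ℕ) (sk : Val) (a : Access) (c m : Val) : AccessResult :=
  O.move ℓ sk
    { a with
      replies := m :: a.replies
      db := O.nextDB ℓ a.db c
      stale := a.stale.map fun d => O.nextDB ℓ d c
      tampered := a.tampered || m != O.reply ℓ a.db c }

/-- The reply `m` to `c` rewinds the database: it is not the reply from the current database, but
the one from an earlier version. -/
def ORAM.rewinds (O : ORAM N) (ℓ : ℕ) (a : Access) (c m : Val) : Bool :=
  m != O.reply ℓ a.db c && a.stale.any fun d => m == O.reply ℓ d c

/-- A completed access turns the database into `db`; an access that is not completed leaves it as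
it was. -/
def Store.commit (S : Store) (db : Val) : Store := ⟨db, S.db :: S.old⟩

/-- An access with the honest server: the new database (if the client succeeds) and the
transcript. -/
def ORAM.honestRun (O : ORAM N) (ℓ : ℕ) (sk : Val) : ℕ → AccessResult → Option Val × List Val
  | _, .done db c _ _ => (some db, [c])
  | _, .fail _ => (none, [])
  | 0, .wait _ c => (none, [c])
  | n + 1, .wait a c =>
    let m := O.reply ℓ a.db c
    let p := O.honestRun ℓ sk n (O.receive ℓ sk a c m)
    (p.1, c :: m :: p.2)

/-- Blocks hold `2ℓ` bits. -/
def validBlock (ℓ d : ℕ) : Bool := decide (d < 2 ^ (2 * ℓ))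

structure ORAMState where
  sk : Val
  store : Store
  /-- The contents of the blocks according to the completed writes. -/
  mem : ℕ → Option ℕ
  session : Option (Access × Val)
  /-- The server has rewound the database. -/
  rewound : Bool
  /-- An access with a modified database has been accepted by the client. -/
  broken : Bool
  /-- An honestly served access has failed or has returned a wrong value. -/
  wrong : Bool
  guess : Option Bool

/-- Bookkeeping after a move of the client; the adversary sees the messages of the client and
whether it succeeds, but not what a read returns. -/
def ORAMState.after (s : ORAMState) (op : Op) : AccessResult → ORAMState × Val
  | .wait a c => ({ s with session := some (a, c) }, .pair (.nat 1) c)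
  | .fail t =>
    ({ s with
        session := none
        wrong := s.wrong || (!s.rewound && !s.broken && !t) }, .nat 0)
  | .done db c out t =>
    ({ s with
        session := none
        store := s.store.commit db
        mem := match op with
          | .read _ => s.mem
          | .write b d => Function.update s.mem b (some d)
        broken := s.broken || (!s.rewound && t)
        wrong := s.wrong || (!s.rewound && !s.broken && !t &&
          match op with
          | .read b => (match s.mem b with
            | some d => out != .nat d
            | none => false)
          | .write _ _ => false) }, .pair (.nat 2) c)

noncomputable def ORAM.begin (O : ORAM N) (ℓ : ℕ) (s : ORAMState) (op : Op) :
    PMF (ORAMState × Val) :=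
  (unif (O.client.coins ℓ)).map fun r => s.after op (O.move ℓ s.sk (Access.new op r s.store))

/-- The ORAM game. The adversary is the (malicious) server. It gets the initial database and then
chooses, one after the other, pairs of reads or pairs of writes, of which the client executes the
first (`β = false`) or the second (`β = true`) with the adversary as the server.
Messages of the adversary outside an access: `(1, (b₀, b₁))` reads, `(2, ((b₀, d₀), (b₁, d₁)))`
writes, `(3, g)` is the final guess. During an access: `(4, m)` replies `m` to the client, anything
else breaks off the access. -/
noncomputable def ORAM.game (O : ORAM N) (β : Bool) (ℓ : ℕ) : Game where
  State := ORAMState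
  start := (O.init.sample ℓ (ones (N ℓ))).map fun v =>
    (⟨v.fst, ⟨v.snd, []⟩, fun _ => none, none, false, false, false, none⟩, v.snd)
  respond s msg :=
    match s.guess, s.session, msg with
    | none, some (a, c), .pair (.nat 4) m =>
      PMF.pure (({ s with rewound := s.rewound || O.rewinds ℓ a c m }).after a.op
        (O.receive ℓ s.sk a c m))
    | none, some _, _ => PMF.pure ({ s with session := none }, .nat 0)
    | none, none, .pair (.nat 1) (.pair (.nat b₀) (.nat b₁)) =>
      if b₀ < N ℓ ∧ b₁ < N ℓ then O.begin ℓ s (.read (bif β then b₁ else b₀))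
      else PMF.pure (s, .nat 0)
    | none, none, .pair (.nat 2) (.pair (.pair (.nat b₀) (.nat d₀)) (.pair (.nat b₁) (.nat d₁))) =>
      if b₀ < N ℓ ∧ b₁ < N ℓ ∧ validBlock ℓ d₀ ∧ validBlock ℓ d₁ then
        O.begin ℓ s (bif β then .write b₁ d₁ else .write b₀ d₀)
      else PMF.pure (s, .nat 0)
    | none, none, .pair (.nat 3) (.nat g) =>
      PMF.pure ({ s with guess := some (g != 0) }, .nat 0)
    | _, _, _ => PMF.pure (s, .nat 0)

/-- Obliviousness: a server that does not rewind the database does not learn which blocks are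
accessed. -/
def ORAM.Oblivious (O : ORAM N) : Prop :=
  ∀ A : Adversary, Negligible fun ℓ =>
    |(O.game false ℓ).prob A ℓ (fun s => s.guess == some true && !s.rewound) -
      (O.game true ℓ).prob A ℓ (fun s => s.guess == some true && !s.rewound)|

/-- Integrity: clients detect every modification of the database (other than rewinding). -/
def ORAM.HasIntegrity (O : ORAM N) : Prop :=
  ∀ (A : Adversary) (β : Bool), Negligible fun ℓ => (O.game β ℓ).prob A ℓ (fun s => s.broken)

/-- Correctness: honestly served accesses succeed, and reads return what was last written. -/
def ORAM.Correct (O : ORAM N) : Prop :=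
  ∀ (A : Adversary) (β : Bool), Negligible fun ℓ => (O.game β ℓ).prob A ℓ (fun s => s.wrong)

end Access

/-! ### The wallet system -/

/-- The building blocks of the system, for at most `N ℓ` households. -/
structure System (N : ℕ → ℕ) where
  ds : SignatureScheme
  com : Pedersen
  prf : PRF
  oram : ORAM N

/-- The state of a registered smart card (the public key of the trusted party is `⊥`). -/
structure CardState where
  skRS : Val
  pkRS : Val
  skT : Val
  K : Val
  idH : ℕ

/-- The record `balance ∥ ctr`, two fields of `ℓ` bits. -/
def record (ℓ balance ctr : ℕ) : ℕ := balance * 2 ^ ℓ + ctr % 2 ^ ℓ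

/-- How far a card is in `Spend`. -/
inductive Stage : Type
  /-- Waiting for the price and the reclaim period. -/
  | start : Stage
  | reading (price ε : ℕ) (a : Access) (c : Val) : Stage
  /-- Writing the new record; the proof `π` is ready. -/
  | writing (price ε : ℕ) (π : Val) (a : Access) (c : Val) : Stage

/-- What a card does on a message of the vendor; `msgs` are the messages it sends. -/
inductive CardMove : Type
  | running (stage : Stage) (S : Store) (msgs : List Val) : CardMove
  | success (price ε : ℕ) (S : Store) (msgs : List Val) : CardMove
  | abort (S : Store) (msgs : List Val) : CardMove

def CardMove.prepend (c : Val) : CardMove → CardMove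
  | .running g S l => .running g S (c :: l)
  | .success p ε S l => .success p ε S (c :: l)
  | .abort S l => .abort S (c :: l)

section System
variable {N : ℕ → ℕ}

/-- `Spend`, from the moves of the client in `ORAM.Write` on. -/
def afterWrite (price ε : ℕ) (π : Val) (S : Store) : AccessResult → CardMove
  | .wait a c => .running (.writing price ε π a c) S [c]
  | .fail _ => .abort S []
  | .done db c _ _ => .success price ε (S.commit db) [c, π]

/-- `Spend`, from the moves of the client in `ORAM.Read` on. -/
noncomputable def System.afterRead (Y : System N) (ℓ : ℕ) (pp : Val) (st : CardState)
    (price ε : ℕ) (S : Store) : AccessResult → PMF CardMove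
  | .wait a c => PMF.pure (.running (.reading price ε a c) S [c])
  | .done db c (.nat rec) _ =>
    let S' := S.commit db
    let balance := rec / 2 ^ ℓ
    let ctr := (rec % 2 ^ ℓ + 1) % 2 ^ ℓ
    if balance < price then PMF.pure (.abort S' [c])
    else
      (Y.com.scalar pp).bind fun r =>
      let Com := Y.com.commit pp price r
      let τ := Y.prf.apply ℓ st.K (.pair (.nat st.idH) (.nat ctr))
      (Y.ds.sign.sample ℓ (.pair st.skRS (.pair τ (.pair (.nat ε) Com)))).bind fun σ =>
      let π := Val.list [σ, τ, Com, .nat r]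
      (unif (Y.oram.client.coins ℓ)).map fun coin =>
      (afterWrite price ε π S' (Y.oram.move ℓ st.skT
        (Access.new (.write st.idH (record ℓ (balance - price) ctr)) coin S'))).prepend c
  | .done db c _ _ => PMF.pure (.abort (S.commit db) [c])
  | .fail _ => PMF.pure (.abort S [])

/-- `Spend` on the message `m` of the vendor, who also relays the database. -/
noncomputable def System.spend (Y : System N) (ℓ : ℕ) (pp : Val) (st : CardState) (S : Store)
    (stage : Stage) (m : Val) : PMF CardMove :=
  match stage, m with
  | .start, .pair (.nat price) (.nat ε) =>
    (unif (Y.oram.client.coins ℓ)).bind fun coin =>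
      Y.afterRead ℓ pp st price ε S
        (Y.oram.move ℓ st.skT (Access.new (.read st.idH) coin S))
  | .start, _ => PMF.pure (.abort S [])
  | .reading price ε a c, m =>
    Y.afterRead ℓ pp st price ε S (Y.oram.receive ℓ st.skT a c m)
  | .writing price ε π a c, m =>
    PMF.pure (afterWrite price ε π S (Y.oram.receive ℓ st.skT a c m))

/-- Whether the message of the vendor rewinds the database. -/
def System.rewinds (Y : System N) (ℓ : ℕ) (stage : Stage) (m : Val) : Bool :=
  match stage with
  | .start => false
  | .reading _ _ a c => Y.oram.rewinds ℓ a c m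
  | .writing _ _ _ a c => Y.oram.rewinds ℓ a c m

/-- The challenge: the states of the two cards, the price and the reclaim period. -/
structure Challenge where
  st₀ : CardState
  st₁ : CardState
  price : ℕ
  ε : ℕ

/-- Progress of the unlinkability experiment. -/
inductive Phase : Type
  | before : Phase
  /-- First challenge transaction. -/
  | first (c : Challenge) : Phase
  | between (c : Challenge) : Phase
  /-- Second challenge transaction. -/
  | second (c : Challenge) : Phase
  | after : Phase
  /-- The experiment has ended with `⊥` (`none`) or with the guess of the adversary. -/
  | over (result : Option Bool) : Phase

structure ExpState where
  pp : Val
  skRS : Val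
  pkRS : Val
  skT : Val
  K : Val
  store : Store
  nextId : ℕ
  /-- `CardSMap`; its domain is the set of identifiers of registered honest cards. -/
  cards : ℕ → Option CardState
  phase : Phase
  /-- The transaction under way. -/
  session : Option (CardState × Stage)
  rewound : Bool

/-- Phases in which the adversary may call the oracles. -/
def Phase.isFree : Phase → Bool
  | .before => true
  | .between _ => true
  | .after => true
  | _ => false

/-- Between the challenge transactions the cards of the two challenge households may not be
used. -/
def Phase.allows : Phase → CardState → Bool
  | .between c, st => st.idH != c.st₀.idH && st.idH != c.st₁.idH
  | _, _ => true

/-- Store the card state under those chosen identifiers that are not in use; also return these. -/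
def assignIds (st : CardState) : List ℕ → (ℕ → Option CardState) →
    (ℕ → Option CardState) × List Val
  | [], f => (f, [])
  | t :: ts, f =>
    match f t with
    | some _ => assignIds st ts f
    | none =>
      let p := assignIds st ts (Function.update f t (some st))
      (p.1, .nat t :: p.2)

/-- The oracle for the registration of an honest household by the honest-but-curious registration
station: the adversary receives the new card identifiers and the full transcript. -/
noncomputable def System.register (Y : System N) (ℓ : ℕ) (s : ExpState) (ids : List ℕ) (bud : ℕ) :
    PMF (ExpState × Val) :=
  if s.nextId < N ℓ ∧ bud < 2 ^ ℓ then
    (Y.com.scalar s.pp).bind fun r =>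
    (Y.ds.sign.sample ℓ (.pair s.skRS (.nat r))).bind fun σ =>
    if Y.ds.accepts ℓ s.pkRS (.nat r) σ then
      (unif (Y.oram.client.coins ℓ)).map fun coin =>
      let run := Y.oram.honestRun ℓ s.skT (polyBound Y.oram.deg ℓ)
        (Y.oram.move ℓ s.skT (Access.new (.write s.nextId (record ℓ bud 0)) coin s.store))
      let trs := Val.list (.nat s.nextId :: s.skRS :: .nat bud :: run.2)
      match run.1 with
      | some db =>
        let p := assignIds ⟨s.skRS, s.pkRS, s.skT, s.K, s.nextId⟩ ids s.cards
        ({ s with store := s.store.commit db, nextId := s.nextId + 1, cards := p.1 },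
          .pair (.nat 1) (.pair (Val.list p.2) trs))
      | none => (s, .pair (.nat 0) trs)
    else PMF.pure (s, .pair (.nat 0) (Val.list [.nat s.nextId, s.skRS]))
  else PMF.pure (s, .nat 0)

/-- The phase after a transaction. `ok` holds the price and the reclaim period that a successful
card outputs. A challenge transaction has to succeed with the price and period announced. -/
def Phase.next (ph : Phase) (ok : Option (ℕ × ℕ)) : Phase :=
  match ph with
  | .first c => if ok = some (c.price, c.ε) then .between c else .over none
  | .second c => if ok = some (c.price, c.ε) then .after else .over none
  | ph => ph

def ExpState.afterCard (s : ExpState) (st : CardState) : CardMove → ExpState × Val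
  | .running g S l =>
    ({ s with store := S, session := some (st, g) }, .pair (.nat 1) (Val.list l))
  | .success p ε S l =>
    ({ s with store := S, session := none, phase := s.phase.next (some (p, ε)) },
      .pair (.nat 2) (Val.list l))
  | .abort S l =>
    ({ s with store := S, session := none, phase := s.phase.next none },
      .pair (.nat 3) (Val.list l))

/-- `TrustedSetup` and `SetupRSKeys`. -/
noncomputable def System.setup (Y : System N) (ℓ : ℕ) : PMF ExpState :=
  (Y.com.gen.sample ℓ (.nat 0)).bind fun pp =>
  (Y.oram.init.sample ℓ (ones (N ℓ))).bind fun v =>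
  (Y.prf.keygen.sample ℓ (.nat 0)).bind fun K =>
  (Y.ds.keygen.sample ℓ (.nat 0)).map fun k =>
  ⟨pp, k.fst, k.snd, v.fst, K, ⟨v.snd, []⟩, 0, fun _ => none, .before, none, false⟩

/-- The unlinkability experiment with challenge bit `b`. The adversary, a malicious vendor who also
holds the database, gets the public parameters, the keys of the registration station and the
initial database. Its messages:
* `(1, (ids, bud))`: register a household with budget `bud` and cards `ids`;
* `(2, tid)`: start a transaction with card `tid`;
* `(3, (t₀, (t₁, (price, ε))))`: announce the challenge, and start the first challenge transaction,
  with card `t_b`;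
* `(4, m)`: send `m` to the card in the transaction under way; every other message breaks the
  transaction off;
* `(5, 0)`: start the second challenge transaction, with card `t_{1-b}`;
* `(6, g)`: final guess. -/
noncomputable def System.experiment (Y : System N) (b : Bool) (ℓ : ℕ) : Game where
  State := ExpState
  start := (Y.setup ℓ).map fun s =>
    (s, .pair s.pp (.pair s.skRS (.pair s.pkRS s.store.db)))
  respond s msg :=
    match s.session, msg with
    | some (st, g), .pair (.nat 4) m =>
      (Y.spend ℓ s.pp st s.store g m).map
        (({ s with rewound := s.rewound || Y.rewinds ℓ g m }).afterCard st)
    | some (st, _), _ => PMF.pure (s.afterCard st (.abort s.store []))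
    | none, .pair (.nat 1) (.pair ids (.nat bud)) =>
      if s.phase.isFree then Y.register ℓ s ids.toNats bud else PMF.pure (s, .nat 0)
    | none, .pair (.nat 2) (.nat tid) =>
      match s.cards tid with
      | some st =>
        if s.phase.isFree && s.phase.allows st then
          PMF.pure ({ s with session := some (st, .start) }, .nat 1)
        else PMF.pure (s, .nat 0)
      | none => PMF.pure (s, .nat 0)
    | none, .pair (.nat 3) (.pair (.nat t₀) (.pair (.nat t₁) (.pair (.nat price) (.nat ε)))) =>
      match s.phase with
      | .before =>
        match s.cards t₀, s.cards t₁ with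
        | some st₀, some st₁ =>
          PMF.pure ({ s with
            phase := .first ⟨st₀, st₁, price, ε⟩
            session := some (bif b then st₁ else st₀, .start) }, .nat 1)
        | _, _ => PMF.pure ({ s with phase := .over none }, .nat 0)
      | _ => PMF.pure (s, .nat 0)
    | none, .pair (.nat 5) _ =>
      match s.phase with
      | .between c =>
        PMF.pure ({ s with
          phase := .second c
          session := some (bif b then c.st₀ else c.st₁, .start) }, .nat 1)
      | _ => PMF.pure (s, .nat 0)
    | none, .pair (.nat 6) (.nat g) =>
      match s.phase with
      | .after => PMF.pure ({ s with phase := .over (some (g != 0)) }, .nat 0)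
      | _ => PMF.pure (s, .nat 0)
    | none, _ => PMF.pure (s, .nat 0)

/-- The experiment has ended with the guess `b' = 1`. -/
def ExpState.guessOne (s : ExpState) : Bool :=
  match s.phase with
  | .over (some g) => g
  | _ => false

/-- The vendor does not rewind the database (except with negligible probability). -/
def System.NonRewinding (Y : System N) (A : Adversary) : Prop :=
  ∀ b : Bool, Negligible fun ℓ => (Y.experiment b ℓ).prob A ℓ (fun s => s.rewound)

/-- The advantage of the adversary in telling the order of the challenge transactions. -/
noncomputable def System.advantage (Y : System N) (A : Adversary) (ℓ : ℕ) : ℝ :=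
  |(Y.experiment false ℓ).prob A ℓ ExpState.guessOne -
    (Y.experiment true ℓ).prob A ℓ ExpState.guessOne|

end System

end AidWallet

/-! A proof of payment `(σ, τ, Com, r)` depends on the paying household only through the token `τ`:
all cards sign with the same key, and `Com` commits to the price named by the vendor. The order of
the challenge transactions can therefore show in three ways only: in the tokens, in the traffic of
the ORAM accesses, and in whether a card finds its balance sufficient. The proof is a chain of games
that closes these channels one by one.

The inner games are instances of `System.walletGame`. A simulator keeps, for each of the two orders
("worlds"), a table with the balance and counter of every household. Cards decide by the table of
world `b`, while the accesses and the token inputs are those of world `β`. Tokens come from an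
oracle `tok`, and a token is requested only after the write access of its payment has been
completed.

From the experiment to ideal memory (`experiment_sub_walletGame_le`): for `β = b` the state of the
experiment is a function of the simulated state (`System.real`), as long as the ORAM has not refused
an honestly served access, returned a wrong value or accepted a tampered reply, and the database has
not been rewound. The game is itself played by an adversary in the ORAM game, so ORAM failures are
negligible by correctness and integrity; rewinding is negligible by assumption.

From the keyed function to fresh tokens (`negligible_walletProb_prf`): the keyed function is
exchanged for a random function. Every token request goes with an increment of the counter of its
household, so no input repeats while there are fewer than `2 ^ ℓ` messages, and the random function
returns independent uniform values (`walletGame_ideal_eq_fresh`). These carry no information about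
`β`.

Change of accesses (`negligible_walletProb_oblivious`): now `β` only selects a component from pairs
of accesses, which is what obliviousness hides. The bit `b` has to stay fixed in this hop, because
the simulator is not shown what reads return and must decide by one of its own tables.

Change of the deciding table (`walletGame_order`): for equal `β` the games for both values of `b`
give the guess `1` without rewinding with exactly the same probability. Up to the first challenge
transaction the tables agree; between the two, they differ by one payment of each challenge
household, and these households are locked; after the second they agree again. A check can differ
only if the price is not the announced one, or if a challenge household was too poor at the
announcement. In these cases neither order ever reaches a guess (`Wallet.Twin`, `Wallet.Doomed`).

The first two hops, taken backwards for `b = true`, lead to the other experiment.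

All comparisons are couplings of two runs, kept in a relation until they fall into an absorbing set
of lost pairs (`Game.run_coupled`, `Coupled.abs_pr_sub_le`). The reductions are genuine programs:
`Game.run_comp` merges an adversary with a machine below it into one adversary, and
`exists_wallet_adversary`, `exists_token_adversary` and `exists_prf_adversary` supply the machines.
Their polynomial running time follows from closure rules, their lengths from explicit invariants. -/

namespace AidWallet

/-! ### Polynomially bounded functions -/

/-- `f` is bounded by one of the polynomials `n ^ d + d`. -/
def PolyBdd (f : ℕ → ℕ) : Prop := ∃ d, ∀ n, f n ≤ polyBound d n

theorem polyBound_mono (d : ℕ) {m n : ℕ} (h : m ≤ n) : polyBound d m ≤ polyBound d n :=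
  Nat.add_le_add_right (Nat.pow_le_pow_left h d) d

theorem polyBound_pos (d n : ℕ) : 0 < polyBound d n := by
  unfold polyBound
  rcases Nat.eq_zero_or_pos d with rfl | hd
  · simp
  · omega

/-- The shape `c * (n + 1) ^ k` is visibly stable under sums and products; closure is proved in this
form and carried back. -/
theorem polyBdd_iff (f : ℕ → ℕ) : PolyBdd f ↔ ∃ c k, ∀ n, f n ≤ c * (n + 1) ^ k := by
  constructor
  · rintro ⟨d, h⟩
    refine ⟨1 + d, d, fun n => (h n).trans ?_⟩
    have h1 : n ^ d ≤ (n + 1) ^ d := Nat.pow_le_pow_left (by omega) d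
    have h2 : 1 ≤ (n + 1) ^ d := Nat.one_le_pow _ _ (by omega)
    unfold polyBound
    nlinarith
  · rintro ⟨c, k, h⟩
    -- One number serves as exponent and as additive constant. As a constant it covers `n ≤ 1`,
    -- where powers of `n` do not grow; for `n ≥ 2` the inequalities `c ≤ n ^ c` and `n + 1 ≤ n ^ 2`
    -- absorb the factor and the shift into the exponent.
    refine ⟨c * 2 ^ k + c + 2 * k, fun n => (h n).trans ?_⟩
    unfold polyBound
    by_cases hn : n ≤ 1
    · have h1 : (n + 1) ^ k ≤ 2 ^ k := Nat.pow_le_pow_left (by omega) k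
      have h2 := Nat.mul_le_mul_left c h1
      omega
    · have hn2 : 2 ≤ n := by omega
      have h1 : (n + 1) ^ k ≤ n ^ (2 * k) := by
        rw [pow_mul]
        exact Nat.pow_le_pow_left (by nlinarith) k
      have h2 : c ≤ n ^ c := (Nat.lt_pow_self (by omega)).le
      calc c * (n + 1) ^ k ≤ n ^ c * n ^ (2 * k) := Nat.mul_le_mul h2 h1
        _ = n ^ (c + 2 * k) := (pow_add _ _ _).symm
        _ ≤ n ^ (c * 2 ^ k + c + 2 * k) := Nat.pow_le_pow_right (by omega) (by omega)
        _ ≤ _ := Nat.le_add_right _ _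

theorem PolyBdd.const (c : ℕ) : PolyBdd fun _ => c :=
  (polyBdd_iff _).2 ⟨c, 0, fun n => by simp⟩

theorem PolyBdd.id : PolyBdd fun n => n :=
  (polyBdd_iff _).2 ⟨1, 1, fun n => by simp⟩

theorem PolyBdd.add {f g : ℕ → ℕ} (hf : PolyBdd f) (hg : PolyBdd g) :
    PolyBdd fun n => f n + g n := by
  obtain ⟨c, k, hf⟩ := (polyBdd_iff _).1 hf
  obtain ⟨d, l, hg⟩ := (polyBdd_iff _).1 hg
  refine (polyBdd_iff _).2 ⟨c + d, k + l, fun n => ?_⟩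
  have h1 : (n + 1) ^ k ≤ (n + 1) ^ (k + l) := Nat.pow_le_pow_right (by omega) (by omega)
  have h2 : (n + 1) ^ l ≤ (n + 1) ^ (k + l) := Nat.pow_le_pow_right (by omega) (by omega)
  have := Nat.mul_le_mul_left c h1
  have := Nat.mul_le_mul_left d h2
  have := hf n
  have := hg n
  rw [add_mul]
  omega

theorem PolyBdd.mul {f g : ℕ → ℕ} (hf : PolyBdd f) (hg : PolyBdd g) :
    PolyBdd fun n => f n * g n := by
  obtain ⟨c, k, hf⟩ := (polyBdd_iff _).1 hf
  obtain ⟨d, l, hg⟩ := (polyBdd_iff _).1 hg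
  refine (polyBdd_iff _).2 ⟨c * d, k + l, fun n => (Nat.mul_le_mul (hf n) (hg n)).trans ?_⟩
  rw [pow_add]
  exact le_of_eq (by ring)

theorem PolyBdd.polyBound {f : ℕ → ℕ} (d : ℕ) (hf : PolyBdd f) :
    PolyBdd fun n => polyBound d (f n) := by
  have h : ∀ e : ℕ, PolyBdd fun n => f n ^ e := by
    intro e
    induction e with
    | zero => simpa using PolyBdd.const 1
    | succ e ih => simpa [pow_succ] using ih.mul hf
  exact (h d).add (PolyBdd.const d)

/-! ### Polynomial-time functions -/

@[simp] theorem Val.fst_pair (a b : Val) : (Val.pair a b).fst = a := rfl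
@[simp] theorem Val.snd_pair (a b : Val) : (Val.pair a b).snd = b := rfl
@[simp] theorem Val.fst_nat (n : ℕ) : (Val.nat n).fst = .nat 0 := rfl
@[simp] theorem Val.snd_nat (n : ℕ) : (Val.nat n).snd = .nat 0 := rfl
@[simp] theorem Val.size_nat (n : ℕ) : (Val.nat n).size = 1 + Nat.size n := rfl
@[simp] theorem Val.size_pair (a b : Val) : (Val.pair a b).size = 1 + a.size + b.size := rfl

theorem Val.size_pos (v : Val) : 0 < v.size := by
  cases v <;> simp

theorem Val.size_fst_le (v : Val) : v.fst.size ≤ v.size := by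
  cases v <;> simp; omega

theorem Val.size_snd_le (v : Val) : v.snd.size ≤ v.size := by
  cases v <;> simp

/-- Every instruction pays for the length of what it writes, so time bounds length. Composition of
polynomial-time functions, and every length bound for the algorithms of the system, rests on this.
-/
theorem Runs.size_le {c : Code} {v w : Val} {t : ℕ} (h : Runs c v w t) : w.size ≤ t := by
  induction h with
  | id => omega
  | const => omega
  | prim => omega
  | comp => omega
  | pair => simp; omega
  | ite_true => omega
  | ite_false => omega
  | loop_stop _ ih => simp at ih; omega
  | loop_next => omega

theorem polyTime_of_bdd {f : Val → Val} (c : Code) {b : ℕ → ℕ} (hb : PolyBdd b)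
    (h : ∀ v, ∃ t, t ≤ b v.size ∧ Runs c v (f v) t) : PolyTime f := by
  obtain ⟨d, hd⟩ := hb
  refine ⟨c, d, fun v => ?_⟩
  obtain ⟨t, ht, hr⟩ := h v
  exact ⟨t, ht.trans (hd _), hr⟩

theorem PolyTime.size_le {f : Val → Val} (h : PolyTime f) :
    ∃ d, ∀ v, (f v).size ≤ polyBound d v.size := by
  obtain ⟨c, d, h⟩ := h
  refine ⟨d, fun v => ?_⟩
  obtain ⟨t, ht, hr⟩ := h v
  exact hr.size_le.trans ht

attribute [fun_prop] PolyTime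

@[fun_prop] theorem PolyTime.id : PolyTime fun v => v :=
  polyTime_of_bdd .id ((PolyBdd.const 1).add PolyBdd.id) fun v => ⟨_, le_rfl, .id v⟩

@[fun_prop] theorem PolyTime.const (w : Val) : PolyTime fun _ => w :=
  polyTime_of_bdd (.const w) (PolyBdd.const (1 + w.size)) fun v => ⟨_, le_rfl, .const w v⟩

@[fun_prop] theorem PolyTime.comp {g f : Val → Val} (hg : PolyTime g) (hf : PolyTime f) :
    PolyTime fun v => g (f v) := by
  obtain ⟨c, d, hf⟩ := hf
  obtain ⟨c', d', hg⟩ := hg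
  refine polyTime_of_bdd (.comp c' c) (((PolyBdd.const 1).add (PolyBdd.id.polyBound d)).add
    ((PolyBdd.id.polyBound d).polyBound d')) fun v => ?_
  obtain ⟨s, hs, rs⟩ := hf v
  obtain ⟨t, ht, rt⟩ := hg (f v)
  refine ⟨_, ?_, .comp rs rt⟩
  -- The second program is charged by the length of the intermediate value, which is at most the
  -- time spent on producing it.
  have := polyBound_mono d' (rs.size_le.trans hs)
  omega

@[fun_prop] theorem PolyTime.pair {f g : Val → Val} (hf : PolyTime f) (hg : PolyTime g) :
    PolyTime fun v => .pair (f v) (g v) := by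
  obtain ⟨c, d, hf⟩ := hf
  obtain ⟨c', d', hg⟩ := hg
  refine polyTime_of_bdd (.pair c c') (((PolyBdd.const 1).add (PolyBdd.id.polyBound d)).add
    (PolyBdd.id.polyBound d')) fun v => ?_
  obtain ⟨s, hs, rs⟩ := hf v
  obtain ⟨t, ht, rt⟩ := hg v
  exact ⟨_, by omega, .pair rs rt⟩

/-- A product has at most as many digits as its factors together, and a sum one more; all other
instructions return something shorter than their input or a single flag. Output length is thus
linear in input length. -/
theorem Prim.size_eval_le (p : Prim) (v : Val) : (p.eval v).size ≤ 2 + 2 * v.size := by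
  have hs0 : ∀ n : ℕ, Nat.size n ≤ n := fun n => Nat.size_le.2 Nat.lt_two_pow_self
  have hle : ∀ {a b : ℕ}, a ≤ b → Nat.size a ≤ Nat.size b := fun h => Nat.size_le_size h
  have hadd : ∀ a b : ℕ, Nat.size (a + b) ≤ Nat.size a + Nat.size b + 1 := fun a b => by
    rw [Nat.size_le]
    have h1 := Nat.lt_size_self a
    have h2 := Nat.lt_size_self b
    have h3 : 2 ^ Nat.size a ≤ 2 ^ (Nat.size a + Nat.size b) :=
      Nat.pow_le_pow_right (by norm_num) (by omega)
    have h4 : 2 ^ Nat.size b ≤ 2 ^ (Nat.size a + Nat.size b) :=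
      Nat.pow_le_pow_right (by norm_num) (by omega)
    rw [pow_succ]; omega
  have hmul : ∀ a b : ℕ, Nat.size (a * b) ≤ Nat.size a + Nat.size b := fun a b => by
    rw [Nat.size_le, pow_add]
    exact Nat.mul_lt_mul'' (Nat.lt_size_self a) (Nat.lt_size_self b)
  have hite : ∀ (P : Prop) [Decidable P], Nat.size (if P then 1 else 0) ≤ 1 := fun P _ => by
    split <;> simp
  have hfst := Val.size_fst_le v
  have hsnd := Val.size_snd_le v
  cases p
  case fst => simp [Prim.eval]; omega
  case snd => simp [Prim.eval]; omega
  case isNat => cases v <;> simp [Prim.eval]; omega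
  case size => have := hs0 v.size; simp [Prim.eval]; omega
  case eq =>
    rcases v with n | ⟨a, b⟩
    · simp [Prim.eval]; omega
    · have := hite (a = b); simp [Prim.eval]; omega
  all_goals
    rcases v with n | ⟨⟨a⟩ | ⟨a, a'⟩, ⟨b⟩ | ⟨b, b'⟩⟩
    case pair.nat.nat =>
      have := hadd a b
      have := hle (Nat.sub_le a b)
      have := hmul a b
      have := hle (Nat.div_le_self a b)
      have := hle (Nat.mod_le a b)
      have := hite (a ≤ b)
      simp [Prim.eval]; omega
    all_goals simp [Prim.eval]; omega

theorem PolyTime.prim (p : Prim) : PolyTime fun v => p.eval v := by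
  refine polyTime_of_bdd (.prim p) (b := fun n => 1 + n + (2 + 2 * n)) ?_ fun v =>
    ⟨_, ?_, .prim p v⟩
  · exact ((PolyBdd.const 1).add PolyBdd.id).add
      ((PolyBdd.const 2).add ((PolyBdd.const 2).mul PolyBdd.id))
  · have := Prim.size_eval_le p v
    omega

@[fun_prop] theorem PolyTime.fst {f : Val → Val} (hf : PolyTime f) : PolyTime fun v => (f v).fst :=
  (PolyTime.prim .fst).comp hf

@[fun_prop] theorem PolyTime.snd {f : Val → Val} (hf : PolyTime f) : PolyTime fun v => (f v).snd :=
  (PolyTime.prim .snd).comp hf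

/-! Arithmetic on values: the number at a leaf, `0` at an inner node. -/

def Val.num : Val → ℕ
  | .nat n => n
  | .pair _ _ => 0

@[simp] theorem Val.num_nat (n : ℕ) : (Val.nat n).num = n := rfl
@[simp] theorem Val.num_pair (a b : Val) : (Val.pair a b).num = 0 := rfl

def Val.IsNat : Val → Prop
  | .nat _ => True
  | .pair _ _ => False

@[simp] theorem Val.isNat_nat (n : ℕ) : (Val.nat n).IsNat := trivial
@[simp] theorem Val.not_isNat_pair (a b : Val) : ¬(Val.pair a b).IsNat := fun h => h

instance (v : Val) : Decidable v.IsNat :=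
  match v with
  | .nat _ => isTrue trivial
  | .pair _ _ => isFalse fun h => h

theorem Val.IsNat.eq {v : Val} (h : v.IsNat) : v = .nat v.num := by
  cases v with
  | nat n => rfl
  | pair a b => exact h.elim

/-- A predicate that is decided in polynomial time. -/
@[fun_prop] def PolyPred (P : Val → Prop) : Prop :=
  ∃ f, PolyTime f ∧ ∀ v, P v ↔ f v ≠ .nat 0

theorem PolyTime.ite_code {c f g : Val → Val} (hc : PolyTime c) (hf : PolyTime f)
    (hg : PolyTime g) : PolyTime fun v => if c v ≠ .nat 0 then f v else g v := by
  obtain ⟨c₁, d₁, h₁⟩ := hc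
  obtain ⟨c₂, d₂, h₂⟩ := hf
  obtain ⟨c₃, d₃, h₃⟩ := hg
  refine polyTime_of_bdd (.ite c₁ c₂ c₃) ((((PolyBdd.const 1).add (PolyBdd.id.polyBound d₁)).add
    (PolyBdd.id.polyBound d₂)).add (PolyBdd.id.polyBound d₃)) fun v => ?_
  obtain ⟨s, hs, rs⟩ := h₁ v
  obtain ⟨t, ht, rt⟩ := h₂ v
  obtain ⟨u, hu, ru⟩ := h₃ v
  by_cases h : c v = .nat 0
  · rw [if_neg (not_not.2 h)]
    exact ⟨_, by omega, .ite_false (h ▸ rs) ru⟩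
  · rw [if_pos h]
    exact ⟨_, by omega, .ite_true rs h rt⟩

@[fun_prop] theorem PolyTime.ite {P : Val → Prop} [DecidablePred P] {f g : Val → Val}
    (hP : PolyPred P) (hf : PolyTime f) (hg : PolyTime g) :
    PolyTime fun v => if P v then f v else g v := by
  obtain ⟨c, hc, h⟩ := hP
  convert PolyTime.ite_code hc hf hg using 3 with v
  exact h v

@[fun_prop] theorem PolyPred.eq {f g : Val → Val} (hf : PolyTime f) (hg : PolyTime g) :
    PolyPred fun v => f v = g v :=
  ⟨_, (PolyTime.prim .eq).comp (hf.pair hg), fun v => by simp [Prim.eval]⟩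

@[fun_prop] theorem PolyPred.isNat {f : Val → Val} (hf : PolyTime f) :
    PolyPred fun v => (f v).IsNat :=
  ⟨_, (PolyTime.prim .isNat).comp hf, fun v => by
    rcases hv : f v with n | ⟨a, b⟩ <;> simp [hv, Prim.eval]⟩

theorem PolyPred.of_ite {P : Val → Prop} [DecidablePred P]
    (h : PolyTime fun v => if P v then .nat 1 else .nat 0) : PolyPred P :=
  ⟨_, h, fun v => by by_cases hv : P v <;> simp [hv]⟩

@[fun_prop] theorem PolyPred.and {P Q : Val → Prop} (hP : PolyPred P) (hQ : PolyPred Q) :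
    PolyPred fun v => P v ∧ Q v := by
  classical
  refine PolyPred.of_ite ?_
  convert PolyTime.ite hP (PolyTime.ite hQ (PolyTime.const (.nat 1)) (PolyTime.const (.nat 0)))
    (PolyTime.const (.nat 0)) using 2 with v
  by_cases h₁ : P v <;> by_cases h₂ : Q v <;> simp [h₁, h₂]

@[fun_prop] theorem PolyPred.not {P : Val → Prop} (hP : PolyPred P) :
    PolyPred fun v => ¬P v := by
  classical
  refine PolyPred.of_ite ?_
  convert PolyTime.ite hP (PolyTime.const (.nat 0)) (PolyTime.const (.nat 1)) using 2 with v
  by_cases h₁ : P v <;> simp [h₁]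

@[fun_prop] theorem PolyPred.or {P Q : Val → Prop} (hP : PolyPred P) (hQ : PolyPred Q) :
    PolyPred fun v => P v ∨ Q v := by
  have := (hP.not.and hQ.not).not
  simpa only [not_and_or, not_not] using this

@[fun_prop] theorem PolyTime.num {f : Val → Val} (hf : PolyTime f) :
    PolyTime fun v => .nat (f v).num := by
  have : PolyTime fun v => if (f v).IsNat then f v else .nat 0 := by fun_prop
  convert this using 2 with v
  cases f v <;> simp

/-- A number computed from a value in polynomial time. -/
@[fun_prop] def PolyNum (f : Val → ℕ) : Prop := PolyTime fun v => .nat (f v)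

@[fun_prop] theorem PolyNum.polyTime {f : Val → ℕ} (h : PolyNum f) : PolyTime fun v => .nat (f v) := h

@[fun_prop] theorem PolyNum.const (n : ℕ) : PolyNum fun _ => n := PolyTime.const _

@[fun_prop] theorem PolyNum.num {f : Val → Val} (hf : PolyTime f) : PolyNum fun v => (f v).num :=
  PolyTime.num hf

@[fun_prop] theorem PolyNum.size {f : Val → Val} (hf : PolyTime f) : PolyNum fun v => (f v).size :=
  (PolyTime.prim .size).comp hf

@[fun_prop] theorem PolyNum.add {f g : Val → ℕ} (hf : PolyNum f) (hg : PolyNum g) :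
    PolyNum fun v => f v + g v :=
  (PolyTime.prim .add).comp (PolyTime.pair hf hg)

@[fun_prop] theorem PolyNum.sub {f g : Val → ℕ} (hf : PolyNum f) (hg : PolyNum g) :
    PolyNum fun v => f v - g v :=
  (PolyTime.prim .sub).comp (PolyTime.pair hf hg)

@[fun_prop] theorem PolyNum.mul {f g : Val → ℕ} (hf : PolyNum f) (hg : PolyNum g) :
    PolyNum fun v => f v * g v :=
  (PolyTime.prim .mul).comp (PolyTime.pair hf hg)

@[fun_prop] theorem PolyNum.mod {f g : Val → ℕ} (hf : PolyNum f) (hg : PolyNum g) :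
    PolyNum fun v => f v % g v :=
  (PolyTime.prim .mod).comp (PolyTime.pair hf hg)

@[fun_prop] theorem PolyPred.le {f g : Val → ℕ} (hf : PolyNum f) (hg : PolyNum g) :
    PolyPred fun v => f v ≤ g v :=
  ⟨_, (PolyTime.prim .le).comp (PolyTime.pair hf hg), fun v => by simp [Prim.eval]⟩

@[fun_prop] theorem PolyPred.lt {f g : Val → ℕ} (hf : PolyNum f) (hg : PolyNum g) :
    PolyPred fun v => f v < g v := by
  have := (PolyPred.le hg hf).not
  simpa using this

@[fun_prop] theorem PolyPred.eq_num {f g : Val → ℕ} (hf : PolyNum f) (hg : PolyNum g) :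
    PolyPred fun v => f v = g v := by
  have := PolyPred.eq (PolyNum.polyTime hf) (PolyNum.polyTime hg)
  simpa using this

theorem PolyNum.polyBound (d : ℕ) {f : Val → ℕ} (hf : PolyNum f) :
    PolyNum fun v => polyBound d (f v) := by
  have h : ∀ e : ℕ, PolyNum fun v => f v ^ e := by
    intro e
    induction e with
    | zero => simpa using PolyNum.const 1
    | succ e ih => simpa [pow_succ] using ih.mul hf
  exact (h d).add (PolyNum.const d)

attribute [fun_prop] PolyNum.polyBound

/-! ### Lists -/

def Val.toList : Val → List Val
  | .nat _ => []
  | .pair a b => a :: b.toList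

@[simp] theorem Val.toList_nat (n : ℕ) : (Val.nat n).toList = [] := rfl
@[simp] theorem Val.toList_pair (a b : Val) : (Val.pair a b).toList = a :: b.toList := rfl
@[simp] theorem Val.list_nil : Val.list [] = .nat 0 := rfl
@[simp] theorem Val.list_cons (v : Val) (l : List Val) :
    Val.list (v :: l) = .pair v (Val.list l) := rfl

@[simp] theorem Val.toList_list (l : List Val) : (Val.list l).toList = l := by
  induction l with
  | nil => rfl
  | cons a l ih => simp [ih]

theorem Val.size_list (l : List Val) : (Val.list l).size = 1 + (l.map fun v => 1 + v.size).sum := by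
  induction l with
  | nil => rfl
  | cons a l ih => simp [ih]; omega

theorem Val.length_toList_le (v : Val) : v.toList.length ≤ v.size := by
  induction v with
  | nat n => simp
  | pair a b _ ih => simp; omega

theorem Val.size_list_le {l : List Val} {B : ℕ} (h : ∀ v ∈ l, v.size ≤ B) :
    (Val.list l).size ≤ 1 + l.length * (1 + B) := by
  rw [Val.size_list]
  have := List.sum_le_card_nsmul (l.map fun v => 1 + v.size) (1 + B) (by
    intro x hx
    simp only [List.mem_map] at hx
    obtain ⟨v, hv, rfl⟩ := hx
    have := h v hv
    omega)
  simpa using this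

/-- The body of the loop of a fold; its state is `(ctx, (acc, rest))`. -/
def foldBody (step : Val → Val) (s : Val) : Val :=
  if s.snd.snd.IsNat then .pair (.nat 0) s.snd.fst
  else .pair (.nat 1) (.pair s.fst (.pair (step (.pair s.fst (.pair s.snd.fst s.snd.snd.fst)))
    s.snd.snd.snd))

theorem foldBody_polyTime {step : Val → Val} (h : PolyTime step) : PolyTime (foldBody step) := by
  unfold foldBody
  fun_prop

/-- Each round is charged at the bound for the largest loop state that occurs, and there are at most
`rest.size + 1` rounds. The assumption on prefixes is needed because a polynomial-time step alone
does not prevent exponential growth of the accumulator. -/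
theorem Runs.fold {step : Val → Val} {c : Code} {b : ℕ → ℕ}
    (hb : Monotone b) (hc : ∀ v, ∃ t, t ≤ b v.size ∧ Runs c v (foldBody step v) t)
    (ctx : Val) (M : ℕ) (rest : Val) : ∀ acc : Val,
    (∀ l, l <+: rest.toList →
      (l.foldl (fun a x => step (.pair ctx (.pair a x))) acc).size ≤ M) →
    ∃ t, t ≤ (rest.size + 1) * (1 + b (2 + ctx.size + M + rest.size)) ∧
      Runs (.loop c) (.pair ctx (.pair acc rest))
        (rest.toList.foldl (fun a x => step (.pair ctx (.pair a x))) acc) t := by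
  induction rest with
  | nat n =>
    intro acc hM
    have h0 := hM [] (by simp)
    simp only [List.foldl_nil] at h0
    obtain ⟨t, ht, hr⟩ := hc (.pair ctx (.pair acc (.nat n)))
    refine ⟨1 + t, ?_, Runs.loop_stop (by simpa [foldBody] using hr)⟩
    have hb' := hb (show (Val.pair ctx (.pair acc (.nat n))).size
      ≤ 2 + ctx.size + M + (Val.nat n).size by simp; omega)
    have : 1 * (1 + t) ≤ ((Val.nat n).size + 1) *
      (1 + b (2 + ctx.size + M + (Val.nat n).size)) := Nat.mul_le_mul (by omega) (by omega)
    omega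
  | pair a r _ ih =>
    intro acc hM
    have h0 := hM [] (by simp)
    simp only [List.foldl_nil] at h0
    obtain ⟨t, ht, hr⟩ := hc (.pair ctx (.pair acc (.pair a r)))
    obtain ⟨u, hu, hru⟩ := ih (step (.pair ctx (.pair acc a))) (fun l hl => by
      have := hM (a :: l) (by simpa using hl)
      simpa using this)
    refine ⟨1 + t + u, ?_, .loop_next (by simpa [foldBody] using hr) (by simp) hru⟩
    have h1 := hb (show (Val.pair ctx (.pair acc (.pair a r))).size
      ≤ 2 + ctx.size + M + (Val.pair a r).size by simp; omega)
    have h2 := hb (show 2 + ctx.size + M + r.size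
      ≤ 2 + ctx.size + M + (Val.pair a r).size by simp)
    have h3 : (r.size + 1) * (1 + b (2 + ctx.size + M + r.size)) ≤
      (r.size + 1) * (1 + b (2 + ctx.size + M + (Val.pair a r).size)) :=
      Nat.mul_le_mul_left _ (by omega)
    -- The additional round is paid for by the list cell that is consumed in it.
    have h4 : ((r.size + 1) + 1) * (1 + b (2 + ctx.size + M + (Val.pair a r).size)) ≤
      ((Val.pair a r).size + 1) * (1 + b (2 + ctx.size + M + (Val.pair a r).size)) :=
      Nat.mul_le_mul_right _ (by have := a.size_pos; simp)
    have h5 := add_mul (r.size + 1) 1 (1 + b (2 + ctx.size + M + (Val.pair a r).size))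
    omega

/-- A fold over a list is computed in polynomial time if its step is, and if the intermediate
results are of polynomial length. -/
theorem PolyTime.foldl {step : Val → Val} (hstep : PolyTime step) {ctx acc lst : Val → Val}
    (hctx : PolyTime ctx) (hacc : PolyTime acc) (hlst : PolyTime lst) {M : ℕ → ℕ}
    (hM : PolyBdd M)
    (h : ∀ v l, l <+: (lst v).toList →
      (l.foldl (fun a x => step (.pair (ctx v) (.pair a x))) (acc v)).size ≤ M v.size) :
    PolyTime fun v =>
      (lst v).toList.foldl (fun a x => step (.pair (ctx v) (.pair a x))) (acc v) := by
  obtain ⟨c, d, hc⟩ := foldBody_polyTime hstep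
  have hpre : PolyTime fun v => .pair (ctx v) (.pair (acc v) (lst v)) := by fun_prop
  obtain ⟨c', d', hc'⟩ := hpre
  refine polyTime_of_bdd (.comp (.loop c) c') (b := fun n => 1 + polyBound d' n +
    (polyBound d' n + 1) * (1 + polyBound d (2 + polyBound d' n + M n + polyBound d' n))) ?_
    fun v => ?_
  · have h1 : PolyBdd (polyBound d') := PolyBdd.id.polyBound d'
    exact (((PolyBdd.const 1).add h1)).add ((h1.add (.const 1)).mul ((PolyBdd.const 1).add
      (((((PolyBdd.const 2).add h1).add hM).add h1).polyBound d)))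
  · obtain ⟨s, hs, rs⟩ := hc' v
    obtain ⟨t, ht, rt⟩ := Runs.fold (fun _ _ => polyBound_mono d) hc (ctx v) (M v.size) (lst v)
      (acc v) (h v)
    refine ⟨_, ?_, .comp rs rt⟩
    have h1 := rs.size_le
    simp only [Val.size_pair] at h1
    have h2 : polyBound d (2 + (ctx v).size + M v.size + (lst v).size) ≤
        polyBound d (2 + polyBound d' v.size + M v.size + polyBound d' v.size) :=
      polyBound_mono d (by omega)
    have h3 := Nat.mul_le_mul (show (lst v).size + 1 ≤ polyBound d' v.size + 1 by omega)
      (Nat.add_le_add_left h2 1)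
    omega

/-! ### Couplings -/

/-- There is a joint distribution with marginals `p` and `q` on which `R` holds surely. -/
def Coupled {α β : Type*} (R : α → β → Prop) (p : PMF α) (q : PMF β) : Prop :=
  ∃ j : PMF (α × β), j.map Prod.fst = p ∧ j.map Prod.snd = q ∧ ∀ x ∈ j.support, R x.1 x.2

section Coupling
variable {α β γ δ : Type*}

theorem pmf_map_id (p : PMF α) : p.map (fun a => a) = p := PMF.map_id p

theorem pmf_map_const (p : PMF α) (b : β) : p.map (fun _ => b) = PMF.pure b := PMF.map_const p b

/-- The independent coupling. It is used once nothing about the two sides has to match any more,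
that is, after both games are lost. -/
theorem Coupled.prod {R : α → β → Prop} {p : PMF α} {q : PMF β}
    (h : ∀ a ∈ p.support, ∀ b ∈ q.support, R a b) : Coupled R p q := by
  refine ⟨p.bind fun a => q.map fun b => (a, b), ?_, ?_, ?_⟩
  · rw [PMF.map_bind]
    simp [PMF.map_comp, Function.comp_def, pmf_map_const]
  · rw [PMF.map_bind]
    simp [PMF.map_comp, Function.comp_def, pmf_map_id]
  · rintro ⟨a, b⟩ hx
    simp only [PMF.mem_support_bind_iff, PMF.support_map, Set.mem_image, Prod.mk.injEq] at hx
    obtain ⟨a', ha, b', hb, rfl, rfl⟩ := hx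
    exact h _ ha _ hb

theorem Coupled.pure {R : α → β → Prop} {a : α} {b : β} (h : R a b) :
    Coupled R (PMF.pure a) (PMF.pure b) :=
  Coupled.prod (by simpa using h)

theorem Coupled.mono {R S : α → β → Prop} {p : PMF α} {q : PMF β} (h : Coupled R p q)
    (hRS : ∀ a b, R a b → S a b) : Coupled S p q := by
  obtain ⟨j, h₁, h₂, h₃⟩ := h
  exact ⟨j, h₁, h₂, fun x hx => hRS _ _ (h₃ x hx)⟩

/-- A pair is drawn from the joint distribution of the first stage, then a pair from a joint
distribution of the two continuations. -/
theorem Coupled.bind {R : α → β → Prop} {S : γ → δ → Prop} {p : PMF α} {q : PMF β}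
    {f : α → PMF γ} {g : β → PMF δ} (h : Coupled R p q)
    (hfg : ∀ a b, R a b → Coupled S (f a) (g b)) : Coupled S (p.bind f) (q.bind g) := by
  obtain ⟨j, h₁, h₂, h₃⟩ := h
  have hJ : ∀ x : α × β, ∃ J : PMF (γ × δ), J.map Prod.fst = f x.1 ∧ J.map Prod.snd = g x.2 ∧
      (R x.1 x.2 → ∀ y ∈ J.support, S y.1 y.2) := by
    intro x
    -- Pairs outside `R` have probability zero under `j`, but a joint distribution must be chosen
    -- for them too; the independent one will do.
    by_cases hx : R x.1 x.2
    · obtain ⟨J, k₁, k₂, k₃⟩ := hfg _ _ hx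
      exact ⟨J, k₁, k₂, fun _ => k₃⟩
    · obtain ⟨J, k₁, k₂, -⟩ := Coupled.prod (R := fun _ _ => True) (p := f x.1) (q := g x.2)
        (by simp)
      exact ⟨J, k₁, k₂, fun h => (hx h).elim⟩
  choose J k₁ k₂ k₃ using hJ
  refine ⟨j.bind J, ?_, ?_, ?_⟩
  · rw [PMF.map_bind, ← h₁, PMF.bind_map]
    congr 1
    funext x
    exact k₁ x
  · rw [PMF.map_bind, ← h₂, PMF.bind_map]
    congr 1
    funext x
    exact k₂ x
  · intro y hy
    obtain ⟨x, hx, hy⟩ := (PMF.mem_support_bind_iff _ _ _).1 hy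
    exact k₃ x (h₃ x hx) y hy

theorem Coupled.refl (p : PMF α) : Coupled (fun a b => a = b ∧ a ∈ p.support) p p :=
  ⟨p.map fun a => (a, a), by simp [PMF.map_comp, Function.comp_def, pmf_map_id],
    by simp [PMF.map_comp, Function.comp_def, pmf_map_id], by
      rintro x hx
      rw [PMF.support_map] at hx
      obtain ⟨a, ha, rfl⟩ := hx
      exact ⟨rfl, ha⟩⟩

theorem Coupled.bind_same {S : γ → δ → Prop} (p : PMF α) {f : α → PMF γ} {g : α → PMF δ}
    (h : ∀ a ∈ p.support, Coupled S (f a) (g a)) : Coupled S (p.bind f) (p.bind g) :=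
  (Coupled.refl p).bind fun a b hab => by
    obtain ⟨rfl, ha⟩ := hab
    exact h a ha

theorem Coupled.map_same {S : γ → δ → Prop} (p : PMF α) {f : α → γ} {g : α → δ}
    (h : ∀ a ∈ p.support, S (f a) (g a)) : Coupled S (p.map f) (p.map g) :=
  Coupled.bind_same p fun a ha => Coupled.pure (h a ha)

theorem Coupled.symm {R : α → β → Prop} {p : PMF α} {q : PMF β} (h : Coupled R p q) :
    Coupled (fun b a => R a b) q p := by
  obtain ⟨j, h₁, h₂, h₃⟩ := h
  refine ⟨j.map Prod.swap, ?_, ?_, ?_⟩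
  · rw [PMF.map_comp]; exact h₂
  · rw [PMF.map_comp]; exact h₁
  · intro x hx
    rw [PMF.support_map] at hx
    obtain ⟨y, hy, rfl⟩ := hx
    exact h₃ y hy

theorem map_apply_true (p : PMF α) (E : α → Bool) :
    p.map E true = p.toOuterMeasure {a | E a = true} := by
  have h := PMF.toOuterMeasure_map_apply (p := p) E {true}
  rw [PMF.toOuterMeasure_apply_singleton] at h
  exact h

/-- The probability of `E`. -/
noncomputable def pr (p : PMF α) (E : α → Bool) : ℝ := (p.map E true).toReal

theorem pr_le_one (p : PMF α) (E : α → Bool) : p.map E true ≠ ⊤ := PMF.apply_ne_top _ _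

theorem pr_map (p : PMF α) (f : α → β) (E : β → Bool) : pr (p.map f) E = pr p (fun a => E (f a)) := by
  unfold pr
  rw [PMF.map_comp]
  rfl

/-- Both probabilities are read off the joint distribution, on whose support one event is contained
in the other. -/
theorem Coupled.pr_le {R : α → β → Prop} {p : PMF α} {q : PMF β} (h : Coupled R p q)
    {E : α → Bool} {F : β → Bool} (hEF : ∀ a b, R a b → E a = true → F b = true) :
    pr p E ≤ pr q F := by
  obtain ⟨j, rfl, rfl, h₃⟩ := h
  rw [pr_map, pr_map]
  unfold pr
  refine ENNReal.toReal_mono (pr_le_one _ _) ?_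
  rw [map_apply_true, map_apply_true]
  refine PMF.toOuterMeasure_mono _ ?_
  rintro x ⟨hx, hs⟩
  exact hEF _ _ (h₃ x hs) hx

theorem Coupled.pr_eq {R : α → β → Prop} {p : PMF α} {q : PMF β} (h : Coupled R p q)
    {E : α → Bool} {F : β → Bool} (hEF : ∀ a b, R a b → E a = F b) :
    pr p E = pr q F :=
  le_antisymm (h.pr_le fun a b hab ha => hEF a b hab ▸ ha)
    (h.symm.pr_le fun b a hab hb => (hEF a b hab).trans hb)

theorem pr_mono (p : PMF α) {E F : α → Bool} (h : ∀ a, E a = true → F a = true) :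
    pr p E ≤ pr p F :=
  (Coupled.refl p).pr_le fun a _ hab ha => hab.1 ▸ h a ha

theorem pr_or_le (p : PMF α) (E F : α → Bool) :
    pr p (fun a => E a || F a) ≤ pr p E + pr p F := by
  unfold pr
  rw [← ENNReal.toReal_add (pr_le_one _ _) (pr_le_one _ _)]
  refine ENNReal.toReal_mono (ENNReal.add_ne_top.2 ⟨pr_le_one _ _, pr_le_one _ _⟩) ?_
  rw [map_apply_true, map_apply_true, map_apply_true]
  have : {a | (E a || F a) = true} = {a | E a = true} ∪ {a | F a = true} := by
    ext a; simp
  rw [this]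
  exact MeasureTheory.measure_union_le _ _

/-- The fundamental lemma of game playing: two games that agree unless something bad happens differ
by at most the probability of the bad event, measured in either game; here it is the second. -/
theorem Coupled.abs_pr_sub_le {R : α → β → Prop} {p : PMF α} {q : PMF β} (h : Coupled R p q)
    {E : α → Bool} {F bad : β → Bool} (hEF : ∀ a b, R a b → E a = F b ∨ bad b = true) :
    |pr p E - pr q F| ≤ pr q bad := by
  have h₁ : pr p E ≤ pr q (fun b => F b || bad b) := h.pr_le fun a b hab ha => by
    rcases hEF a b hab with h | h
    · simp [← h, ha]
    · simp [h]
  have h₂ : pr q (fun b => F b && !bad b) ≤ pr p E := h.symm.pr_le fun b a hab hb => by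
    simp only [Bool.and_eq_true, Bool.not_eq_true'] at hb
    rcases hEF a b hab with h | h
    · rw [h, hb.1]
    · simp [h] at hb
  have h₃ := pr_or_le q F bad
  have h₄ := (pr_mono q (E := F) (F := fun b => (F b && !bad b) || bad b) fun b hb => by
    cases hb' : bad b <;> simp [hb]).trans (pr_or_le q _ bad)
  rw [abs_le]
  constructor <;> linarith

end Coupling

theorem unif_support {m x : ℕ} (h : x ∈ (unif m).support) : x ≤ m := by
  unfold unif at h
  rw [PMF.support_map] at h
  obtain ⟨y, -, rfl⟩ := h
  omega

-- A request for a number in `{0}` has no effect on the challenger. The composed machine uses it as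
-- an idle move.
@[simp] theorem unif_zero : unif 0 = PMF.pure 0 := by
  ext x
  have : (unif 0).support ⊆ {0} := fun y hy => by simpa using unif_support hy
  have h0 : (unif 0).support = {0} :=
    Set.Nonempty.subset_singleton_iff (PMF.support_nonempty _) |>.1 this
  by_cases hx : x = 0
  · subst hx
    simpa using (PMF.apply_eq_one_iff _ 0).2 h0
  · rw [(PMF.apply_eq_zero_iff _ _).2 (by rw [h0]; simpa using hx)]
    simp [PMF.pure_apply, hx]

/-! ### Playing two games with the same adversary -/

/-- A request for a random number. -/
def Val.IsRand : Val → Prop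
  | .pair (.nat 0) (.nat _) => True
  | _ => False

theorem Val.isRand_iff (a : Val) : a.IsRand ↔ ∃ m, a = .pair (.nat 0) (.nat m) := by
  constructor
  · intro h
    unfold Val.IsRand at h
    split at h
    · exact ⟨_, rfl⟩
    · exact h.elim
  · rintro ⟨m, rfl⟩
    trivial

theorem Adversary.activate_fst_size (A : Adversary) (ℓ : ℕ) (st msg : Val) :
    (A.activate ℓ st msg).1.size ≤ polyBound A.deg ℓ := by
  unfold Adversary.activate
  simp only
  split_ifs with h
  · exact (Val.size_fst_le _).trans h
  · have := polyBound_pos A.deg ℓ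
    simpa using Nat.succ_le_of_lt this

theorem Adversary.activate_snd_size (A : Adversary) (ℓ : ℕ) (st msg : Val) :
    (A.activate ℓ st msg).2.size ≤ polyBound A.deg ℓ := by
  unfold Adversary.activate
  simp only
  split_ifs with h
  · exact (Val.size_snd_le _).trans h
  · have := polyBound_pos A.deg ℓ
    simpa using Nat.succ_le_of_lt this

theorem Game.play_rand {G : Game} {A : Adversary} {ℓ : ℕ} {n : ℕ} {s : G.State} {st msg : Val}
    {m : ℕ} (h : (A.activate ℓ st msg).2 = .pair (.nat 0) (.nat m)) :
    G.play A ℓ (n + 1) s st msg =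
      (unif m).bind fun x => G.play A ℓ n s (A.activate ℓ st msg).1 (.nat x) := by
  rw [Game.play]
  rcases hA : A.activate ℓ st msg with ⟨st', a⟩
  rw [hA] at h
  subst h
  rfl

theorem Game.play_respond {G : Game} {A : Adversary} {ℓ : ℕ} {n : ℕ} {s : G.State} {st msg : Val}
    (h : ¬(A.activate ℓ st msg).2.IsRand) :
    G.play A ℓ (n + 1) s st msg =
      (G.respond s (A.activate ℓ st msg).2).bind fun p =>
        G.play A ℓ n p.1 (A.activate ℓ st msg).1 p.2 := by
  rw [Game.play]
  rcases hA : A.activate ℓ st msg with ⟨st', a⟩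
  rw [hA] at h
  split
  · rename_i heq
    obtain ⟨rfl, rfl⟩ := Prod.mk.inj heq
    exact (h ((Val.isRand_iff _).2 ⟨_, rfl⟩)).elim
  · rename_i heq
    obtain ⟨rfl, rfl⟩ := Prod.mk.inj heq
    rfl

/-- A property of the states that is kept by every answer of the challenger. -/
theorem Game.play_stable {G : Game} {A : Adversary} {ℓ : ℕ} {P : G.State → Prop}
    (hP : ∀ s a, P s → ∀ x ∈ (G.respond s a).support, P x.1) (n : ℕ) :
    ∀ (s : G.State) (st msg : Val), P s → ∀ s' ∈ (G.play A ℓ n s st msg).support, P s' := by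
  induction n with
  | zero =>
    intro s st msg h s' hs'
    simp only [Game.play, PMF.support_pure, Set.mem_singleton_iff] at hs'
    exact hs' ▸ h
  | succ n ih =>
    intro s st msg h s' hs'
    by_cases hr : (A.activate ℓ st msg).2.IsRand
    · obtain ⟨m, hm⟩ := (Val.isRand_iff _).1 hr
      rw [Game.play_rand hm] at hs'
      obtain ⟨x, -, hx⟩ := (PMF.mem_support_bind_iff _ _ _).1 hs'
      exact ih _ _ _ h _ hx
    · rw [Game.play_respond hr] at hs'
      obtain ⟨x, hx, hx'⟩ := (PMF.mem_support_bind_iff _ _ _).1 hs'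
      exact ih _ _ _ (hP _ _ h _ hx) _ hx'

/-- Two games stay in relation `R i` (where `i` counts the activations of the adversary) as long
as they give the same answers, or they get into states `DX` and `DY` that they never leave. -/
theorem Game.play_coupled {X Y : Game} {A : Adversary} {ℓ : ℕ}
    {R : ℕ → X.State → Y.State → Prop} {D : X.State → Y.State → Prop}
    (hD : ∀ s t, D s t → ∀ a, (∀ x ∈ (X.respond s a).support, D x.1 t) ∧
      (∀ y ∈ (Y.respond t a).support, D s y.1))
    (hmono : ∀ i s t, R i s t → R (i + 1) s t)
    (hR : ∀ i s t a, i < polyBound A.deg ℓ → R i s t → a.size ≤ polyBound A.deg ℓ → ¬a.IsRand →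
      Coupled (fun x y => (R (i + 1) x.1 y.1 ∧ x.2 = y.2) ∨ D x.1 y.1)
        (X.respond s a) (Y.respond t a)) (n : ℕ) :
    ∀ (i : ℕ) (s : X.State) (t : Y.State) (st msg : Val), i + n ≤ polyBound A.deg ℓ → R i s t →
    Coupled (fun s t => R (i + n) s t ∨ D s t) (X.play A ℓ n s st msg) (Y.play A ℓ n t st msg) := by
  induction n with
  | zero => exact fun i s t st msg _ h => Coupled.pure (Or.inl h)
  | succ n ih =>
    intro i s t st msg hi h
    by_cases hr : (A.activate ℓ st msg).2.IsRand
    · obtain ⟨m, hm⟩ := (Val.isRand_iff _).1 hr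
      rw [Game.play_rand hm, Game.play_rand hm]
      refine Coupled.bind_same _ fun x _ => ?_
      have := ih (i + 1) s t (A.activate ℓ st msg).1 (.nat x) (by omega) (hmono _ _ _ h)
      rwa [show i + 1 + n = i + (n + 1) by omega] at this
    · rw [Game.play_respond hr, Game.play_respond hr]
      refine (hR i s t _ (by omega) h (A.activate_snd_size _ _ _) hr).bind ?_
      rintro ⟨s', m⟩ ⟨t', m'⟩ (⟨h', hm⟩ | h')
      · simp only at hm
        subst hm
        have := ih (i + 1) s' t' (A.activate ℓ st msg).1 m (by omega) h'
        rwa [show i + 1 + n = i + (n + 1) by omega] at this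
      -- A lost pair stays lost whatever each side does on its own, so the rest of the two plays can
      -- be coupled independently: first the left state is moved with the right one fixed, then the
      -- right one.
      · refine Coupled.prod fun a ha b hb => Or.inr ?_
        have h₁ : D a t' := Game.play_stable (P := fun s => D s t')
          (fun s a hs => (hD s t' hs a).1) n _ _ _ h' _ ha
        exact Game.play_stable (P := fun t => D a t) (fun t c ht => (hD a t ht c).2) n _ _ _ h₁ _ hb

theorem Game.run_coupled {X Y : Game} {A : Adversary} {ℓ : ℕ}
    {R : ℕ → X.State → Y.State → Prop} {D : X.State → Y.State → Prop}
    (hstart : Coupled (fun x y => (R 0 x.1 y.1 ∧ x.2 = y.2)) X.start Y.start)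
    (hD : ∀ s t, D s t → ∀ a, (∀ x ∈ (X.respond s a).support, D x.1 t) ∧
      (∀ y ∈ (Y.respond t a).support, D s y.1))
    (hmono : ∀ i s t, R i s t → R (i + 1) s t)
    (hR : ∀ i s t a, i < polyBound A.deg ℓ → R i s t → a.size ≤ polyBound A.deg ℓ → ¬a.IsRand →
      Coupled (fun x y => (R (i + 1) x.1 y.1 ∧ x.2 = y.2) ∨ D x.1 y.1)
        (X.respond s a) (Y.respond t a)) :
    Coupled (fun s t => R (polyBound A.deg ℓ) s t ∨ D s t) (X.run A ℓ) (Y.run A ℓ) := by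
  refine hstart.bind ?_
  rintro ⟨s, m⟩ ⟨t, m'⟩ ⟨h, hm⟩
  simp only at hm
  subst hm
  have := Game.play_coupled (n := polyBound A.deg ℓ) hD hmono hR 0 s t (.nat 0) m (by omega) h
  rwa [zero_add] at this

theorem Game.prob_eq_pr (G : Game) (A : Adversary) (ℓ : ℕ) (E : G.State → Bool) :
    G.prob A ℓ E = pr (G.run A ℓ) E := rfl

/-! ### Composition of an adversary with a reduction -/

/-- The number `2 ^ n - 1` consists of `n` binary ones. Machines recover `ℓ` from `1^ℓ`, and the
number of blocks from its unary form, as a length. -/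
theorem size_two_pow_sub_one (n : ℕ) : Nat.size (2 ^ n - 1) = n := by
  apply le_antisymm
  · rw [Nat.size_le]
    have := Nat.two_pow_pos n
    omega
  · rcases n with _ | n
    · simp
    · rw [Nat.succ_le_iff, Nat.lt_size, pow_succ]
      have := Nat.two_pow_pos n
      omega

@[simp] theorem size_ones (ℓ : ℕ) : (ones ℓ).size = 1 + ℓ := by
  simp [ones, size_two_pow_sub_one]

theorem nat_size_le (n : ℕ) : Nat.size n ≤ n := Nat.size_le.2 Nat.lt_two_pow_self

@[fun_prop] theorem PolyPred.isRand {f : Val → Val} (hf : PolyTime f) :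
    PolyPred fun v => (f v).IsRand := by
  have : PolyPred fun v => (f v).fst = .nat 0 ∧ ¬(f v).IsNat ∧ (f v).snd.IsNat := by fun_prop
  convert this using 2 with v
  rw [Val.isRand_iff]
  rcases f v with n | ⟨a, b⟩
  · simp
  · cases b <;> simp

instance (v : Val) : Decidable v.IsRand := by
  unfold Val.IsRand
  split <;> infer_instance

/-- One activation, as a function of `(1^ℓ, (state, message))`. -/
def Adversary.act (A : Adversary) (v : Val) : Val :=
  if (A.step v).size ≤ polyBound A.deg (v.fst.size - 1) then .pair (A.step v).fst (A.step v).snd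
  else .pair (.nat 0) (.nat 0)

theorem Adversary.act_eq (A : Adversary) (ℓ : ℕ) (st msg : Val) :
    A.act (.pair (ones ℓ) (.pair st msg)) =
      .pair (A.activate ℓ st msg).1 (A.activate ℓ st msg).2 := by
  unfold Adversary.act Adversary.activate
  simp only [Val.fst_pair, size_ones, Nat.add_sub_cancel_left]
  split_ifs <;> rfl

@[fun_prop] theorem Adversary.act_poly (A : Adversary) : PolyTime A.act := by
  have := A.step_poly
  unfold Adversary.act
  fun_prop

theorem Adversary.activate_eq {A : Adversary} {ℓ : ℕ} {st msg st' out : Val}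
    (h : A.step (.pair (ones ℓ) (.pair st msg)) = .pair st' out)
    (hs : (Val.pair st' out).size ≤ polyBound A.deg ℓ) : A.activate ℓ st msg = (st', out) := by
  unfold Adversary.activate
  simp only [h, if_pos hs, Val.fst_pair, Val.snd_pair]

/-- Run the reduction `R` (for at most `k` activations) with the challenger `G` below it, until it
sends a message up. The messages that `R` receives are `(0, a)` from above and `(1, m)` from
below; it sends `(0, m)` up and `(1, d)` down. -/
noncomputable def Game.drive (G : Game) (R : Adversary) (ℓ : ℕ) :
    ℕ → Val → G.State → Val → PMF ((Val × G.State) × Val)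
  | 0, w, s, _ => PMF.pure ((w, s), .nat 0)
  | k + 1, w, s, msg =>
    if (R.activate ℓ w msg).2.fst = .nat 0 then
      PMF.pure (((R.activate ℓ w msg).1, s), (R.activate ℓ w msg).2.snd)
    else if (R.activate ℓ w msg).2.snd.IsRand then
      (unif (R.activate ℓ w msg).2.snd.snd.num).bind fun x =>
        G.drive R ℓ k (R.activate ℓ w msg).1 s (.pair (.nat 1) (.nat x))
    else (G.respond s (R.activate ℓ w msg).2.snd).bind fun q =>
        G.drive R ℓ k (R.activate ℓ w msg).1 q.1 (.pair (.nat 1) q.2)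

/-- The challenger that consists of the reduction `R` and the challenger `G` below it. -/
@[reducible] noncomputable def Game.reduce (G : Game) (R : Adversary) (ℓ : ℕ) : Game where
  State := Val × G.State
  start := G.start.bind fun p => G.drive R ℓ (polyBound R.deg ℓ) (.nat 0) p.1 (.pair (.nat 1) p.2)
  respond s a := G.drive R ℓ (polyBound R.deg ℓ) s.1 s.2 (.pair (.nat 0) a)

/-- The state of the composed machine: the number of activations left for the adversary, who is
to be activated next (`0`: the adversary, `1`: the reduction), whether it gets the incoming message
or the pending one, the states of both, the pending message, and the number of activations left for
the reduction. -/
def compState (cnt mode : ℕ) (inc : Bool) (stA stR pend : Val) (k : ℕ) : Val :=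
  .pair (.nat cnt) (.pair (.nat mode) (.pair (.nat (bif inc then 1 else 0))
    (.pair stA (.pair stR (.pair pend (.nat k))))))

/-- The composed machine, after the activation `r` of the adversary; the input is
`(1^ℓ, (state, r))`. -/
def compAfterA (R : Adversary) (v : Val) : Val :=
  if v.snd.snd.snd.IsRand then
    .pair (.pair (.nat (v.snd.fst.fst.num - 1)) (.pair (.nat 0) (.pair (.nat 1)
      (.pair v.snd.snd.fst (.pair v.snd.fst.snd.snd.snd.snd.fst (.pair (.nat 0) (.nat 0)))))))
      v.snd.snd.snd
  else
    .pair (.pair (.nat (v.snd.fst.fst.num - 1)) (.pair (.nat 1) (.pair (.nat 0)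
      (.pair v.snd.snd.fst (.pair v.snd.fst.snd.snd.snd.snd.fst
        (.pair (.pair (.nat 0) v.snd.snd.snd) (.nat (polyBound R.deg (v.fst.size - 1)))))))))
      (.pair (.nat 0) (.nat 0))

/-- The composed machine, after the activation `r` of the reduction; the input is `(state, r)`. -/
def compAfterR (v : Val) : Val :=
  if v.snd.snd.fst = .nat 0 then
    .pair (.pair v.fst.fst (.pair (.nat 0) (.pair (.nat 0)
      (.pair v.fst.snd.snd.snd.fst (.pair v.snd.fst (.pair v.snd.snd.snd (.nat 0)))))))
      (.pair (.nat 0) (.nat 0))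
  else
    .pair (.pair v.fst.fst (.pair (.nat 1) (.pair (.nat 1)
      (.pair v.fst.snd.snd.snd.fst (.pair v.snd.fst (.pair (.nat 0)
        (.nat (v.fst.snd.snd.snd.snd.snd.snd.num - 1))))))))
      v.snd.snd.snd

/-- The composed machine; the input is `(1^ℓ, (state, message))`. -/
def compGo (A R : Adversary) (v : Val) : Val :=
  if v.snd.fst.snd.fst = .nat 0 then
    if v.snd.fst.fst = .nat 0 then .pair v.snd.fst (.pair (.nat 0) (.nat 0))
    else compAfterA R (.pair v.fst (.pair v.snd.fst (A.act (.pair v.fst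
      (.pair v.snd.fst.snd.snd.snd.fst (if v.snd.fst.snd.snd.fst = .nat 1 then v.snd.snd
        else v.snd.fst.snd.snd.snd.snd.snd.fst))))))
  else if v.snd.fst.snd.snd.snd.snd.snd.snd = .nat 0 then
    .pair (.pair v.snd.fst.fst (.pair (.nat 0) (.pair (.nat 0) (.pair v.snd.fst.snd.snd.snd.fst
      (.pair v.snd.fst.snd.snd.snd.snd.fst (.pair (.nat 0) (.nat 0)))))))
      (.pair (.nat 0) (.nat 0))
  else compAfterR (.pair v.snd.fst (R.act (.pair v.fst (.pair v.snd.fst.snd.snd.snd.snd.fst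
    (if v.snd.fst.snd.snd.fst = .nat 1 then .pair (.nat 1) v.snd.snd
      else v.snd.fst.snd.snd.snd.snd.snd.fst)))))

/-- A state that is a bare number can only be the initial one, since every `compState` is a pair. It
is replaced by the state in which the reduction is about to receive the first message of the
challenger. -/
def compStep (A R : Adversary) (v : Val) : Val :=
  compGo A R (.pair v.fst (.pair
    (if v.snd.fst.IsNat then
      .pair (.nat (polyBound A.deg (v.fst.size - 1))) (.pair (.nat 1) (.pair (.nat 1)
        (.pair (.nat 0) (.pair (.nat 0) (.pair (.nat 0)
          (.nat (polyBound R.deg (v.fst.size - 1))))))))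
      else v.snd.fst) v.snd.snd))

theorem compStep_poly (A R : Adversary) : PolyTime (compStep A R) := by
  have h₁ : PolyTime (compAfterA R) := by unfold compAfterA; fun_prop
  have h₂ : PolyTime compAfterR := by unfold compAfterR; fun_prop
  have h₃ : PolyTime (compGo A R) := by unfold compGo; fun_prop
  unfold compStep
  fun_prop

/-- Length of the states and number of activations of the composed machine. -/
def compBound (A R : Adversary) (ℓ : ℕ) : ℕ :=
  40 + 5 * polyBound A.deg ℓ + 5 * polyBound R.deg ℓ +
    (polyBound A.deg ℓ + 1) * (polyBound R.deg ℓ + 3)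

theorem compBound_polyBdd (A R : Adversary) : PolyBdd (compBound A R) := by
  have h : ∀ d : ℕ, PolyBdd (polyBound d) := fun d => PolyBdd.id.polyBound d
  exact ((((PolyBdd.const 40).add ((PolyBdd.const 5).mul (h _))).add
    ((PolyBdd.const 5).mul (h _)))).add (((h _).add (.const 1)).mul ((h _).add (.const 3)))

/-- The adversary `A` on top of the reduction `R`. -/
noncomputable def Adversary.comp (A R : Adversary) : Adversary where
  step := compStep A R
  step_poly := compStep_poly A R
  deg := (compBound_polyBdd A R).choose

theorem Adversary.comp_bound (A R : Adversary) (ℓ : ℕ) :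
    compBound A R ℓ ≤ polyBound (A.comp R).deg ℓ :=
  (compBound_polyBdd A R).choose_spec ℓ

section Comp
variable {A R : Adversary} {ℓ cnt k : ℕ} {inc : Bool} {stA stR pend msg : Val}

theorem comp_step_state (mode : ℕ) :
    (A.comp R).step (.pair (ones ℓ) (.pair (compState cnt mode inc stA stR pend k) msg)) =
      compGo A R (.pair (ones ℓ) (.pair (compState cnt mode inc stA stR pend k) msg)) := by
  change compStep A R _ = _
  simp [compStep, compState]

theorem compState_size_le {a r mode : ℕ} (h₁ : cnt ≤ a) (h₂ : stA.size ≤ a) (h₃ : stR.size ≤ r)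
    (h₄ : pend.size ≤ a + r + 5) (h₅ : k ≤ r) (h₆ : mode ≤ 1) :
    (compState cnt mode inc stA stR pend k).size ≤ 3 * a + 3 * r + 25 := by
  have := nat_size_le cnt
  have := nat_size_le mode
  have := nat_size_le k
  cases inc <;> simp [compState] <;> omega

theorem size_le_comp_bound {cnt' mode' : ℕ} {inc' : Bool} {stA' stR' pend' out : Val} {k' : ℕ}
    (h₁ : cnt' ≤ polyBound A.deg ℓ) (h₂ : stA'.size ≤ polyBound A.deg ℓ)
    (h₃ : stR'.size ≤ polyBound R.deg ℓ)
    (h₄ : pend'.size ≤ polyBound A.deg ℓ + polyBound R.deg ℓ + 5) (h₅ : k' ≤ polyBound R.deg ℓ)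
    (h₆ : mode' ≤ 1) (h₇ : out.size ≤ polyBound A.deg ℓ + polyBound R.deg ℓ + 5) :
    (Val.pair (compState cnt' mode' inc' stA' stR' pend' k') out).size ≤
      polyBound (A.comp R).deg ℓ := by
  have := compState_size_le (inc := inc') h₁ h₂ h₃ h₄ h₅ h₆
  have := A.comp_bound R ℓ
  simp only [compBound, Val.size_pair] at *
  omega

theorem comp_activate_idle (h₂ : stA.size ≤ polyBound A.deg ℓ) (h₃ : stR.size ≤ polyBound R.deg ℓ)
    (h₄ : pend.size ≤ polyBound A.deg ℓ + polyBound R.deg ℓ + 5) (h₅ : k ≤ polyBound R.deg ℓ) :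
    (A.comp R).activate ℓ (compState 0 0 inc stA stR pend k) msg =
      (compState 0 0 inc stA stR pend k, .pair (.nat 0) (.nat 0)) := by
  refine Adversary.activate_eq ?_ (size_le_comp_bound (by omega) h₂ h₃ h₄ h₅ (by omega)
    (by simp))
  rw [comp_step_state]
  simp [compGo, compState]

theorem comp_activate_A (h₁ : cnt + 1 ≤ polyBound A.deg ℓ)
    (h₃ : stR.size ≤ polyBound R.deg ℓ) :
    (A.comp R).activate ℓ (compState (cnt + 1) 0 inc stA stR pend k) msg =
      if (A.activate ℓ stA (bif inc then msg else pend)).2.IsRand then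
        (compState cnt 0 true (A.activate ℓ stA (bif inc then msg else pend)).1 stR (.nat 0) 0,
          (A.activate ℓ stA (bif inc then msg else pend)).2)
      else (compState cnt 1 false (A.activate ℓ stA (bif inc then msg else pend)).1 stR
        (.pair (.nat 0) (A.activate ℓ stA (bif inc then msg else pend)).2) (polyBound R.deg ℓ),
          .pair (.nat 0) (.nat 0)) := by
  have ha := A.activate_fst_size ℓ stA (bif inc then msg else pend)
  have hb := A.activate_snd_size ℓ stA (bif inc then msg else pend)
  have hgo : (A.comp R).step (.pair (ones ℓ)
      (.pair (compState (cnt + 1) 0 inc stA stR pend k) msg)) =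
      compAfterA R (.pair (ones ℓ) (.pair (compState (cnt + 1) 0 inc stA stR pend k)
        (.pair (A.activate ℓ stA (bif inc then msg else pend)).1
          (A.activate ℓ stA (bif inc then msg else pend)).2))) := by
    rw [comp_step_state, ← Adversary.act_eq]
    cases inc <;> simp [compGo, compState]
  split_ifs with hr
  · refine Adversary.activate_eq ?_ (size_le_comp_bound (by omega) ha h₃ (by simp) (by omega)
      (by omega) (by omega))
    rw [hgo]
    simp [compAfterA, hr, compState]
  · refine Adversary.activate_eq ?_ (size_le_comp_bound (by omega) ha h₃ (by simp; omega) le_rfl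
      (by omega) (by simp))
    rw [hgo]
    simp [compAfterA, hr, compState]

theorem comp_activate_R_zero (h₁ : cnt ≤ polyBound A.deg ℓ) (h₂ : stA.size ≤ polyBound A.deg ℓ)
    (h₃ : stR.size ≤ polyBound R.deg ℓ) :
    (A.comp R).activate ℓ (compState cnt 1 inc stA stR pend 0) msg =
      (compState cnt 0 false stA stR (.nat 0) 0, .pair (.nat 0) (.nat 0)) := by
  refine Adversary.activate_eq ?_ (size_le_comp_bound h₁ h₂ h₃ (by simp) (by omega) (by omega)
    (by simp))
  rw [comp_step_state]
  simp [compGo, compState]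

theorem comp_activate_R (h₁ : cnt ≤ polyBound A.deg ℓ) (h₂ : stA.size ≤ polyBound A.deg ℓ)
    (h₅ : k + 1 ≤ polyBound R.deg ℓ) :
    (A.comp R).activate ℓ (compState cnt 1 inc stA stR pend (k + 1)) msg =
      if (R.activate ℓ stR (bif inc then .pair (.nat 1) msg else pend)).2.fst = .nat 0 then
        (compState cnt 0 false stA (R.activate ℓ stR (bif inc then .pair (.nat 1) msg else pend)).1
          (R.activate ℓ stR (bif inc then .pair (.nat 1) msg else pend)).2.snd 0,
          .pair (.nat 0) (.nat 0))
      else (compState cnt 1 true stA (R.activate ℓ stR (bif inc then .pair (.nat 1) msg else pend)).1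
        (.nat 0) k, (R.activate ℓ stR (bif inc then .pair (.nat 1) msg else pend)).2.snd) := by
  have ha := R.activate_fst_size ℓ stR (bif inc then .pair (.nat 1) msg else pend)
  have hb := (Val.size_snd_le _).trans
    (R.activate_snd_size ℓ stR (bif inc then .pair (.nat 1) msg else pend))
  have hgo : (A.comp R).step (.pair (ones ℓ)
      (.pair (compState cnt 1 inc stA stR pend (k + 1)) msg)) =
      compAfterR (.pair (compState cnt 1 inc stA stR pend (k + 1))
        (.pair (R.activate ℓ stR (bif inc then .pair (.nat 1) msg else pend)).1
          (R.activate ℓ stR (bif inc then .pair (.nat 1) msg else pend)).2)) := by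
    rw [comp_step_state, ← Adversary.act_eq]
    cases inc <;> simp [compGo, compState]
  split_ifs with hr
  · refine Adversary.activate_eq ?_ (size_le_comp_bound h₁ h₂ ha (by omega) (by omega)
      (by omega) (by simp))
    rw [hgo]
    simp [compAfterR, hr, compState]
  · refine Adversary.activate_eq ?_ (size_le_comp_bound h₁ h₂ ha (by simp) (by omega)
      (by omega) (by omega))
    rw [hgo]
    simp [compAfterR, hr, compState]

end Comp

/-- One induction for both control modes, since each hands over to the other. A full activation of
`A` uses one step for `A`, at most `polyBound R.deg ℓ` for the reduction, and one more if the
reduction exhausts its allowance; the `+ 3` leaves a step to spare. Steps without business with the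
challenger are idle requests for a number in `{0}`. -/
theorem Game.play_comp (G : Game) (A R : Adversary) (ℓ n : ℕ) :
    (∀ (cnt : ℕ) (inc : Bool) (stA stR pend : Val) (k : ℕ) (s : G.State) (msg : Val),
      cnt ≤ polyBound A.deg ℓ → stA.size ≤ polyBound A.deg ℓ → stR.size ≤ polyBound R.deg ℓ →
      pend.size ≤ polyBound A.deg ℓ + polyBound R.deg ℓ + 5 → k ≤ polyBound R.deg ℓ →
      cnt * (polyBound R.deg ℓ + 3) ≤ n →
      G.play (A.comp R) ℓ n s (compState cnt 0 inc stA stR pend k) msg =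
        ((G.reduce R ℓ).play A ℓ cnt (stR, s) stA (bif inc then msg else pend)).map Prod.snd) ∧
    (∀ (cnt : ℕ) (inc : Bool) (stA stR pend : Val) (k : ℕ) (s : G.State) (msg : Val),
      cnt ≤ polyBound A.deg ℓ → stA.size ≤ polyBound A.deg ℓ → stR.size ≤ polyBound R.deg ℓ →
      pend.size ≤ polyBound A.deg ℓ + polyBound R.deg ℓ + 5 → k ≤ polyBound R.deg ℓ →
      k + 1 + cnt * (polyBound R.deg ℓ + 3) ≤ n →
      G.play (A.comp R) ℓ n s (compState cnt 1 inc stA stR pend k) msg =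
        (G.drive R ℓ k stR s (bif inc then .pair (.nat 1) msg else pend)).bind fun x =>
          ((G.reduce R ℓ).play A ℓ cnt x.1 stA x.2).map Prod.snd) := by
  induction n with
  | zero =>
    refine ⟨fun cnt inc stA stR pend k s msg _ _ _ _ _ h => ?_,
      fun cnt inc stA stR pend k s msg _ _ _ _ _ h => by omega⟩
    obtain rfl : cnt = 0 := by
      rcases Nat.eq_zero_or_pos cnt with h0 | h0
      · exact h0
      · have := Nat.mul_le_mul_right (polyBound R.deg ℓ + 3) h0
        omega
    simp [Game.play, PMF.pure_map]
  | succ n ih =>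
    obtain ⟨ihA, ihR⟩ := ih
    constructor
    · intro cnt inc stA stR pend k s msg h₁ h₂ h₃ h₄ h₅ h
      rcases cnt with _ | cnt
      · have hact := comp_activate_idle (A := A) (inc := inc) (msg := msg) h₂ h₃ h₄ h₅
        -- With no activation of `A` left the machine idles until its own allowance is used up.
        rw [Game.play_rand (m := 0) (by rw [hact]), hact, unif_zero, PMF.pure_bind]
        rw [ihA 0 inc stA stR pend k s _ h₁ h₂ h₃ h₄ h₅ (by omega)]
        simp [Game.play, PMF.pure_map]
      · have hact := comp_activate_A (A := A) (R := R) (inc := inc) (stA := stA) (pend := pend)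
          (k := k) (msg := msg) h₁ h₃
        have ha := A.activate_fst_size ℓ stA (bif inc then msg else pend)
        have hb := A.activate_snd_size ℓ stA (bif inc then msg else pend)
        rw [add_mul] at h
        split_ifs at hact with hr
        · obtain ⟨m, hm⟩ := (Val.isRand_iff _).1 hr
          rw [Game.play_rand (m := m) (by rw [hact]; exact hm), hact, Game.play_rand hm,
            PMF.map_bind]
          congr 1
          funext x
          rw [ihA cnt true _ stR _ _ s _ (by omega) ha h₃ (by simp) (by omega) (by omega)]
          rfl
        · rw [Game.play_rand (m := 0) (by rw [hact]), hact, unif_zero, PMF.pure_bind,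
            Game.play_respond hr, PMF.map_bind,
            ihR cnt false _ stR _ _ s _ (by omega) ha h₃ (by simp; omega) le_rfl (by omega)]
          rfl
    · intro cnt inc stA stR pend k s msg h₁ h₂ h₃ h₄ h₅ h
      rcases k with _ | k
      -- A reduction out of activations counts as having answered `0`; this is the value that
      -- `Game.drive` returns with no fuel left.
      · have hact := comp_activate_R_zero (A := A) (R := R) (inc := inc) (pend := pend)
          (msg := msg) h₁ h₂ h₃
        rw [Game.play_rand (m := 0) (by rw [hact]), hact, unif_zero, PMF.pure_bind,
          ihA cnt false stA stR _ _ s _ h₁ h₂ h₃ (by simp) (by omega) (by omega)]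
        simp [Game.drive]
      · have hact := comp_activate_R (A := A) (R := R) (inc := inc) (stR := stR) (pend := pend)
          (msg := msg) h₁ h₂ h₅
        have ha := R.activate_fst_size ℓ stR (bif inc then .pair (.nat 1) msg else pend)
        have hb := (Val.size_snd_le _).trans
          (R.activate_snd_size ℓ stR (bif inc then .pair (.nat 1) msg else pend))
        rw [Game.drive]
        split_ifs at hact ⊢ with hu hr
        · rw [Game.play_rand (m := 0) (by rw [hact]), hact, unif_zero, PMF.pure_bind,
            ihA cnt false stA _ _ _ s _ h₁ h₂ ha (by omega) (by omega) (by omega), PMF.pure_bind]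
          rfl
        · obtain ⟨m, hm⟩ := (Val.isRand_iff _).1 hr
          rw [Game.play_rand (m := m) (by rw [hact]; exact hm), hact, hm, PMF.bind_bind]
          congr 1
          funext x
          rw [ihR cnt true stA _ _ _ s _ h₁ h₂ ha (by simp) (by omega) (by omega)]
          rfl
        · rw [Game.play_respond (by rw [hact]; exact hr), hact, PMF.bind_bind]
          congr 1
          funext x
          rw [ihR cnt true stA _ _ _ x.1 _ h₁ h₂ ha (by simp) (by omega) (by omega)]
          rfl

/-- Playing against `G` with the composed adversary is playing against the composed challenger. -/
theorem Game.run_comp (G : Game) (A R : Adversary) (ℓ : ℕ) :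
    G.run (A.comp R) ℓ = ((G.reduce R ℓ).run A ℓ).map Prod.snd := by
  unfold Game.run
  rw [PMF.map_bind]
  change _ = (PMF.bind (PMF.bind _ _) _)
  rw [PMF.bind_bind]
  congr 1
  funext p
  have hA := polyBound_pos A.deg ℓ
  have hR := polyBound_pos R.deg ℓ
  -- The extra `polyBound R.deg ℓ + 1` is for the opening, in which the reduction reacts to the
  -- first message of the challenger before `A` is activated.
  have hn : polyBound R.deg ℓ + 1 + polyBound A.deg ℓ * (polyBound R.deg ℓ + 3) ≤
      polyBound (A.comp R).deg ℓ := by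
    have := A.comp_bound R ℓ
    unfold compBound at this
    rw [add_mul] at this
    omega
  -- `compStep` treats the number `0` and the explicit initial state alike. The transition function
  -- must be applied at least once for this, hence the exception `n = 0`.
  have hinit : ∀ n, G.play (A.comp R) ℓ n p.1 (.nat 0) p.2 =
      G.play (A.comp R) ℓ n p.1 (compState (polyBound A.deg ℓ) 1 true (.nat 0) (.nat 0) (.nat 0)
        (polyBound R.deg ℓ)) p.2 ∨ n = 0 := by
    intro n
    rcases n with _ | n
    · exact Or.inr rfl
    · left
      have hact : (A.comp R).activate ℓ (.nat 0) p.2 = (A.comp R).activate ℓ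
          (compState (polyBound A.deg ℓ) 1 true (.nat 0) (.nat 0) (.nat 0) (polyBound R.deg ℓ))
            p.2 := by
        have hstep : (A.comp R).step (.pair (ones ℓ) (.pair (.nat 0) p.2)) =
            (A.comp R).step (.pair (ones ℓ) (.pair (compState (polyBound A.deg ℓ) 1 true (.nat 0)
              (.nat 0) (.nat 0) (polyBound R.deg ℓ)) p.2)) := by
          rw [comp_step_state]
          change compStep A R (.pair (ones ℓ) (.pair (.nat 0) p.2)) = _
          simp [compStep, compState]
        unfold Adversary.activate
        rw [hstep]
      rw [Game.play, Game.play, hact]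
  rw [(hinit _).resolve_right (by omega), (G.play_comp A R ℓ _).2 _ true _ _ _ _ _ _ le_rfl
    (by simp; omega) (by simp; omega) (by simp) le_rfl hn]
  rfl

theorem Game.prob_comp (G : Game) (A R : Adversary) (ℓ : ℕ) (E : G.State → Bool) :
    G.prob (A.comp R) ℓ E = (G.reduce R ℓ).prob A ℓ fun s => E s.2 := by
  rw [Game.prob_eq_pr, Game.prob_eq_pr, Game.run_comp, pr_map]

/-! Single activations of the reduction. -/

theorem Game.drive_up {G : Game} {R : Adversary} {ℓ k : ℕ} {w w' m msg : Val} {s : G.State}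
    (h : R.step (.pair (ones ℓ) (.pair w msg)) = .pair w' (.pair (.nat 0) m))
    (hs : (Val.pair w' (.pair (.nat 0) m)).size ≤ polyBound R.deg ℓ) :
    G.drive R ℓ (k + 1) w s msg = PMF.pure ((w', s), m) := by
  rw [Game.drive, Adversary.activate_eq h hs]
  simp

theorem Game.drive_rand {G : Game} {R : Adversary} {ℓ k n : ℕ} {w w' msg : Val} {s : G.State}
    (h : R.step (.pair (ones ℓ) (.pair w msg)) =
      .pair w' (.pair (.nat 1) (.pair (.nat 0) (.nat n))))
    (hs : (Val.pair w' (.pair (.nat 1) (.pair (.nat 0) (.nat n)))).size ≤ polyBound R.deg ℓ) :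
    G.drive R ℓ (k + 1) w s msg =
      (unif n).bind fun x => G.drive R ℓ k w' s (.pair (.nat 1) (.nat x)) := by
  rw [Game.drive, Adversary.activate_eq h hs]
  simp [(Val.isRand_iff _).2 ⟨n, rfl⟩]

theorem Game.drive_down {G : Game} {R : Adversary} {ℓ k : ℕ} {w w' d msg : Val} {s : G.State}
    (h : R.step (.pair (ones ℓ) (.pair w msg)) = .pair w' (.pair (.nat 1) d)) (hd : ¬d.IsRand)
    (hs : (Val.pair w' (.pair (.nat 1) d)).size ≤ polyBound R.deg ℓ) :
    G.drive R ℓ (k + 1) w s msg =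
      (G.respond s d).bind fun q => G.drive R ℓ k w' q.1 (.pair (.nat 1) q.2) := by
  rw [Game.drive, Adversary.activate_eq h hs]
  simp [hd]

/-! ### Lengths of what probabilistic algorithms and ORAM clients output -/

theorem PolyComputable.exists_bound {f : ℕ → ℕ} (h : PolyComputable f) :
    ∃ b, PolyBdd b ∧ ∀ ℓ, (Val.nat (f ℓ)).size ≤ b ℓ := by
  obtain ⟨F, hF, hf⟩ := h
  obtain ⟨d, hd⟩ := hF.size_le
  refine ⟨fun ℓ => polyBound d (1 + ℓ), ((PolyBdd.const 1).add PolyBdd.id).polyBound d, fun ℓ => ?_⟩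
  have := hd (ones ℓ)
  rwa [hf, size_ones] at this

theorem nat_size_mono {m n : ℕ} (h : m ≤ n) : (Val.nat m).size ≤ (Val.nat n).size := by
  have := Nat.size_le_size h
  simpa using this

/-- The number that a function of `1^ℓ` computes. -/
noncomputable def PolyComputable.fn {f : ℕ → ℕ} (h : PolyComputable f) : Val → Val := h.choose

@[fun_prop] theorem PolyComputable.fn_poly {f : ℕ → ℕ} (h : PolyComputable f) : PolyTime h.fn :=
  h.choose_spec.1

@[simp] theorem PolyComputable.fn_ones {f : ℕ → ℕ} (h : PolyComputable f) (ℓ : ℕ) :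
    h.fn (ones ℓ) = .nat (f ℓ) :=
  h.choose_spec.2 ℓ

theorem RandAlg.exists_bound (R : RandAlg) {b : ℕ → ℕ} (hb : PolyBdd b) :
    ∃ c, PolyBdd c ∧ ∀ ℓ x r, x.size ≤ b ℓ → r ≤ R.coins ℓ → (R.out ℓ x r).size ≤ c ℓ := by
  obtain ⟨b', hb', h⟩ := R.coins_poly.exists_bound
  obtain ⟨d, hd⟩ := R.run_poly.size_le
  refine ⟨fun ℓ => polyBound d (3 + ℓ + b ℓ + b' ℓ),
    ((((PolyBdd.const 3).add PolyBdd.id).add hb).add hb').polyBound d, fun ℓ x r hx hr => ?_⟩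
  refine (hd _).trans (polyBound_mono d ?_)
  have h₁ := h ℓ
  have h₂ := nat_size_mono hr
  simp only [Val.size_pair, size_ones]
  omega

theorem RandAlg.mem_support {R : RandAlg} {ℓ : ℕ} {x v : Val}
    (h : v ∈ (R.sample ℓ x).support) : ∃ r ≤ R.coins ℓ, v = R.out ℓ x r := by
  unfold RandAlg.sample at h
  rw [PMF.support_map] at h
  obtain ⟨r, hr, rfl⟩ := h
  exact ⟨r, unif_support hr, rfl⟩

variable {N : ℕ → ℕ}

theorem ORAM.size_of_move_wait {O : ORAM N} {ℓ : ℕ} {sk : Val} {a a' : Access} {c : Val}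
    (h : O.move ℓ sk a = .wait a' c) : c.size ≤ polyBound O.deg ℓ ∧ a' = a := by
  have hb := O.client_bound ℓ (.pair sk (.pair a.op.toVal (Val.list a.replies))) a.coin
  unfold ORAM.move at h
  split_ifs at h
  split at h
  · rename_i heq
    obtain ⟨rfl, rfl⟩ := AccessResult.wait.inj h
    rw [heq] at hb
    simp only [Val.size_pair] at hb
    exact ⟨by omega, rfl⟩
  · cases h
  · cases h

theorem ORAM.size_of_move_done {O : ORAM N} {ℓ : ℕ} {sk : Val} {a : Access} {db c out : Val}
    {t : Bool} (h : O.move ℓ sk a = .done db c out t) :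
    c.size ≤ polyBound O.deg ℓ ∧ db = O.nextDB ℓ a.db c ∧ t = a.tampered := by
  have hb := O.client_bound ℓ (.pair sk (.pair a.op.toVal (Val.list a.replies))) a.coin
  unfold ORAM.move at h
  split_ifs at h
  split at h
  · cases h
  · rename_i heq
    obtain ⟨rfl, rfl, rfl, rfl⟩ := AccessResult.done.inj h
    rw [heq] at hb
    simp only [Val.size_pair] at hb
    exact ⟨by omega, rfl, rfl⟩
  · cases h

theorem ORAM.size_after_move {O : ORAM N} {ℓ : ℕ} {sk : Val} (a : Access) (s : ORAMState) (op : Op) :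
    (s.after op (O.move ℓ sk a)).2.size ≤ polyBound O.deg ℓ + 4 := by
  rcases h : O.move ℓ sk a with ⟨a', c⟩ | ⟨db, c, out, t⟩ | t
  · have := (ORAM.size_of_move_wait h).1
    simp [ORAMState.after]; omega
  · have := (ORAM.size_of_move_done h).1
    have h2 : Nat.size 2 = 2 := by decide
    simp [ORAMState.after, h2]; omega
  · simp [ORAMState.after]

/-- The answers of the challenger in the ORAM game. -/
noncomputable def ORAM.answer (O : ORAM N) (β : Bool) (ℓ : ℕ) (s : ORAMState) (a : Val) :
    PMF (ORAMState × Val) := (O.game β ℓ).respond s a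

def ORAMState.init (v : Val) : ORAMState :=
  ⟨v.fst, ⟨v.snd, []⟩, fun _ => none, none, false, false, false, none⟩

/-- The ORAM game with its fields made visible. -/
@[reducible] noncomputable def ORAM.openGame (O : ORAM N) (β : Bool) (ℓ : ℕ) : Game where
  State := ORAMState
  start := (O.init.sample ℓ (ones (N ℓ))).map fun v => (ORAMState.init v, v.snd)
  respond := O.answer β ℓ

/-! ### The answers of the ORAM challenger, case by case -/

section Answer
variable {O : ORAM N} {β : Bool} {ℓ : ℕ} {s : ORAMState}

theorem ORAM.answer_reply {a : Access} {c m : Val} (hg : s.guess = none)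
    (hs : s.session = some (a, c)) : O.answer β ℓ s (.pair (.nat 4) m) =
      PMF.pure (({ s with rewound := s.rewound || O.rewinds ℓ a c m }).after a.op
        (O.receive ℓ s.sk a c m)) := by
  unfold ORAM.answer ORAM.game
  simp only [hg, hs]

theorem ORAM.answer_break {p : Access × Val} {msg : Val} (hg : s.guess = none)
    (hs : s.session = some p) (hm : ∀ m, msg ≠ .pair (.nat 4) m) : O.answer β ℓ s msg =
      PMF.pure ({ s with session := none }, .nat 0) := by
  unfold ORAM.answer ORAM.game
  simp only [hg, hs]
  split <;> simp_all

theorem ORAM.answer_read {b₀ b₁ : ℕ} (hg : s.guess = none) (hs : s.session = none)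
    (h₀ : b₀ < N ℓ) (h₁ : b₁ < N ℓ) :
    O.answer β ℓ s (.pair (.nat 1) (.pair (.nat b₀) (.nat b₁))) =
      O.begin ℓ s (.read (bif β then b₁ else b₀)) := by
  unfold ORAM.answer ORAM.game
  simp only [hg, hs, if_pos (And.intro h₀ h₁)]

theorem ORAM.answer_write {b₀ b₁ d₀ d₁ : ℕ} (hg : s.guess = none) (hs : s.session = none)
    (h₀ : b₀ < N ℓ) (h₁ : b₁ < N ℓ) (k₀ : validBlock ℓ d₀ = true) (k₁ : validBlock ℓ d₁ = true) :
    O.answer β ℓ s (.pair (.nat 2) (.pair (.pair (.nat b₀) (.nat d₀))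
      (.pair (.nat b₁) (.nat d₁)))) =
      O.begin ℓ s (bif β then .write b₁ d₁ else .write b₀ d₀) := by
  unfold ORAM.answer ORAM.game
  simp only [hg, hs, k₀, k₁, h₀, h₁, and_self, if_true]

theorem ORAM.answer_guess {g : ℕ} (hg : s.guess = none) (hs : s.session = none) :
    O.answer β ℓ s (.pair (.nat 3) (.nat g)) =
      PMF.pure ({ s with guess := some (g != 0) }, .nat 0) := by
  unfold ORAM.answer ORAM.game
  simp only [hg, hs]

theorem ORAM.answer_after_guess {g : Bool} (hg : s.guess = some g) (msg : Val) :
    O.answer β ℓ s msg = PMF.pure (s, .nat 0) := by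
  unfold ORAM.answer ORAM.game
  simp only [hg]

theorem ORAM.size_begin {op : Op} {x : ORAMState × Val}
    (h : x ∈ (O.begin ℓ s op).support) : x.2.size ≤ polyBound O.deg ℓ + 4 := by
  unfold ORAM.begin at h
  rw [PMF.support_map] at h
  obtain ⟨r, -, rfl⟩ := h
  exact ORAM.size_after_move _ _ _

/-- Machines that relay these answers must fit them into their length bound. -/
theorem ORAM.size_answer {a : Val} {x : ORAMState × Val}
    (h : x ∈ (O.answer β ℓ s a).support) : x.2.size ≤ polyBound O.deg ℓ + 4 := by
  have hp : ∀ {s' : ORAMState}, x ∈ (PMF.pure (s', Val.nat 0)).support →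
      x.2.size ≤ polyBound O.deg ℓ + 4 := by
    intro s' h
    simp only [PMF.support_pure, Set.mem_singleton_iff] at h
    subst h
    simp
  unfold ORAM.answer ORAM.game at h
  simp only at h
  split at h
  · rw [PMF.support_pure, Set.mem_singleton_iff] at h
    subst h
    exact ORAM.size_after_move _ _ _
  · exact hp h
  · split_ifs at h
    · exact ORAM.size_begin h
    · exact hp h
  · split_ifs at h
    · exact ORAM.size_begin h
    · exact hp h
  · exact hp h
  · exact hp h

end Answer

/-! ### The ORAM game together with an oracle for tokens -/

/-- The oracle of the PRF game: the keyed function or a random function. -/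
noncomputable def PRF.answer (F : PRF) (ideal : Bool) (ℓ : ℕ) (p : PRFState) (x : Val) :
    PMF (PRFState × Val) :=
  if ideal then
    match p.table x with
    | some y => PMF.pure (p, y)
    | none => (unif (2 ^ F.outLen ℓ - 1)).map fun y =>
        ({ p with table := Function.update p.table x (some (.nat y)) }, .nat y)
  else PMF.pure (p, F.apply ℓ p.key x)

/-- An oracle that answers every query with a fresh random number. -/
noncomputable def PRF.fresh (F : PRF) (ℓ : ℕ) (p : PRFState) (_ : Val) : PMF (PRFState × Val) :=
  (unif (2 ^ F.outLen ℓ - 1)).map fun y => (p, .nat y)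

/-- The ORAM game with a token oracle: the query `(7, (x₀, x₁))` is answered with the token for
`x_β`. -/
@[reducible] noncomputable def comboGame (O : ORAM N) (F : PRF)
    (tok : PRFState → Val → PMF (PRFState × Val)) (β : Bool) (ℓ : ℕ) : Game where
  State := ORAMState × PRFState
  start := (O.init.sample ℓ (ones (N ℓ))).bind fun v =>
    (F.keygen.sample ℓ (.nat 0)).map fun K =>
      ((ORAMState.init v, ⟨K, fun _ => none, none⟩), v.snd)
  respond s a :=
    if a.fst = .nat 7 then
      (tok s.2 (bif β then a.snd.snd else a.snd.fst)).map fun p => ((s.1, p.1), p.2)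
    else (O.answer β ℓ s.1 a).map fun p => ((p.1, s.2), p.2)

/-- The machine that adds the token oracle to the ORAM game. -/
noncomputable def tokenStep (F : PRF) (fresh β : Bool) (v : Val) : Val :=
  if v.snd.fst.IsNat then
    .pair (.pair (.nat 1) v.snd.snd.snd)
      (.pair (.nat 1) (.pair (.nat 0) (F.keygen.coins_poly.fn v.fst)))
  else if v.snd.fst.fst = .nat 1 then
    .pair (.pair (.nat 2) (F.keygen.run (.pair v.fst (.pair (.nat 0) v.snd.snd.snd))))
      (.pair (.nat 0) v.snd.fst.snd)
  else if v.snd.snd.fst = .nat 0 then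
    if v.snd.snd.snd.fst = .nat 7 then
      bif fresh then .pair v.snd.fst (.pair (.nat 1) (.pair (.nat 0)
        (.nat ((F.outLen_poly.fn v.fst).num - 1))))
      else .pair v.snd.fst (.pair (.nat 0) (F.eval (.pair v.fst (.pair v.snd.fst.snd
        (bif β then v.snd.snd.snd.snd.snd else v.snd.snd.snd.snd.fst)))))
    else .pair v.snd.fst (.pair (.nat 1) v.snd.snd.snd)
  else .pair v.snd.fst (.pair (.nat 0) v.snd.snd.snd)

theorem tokenStep_poly (F : PRF) (fresh β : Bool) : PolyTime (tokenStep F fresh β) := by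
  have h₁ := F.keygen.run_poly
  have h₂ := F.eval_poly
  unfold tokenStep
  cases fresh <;> cases β <;> simp only [cond_true, cond_false] <;> fun_prop

/-- One polynomial with room for everything the token machine stores or sends: the key, its coin, a
token, and relayed messages of both sides. -/
theorem exists_token_bound (O : ORAM N) (F : PRF) (d : ℕ) :
    ∃ b, PolyBdd b ∧ ∀ ℓ, 3 ≤ b ℓ ∧ polyBound O.deg ℓ + 20 ≤ b ℓ ∧ polyBound d ℓ + 20 ≤ b ℓ ∧
      (Val.nat (F.keygen.coins ℓ)).size + polyBound O.deg ℓ + 20 ≤ b ℓ ∧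
      (Val.nat (2 ^ F.outLen ℓ)).size + 20 ≤ b ℓ ∧
      ∀ r ≤ F.keygen.coins ℓ, (F.keygen.out ℓ (.nat 0) r).size + polyBound O.deg ℓ + polyBound d ℓ +
        (Val.nat (2 ^ F.outLen ℓ)).size + 20 ≤ b ℓ := by
  obtain ⟨b₁, hb₁, h₁⟩ := F.keygen.coins_poly.exists_bound
  obtain ⟨b₂, hb₂, h₂⟩ := F.outLen_poly.exists_bound
  obtain ⟨b₃, hb₃, h₃⟩ := F.keygen.exists_bound (PolyBdd.const 1)
  refine ⟨fun ℓ => polyBound O.deg ℓ + polyBound d ℓ + b₁ ℓ + b₂ ℓ + b₃ ℓ + 20,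
    (((((PolyBdd.id.polyBound O.deg).add (PolyBdd.id.polyBound d)).add hb₁).add hb₂).add hb₃).add
      (.const 20), fun ℓ => ?_⟩
  have := h₁ ℓ
  have := h₂ ℓ
  dsimp only
  refine ⟨by omega, by omega, by omega, by omega, by omega, fun r hr => ?_⟩
  have := h₃ ℓ (.nat 0) r (by simp) hr
  omega

/-- The ORAM game with keyed or with fresh tokens is played by an ORAM adversary, who has to know
the bit of the game only for keyed tokens. -/
theorem exists_token_adversary (O : ORAM N) (F : PRF) (fresh β₀ : Bool) (A : Adversary) :
    ∃ B : Adversary, ∀ β, (fresh = false → β = β₀) → ∀ ℓ (E : ORAMState → Bool),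
      (comboGame O F (bif fresh then F.fresh ℓ else F.answer false ℓ) β ℓ).prob A ℓ
        (fun s => E s.1) = (O.game β ℓ).prob B ℓ E := by
  obtain ⟨b, ⟨e, he⟩, hb⟩ := exists_token_bound O F A.deg
  let T : Adversary := ⟨tokenStep F fresh β₀, tokenStep_poly F fresh β₀, e⟩
  refine ⟨A.comp T, fun β hβ ℓ E => ?_⟩
  obtain ⟨b0, b1, b2, b3, b4, b5⟩ := hb ℓ
  have hTd : T.deg = e := rfl
  have hE := he ℓ
  change _ = (O.openGame β ℓ).prob _ _ _
  rw [Game.prob_comp, Game.prob_eq_pr, Game.prob_eq_pr]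
  obtain ⟨k, hk⟩ : ∃ k, polyBound T.deg ℓ = k + 3 := ⟨polyBound e ℓ - 3, by rw [hTd]; omega⟩
  have h2s : Nat.size 2 = 2 := by decide
  -- The machine holds the key and otherwise only relays, so the simulation is perfect and no pair
  -- is ever lost. That the key is an actual output of key generation is remembered because only
  -- such keys have a known length bound.
  refine (Game.run_coupled (D := fun _ _ => False)
    (R := fun _ (s : ORAMState × PRFState) (t : Val × ORAMState) =>
      t = (.pair (.nat 2) s.2.key, s.1) ∧ ∃ r ≤ F.keygen.coins ℓ, s.2.key = F.keygen.out ℓ (.nat 0) r)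
    ?_ (fun _ _ h => h.elim) (fun _ _ _ h => h) ?_).pr_eq ?_
  · change Coupled _ (PMF.bind _ _) (PMF.bind (PMF.map _ _) _)
    rw [PMF.bind_map]
    refine Coupled.bind_same _ fun v hv => ?_
    have hv' := O.init_bound ℓ v hv
    have hv'' := v.size_snd_le
    simp only [Function.comp_apply]
    rw [hk, Game.drive_rand (n := F.keygen.coins ℓ) (w' := .pair (.nat 1) v.snd) (by
        simp [T, tokenStep]) (by rw [hTd]; simp at *; omega)]
    unfold RandAlg.sample
    rw [PMF.map_comp]
    refine Coupled.bind_same _ fun r hr => ?_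
    have hr' := unif_support hr
    have := b5 r hr'
    rw [Game.drive_up (w' := .pair (.nat 2) (F.keygen.out ℓ (.nat 0) r)) (m := v.snd) (by
        simp [T, tokenStep, RandAlg.out]) (by rw [hTd]; simp at *; omega)]
    exact Coupled.pure ⟨⟨rfl, r, hr', rfl⟩, rfl⟩
  · rintro i ⟨o, p⟩ t a hi ⟨rfl, r, hr, hkey⟩ ha hnr
    simp only at hkey
    have hK := b5 r hr
    rw [← hkey] at hK
    change Coupled _ _ (Game.drive _ _ _ _ _ _ _)
    rw [hk]
    by_cases h7 : a.fst = .nat 7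
    · simp only [h7, if_true]
      cases fresh
      · obtain ⟨y, hy, hy'⟩ := F.eval_range ℓ p.key (bif β then a.snd.snd else a.snd.fst)
        have := nat_size_mono hy.le
        rw [Game.drive_up (w' := .pair (.nat 2) p.key) (m := .nat y) (by
          -- Only here is the bit of the game needed: the machine itself evaluates the keyed
          -- function at the input of the right world. Fresh tokens do not look at their input.
          rw [← hy', hβ rfl]
          simp [T, tokenStep, h7]) (by rw [hTd]; simp at *; omega)]
        simp only [cond_false, PRF.answer, Bool.false_eq_true, if_false, PMF.pure_map, PRF.apply, hy']
        exact Coupled.pure (Or.inl ⟨⟨rfl, r, hr, hkey⟩, rfl⟩)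
      · have := nat_size_mono (Nat.sub_le (2 ^ F.outLen ℓ) 1)
        rw [Game.drive_rand (n := 2 ^ F.outLen ℓ - 1) (w' := .pair (.nat 2) p.key) (by
          simp [T, tokenStep, h7]) (by rw [hTd]; simp at *; omega)]
        simp only [cond_true, PRF.fresh, PMF.map_comp]
        refine Coupled.bind_same _ fun y hy => ?_
        have := nat_size_mono (unif_support hy)
        rw [Game.drive_up (w' := .pair (.nat 2) p.key) (m := .nat y) (by
          simp [T, tokenStep]) (by rw [hTd]; simp at *; omega)]
        exact Coupled.pure (Or.inl ⟨⟨rfl, r, hr, hkey⟩, rfl⟩)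
    · simp only [h7, if_false]
      rw [Game.drive_down (w' := .pair (.nat 2) p.key) (d := a) (by
          simp [T, tokenStep, h7]) hnr (by rw [hTd]; simp at *; omega)]
      refine Coupled.bind_same _ fun q hq => ?_
      have := ORAM.size_answer hq
      rw [Game.drive_up (w' := .pair (.nat 2) p.key) (m := q.2) (by
          simp [T, tokenStep]) (by rw [hTd]; simp at *; omega)]
      exact Coupled.pure (Or.inl ⟨⟨rfl, r, hr, hkey⟩, rfl⟩)
  · rintro s t (⟨rfl, -⟩ | h)
    · rfl
    · exact h.elim

/-! ### Operations on lists in polynomial time -/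

theorem Val.size_le_of_mem_toList {v x : Val} (h : x ∈ v.toList) : x.size ≤ v.size := by
  induction v with
  | nat n => simp at h
  | pair a b _ ih =>
    simp only [Val.toList_pair, List.mem_cons] at h
    rcases h with rfl | h
    · simp; omega
    · have := ih h
      simp; omega

theorem List.length_prefix_le {v : Val} {l : List Val} (h : l <+: v.toList) : l.length ≤ v.size :=
  h.length_le.trans v.length_toList_le

@[fun_prop] theorem PolyNum.length {f : Val → Val} (hf : PolyTime f) :
    PolyNum fun v => (f v).toList.length := by
  have hstep : PolyTime fun x => .nat (x.snd.fst.num + 1) := by fun_prop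
  have key : ∀ (l : List Val) (c : ℕ),
      l.foldl (fun a x => Val.nat ((Val.pair (.nat 0) (.pair a x)).snd.fst.num + 1)) (.nat c) =
        .nat (c + l.length) := by
    intro l
    induction l with
    | nil => simp
    | cons a l ih => intro c; simp at ih ⊢; rw [ih]; congr 1; omega
  obtain ⟨d, hd⟩ := hf.size_le
  have := PolyTime.foldl hstep (PolyTime.const (.nat 0)) (PolyTime.const (.nat 0)) hf
    (M := fun n => 1 + AidWallet.polyBound d n) ((PolyBdd.const 1).add (PolyBdd.id.polyBound d)) (by
      intro v l hl
      have h := key l 0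
      rw [h]
      have h₁ := nat_size_le l.length
      have h₂ := List.length_prefix_le hl
      have h₃ := hd v
      simp; omega)
  unfold PolyNum
  convert this using 2 with v
  have h := key (f v).toList 0
  rw [h, zero_add]

/-- A left fold pushes the results onto its accumulator, so they come out in reverse order. All
intermediate lists are short because each entry has polynomial length and there are no more entries
than the list has nodes. -/
theorem PolyTime.listMap_reverse {g : Val → Val} (hg : PolyTime g) {ctx lst : Val → Val}
    (hctx : PolyTime ctx) (hlst : PolyTime lst) :
    PolyTime fun v => Val.list (((lst v).toList.map fun x => g (.pair (ctx v) x)).reverse) := by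
  have hstep : PolyTime fun x => .pair (g (.pair x.fst x.snd.snd)) x.snd.fst := by fun_prop
  have key : ∀ (c : Val) (l : List Val) (acc : List Val),
      l.foldl (fun a x => Val.pair (g (.pair (Val.pair c (.pair a x)).fst
        (Val.pair c (.pair a x)).snd.snd)) (Val.pair c (.pair a x)).snd.fst) (Val.list acc) =
        Val.list ((l.map fun x => g (.pair c x)).reverse ++ acc) := by
    intro c l
    induction l with
    | nil => simp
    | cons a l ih =>
      intro acc
      have := ih (g (.pair c a) :: acc)
      simp at this ⊢
      exact this
  obtain ⟨d, hd⟩ := hg.size_le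
  obtain ⟨d₁, hd₁⟩ := hctx.size_le
  obtain ⟨d₂, hd₂⟩ := hlst.size_le
  have h₁ : PolyBdd (AidWallet.polyBound d₁) := PolyBdd.id.polyBound d₁
  have h₂ : PolyBdd (AidWallet.polyBound d₂) := PolyBdd.id.polyBound d₂
  have := PolyTime.foldl hstep hctx (PolyTime.const (.nat 0)) hlst
    (M := fun n => 1 + polyBound d₂ n *
      (1 + polyBound d (1 + polyBound d₁ n + polyBound d₂ n)))
    ((PolyBdd.const 1).add (h₂.mul ((PolyBdd.const 1).add
      ((((PolyBdd.const 1).add h₁).add h₂).polyBound d)))) (by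
      intro v l hl
      have h := key (ctx v) l []
      rw [Val.list_nil] at h
      rw [h]
      refine (Val.size_list_le (B := polyBound d (1 + polyBound d₁ v.size + polyBound d₂ v.size))
        ?_).trans ?_
      · intro y hy
        simp only [List.append_nil, List.mem_reverse, List.mem_map] at hy
        obtain ⟨x, hx, rfl⟩ := hy
        refine (hd _).trans (polyBound_mono d ?_)
        have k₁ := Val.size_le_of_mem_toList (hl.subset hx)
        have k₂ := hd₁ v
        have k₃ := hd₂ v
        simp only [Val.size_pair]
        omega
      · have k₁ := (List.length_prefix_le hl).trans (hd₂ v)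
        simp only [List.append_nil, List.length_reverse, List.length_map]
        exact Nat.add_le_add_left (Nat.mul_le_mul_right _ k₁) 1)
  convert this using 2 with v
  have h := key (ctx v) (lst v).toList []
  rw [Val.list_nil] at h
  rw [h, List.append_nil]

@[fun_prop] theorem PolyTime.listReverse {f : Val → Val} (hf : PolyTime f) :
    PolyTime fun v => Val.list (f v).toList.reverse := by
  have := PolyTime.listMap_reverse (PolyTime.snd PolyTime.id) (PolyTime.const (.nat 0)) hf
  simpa using this

theorem PolyTime.listMap {g : Val → Val} (hg : PolyTime g) {ctx lst : Val → Val}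
    (hctx : PolyTime ctx) (hlst : PolyTime lst) :
    PolyTime fun v => Val.list ((lst v).toList.map fun x => g (.pair (ctx v) x)) := by
  have := (PolyTime.listMap_reverse hg hctx hlst).listReverse
  simpa using this

/-- A fold whose accumulator is a single flag. It serves to compare a reply with the replies from
all earlier versions of the database. -/
theorem PolyPred.exists_mem {P : Val → Prop} (hP : PolyPred P) {ctx lst : Val → Val}
    (hctx : PolyTime ctx) (hlst : PolyTime lst) :
    PolyPred fun v => ∃ x ∈ (lst v).toList, P (.pair (ctx v) x) := by
  classical
  obtain ⟨g, hg, hgP⟩ := hP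
  have hstep : PolyTime fun x => if g (.pair x.fst x.snd.snd) ≠ .nat 0 then .nat 1 else x.snd.fst := by
    fun_prop
  have key : ∀ (c : Val) (l : List Val) (acc : Val), acc = .nat 0 ∨ acc = .nat 1 →
      l.foldl (fun a x => if g (.pair (Val.pair c (.pair a x)).fst
        (Val.pair c (.pair a x)).snd.snd) ≠ .nat 0 then .nat 1
          else (Val.pair c (.pair a x)).snd.fst) acc =
        if acc = .nat 1 ∨ ∃ x ∈ l, P (.pair c x) then .nat 1 else .nat 0 := by
    intro c l
    induction l with
    | nil => rintro acc (rfl | rfl) <;> simp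
    | cons a l ih =>
      intro acc hacc
      rw [List.foldl_cons, ih _ (by split_ifs <;> simp_all)]
      simp only [Val.fst_pair, Val.snd_pair, List.mem_cons, exists_eq_or_imp, hgP]
      by_cases h : g (.pair c a) = .nat 0 <;> rcases hacc with rfl | rfl <;> simp [h]
  have := PolyTime.foldl hstep hctx (PolyTime.const (.nat 0)) hlst (M := fun _ => 2)
    (PolyBdd.const 2) (by
      intro v l hl
      rw [key (ctx v) l (.nat 0) (Or.inl rfl)]
      split_ifs <;> simp)
  refine ⟨_, this, fun v => ?_⟩
  rw [key (ctx v) _ (.nat 0) (Or.inl rfl)]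
  split_ifs with h <;> simpa using h

/-! ### A machine that plays the challenger of the ORAM game -/

/-- Messages `(1, (b₀, b₁))`. -/
def IsReadMsg (a : Val) : Prop :=
  a.fst = .nat 1 ∧ ¬a.snd.IsNat ∧ a.snd.fst.IsNat ∧ a.snd.snd.IsNat

/-- Messages `(2, ((b₀, d₀), (b₁, d₁)))`. -/
def IsWriteMsg (a : Val) : Prop :=
  a.fst = .nat 2 ∧ ¬a.snd.IsNat ∧ (¬a.snd.fst.IsNat ∧ a.snd.fst.fst.IsNat ∧ a.snd.fst.snd.IsNat) ∧
    (¬a.snd.snd.IsNat ∧ a.snd.snd.fst.IsNat ∧ a.snd.snd.snd.IsNat)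

instance (a : Val) : Decidable (IsReadMsg a) := by unfold IsReadMsg; infer_instance
instance (a : Val) : Decidable (IsWriteMsg a) := by unfold IsWriteMsg; infer_instance

theorem isReadMsg_iff {a : Val} :
    IsReadMsg a ↔ ∃ b₀ b₁, a = .pair (.nat 1) (.pair (.nat b₀) (.nat b₁)) := by
  constructor
  · rintro ⟨h₁, h₂, h₃, h₄⟩
    rcases a with n | ⟨a, x⟩
    · simp at h₁
    · rcases x with n | ⟨y, z⟩
      · simp at h₂
      · simp only [Val.fst_pair, Val.snd_pair] at h₁ h₃ h₄
        exact ⟨y.num, z.num, by rw [h₁, ← h₃.eq, ← h₄.eq]⟩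
  · rintro ⟨b₀, b₁, rfl⟩
    simp [IsReadMsg]

theorem isWriteMsg_iff {a : Val} :
    IsWriteMsg a ↔ ∃ b₀ d₀ b₁ d₁,
      a = .pair (.nat 2) (.pair (.pair (.nat b₀) (.nat d₀)) (.pair (.nat b₁) (.nat d₁))) := by
  constructor
  · rintro ⟨h₁, h₂, ⟨h₃, h₄, h₅⟩, ⟨h₆, h₇, h₈⟩⟩
    rcases a with n | ⟨a, _ | ⟨_ | ⟨x, y⟩, _ | ⟨z, w⟩⟩⟩ <;> simp at h₁ h₂ h₃ h₆ h₄ h₅ h₇ h₈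
    exact ⟨x.num, y.num, z.num, w.num, by rw [h₁, ← h₄.eq, ← h₅.eq, ← h₇.eq, ← h₈.eq]⟩
  · rintro ⟨b₀, d₀, b₁, d₁, rfl⟩
    simp [IsWriteMsg]

theorem ORAM.answer_other {O : ORAM N} {β : Bool} {ℓ : ℕ} {s : ORAMState} {a : Val}
    (hg : s.guess = none) (hs : s.session = none) (h₁ : ¬IsReadMsg a) (h₂ : ¬IsWriteMsg a)
    (h₃ : ¬(a.fst = .nat 3 ∧ a.snd.IsNat)) : O.answer β ℓ s a = PMF.pure (s, .nat 0) := by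
  unfold ORAM.answer ORAM.game
  simp only [hg, hs]
  split <;> first
    | rfl
    | simp_all [IsReadMsg, IsWriteMsg]

/-- An access, without the bookkeeping. -/
def accessVal (a : Access) : Val :=
  .pair a.op.toVal (.pair (.nat a.coin) (.pair (Val.list a.replies)
    (.pair a.db (Val.list a.stale))))

/-- The old versions are kept to recognize rewinding, and the flag `rewound` because the event to be
simulated includes it. The fields `mem`, `broken` and `wrong` never influence an answer of the
challenger and are dropped. -/
def baseVal (o : ORAMState) : Val :=
  .pair o.sk (.pair o.store.db (.pair (Val.list o.store.old)
    (.nat (bif o.rewound then 1 else 0))))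

def sessionVal : Option (Access × Val) → Val
  | none => .nat 0
  | some (a, c) => .pair (accessVal a) c

/-- The part of the state of the challenger that the machine keeps. -/
def oramVal (o : ORAMState) : Val := .pair (baseVal o) (sessionVal o.session)

/-- The next move of the client; the input is `(1^ℓ, (base, access))`. -/
def moveVal₁ (O : ORAM N) (v : Val) : Val :=
  if ¬v.snd.IsNat ∧ v.snd.fst = .nat 0 then
    .pair (.pair v.fst.snd.fst (.pair v.fst.snd.snd v.snd.snd)) (.pair (.nat 1) v.snd.snd)
  else if v.snd.fst = .nat 1 ∧ ¬v.snd.snd.IsNat then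
    .pair (.pair (.pair v.fst.snd.fst.fst (.pair
      (O.serve (.pair v.fst.fst (.pair v.fst.snd.snd.snd.snd.snd.fst v.snd.snd.fst))).fst
      (.pair (.pair v.fst.snd.fst.snd.fst v.fst.snd.fst.snd.snd.fst) v.fst.snd.fst.snd.snd.snd)))
      (.nat 0)) (.pair (.nat 2) v.snd.snd.fst)
  else .pair (.pair v.fst.snd.fst (.nat 0)) (.nat 0)

def moveVal (O : ORAM N) (v : Val) : Val :=
  if polyBound O.deg (v.fst.size - 1) ≤ v.snd.snd.snd.snd.fst.toList.length then
    .pair (.pair v.snd.fst (.nat 0)) (.nat 0)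
  else moveVal₁ O (.pair v (O.client.run (.pair v.fst (.pair
    (.pair v.snd.fst.fst (.pair v.snd.snd.fst v.snd.snd.snd.snd.fst)) v.snd.snd.snd.fst))))

theorem moveVal_poly (O : ORAM N) : PolyTime (moveVal O) := by
  have h₁ := O.serve_poly
  have h₂ := O.client.run_poly
  have h₃ : PolyTime (moveVal₁ O) := by unfold moveVal₁; fun_prop
  unfold moveVal
  fun_prop

/-- The database after a completed access depends only on the access and the last client message,
and the bookkeeping copies the rest; the fields that were dropped are not consulted. -/
theorem moveVal_eq (O : ORAM N) (ℓ : ℕ) (o : ORAMState) (a : Access) :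
    moveVal O (.pair (ones ℓ) (.pair (baseVal o) (accessVal a))) =
      .pair (oramVal (o.after a.op (O.move ℓ o.sk a)).1) (o.after a.op (O.move ℓ o.sk a)).2 := by
  unfold moveVal ORAM.move
  simp only [Val.fst_pair, Val.snd_pair, size_ones, Nat.add_sub_cancel_left, accessVal,
    Val.toList_list]
  split_ifs with h
  · simp [ORAMState.after, oramVal, baseVal, sessionVal]
  · have hout : O.client.run (.pair (ones ℓ) (.pair (.pair (baseVal o).fst
        (.pair a.op.toVal (Val.list a.replies))) (.nat a.coin))) =
        O.client.out ℓ (.pair o.sk (.pair a.op.toVal (Val.list a.replies))) a.coin := rfl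
    rw [hout]
    generalize O.client.out ℓ (.pair o.sk (.pair a.op.toVal (Val.list a.replies))) a.coin = out
    split
    · simp [moveVal₁, ORAMState.after, oramVal, baseVal, sessionVal, accessVal]
    · simp [moveVal₁, ORAMState.after, oramVal, baseVal, sessionVal, ORAM.nextDB, Store.commit]
    -- The client's output matches neither pattern. The machine recognizes patterns by projections,
    -- so both of its tests have to be shown to fail as well.
    · rename_i h₁ h₂
      have k₁ : ¬(¬out.IsNat ∧ out.fst = .nat 0) := by
        rintro ⟨k, k'⟩
        rcases out with n | ⟨x, y⟩
        · simp at k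
        · exact h₁ y (by simp at k'; rw [k'])
      have k₂ : ¬(out.fst = .nat 1 ∧ ¬out.snd.IsNat) := by
        rintro ⟨k, k'⟩
        rcases out with n | ⟨x, _ | ⟨y, z⟩⟩
        · simp at k
        · simp at k'
        · exact h₂ y z (by simp at k; rw [k])
      exact (if_neg k₁).trans ((if_neg k₂).trans rfl)

/-- Whether the reply `m` rewinds the database; the input is `(1^ℓ, (access, (c, m)))`. -/
def RewindsVal (O : ORAM N) (v : Val) : Prop :=
  v.snd.snd.snd ≠ (O.serve (.pair v.fst (.pair v.snd.fst.snd.snd.snd.fst v.snd.snd.fst))).snd ∧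
  ∃ d ∈ v.snd.fst.snd.snd.snd.snd.toList,
    v.snd.snd.snd = (O.serve (.pair v.fst (.pair d v.snd.snd.fst))).snd

theorem rewindsVal_poly (O : ORAM N) : PolyPred (RewindsVal O) := by
  have h₁ := O.serve_poly
  have h₂ : PolyPred fun x => x.fst.snd.snd.snd =
      (O.serve (.pair x.fst.fst (.pair x.snd x.fst.snd.snd.fst))).snd := by fun_prop
  have h₃ := h₂.exists_mem (ctx := fun v => v) (lst := fun v => v.snd.fst.snd.snd.snd.snd)
    (by fun_prop) (by fun_prop)
  simp only [Val.fst_pair, Val.snd_pair] at h₃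
  unfold RewindsVal
  refine PolyPred.and ?_ h₃
  have : PolyPred fun v => v.snd.snd.snd =
    (O.serve (.pair v.fst (.pair v.snd.fst.snd.snd.snd.fst v.snd.snd.fst))).snd := by fun_prop
  exact this.not

theorem rewindsVal_iff (O : ORAM N) (ℓ : ℕ) (a : Access) (c m : Val) :
    RewindsVal O (.pair (ones ℓ) (.pair (accessVal a) (.pair c m))) ↔
      O.rewinds ℓ a c m = true := by
  simp [RewindsVal, accessVal, ORAM.rewinds, ORAM.reply]

/-- The access after the reply `m` to `c`; the input is `(1^ℓ, (access, (c, m)))`. -/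
def receiveVal (O : ORAM N) (v : Val) : Val :=
  .pair v.snd.fst.fst (.pair v.snd.fst.snd.fst (.pair (.pair v.snd.snd.snd v.snd.fst.snd.snd.fst)
    (.pair (O.serve (.pair v.fst (.pair v.snd.fst.snd.snd.snd.fst v.snd.snd.fst))).fst
      (Val.list (v.snd.fst.snd.snd.snd.snd.toList.map fun d =>
        (O.serve (.pair v.fst (.pair d v.snd.snd.fst))).fst)))))

theorem receiveVal_poly (O : ORAM N) : PolyTime (receiveVal O) := by
  have h₁ := O.serve_poly
  have h₂ : PolyTime fun x => (O.serve (.pair x.fst.fst (.pair x.snd x.fst.snd.snd.fst))).fst := by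
    fun_prop
  have h₃ := h₂.listMap (ctx := fun v => v) (lst := fun v => v.snd.fst.snd.snd.snd.snd)
    (by fun_prop) (by fun_prop)
  simp only [Val.fst_pair, Val.snd_pair] at h₃
  unfold receiveVal
  fun_prop

open Classical in
/-- The answer of the challenger to a reply; the input is `(1^ℓ, ((base, (access, c)), m))`. -/
noncomputable def replyVal (O : ORAM N) (v : Val) : Val :=
  moveVal O (.pair v.fst (.pair
    (.pair v.snd.fst.fst.fst (.pair v.snd.fst.fst.snd.fst (.pair v.snd.fst.fst.snd.snd.fst
      (if RewindsVal O (.pair v.fst (.pair v.snd.fst.snd.fst (.pair v.snd.fst.snd.snd v.snd.snd)))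
        then .nat 1 else v.snd.fst.fst.snd.snd.snd))))
    (receiveVal O (.pair v.fst (.pair v.snd.fst.snd.fst
      (.pair v.snd.fst.snd.snd v.snd.snd))))))

theorem replyVal_poly (O : ORAM N) : PolyTime (replyVal O) := by
  have h₁ := moveVal_poly O
  have h₂ := rewindsVal_poly O
  have h₃ := receiveVal_poly O
  have h₄ : PolyPred fun v => RewindsVal O
      (.pair v.fst (.pair v.snd.fst.snd.fst (.pair v.snd.fst.snd.snd v.snd.snd))) := by
    obtain ⟨f, hf, h⟩ := h₂
    exact ⟨fun v => f (.pair v.fst (.pair v.snd.fst.snd.fst (.pair v.snd.fst.snd.snd v.snd.snd))),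
      by fun_prop, fun v => h _⟩
  unfold replyVal
  fun_prop

theorem replyVal_eq (O : ORAM N) (ℓ : ℕ) (o : ORAMState) (a : Access) (c m : Val)
    (hs : o.session = some (a, c)) :
    replyVal O (.pair (ones ℓ) (.pair (oramVal o) m)) =
      .pair (oramVal (({ o with rewound := o.rewound || O.rewinds ℓ a c m }).after a.op
        (O.receive ℓ o.sk a c m)).1) (({ o with rewound := o.rewound || O.rewinds ℓ a c m }).after
          a.op (O.receive ℓ o.sk a c m)).2 := by
  have h := moveVal_eq O ℓ { o with rewound := o.rewound || O.rewinds ℓ a c m }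
    { a with
      replies := m :: a.replies
      db := O.nextDB ℓ a.db c
      stale := a.stale.map fun d => O.nextDB ℓ d c
      tampered := a.tampered || m != O.reply ℓ a.db c }
  unfold ORAM.receive
  simp only at h ⊢
  rw [← h]
  unfold replyVal
  congr 2
  simp only [oramVal, hs, sessionVal, Val.fst_pair, Val.snd_pair, rewindsVal_iff]
  congr 1
  · unfold baseVal
    rcases hr : O.rewinds ℓ a c m <;> simp
  · simp [receiveVal, accessVal, ORAM.nextDB]

/-- The operation that a request of the adversary asks for. -/
def opVal (β : Bool) (a : Val) : Val :=
  if a.fst = .nat 1 then .pair (.nat 0) (bif β then a.snd.snd else a.snd.fst)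
  else .pair (.nat 1) (bif β then a.snd.snd else a.snd.fst)

/-- The number of blocks, computed from `1^ℓ`. -/
noncomputable def ORAM.cap (O : ORAM N) (v : Val) : ℕ := (O.cap_poly.fn v).size - 1

@[fun_prop] theorem ORAM.cap_polyNum (O : ORAM N) {f : Val → Val} (hf : PolyTime f) :
    PolyNum fun v => O.cap (f v) := by
  unfold ORAM.cap
  fun_prop

@[simp] theorem ORAM.cap_ones (O : ORAM N) (ℓ : ℕ) : O.cap (ones ℓ) = N ℓ := by
  rw [ORAM.cap, PolyComputable.fn_ones, Val.size_nat, size_two_pow_sub_one]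
  omega

/-- Whether `a` is a request for an access that the challenger executes; the input is
`(1^ℓ, a)`. -/
def IsAccessMsg (O : ORAM N) (v : Val) : Prop :=
  (IsReadMsg v.snd ∧ v.snd.snd.fst.num < O.cap v.fst ∧
    v.snd.snd.snd.num < O.cap v.fst) ∨
  (IsWriteMsg v.snd ∧ v.snd.snd.fst.fst.num < O.cap v.fst ∧
    v.snd.snd.snd.fst.num < O.cap v.fst ∧
    v.snd.snd.fst.snd.num < (v.fst.num + 1) * (v.fst.num + 1) ∧
    v.snd.snd.snd.snd.num < (v.fst.num + 1) * (v.fst.num + 1))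

theorem isAccessMsg_poly (O : ORAM N) : PolyPred (IsAccessMsg O) := by
  unfold IsAccessMsg IsReadMsg IsWriteMsg
  fun_prop

theorem ones_num_succ (ℓ : ℕ) : (ones ℓ).num + 1 = 2 ^ ℓ := by
  have := Nat.two_pow_pos ℓ
  simp only [ones, Val.num_nat]
  omega

/-- The operation can be read off the request before the coin of the client is drawn, so the machine
can store it while it waits for the coin. -/
theorem ORAM.answer_access {O : ORAM N} {β : Bool} {ℓ : ℕ} {s : ORAMState} {a : Val}
    (hg : s.guess = none) (hs : s.session = none)
    (h : IsAccessMsg O (.pair (ones ℓ) a)) :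
    ∃ op, O.answer β ℓ s a = O.begin ℓ s op ∧ opVal β a = op.toVal ∧
      op.toVal.size ≤ a.size + 2 := by
  simp only [IsAccessMsg, Val.fst_pair, Val.snd_pair, ones_num_succ, ORAM.cap_ones] at h
  rcases h with ⟨h, h₀, h₁⟩ | ⟨h, h₀, h₁, h₂, h₃⟩
  · obtain ⟨b₀, b₁, rfl⟩ := isReadMsg_iff.1 h
    refine ⟨_, ORAM.answer_read hg hs h₀ h₁, ?_⟩
    cases β <;> simp [opVal, Op.toVal] <;> omega
  · obtain ⟨b₀, d₀, b₁, d₁, rfl⟩ := isWriteMsg_iff.1 h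
    simp only [Val.fst_pair, Val.snd_pair, Val.num_nat, ← pow_add, ← two_mul] at h₀ h₁ h₂ h₃
    refine ⟨_, ORAM.answer_write hg hs h₀ h₁ (by simpa [validBlock] using h₂)
      (by simpa [validBlock] using h₃), ?_⟩
    have h2 : Nat.size 2 = 2 := by decide
    cases β <;> simp [opVal, Op.toVal, h2] <;> omega

theorem ORAM.answer_not_access {O : ORAM N} {β : Bool} {ℓ : ℕ} {s : ORAMState} {a : Val}
    (hg : s.guess = none) (hs : s.session = none)
    (h : ¬IsAccessMsg O (.pair (ones ℓ) a)) (h₃ : ¬(a.fst = .nat 3 ∧ a.snd.IsNat)) :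
    O.answer β ℓ s a = PMF.pure (s, .nat 0) := by
  simp only [IsAccessMsg, Val.fst_pair, Val.snd_pair, ones_num_succ, ORAM.cap_ones, not_or] at h
  by_cases k₁ : IsReadMsg a
  · obtain ⟨b₀, b₁, rfl⟩ := isReadMsg_iff.1 k₁
    have := h.1
    unfold ORAM.answer ORAM.game
    simp only [hg, hs]
    rw [if_neg]
    rintro ⟨k, k'⟩
    exact this ⟨k₁, k, k'⟩
  · by_cases k₂ : IsWriteMsg a
    · obtain ⟨b₀, d₀, b₁, d₁, rfl⟩ := isWriteMsg_iff.1 k₂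
      have := h.2
      simp only [Val.fst_pair, Val.snd_pair, Val.num_nat, ← pow_add, ← two_mul] at this
      unfold ORAM.answer ORAM.game
      simp only [hg, hs]
      rw [if_neg]
      rintro ⟨k, k', k'', k'''⟩
      simp only [validBlock, decide_eq_true_eq] at k'' k'''
      exact this ⟨k₂, k, k', k'', k'''⟩
    · exact ORAM.answer_other hg hs k₁ k₂ h₃

open Classical in
/-- The machine, on the message `a` of the adversary; the input is `(1^ℓ, (state, a))`. -/
noncomputable def challengerMsg (O : ORAM N) (β : Bool) (v : Val) : Val :=
  if v.snd.snd.fst = .nat 7 then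
    .pair (.pair (.nat 2) v.snd.fst) (.pair (.nat 1) (.pair (.nat 1)
      (bif β then v.snd.snd.snd.snd else v.snd.snd.snd.fst)))
  else if ¬v.snd.fst.snd.IsNat then
    if v.snd.snd.fst = .nat 4 then
      .pair (.pair (.nat 2) (replyVal O (.pair v.fst (.pair v.snd.fst v.snd.snd.snd))).fst)
        (.pair (.nat 0) (replyVal O (.pair v.fst (.pair v.snd.fst v.snd.snd.snd))).snd)
    else .pair (.pair (.nat 2) (.pair v.snd.fst.fst (.nat 0))) (.pair (.nat 0) (.nat 0))
  else if IsAccessMsg O (.pair v.fst v.snd.snd) then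
    .pair (.pair (.nat 3) (.pair (opVal β v.snd.snd) v.snd.fst.fst))
      (.pair (.nat 1) (.pair (.nat 0) (O.client.coins_poly.fn v.fst)))
  else if v.snd.snd.fst = .nat 3 ∧ v.snd.snd.snd.IsNat then
    .pair (.pair (.nat 2) v.snd.fst) (.pair (.nat 1) (.pair (.nat 2)
      (if v.snd.snd.snd ≠ .nat 0 ∧ v.snd.fst.fst.snd.snd.snd = .nat 0 then .nat 1 else .nat 0)))
  else .pair (.pair (.nat 2) v.snd.fst) (.pair (.nat 0) (.nat 0))

/-- The state of the machine after the initialization with output `x`. -/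
def challengerInit (x : Val) : Val :=
  .pair (.pair (.nat 2) (.pair (.pair x.fst (.pair x.snd (.pair (.nat 0) (.nat 0)))) (.nat 0)))
    (.pair (.nat 0) x.snd)

/-- The answer of the machine after the first move of an access. -/
def challengerBegin (x : Val) : Val := .pair (.pair (.nat 2) x.fst) (.pair (.nat 0) x.snd)

/-- The machine that plays the challenger of the ORAM game and uses the oracle below it for the
tokens. -/
noncomputable def challengerStep (O : ORAM N) (β : Bool) (v : Val) : Val :=
  if v.snd.fst.IsNat then
    .pair (.pair (.nat 1) (.nat 0)) (.pair (.nat 1) (.pair (.nat 0) (O.init.coins_poly.fn v.fst)))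
  else if v.snd.fst.fst = .nat 1 then
    challengerInit (O.init.run (.pair v.fst (.pair (O.cap_poly.fn v.fst) v.snd.snd.snd)))
  else if v.snd.fst.fst = .nat 3 then
    challengerBegin (moveVal O (.pair v.fst (.pair v.snd.fst.snd.snd
      (.pair v.snd.fst.snd.fst (.pair v.snd.snd.snd (.pair (.nat 0)
        (.pair v.snd.fst.snd.snd.snd.fst v.snd.fst.snd.snd.snd.snd.fst)))))))
  else if v.snd.snd.fst = .nat 0 then
    challengerMsg O β (.pair v.fst (.pair v.snd.fst.snd v.snd.snd.snd))
  else .pair v.snd.fst (.pair (.nat 0) v.snd.snd.snd)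

theorem challengerStep_poly (O : ORAM N) (β : Bool) : PolyTime (challengerStep O β) := by
  have h₁ := moveVal_poly O
  have h₂ := replyVal_poly O
  have h₃ : PolyPred fun v => IsAccessMsg O (.pair v.fst v.snd.snd) := by
    obtain ⟨f, hf, h⟩ := isAccessMsg_poly O
    exact ⟨fun v => f (.pair v.fst v.snd.snd), by fun_prop, fun v => h _⟩
  have h₄ : PolyTime (opVal β) := by
    unfold opVal
    cases β <;> simp only [cond_true, cond_false] <;> fun_prop
  have h₅ : PolyTime (challengerMsg O β) := by
    unfold challengerMsg
    cases β <;> simp only [cond_true, cond_false] <;> fun_prop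
  have h₆ := O.init.run_poly
  have h₇ : PolyTime challengerInit := by unfold challengerInit; fun_prop
  have h₈ : PolyTime challengerBegin := by unfold challengerBegin; fun_prop
  unfold challengerStep
  fun_prop

/-! ### Lengths in the ORAM game -/

/-- All parts of an access are short: `P` bounds databases and client messages, `Q` bounds the
replies, `n` bounds the number of earlier versions. -/
def Access.Bdd (P Q n : ℕ) (a : Access) : Prop :=
  a.op.toVal.size ≤ Q + 2 ∧ (Val.nat a.coin).size ≤ Q ∧ a.replies.length ≤ P ∧
    (∀ m ∈ a.replies, m.size ≤ Q) ∧ a.db.size ≤ P ∧ a.stale.length ≤ n ∧ ∀ d ∈ a.stale, d.size ≤ P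

/-- The condition `a.replies.length + 1 ≤ P` leaves room for the reply that is being awaited: a
client that has received `P` replies has already stopped, for `P` the bound of the protocol. -/
def ORAMState.Bdd (P Q n : ℕ) (o : ORAMState) : Prop :=
  o.sk.size ≤ P ∧ o.store.db.size ≤ P ∧ o.store.old.length ≤ n ∧ (∀ d ∈ o.store.old, d.size ≤ P) ∧
    ∀ a c, o.session = some (a, c) → a.Bdd P Q n ∧ a.replies.length + 1 ≤ P ∧ c.size ≤ P

theorem Access.Bdd.mono {P Q n n' : ℕ} {a : Access} (h : a.Bdd P Q n) (hn : n ≤ n') :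
    a.Bdd P Q n' := by
  obtain ⟨h₁, h₂, h₃, h₄, h₅, h₆, h₇⟩ := h
  exact ⟨h₁, h₂, h₃, h₄, h₅, h₆.trans hn, h₇⟩

theorem ORAMState.Bdd.mono {P Q n n' : ℕ} {o : ORAMState} (h : o.Bdd P Q n) (hn : n ≤ n') :
    o.Bdd P Q n' := by
  obtain ⟨h₁, h₂, h₃, h₄, h₅⟩ := h
  exact ⟨h₁, h₂, h₃.trans hn, h₄, fun a c hac =>
    ⟨(h₅ a c hac).1.mono hn, (h₅ a c hac).2⟩⟩

theorem ORAM.nextDB_size (O : ORAM N) {ℓ : ℕ} {db c : Val} (hd : db.size ≤ polyBound O.deg ℓ)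
    (hc : c.size ≤ polyBound O.deg ℓ) : (O.nextDB ℓ db c).size ≤ polyBound O.deg ℓ :=
  O.serve_bound ℓ db c hd hc

/-- A move adds at most one version of the database, namely when it completes the access; this is
the increase from `n` to `n + 1`. -/
theorem ORAMState.Bdd.after_move {O : ORAM N} {ℓ Q n : ℕ} {o : ORAMState} {a : Access} {sk : Val}
    (h : o.Bdd (polyBound O.deg ℓ) Q n) (ha : a.Bdd (polyBound O.deg ℓ) Q n) (op : Op) :
    (o.after op (O.move ℓ sk a)).1.Bdd (polyBound O.deg ℓ) Q (n + 1) := by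
  obtain ⟨h₁, h₂, h₃, h₄, -⟩ := h
  rcases hm : O.move ℓ sk a with ⟨a', c⟩ | ⟨db, c, out, t⟩ | t
  · obtain ⟨hc, rfl⟩ := ORAM.size_of_move_wait hm
    refine ⟨h₁, h₂, h₃.trans (by omega), h₄, ?_⟩
    intro a c' hac
    simp only [ORAMState.after, Option.some.injEq, Prod.mk.injEq] at hac
    obtain ⟨rfl, rfl⟩ := hac
    refine ⟨ha.mono (by omega), ?_, hc⟩
    unfold ORAM.move at hm
    split_ifs at hm
    omega
  · obtain ⟨hc, rfl, rfl⟩ := ORAM.size_of_move_done hm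
    refine ⟨h₁, O.nextDB_size ha.2.2.2.2.1 hc, ?_, ?_, ?_⟩
    · simpa [ORAMState.after, Store.commit] using h₃
    · intro d hd
      simp only [ORAMState.after, Store.commit, List.mem_cons] at hd
      rcases hd with rfl | hd
      · exact h₂
      · exact h₄ d hd
    · intro a c hac
      simp [ORAMState.after] at hac
  · refine ⟨h₁, h₂, h₃.trans (by omega), h₄, ?_⟩
    intro a c hac
    simp [ORAMState.after] at hac

theorem ORAMState.Bdd.after_receive {O : ORAM N} {ℓ Q n : ℕ} {o : ORAMState} {a : Access}
    {sk c m : Val} {b : Bool}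
    (h : o.Bdd (polyBound O.deg ℓ) Q n) (hs : o.session = some (a, c)) (hm : m.size ≤ Q) :
    (({ o with rewound := b }).after a.op (O.receive ℓ sk a c m)).1.Bdd
      (polyBound O.deg ℓ) Q (n + 1) := by
  obtain ⟨⟨k₁, k₂, k₃, k₄, k₅, k₆, k₇⟩, hr, hc⟩ := h.2.2.2.2 a c hs
  unfold ORAM.receive
  refine ORAMState.Bdd.after_move (o := { o with rewound := b }) (a := { a with
      replies := m :: a.replies
      db := O.nextDB ℓ a.db c
      stale := a.stale.map fun d => O.nextDB ℓ d c
      tampered := a.tampered || m != O.reply ℓ a.db c }) h ⟨k₁, k₂, hr, ?_, ?_, ?_, ?_⟩ _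
  · intro x hx
    simp only [List.mem_cons] at hx
    rcases hx with rfl | hx
    · exact hm
    · exact k₄ x hx
  · exact O.nextDB_size k₅ hc
  · simpa using k₆
  · intro d hd
    simp only [List.mem_map] at hd
    obtain ⟨d', hd', rfl⟩ := hd
    exact O.nextDB_size (k₇ d' hd') hc

theorem Access.Bdd.new {P Q n : ℕ} {o : ORAMState} (h : o.Bdd P Q n) {op : Op} {r : ℕ}
    (hop : op.toVal.size ≤ Q + 2) (hr : (Val.nat r).size ≤ Q) :
    (Access.new op r o.store).Bdd P Q n :=
  ⟨hop, hr, by simp [Access.new], by simp [Access.new], h.2.1, h.2.2.1, h.2.2.2.1⟩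

theorem ORAMState.after_guess (o : ORAMState) (op : Op) (r : AccessResult) :
    (o.after op r).1.guess = o.guess := by
  cases r <;> rfl

/-- A bound for the length of the state of the machine that plays the challenger. -/
def oramValBound (P Q n : ℕ) : ℕ := 30 + 4 * P + 2 * Q + P * (1 + Q) + 2 * (n * (1 + P))

theorem baseVal_size {P Q n : ℕ} {o : ORAMState} (h : o.Bdd P Q n) :
    (baseVal o).size ≤ 10 + 2 * P + n * (1 + P) := by
  obtain ⟨h₁, h₂, h₃, h₄, -⟩ := h
  have h₅ := Val.size_list_le h₄
  have h₆ := Nat.mul_le_mul_right (1 + P) h₃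
  have h₇ : (Val.nat (bif o.rewound then 1 else 0)).size ≤ 2 := by cases o.rewound <;> simp
  simp only [baseVal, Val.size_pair]
  omega

theorem oramVal_size {P Q n : ℕ} {o : ORAMState} (h : o.Bdd P Q n) :
    (oramVal o).size ≤ oramValBound P Q n := by
  have hb := baseVal_size h
  unfold oramVal oramValBound
  rcases hs : o.session with _ | ⟨a, c⟩
  · simp [sessionVal]
    omega
  · obtain ⟨⟨k₁, k₂, k₃, k₄, k₅, k₆, k₇⟩, hr, hc⟩ := h.2.2.2.2 a c hs
    have e₁ := Val.size_list_le k₄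
    have e₂ := Nat.mul_le_mul_right (1 + Q) k₃
    have e₃ := Val.size_list_le k₇
    have e₄ := Nat.mul_le_mul_right (1 + P) k₆
    simp only [sessionVal, accessVal, Val.size_pair]
    omega

/-! ### The PRF game -/

noncomputable def PRF.respond (F : PRF) (ideal : Bool) (ℓ : ℕ) (p : PRFState) (a : Val) :
    PMF (PRFState × Val) := (F.game ideal ℓ).respond p a

/-- The PRF game with its fields made visible. -/
@[reducible] noncomputable def PRF.openGame (F : PRF) (ideal : Bool) (ℓ : ℕ) : Game where
  State := PRFState
  start := (F.keygen.sample ℓ (.nat 0)).map fun K => (⟨K, fun _ => none, none⟩, .nat 0)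
  respond := F.respond ideal ℓ

section PRFGame
variable {F : PRF} {ideal : Bool} {ℓ : ℕ} {p : PRFState}

theorem PRF.respond_query {x : Val} (hg : p.guess = none) :
    F.respond ideal ℓ p (.pair (.nat 1) x) = F.answer ideal ℓ p x := by
  obtain ⟨K, table, guess⟩ := p
  simp only at hg
  subst hg
  rfl

theorem PRF.respond_guess {g : ℕ} (hg : p.guess = none) :
    F.respond ideal ℓ p (.pair (.nat 2) (.nat g)) =
      PMF.pure ({ p with guess := some (g != 0) }, .nat 0) := by
  unfold PRF.respond PRF.game
  simp only [hg]

theorem PRF.respond_after_guess {g : Bool} (hg : p.guess = some g) (a : Val) :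
    F.respond ideal ℓ p a = PMF.pure (p, .nat 0) := by
  unfold PRF.respond PRF.game
  simp only [hg]

/-- The values of the random function that have been drawn are short. -/
def PRFState.Bdd (F : PRF) (ℓ : ℕ) (p : PRFState) : Prop :=
  p.guess = none ∧ ∀ x y, p.table x = some y → y.size ≤ (Val.nat (2 ^ F.outLen ℓ)).size

theorem PRF.answer_bdd {x : Val} (hp : p.Bdd F ℓ) {q : PRFState × Val}
    (hq : q ∈ (F.answer ideal ℓ p x).support) :
    q.1.Bdd F ℓ ∧ q.2.size ≤ (Val.nat (2 ^ F.outLen ℓ)).size := by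
  unfold PRF.answer at hq
  split_ifs at hq
  · split at hq
    · rename_i y hy
      rw [PMF.support_pure, Set.mem_singleton_iff] at hq
      subst hq
      exact ⟨hp, hp.2 _ _ hy⟩
    · rw [PMF.support_map] at hq
      obtain ⟨y, hy, rfl⟩ := hq
      have hy' := nat_size_mono ((unif_support hy).trans (Nat.sub_le _ _))
      refine ⟨⟨hp.1, fun x' y' h => ?_⟩, hy'⟩
      by_cases hx : x' = x
      · subst hx
        simp only [Function.update_self, Option.some.injEq] at h
        exact h ▸ hy'
      · simp only [Function.update_of_ne hx] at h
        exact hp.2 _ _ h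
  · rw [PMF.support_pure, Set.mem_singleton_iff] at hq
    subst hq
    obtain ⟨y, hy, hy'⟩ := F.eval_range ℓ p.key x
    refine ⟨hp, ?_⟩
    change (F.eval _).size ≤ _
    rw [hy']
    exact nat_size_mono hy.le

end PRFGame

/-- Used to see that the PRF challenger, which ignores everything after the guess, keeps the guess
whatever the machine above it still does. -/
theorem Game.drive_stable {G : Game} {R : Adversary} {ℓ : ℕ} {P : G.State → Prop}
    (hP : ∀ s a, P s → ∀ x ∈ (G.respond s a).support, P x.1) (k : ℕ) :
    ∀ (w : Val) (s : G.State) (msg : Val), P s → ∀ x ∈ (G.drive R ℓ k w s msg).support, P x.1.2 := by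
  induction k with
  | zero =>
    intro w s msg h x hx
    rw [Game.drive, PMF.support_pure, Set.mem_singleton_iff] at hx
    exact hx ▸ h
  | succ k ih =>
    intro w s msg h x hx
    rw [Game.drive] at hx
    split_ifs at hx
    · rw [PMF.support_pure, Set.mem_singleton_iff] at hx
      exact hx ▸ h
    · obtain ⟨y, -, hy⟩ := (PMF.mem_support_bind_iff _ _ _).1 hx
      exact ih _ _ _ h _ hy
    · obtain ⟨y, hy, hy'⟩ := (PMF.mem_support_bind_iff _ _ _).1 hx
      exact ih _ _ _ (hP _ _ h _ hy) _ hy'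

theorem Val.eq_pair_of_fst {a : Val} {n : ℕ} (h : a.fst = .nat (n + 1)) :
    a = .pair (.nat (n + 1)) a.snd := by
  cases a with
  | nat m => simp at h
  | pair x y => simp at h; simp [h]

/-- The ORAM game with a token oracle is played by an adversary against the PRF. -/
theorem exists_prf_adversary (O : ORAM N) (F : PRF) (β : Bool) (A : Adversary) :
    ∃ B : Adversary, ∀ (ideal : Bool) (ℓ : ℕ),
      (comboGame O F (F.answer ideal ℓ) β ℓ).prob A ℓ
        (fun s => s.1.guess == some true && !s.1.rewound) =
      (F.game ideal ℓ).prob B ℓ (fun s => s.guess == some true) := by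
  obtain ⟨b₁, hb₁, h₁⟩ := O.init.coins_poly.exists_bound
  obtain ⟨b₂, hb₂, h₂⟩ := O.client.coins_poly.exists_bound
  obtain ⟨b₃, hb₃, h₃⟩ := F.outLen_poly.exists_bound
  have hO : PolyBdd (polyBound O.deg) := PolyBdd.id.polyBound _
  have hA : PolyBdd (polyBound A.deg) := PolyBdd.id.polyBound _
  have hQ := hA.add hb₂
  have hbd : PolyBdd fun ℓ => 50 + polyBound A.deg ℓ + b₁ ℓ + b₂ ℓ + b₃ ℓ +
      5 * polyBound O.deg ℓ + oramValBound (polyBound O.deg ℓ) (polyBound A.deg ℓ + b₂ ℓ) (polyBound A.deg ℓ) := by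
    refine ((((((PolyBdd.const 50).add hA).add hb₁).add hb₂).add hb₃).add
      ((PolyBdd.const 5).mul hO)).add ?_
    exact (((((PolyBdd.const 30).add ((PolyBdd.const 4).mul hO)).add ((PolyBdd.const 2).mul
      hQ)).add (hO.mul ((PolyBdd.const 1).add hQ)))).add ((PolyBdd.const 2).mul
        (hA.mul ((PolyBdd.const 1).add hO)))
  obtain ⟨e, he⟩ := hbd
  let M : Adversary := ⟨challengerStep O β, challengerStep_poly O β, e⟩
  refine ⟨A.comp M, fun ideal ℓ => ?_⟩
  have hMd : M.deg = e := rfl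
  have hE := he ℓ
  dsimp only at hE
  have hc₁ := h₁ ℓ
  have hc₂ := h₂ ℓ
  have hc₃ := h₃ ℓ
  set P := polyBound O.deg ℓ with hP
  set Q := polyBound A.deg ℓ + b₂ ℓ with hQdef
  have hsize : ∀ {o : ORAMState} {n : ℕ}, o.Bdd P Q n → n ≤ polyBound A.deg ℓ →
      (oramVal o).size + 50 + polyBound A.deg ℓ + b₁ ℓ + b₂ ℓ + b₃ ℓ + 5 * P ≤
        polyBound M.deg ℓ := by
    intro o n ho hn
    have := oramVal_size (ho.mono hn)
    rw [hMd]
    omega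
  obtain ⟨k, hk⟩ : ∃ k, polyBound M.deg ℓ = k + 3 := ⟨polyBound e ℓ - 3, by rw [hMd]; omega⟩
  have h2s : Nat.size 2 = 2 := by decide
  have h3s : Nat.size 3 = 2 := by decide
  change _ = (F.openGame ideal ℓ).prob (A.comp M) ℓ (fun s : PRFState => s.guess == some true)
  rw [Game.prob_comp, Game.prob_eq_pr, Game.prob_eq_pr]
  -- Up to the guess in the ORAM game the machine is an exact copy of the challenger. With that
  -- guess it makes its own guess in the PRF game; from then on the flag `rewound` and both guesses
  -- are frozen, which is what the second relation records.
  refine (Game.run_coupled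
    (D := fun (s : ORAMState × PRFState) (t : Val × PRFState) =>
      ∃ g, s.1.guess = some g ∧ t.2.guess = some (g && !s.1.rewound))
    (R := fun i (s : ORAMState × PRFState) (t : Val × PRFState) =>
      s.1.guess = none ∧ t = (.pair (.nat 2) (oramVal s.1), s.2) ∧ s.1.Bdd P Q i ∧ s.2.Bdd F ℓ)
    ?_ ?_ (fun _ _ _ h => ⟨h.1, h.2.1, h.2.2.1.mono (by omega), h.2.2.2⟩) ?_).pr_eq ?_
  · change Coupled _ (PMF.bind _ _) (PMF.bind (PMF.map _ _) _)
    rw [PMF.bind_map]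
    simp only [PMF.map, Function.comp_def]
    -- The PRF game draws its key first, the game with the token oracle initializes the ORAM first.
    -- The draws are independent.
    rw [PMF.bind_comm]
    refine Coupled.bind_same _ fun K _ => ?_
    rw [hk, Game.drive_rand (n := O.init.coins ℓ) (w' := .pair (.nat 1) (.nat 0)) (by
        simp [M, challengerStep]) (by rw [hMd]; simp at *; omega)]
    unfold RandAlg.sample
    rw [PMF.bind_map]
    refine Coupled.bind_same _ fun r hr => ?_
    have hv := O.init_bound ℓ (O.init.out ℓ (ones (N ℓ)) r) (by
      unfold RandAlg.sample
      rw [PMF.support_map]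
      exact ⟨r, hr, rfl⟩)
    have hv₁ := (O.init.out ℓ (ones (N ℓ)) r).size_fst_le
    have hv₂ := (O.init.out ℓ (ones (N ℓ)) r).size_snd_le
    have hbd : (ORAMState.init (O.init.out ℓ (ones (N ℓ)) r)).Bdd P Q 0 :=
      ⟨by simp [ORAMState.init]; omega, by simp [ORAMState.init]; omega, by simp [ORAMState.init],
        by simp [ORAMState.init], by simp [ORAMState.init]⟩
    have hs := hsize hbd (by omega)
    rw [Game.drive_up (w' := .pair (.nat 2) (oramVal (ORAMState.init (O.init.out ℓ (ones (N ℓ)) r))))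
      (m := (O.init.out ℓ (ones (N ℓ)) r).snd) (by
        have hcap : O.cap_poly.fn (ones ℓ) = ones (N ℓ) := PolyComputable.fn_ones _ _
        simp [M, challengerStep, challengerInit, RandAlg.out, hcap, ORAMState.init, oramVal, baseVal,
          sessionVal]) (by
        simp only [Val.size_pair, Val.size_nat, h2s, Nat.size_zero]
        omega)]
    exact Coupled.pure ⟨⟨rfl, rfl, hbd, rfl, by simp⟩, rfl⟩
  · rintro ⟨o, p⟩ ⟨w, q⟩ ⟨g, hg, hq⟩ a
    constructor
    · intro x hx
      simp only at hx hg hq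
      split_ifs at hx
      · rw [PMF.support_map] at hx
        obtain ⟨y, -, rfl⟩ := hx
        exact ⟨g, hg, hq⟩
      · rw [ORAM.answer_after_guess hg, PMF.pure_map, PMF.support_pure,
          Set.mem_singleton_iff] at hx
        subst hx
        exact ⟨g, hg, hq⟩
    · intro y hy
      refine ⟨g, hg, ?_⟩
      exact Game.drive_stable (G := F.openGame ideal ℓ)
        (P := fun p : PRFState => p.guess = some (g && !o.rewound)) (fun s a hs x hx => by
          have h := PRF.respond_after_guess (F := F) (ideal := ideal) (ℓ := ℓ) hs a
          change x ∈ (F.respond ideal ℓ s a).support at hx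
          rw [h, PMF.support_pure, Set.mem_singleton_iff] at hx
          exact hx ▸ hs) _ _ _ _ hq _ hy
  · rintro i ⟨o, p⟩ t a hi ⟨hg, rfl, ho, hp⟩ ha hnr
    simp only at hg ho hp
    have hs := hsize ho hi.le
    have hs1 : ∀ {o' : ORAMState}, o'.Bdd P Q (i + 1) → _ := fun h => hsize h hi
    change Coupled _ _ (Game.drive _ _ _ _ _ _ _)
    rw [hk]
    by_cases h7 : a.fst = .nat 7
    · have hx : (bif β then a.snd.snd else a.snd.fst).size ≤ a.size := by
        cases β
        · exact (Val.size_fst_le _).trans (Val.size_snd_le _)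
        · exact (Val.size_snd_le _).trans (Val.size_snd_le _)
      simp only [h7, if_true]
      rw [Game.drive_down (w' := .pair (.nat 2) (oramVal o))
        (d := .pair (.nat 1) (bif β then a.snd.snd else a.snd.fst)) (by
          simp [M, challengerStep, challengerMsg, h7]) (by rw [Val.isRand_iff]; simp)
        (by simp at *; omega)]
      change Coupled _ _ ((F.respond ideal ℓ p _).bind _)
      rw [PRF.respond_query hp.1]
      refine Coupled.bind_same _ fun q hq => ?_
      obtain ⟨hq₁, hq₂⟩ := PRF.answer_bdd hp hq
      rw [Game.drive_up (w' := .pair (.nat 2) (oramVal o)) (m := q.2) (by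
          simp [M, challengerStep]) (by simp at *; omega)]
      exact Coupled.pure (Or.inl ⟨⟨hg, rfl, ho.mono (by omega), hq₁⟩, rfl⟩)
    · simp only [h7, if_false]
      rcases hses : o.session with _ | ⟨ac, c⟩
      · by_cases hacc : IsAccessMsg O (.pair (ones ℓ) a)
        · obtain ⟨op, hop, hopv, hops⟩ := ORAM.answer_access (β := β) hg hses hacc
          have hbs : (baseVal o).size ≤ (oramVal o).size := by
            simp only [oramVal, Val.size_pair]; omega
          rw [Game.drive_rand (n := O.client.coins ℓ)
            (w' := .pair (.nat 3) (.pair op.toVal (baseVal o))) (by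
              simp [M, challengerStep, challengerMsg, h7, oramVal, hses, sessionVal, hacc, hopv])
            (by simp at *; omega), hop]
          unfold ORAM.begin
          rw [PMF.map_comp]
          refine Coupled.bind_same _ fun r hr => ?_
          have hr' := nat_size_mono (unif_support hr)
          have hb' := ho.after_move (sk := o.sk) (Access.Bdd.new ho (op := op) (r := r)
            (by omega) (by omega)) op
          have hm := moveVal_eq O ℓ o (Access.new op r o.store)
          have hms := ORAM.size_after_move (O := O) (ℓ := ℓ) (sk := o.sk) (Access.new op r o.store) o op
          have hs' := hs1 hb'
          rw [Game.drive_up (w' := .pair (.nat 2)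
            (oramVal (o.after op (O.move ℓ o.sk (Access.new op r o.store))).1))
            (m := (o.after op (O.move ℓ o.sk (Access.new op r o.store))).2) (by
              have hm' : moveVal O (.pair (ones ℓ) (.pair (baseVal o) (.pair op.toVal (.pair (.nat r)
                (.pair (.nat 0) (.pair o.store.db (Val.list o.store.old))))))) = _ := hm
              simp [M, challengerStep, challengerBegin, baseVal] at hm' ⊢
              simp [hm', Access.new])
            (by simp at *; omega)]
          exact Coupled.pure (Or.inl ⟨⟨(ORAMState.after_guess _ _ _).trans hg, rfl, hb', hp⟩, rfl⟩)
        · by_cases h3 : a.fst = .nat 3 ∧ a.snd.IsNat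
          · obtain ⟨g, rfl⟩ : ∃ g, a = .pair (.nat 3) (.nat g) :=
              ⟨a.snd.num, by rw [← h3.2.eq]; exact Val.eq_pair_of_fst h3.1⟩
            rw [ORAM.answer_guess hg hses, PMF.pure_map]
            -- The flag `rewound` is folded into the guess, so that guessing `1` without having
            -- rewound becomes simply guessing `1` in the PRF game.
            rw [Game.drive_down (w' := .pair (.nat 2) (oramVal o))
              (d := .pair (.nat 2) (.nat (if g ≠ 0 ∧ o.rewound = false then 1 else 0))) (by
                have hsn : (oramVal o).snd = .nat 0 := by simp [oramVal, hses, sessionVal]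
                have hrw : (oramVal o).fst.snd.snd.snd = .nat (bif o.rewound then 1 else 0) := rfl
                simp only [M, challengerStep, challengerMsg, Val.fst_pair, Val.snd_pair, hsn, hrw,
                  hacc]
                cases hrew : o.rewound <;> by_cases hg0 : g = 0 <;> simp [hg0])
              (by rw [Val.isRand_iff]; simp) (by split_ifs <;> simp at * <;> omega)]
            change Coupled _ _ ((F.respond ideal ℓ p _).bind _)
            rw [PRF.respond_guess hp.1, PMF.pure_bind]
            rw [Game.drive_up (w' := .pair (.nat 2) (oramVal o)) (m := .nat 0) (by
              simp [M, challengerStep]) (by simp at *; omega)]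
            refine Coupled.pure (Or.inr ⟨_, rfl, ?_⟩)
            cases hrew : o.rewound <;> by_cases hg0 : g = 0 <;> simp [hg0]
          · rw [ORAM.answer_not_access hg hses hacc h3, PMF.pure_map]
            rw [Game.drive_up (w' := .pair (.nat 2) (oramVal o)) (m := .nat 0) (by
              simp [M, challengerStep, challengerMsg, h7, oramVal, hses, sessionVal, hacc]
              simpa using h3) (by simp at *; omega)]
            exact Coupled.pure (Or.inl ⟨⟨hg, rfl, ho.mono (by omega), hp⟩, rfl⟩)
      · by_cases h4 : a.fst = .nat 4
        · obtain ⟨m, rfl⟩ : ∃ m, a = .pair (.nat 4) m := ⟨_, Val.eq_pair_of_fst h4⟩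
          have hms : m.size ≤ Q := by simp at ha; omega
          have hb' := ho.after_receive (sk := o.sk) (b := o.rewound || O.rewinds ℓ ac c m) hses hms
          have hs' := hs1 hb'
          have hz := ORAM.size_after_move (O := O) (ℓ := ℓ) (sk := o.sk)
            { ac with
              replies := m :: ac.replies
              db := O.nextDB ℓ ac.db c
              stale := ac.stale.map fun d => O.nextDB ℓ d c
              tampered := ac.tampered || m != O.reply ℓ ac.db c }
            { o with rewound := o.rewound || O.rewinds ℓ ac c m } ac.op
          change (ORAMState.after _ _ (O.receive ℓ o.sk ac c m)).2.size ≤ _ at hz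
          rw [ORAM.answer_reply hg hses, PMF.pure_map]
          rw [Game.drive_up (w' := .pair (.nat 2)
              (oramVal (({ o with rewound := o.rewound || O.rewinds ℓ ac c m }).after ac.op
                (O.receive ℓ o.sk ac c m)).1))
            (m := (({ o with rewound := o.rewound || O.rewinds ℓ ac c m }).after ac.op
                (O.receive ℓ o.sk ac c m)).2) (by
              have hn : ¬(oramVal o).snd.IsNat := by simp [oramVal, hses, sessionVal]
              simp [M, challengerStep, challengerMsg, replyVal_eq O ℓ o ac c m hses, hn])
            (by simp only [Val.size_pair, Val.size_nat, h2s, Nat.size_zero]; omega)]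
          exact Coupled.pure (Or.inl ⟨⟨(ORAMState.after_guess _ _ _).trans hg, rfl, hb', hp⟩, rfl⟩)
        · rw [ORAM.answer_break hg hses (by rintro m rfl; simp at h4), PMF.pure_map]
          have hb' : ({ o with session := none } : ORAMState).Bdd P Q (i + 1) := by
            obtain ⟨k₁, k₂, k₃, k₄, -⟩ := ho
            exact ⟨k₁, k₂, k₃.trans (by omega), k₄, by simp⟩
          have hs' := hs1 hb'
          rw [Game.drive_up (w' := .pair (.nat 2) (oramVal { o with session := none }))
            (m := .nat 0) (by
              simp [M, challengerStep, challengerMsg, h7, h4, oramVal, hses, sessionVal, baseVal])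
            (by simp only [Val.size_pair, Val.size_nat, h2s, Nat.size_zero]; omega)]
          exact Coupled.pure (Or.inl ⟨⟨hg, rfl, hb', hp⟩, rfl⟩)
  · rintro s t (⟨hg, rfl, -, hp⟩ | ⟨g, hg, ht⟩)
    · simp [hg, hp.1]
    · simp [hg, ht]

/-! ### The experiment with ideal memory -/

/-- The access under way lives in the state of the ORAM challenger. While writing, the stage keeps
only the commitment randomness and the coin of the signature: they fix the proof of payment as soon
as the token is known. -/
inductive WStage : Type
  | start : WStage
  | reading (price ε : ℕ) : WStage
  | writing (price ε r coin : ℕ) : WStage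

/-- A transaction: the households that pay in the two worlds, and its stage. -/
structure WSession where
  i₀ : ℕ
  i₁ : ℕ
  stage : WStage

/-- All cards of a household have the same state, so the challenge is recorded by households rather
than by card states. -/
inductive WPhase : Type
  | before : WPhase
  | first (i₀ i₁ price ε : ℕ) : WPhase
  | between (i₀ i₁ price ε : ℕ) : WPhase
  | second (i₀ i₁ price ε : ℕ) : WPhase
  | after : WPhase
  | over (result : Option Bool) : WPhase

def WPhase.isFree : WPhase → Bool
  | .before => true
  | .between _ _ _ _ => true
  | .after => true
  | _ => false

def WPhase.allows : WPhase → ℕ → Bool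
  | .between i₀ i₁ _ _, i => i != i₀ && i != i₁
  | _, _ => true

def WPhase.next (ph : WPhase) (ok : Option (ℕ × ℕ)) : WPhase :=
  match ph with
  | .first i₀ i₁ price ε =>
    if ok = some (price, ε) then .between i₀ i₁ price ε else .over none
  | .second _ _ price ε => if ok = some (price, ε) then .after else .over none
  | ph => ph

/-- What the simulator of the wallets keeps: keys, the households of the cards, and for both worlds
the balance and counter of every household. -/
structure Wallet where
  pp : Val
  skRS : Val
  pkRS : Val
  nextId : ℕ
  cards : List (ℕ × ℕ)
  rec₀ : List (ℕ × (ℕ × ℕ))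
  rec₁ : List (ℕ × (ℕ × ℕ))
  phase : WPhase
  session : Option WSession

/-- The record of a household. -/
def getRec (T : List (ℕ × (ℕ × ℕ))) (i : ℕ) : ℕ × ℕ := (T.lookup i).getD (0, 0)

/-- The records of world `β`. -/
def Wallet.recs (w : Wallet) (β : Bool) : List (ℕ × (ℕ × ℕ)) := bif β then w.rec₁ else w.rec₀

/-- The record after a payment. -/
def payRec (ℓ price : ℕ) (x : ℕ × ℕ) : ℕ × ℕ := (x.1 - price, (x.2 + 1) % 2 ^ ℓ)

/-- The block that is written in a payment. -/
def payBlock (ℓ price : ℕ) (x : ℕ × ℕ) : ℕ :=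
  record ℓ (payRec ℓ price x).1 (payRec ℓ price x).2

/-- The input of the pseudorandom function in a payment. -/
def tokenInput (ℓ i : ℕ) (x : ℕ × ℕ) : Val := .pair (.nat i) (.nat ((x.2 + 1) % 2 ^ ℓ))

/-- The end of a transaction. -/
def Wallet.close (w : Wallet) (ok : Option (ℕ × ℕ)) : Wallet :=
  { w with session := none, phase := w.phase.next ok }

/-- The end of a successful transaction. -/
def Wallet.pay (ℓ : ℕ) (w : Wallet) (i₀ i₁ price ε : ℕ) : Wallet :=
  { w with
    rec₀ := (i₀, payRec ℓ price (getRec w.rec₀ i₀)) :: w.rec₀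
    rec₁ := (i₁, payRec ℓ price (getRec w.rec₁ i₁)) :: w.rec₁
    session := none
    phase := w.phase.next (some (price, ε)) }

def assignCards (i : ℕ) : List ℕ → List (ℕ × ℕ) → List (ℕ × ℕ) × List Val
  | [], T => (T, [])
  | t :: ts, T =>
    match T.lookup t with
    | some _ => assignCards i ts T
    | none =>
      let p := assignCards i ts ((t, i) :: T)
      (p.1, .nat t :: p.2)

/-- A step of the experiment, up to the query of a token. -/
inductive Out : Type
  | done (w : Wallet) (o : ORAMState) (m : Val) : Out
  | pay (w : Wallet) (o : ORAMState) (i₀ i₁ price ε r coin : ℕ) (msgs : List Val) : Out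

/-- A transaction, from the moves of the client in the write access on. -/
def cardWrite (w : Wallet) (o : ORAMState) (op : Op) (i₀ i₁ price ε r coin : ℕ) (pre : List Val)
    (res : AccessResult) : Out :=
  match res with
  | .wait _ c => .done { w with session := some ⟨i₀, i₁, .writing price ε r coin⟩ }
      (o.after op res).1 (.pair (.nat 1) (Val.list (pre ++ [c])))
  | .fail _ => .done (w.close none) (o.after op res).1 (.pair (.nat 3) (Val.list pre))
  | .done _ c _ _ => .pay w (o.after op res).1 i₀ i₁ price ε r coin (pre ++ [c])

/-- The write access of a payment in world `β`. -/
def payOp (ℓ : ℕ) (w : Wallet) (β : Bool) (i₀ i₁ price : ℕ) : Op :=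
  bif β then .write i₁ (payBlock ℓ price (getRec w.rec₁ i₁))
  else .write i₀ (payBlock ℓ price (getRec w.rec₀ i₀))

/-- A transaction, from the moves of the client in the read access on. The card takes its balance
from the records of world `b`, the accesses are those of world `β`. -/
noncomputable def System.cardRead (Y : System N) (b β : Bool) (ℓ : ℕ) (w : Wallet) (o : ORAMState)
    (op : Op) (i₀ i₁ price ε : ℕ) (res : AccessResult) : PMF Out :=
  match res with
  | .wait _ c => PMF.pure (.done { w with session := some ⟨i₀, i₁, .reading price ε⟩ }
      (o.after op res).1 (.pair (.nat 1) (Val.list [c])))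
  | .fail _ => PMF.pure (.done (w.close none) (o.after op res).1 (.pair (.nat 3) (Val.list [])))
  | .done _ c _ _ =>
    if (getRec (w.recs b) (bif b then i₁ else i₀)).1 < price then
      PMF.pure (.done (w.close none) (o.after op res).1 (.pair (.nat 3) (Val.list [c])))
    else
      (unif (Y.com.q w.pp - 1)).bind fun r =>
      (unif (Y.ds.sign.coins ℓ)).bind fun coin =>
      (unif (Y.oram.client.coins ℓ)).map fun x =>
      cardWrite w (o.after op res).1 (payOp ℓ w β i₀ i₁ price) i₀ i₁ price ε r coin [c]
        (Y.oram.move ℓ o.sk (Access.new (payOp ℓ w β i₀ i₁ price) x (o.after op res).1.store))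

/-- The state of the ORAM challenger after an honest write access. -/
def ORAMState.afterHonest (o : ORAMState) (i d : ℕ) : Option Val → ORAMState
  | some db => { o with store := o.store.commit db, mem := Function.update o.mem i (some d) }
  | none => { o with wrong := o.wrong || (!o.rewound && !o.broken) }

/-- The registration of a household. -/
noncomputable def System.walletRegister (Y : System N) (ℓ : ℕ) (w : Wallet) (o : ORAMState)
    (ids : List ℕ) (bud : ℕ) : PMF Out :=
  if w.nextId < N ℓ ∧ bud < 2 ^ ℓ then
    (unif (Y.com.q w.pp - 1)).bind fun r =>
    (unif (Y.ds.sign.coins ℓ)).bind fun coin =>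
    if Y.ds.accepts ℓ w.pkRS (.nat r) (Y.ds.sign.out ℓ (.pair w.skRS (.nat r)) coin) then
      (unif (Y.oram.client.coins ℓ)).map fun x =>
      let run := Y.oram.honestRun ℓ o.sk (polyBound Y.oram.deg ℓ)
        (Y.oram.move ℓ o.sk (Access.new (.write w.nextId (record ℓ bud 0)) x o.store))
      let trs := Val.list (.nat w.nextId :: w.skRS :: .nat bud :: run.2)
      match run.1 with
      | some db =>
        let p := assignCards w.nextId ids w.cards
        .done { w with
            nextId := w.nextId + 1
            cards := p.1
            rec₀ := (w.nextId, (bud, 0)) :: w.rec₀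
            rec₁ := (w.nextId, (bud, 0)) :: w.rec₁ }
          (o.afterHonest w.nextId (record ℓ bud 0) (some db))
          (.pair (.nat 1) (.pair (Val.list p.2) trs))
      | none => .done w (o.afterHonest w.nextId (record ℓ bud 0) none) (.pair (.nat 0) trs)
    else PMF.pure (.done w o (.pair (.nat 0) (Val.list [.nat w.nextId, w.skRS])))
  else PMF.pure (.done w o (.nat 0))

/-- A message of the adversary outside a transaction. -/
noncomputable def System.walletFree (Y : System N) (ℓ : ℕ) (w : Wallet) (o : ORAMState)
    (msg : Val) : PMF Out :=
  match msg with
  | .pair (.nat 1) (.pair ids (.nat bud)) =>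
    if w.phase.isFree then Y.walletRegister ℓ w o ids.toNats bud else PMF.pure (.done w o (.nat 0))
  | .pair (.nat 2) (.nat tid) =>
    match w.cards.lookup tid with
    | some i =>
      if w.phase.isFree && w.phase.allows i then
        PMF.pure (.done { w with session := some ⟨i, i, .start⟩ } o (.nat 1))
      else PMF.pure (.done w o (.nat 0))
    | none => PMF.pure (.done w o (.nat 0))
  | .pair (.nat 3) (.pair (.nat t₀) (.pair (.nat t₁) (.pair (.nat price) (.nat ε)))) =>
    match w.phase with
    | .before =>
      match w.cards.lookup t₀, w.cards.lookup t₁ with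
      | some i₀, some i₁ =>
        PMF.pure (.done { w with
          phase := .first i₀ i₁ price ε
          session := some ⟨i₀, i₁, .start⟩ } o (.nat 1))
      | _, _ => PMF.pure (.done { w with phase := .over none } o (.nat 0))
    | _ => PMF.pure (.done w o (.nat 0))
  | .pair (.nat 5) _ =>
    match w.phase with
    | .between i₀ i₁ price ε =>
      PMF.pure (.done { w with
        phase := .second i₀ i₁ price ε
        session := some ⟨i₁, i₀, .start⟩ } o (.nat 1))
    | _ => PMF.pure (.done w o (.nat 0))
  | .pair (.nat 6) (.nat g) =>
    match w.phase with
    | .after => PMF.pure (.done { w with phase := .over (some (g != 0)) }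
        { o with guess := some (g != 0) } (.nat 0))
    | _ => PMF.pure (.done w o (.nat 0))
  | _ => PMF.pure (.done w o (.nat 0))

/-- A message of the adversary to the card in a transaction. -/
noncomputable def System.walletCard (Y : System N) (b β : Bool) (ℓ : ℕ) (w : Wallet)
    (o : ORAMState) (s : WSession) (m : Val) : PMF Out :=
  match s.stage, m, o.session with
  | .start, .pair (.nat price) (.nat ε), _ =>
    (unif (Y.oram.client.coins ℓ)).bind fun x =>
      Y.cardRead b β ℓ w o (.read (bif β then s.i₁ else s.i₀)) s.i₀ s.i₁ price ε
        (Y.oram.move ℓ o.sk (Access.new (.read (bif β then s.i₁ else s.i₀)) x o.store))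
  | .reading price ε, m, some (a, c) =>
    Y.cardRead b β ℓ w { o with rewound := o.rewound || Y.oram.rewinds ℓ a c m } a.op s.i₀ s.i₁
      price ε (Y.oram.receive ℓ o.sk a c m)
  | .writing price ε r coin, m, some (a, c) =>
    PMF.pure (cardWrite w { o with rewound := o.rewound || Y.oram.rewinds ℓ a c m } a.op s.i₀ s.i₁
      price ε r coin [] (Y.oram.receive ℓ o.sk a c m))
  | _, _, _ => PMF.pure (.done (w.close none) { o with session := none }
      (.pair (.nat 3) (Val.list [])))

noncomputable def System.walletStep (Y : System N) (b β : Bool) (ℓ : ℕ) (w : Wallet)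
    (o : ORAMState) (msg : Val) : PMF Out :=
  match w.session with
  | none => Y.walletFree ℓ w o msg
  | some s =>
    match msg with
    | .pair (.nat 4) m => Y.walletCard b β ℓ w o s m
    | _ => PMF.pure (.done (w.close none) { o with session := none }
        (.pair (.nat 3) (Val.list [])))

/-- The proof of payment with token `τ`. -/
def System.payProof (Y : System N) (ℓ : ℕ) (w : Wallet) (price ε r coin : ℕ) (τ : Val) : Val :=
  Val.list [Y.ds.sign.out ℓ (.pair w.skRS (.pair τ (.pair (.nat ε) (Y.com.commit w.pp price r))))
    coin, τ, Y.com.commit w.pp price r, .nat r]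

/-- The card computes its token before the write access, but nobody sees it unless that access
succeeds. Asking for it only here makes token requests coincide with completed payments. If a write
is broken off, the counter is not advanced and the same input will be used by a later payment; an
early request would then be repeated. -/
noncomputable def System.finish (Y : System N) (tok : PRFState → Val → PMF (PRFState × Val))
    (β : Bool) (ℓ : ℕ) (p : PRFState) : Out → PMF ((Wallet × (ORAMState × PRFState)) × Val)
  | .done w o m => PMF.pure ((w, (o, p)), m)
  | .pay w o i₀ i₁ price ε r coin msgs =>
    (tok p (bif β then tokenInput ℓ i₁ (getRec w.rec₁ i₁)
      else tokenInput ℓ i₀ (getRec w.rec₀ i₀))).map fun t =>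
      ((w.pay ℓ i₀ i₁ price ε, (o, t.1)),
        .pair (.nat 2) (Val.list (msgs ++ [Y.payProof ℓ w price ε r coin t.2])))

/-- The experiment with ideal memory: cards decide by the records of world `b`, the ORAM accesses
are those of world `β`, and the tokens come from the oracle `tok`. -/
@[reducible] noncomputable def System.walletGame (Y : System N)
    (tok : PRFState → Val → PMF (PRFState × Val)) (b β : Bool) (ℓ : ℕ) : Game where
  State := Wallet × (ORAMState × PRFState)
  start :=
    (Y.oram.init.sample ℓ (ones (N ℓ))).bind fun v =>
    (Y.prf.keygen.sample ℓ (.nat 0)).bind fun K =>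
    (Y.com.gen.sample ℓ (.nat 0)).bind fun pp =>
    (Y.ds.keygen.sample ℓ (.nat 0)).map fun k =>
    ((⟨pp, k.fst, k.snd, 0, [], [], [], .before, none⟩,
      (ORAMState.init v, ⟨K, fun _ => none, none⟩)),
      .pair pp (.pair k.fst (.pair k.snd v.snd)))
  respond s msg := (Y.walletStep b β ℓ s.1 s.2.1 msg).bind (Y.finish tok β ℓ s.2.2)

/-! ### Association lists as values -/

def lookupStep (x : Val) : Val :=
  if x.snd.fst.IsNat ∧ x.snd.snd.fst = x.fst then .pair (.nat 1) x.snd.snd.snd else x.snd.fst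

/-- The value of the key `k` in the association list `T`: `(1, v)`, or `0` if there is none. -/
def lookupVal (k T : Val) : Val :=
  T.toList.foldl (fun a x => lookupStep (.pair k (.pair a x))) (.nat 0)

/-- A pair in the accumulator means that the key has been found. Later entries do not change it, so
the first match wins, as for `List.lookup`. -/
theorem lookup_fold_pair (k a b : Val) (l : List Val) :
    l.foldl (fun a x => lookupStep (.pair k (.pair a x))) (.pair a b) = .pair a b := by
  induction l with
  | nil => rfl
  | cons x l ih => simpa [lookupStep] using ih

theorem lookup_fold_size (k : Val) {l : List Val} {s : ℕ} (hl : ∀ x ∈ l, x.size ≤ s) :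
    (l.foldl (fun a x => lookupStep (.pair k (.pair a x))) (.nat 0)).size ≤ 3 + s := by
  induction l with
  | nil => simp; omega
  | cons x l ih =>
    rw [List.foldl_cons]
    by_cases h : x.fst = k
    · have h₁ : lookupStep (.pair k (.pair (.nat 0) x)) = .pair (.nat 1) x.snd := by
        simp [lookupStep, h]
      have h₂ := hl x (by simp)
      have h₃ := x.size_snd_le
      rw [h₁, lookup_fold_pair]
      simp
      omega
    · have h₁ : lookupStep (.pair k (.pair (.nat 0) x)) = .nat 0 := by simp [lookupStep, h]
      rw [h₁]
      exact ih fun y hy => hl y (by simp [hy])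

@[fun_prop] theorem lookupVal_poly {k T : Val → Val} (hk : PolyTime k) (hT : PolyTime T) :
    PolyTime fun v => lookupVal (k v) (T v) := by
  obtain ⟨d, hd⟩ := hT.size_le
  refine PolyTime.foldl (step := lookupStep) (M := fun n => 3 + polyBound d n)
    (by unfold lookupStep; fun_prop) hk (PolyTime.const _) hT
    ((PolyBdd.const 3).add (PolyBdd.id.polyBound d)) fun v l hl => ?_
  refine (lookup_fold_size (k v) (s := (T v).size) fun x hx =>
    Val.size_le_of_mem_toList (hl.subset hx)).trans ?_
  exact Nat.add_le_add_left (hd v) 3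

def assocVal {α : Type} (g : α → Val) (T : List (ℕ × α)) : Val :=
  Val.list (T.map fun p => .pair (.nat p.1) (g p.2))

theorem assocVal_cons {α : Type} (g : α → Val) (p : ℕ × α) (T : List (ℕ × α)) :
    assocVal g (p :: T) = .pair (.pair (.nat p.1) (g p.2)) (assocVal g T) := rfl

theorem lookupVal_assoc {α : Type} (g : α → Val) (T : List (ℕ × α)) (k : ℕ) :
    lookupVal (.nat k) (assocVal g T) =
      (match T.lookup k with
        | some v => .pair (.nat 1) (g v)
        | none => .nat 0) := by
  unfold lookupVal assocVal
  rw [Val.toList_list]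
  induction T with
  | nil => rfl
  | cons p T ih =>
    rw [List.map_cons, List.foldl_cons, List.lookup_cons]
    by_cases h : p.1 = k
    · have h₁ : lookupStep (.pair (.nat k) (.pair (.nat 0) (.pair (.nat p.1) (g p.2)))) =
        .pair (.nat 1) (g p.2) := by simp [lookupStep, h]
      rw [h₁, lookup_fold_pair]
      simp [h]
    · have h₁ : lookupStep (.pair (.nat k) (.pair (.nat 0) (.pair (.nat p.1) (g p.2)))) =
        .nat 0 := by simp [lookupStep, h]
      have h₂ : (k == p.1) = false := by simpa using fun h' => h h'.symm
      rw [h₁, ih, h₂]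

/-! The cards of a new household. -/

/-- The accumulator is `(flag, (cards, new identifiers))`. The flag becomes `1` at the first entry
that is not a number; the rest of the list is then ignored, as by `Val.toNats`. -/
def assignStep (x : Val) : Val :=
  if x.snd.fst.fst = .nat 0 ∧ x.snd.snd.IsNat then
    if (lookupVal x.snd.snd x.snd.fst.snd.fst).IsNat then
      .pair (.nat 0) (.pair (.pair (.pair x.snd.snd x.fst) x.snd.fst.snd.fst)
        (.pair x.snd.snd x.snd.fst.snd.snd))
    else x.snd.fst
  else .pair (.nat 1) x.snd.fst.snd

def assignFold (i ids T : Val) : Val :=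
  ids.toList.foldl (fun a x => assignStep (.pair i (.pair a x)))
    (.pair (.nat 0) (.pair T (.nat 0)))

/-- The growth per step is additive, bounded independently of the accumulator; over polynomially
many steps the length stays polynomial. -/
theorem assignStep_size (i a x : Val) :
    (assignStep (.pair i (.pair a x))).size ≤ a.size + (2 * x.size + i.size + 8) := by
  have h₁ := a.size_snd_le
  have h₂ := a.snd.size_snd_le
  have h₃ := a.snd.size_fst_le
  have h₄ : a.snd.fst.size + a.snd.snd.size ≤ a.size + 1 := by
    rcases a with _ | ⟨_, _ | ⟨_, _⟩⟩ <;> simp <;> omega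
  unfold assignStep
  split_ifs <;> simp <;> omega

theorem assign_fold_size (i : Val) {l : List Val} {s : ℕ} (hl : ∀ x ∈ l, x.size ≤ s) (a : Val) :
    (l.foldl (fun a x => assignStep (.pair i (.pair a x))) a).size ≤
      a.size + l.length * (2 * s + i.size + 8) := by
  induction l generalizing a with
  | nil => simp
  | cons x l ih =>
    rw [List.foldl_cons]
    have h₁ := ih (fun y hy => hl y (by simp [hy])) (assignStep (.pair i (.pair a x)))
    have h₂ := assignStep_size i a x
    have h₃ := hl x (by simp)
    rw [List.length_cons, Nat.succ_mul]
    omega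

@[fun_prop] theorem assignFold_poly {i ids T : Val → Val} (hi : PolyTime i) (hids : PolyTime ids)
    (hT : PolyTime T) : PolyTime fun v => assignFold (i v) (ids v) (T v) := by
  obtain ⟨d₁, h₁⟩ := hi.size_le
  obtain ⟨d₂, h₂⟩ := hids.size_le
  obtain ⟨d₃, h₃⟩ := hT.size_le
  have hp : ∀ d : ℕ, PolyBdd (polyBound d) := fun d => PolyBdd.id.polyBound d
  refine PolyTime.foldl (step := assignStep)
    (acc := fun v => .pair (.nat 0) (.pair (T v) (.nat 0)))
    (M := fun n => (4 + polyBound d₃ n) + polyBound d₂ n * (2 * polyBound d₂ n + polyBound d₁ n + 8))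
    (by unfold assignStep; fun_prop) hi (by fun_prop) hids
    (((PolyBdd.const 4).add (hp _)).add ((hp _).mul ((((PolyBdd.const 2).mul (hp _)).add
      (hp _)).add (.const 8)))) fun v l hl => ?_
  refine (assign_fold_size (i v) (s := (ids v).size) (fun x hx =>
    Val.size_le_of_mem_toList (hl.subset hx)) _).trans ?_
  have e₁ := h₁ v
  have e₂ := h₂ v
  have e₃ := h₃ v
  have e₄ : l.length ≤ polyBound d₂ v.size := (List.length_prefix_le hl).trans e₂
  have e₅ := Nat.mul_le_mul e₄ (show 2 * (ids v).size + (i v).size + 8 ≤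
    2 * polyBound d₂ v.size + polyBound d₁ v.size + 8 by omega)
  simp only [Val.size_pair, Val.size_nat, Nat.size_zero]
  omega

theorem assign_fold_stop (i : Val) (l : List Val) (x : Val) :
    (l.foldl (fun a x => assignStep (.pair i (.pair a x))) (.pair (.nat 1) x)) =
      .pair (.nat 1) x := by
  induction l with
  | nil => rfl
  | cons y l ih =>
    rw [List.foldl_cons]
    have : assignStep (.pair i (.pair (.pair (.nat 1) x) y)) = .pair (.nat 1) x := by
      simp [assignStep]
    rw [this, ih]

/-- The fold collects the new identifiers in front of `out`, hence the reversal; `out` is arbitrary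
for the sake of the induction. -/
theorem assign_fold_eq (i : ℕ) (ids : Val) (T : List (ℕ × ℕ)) (out : List Val) :
    (ids.toList.foldl (fun a x => assignStep (.pair (.nat i) (.pair a x)))
      (.pair (.nat 0) (.pair (assocVal Val.nat T) (Val.list out)))).snd =
      .pair (assocVal Val.nat (assignCards i ids.toNats T).1)
        (Val.list ((assignCards i ids.toNats T).2.reverse ++ out)) := by
  induction ids generalizing T out with
  | nat n => simp [Val.toNats, assignCards]
  | pair x ids _ ih =>
    rw [Val.toList_pair, List.foldl_cons]
    rcases x with t | ⟨y, z⟩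
    · simp only [Val.toNats, assignCards]
      have hl := lookupVal_assoc Val.nat T t
      rcases h : T.lookup t with _ | j
      · simp only [h] at hl
        have h₁ : assignStep (.pair (.nat i) (.pair (.pair (.nat 0) (.pair (assocVal Val.nat T)
            (Val.list out))) (.nat t))) = .pair (.nat 0)
              (.pair (assocVal Val.nat ((t, i) :: T)) (Val.list (.nat t :: out))) := by
          simp [assignStep, hl, assocVal_cons]
        rw [h₁, ih]
        simp
      · simp only [h] at hl
        have h₁ : assignStep (.pair (.nat i) (.pair (.pair (.nat 0) (.pair (assocVal Val.nat T)
            (Val.list out))) (.nat t))) = .pair (.nat 0)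
              (.pair (assocVal Val.nat T) (Val.list out)) := by
          simp [assignStep, hl]
        rw [h₁, ih]
    · have h₁ : assignStep (.pair (.nat i) (.pair (.pair (.nat 0) (.pair (assocVal Val.nat T)
          (Val.list out))) (.pair y z))) = .pair (.nat 1)
            (.pair (assocVal Val.nat T) (Val.list out)) := by
        simp [assignStep]
      rw [h₁, assign_fold_stop]
      simp [Val.toNats, assignCards]

theorem assignFold_eq (i : ℕ) (ids : Val) (T : List (ℕ × ℕ)) :
    (assignFold (.nat i) ids (assocVal Val.nat T)).snd =
      .pair (assocVal Val.nat (assignCards i ids.toNats T).1)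
        (Val.list (assignCards i ids.toNats T).2.reverse) := by
  have := assign_fold_eq i ids T []
  rw [List.append_nil] at this
  exact this

/-! ### A machine that plays the experiment with ideal memory

Its state is `(tag, (core, ext))`, where `core` holds the keys, the database and the tables. -/

def coreMk (pp sk pk db nid cards r₀ r₁ ph : Val) : Val :=
  .pair pp (.pair sk (.pair pk (.pair db (.pair nid (.pair cards (.pair r₀ (.pair r₁ ph)))))))

def corePp (c : Val) : Val := c.fst
def coreSk (c : Val) : Val := c.snd.fst
def corePk (c : Val) : Val := c.snd.snd.fst
def coreDb (c : Val) : Val := c.snd.snd.snd.fst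
def coreNid (c : Val) : Val := c.snd.snd.snd.snd.fst
def coreCards (c : Val) : Val := c.snd.snd.snd.snd.snd.fst
def coreRec₀ (c : Val) : Val := c.snd.snd.snd.snd.snd.snd.fst
def coreRec₁ (c : Val) : Val := c.snd.snd.snd.snd.snd.snd.snd.fst
def corePhase (c : Val) : Val := c.snd.snd.snd.snd.snd.snd.snd.snd

section CoreMk
variable (pp sk pk db nid cards r₀ r₁ ph : Val)

@[simp] theorem corePp_mk : corePp (coreMk pp sk pk db nid cards r₀ r₁ ph) = pp := rfl
@[simp] theorem coreSk_mk : coreSk (coreMk pp sk pk db nid cards r₀ r₁ ph) = sk := rfl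
@[simp] theorem corePk_mk : corePk (coreMk pp sk pk db nid cards r₀ r₁ ph) = pk := rfl
@[simp] theorem coreDb_mk : coreDb (coreMk pp sk pk db nid cards r₀ r₁ ph) = db := rfl
@[simp] theorem coreNid_mk : coreNid (coreMk pp sk pk db nid cards r₀ r₁ ph) = nid := rfl
@[simp] theorem coreCards_mk : coreCards (coreMk pp sk pk db nid cards r₀ r₁ ph) = cards := rfl
@[simp] theorem coreRec₀_mk : coreRec₀ (coreMk pp sk pk db nid cards r₀ r₁ ph) = r₀ := rfl
@[simp] theorem coreRec₁_mk : coreRec₁ (coreMk pp sk pk db nid cards r₀ r₁ ph) = r₁ := rfl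
@[simp] theorem corePhase_mk : corePhase (coreMk pp sk pk db nid cards r₀ r₁ ph) = ph := rfl

end CoreMk

section CorePoly
variable {f : Val → Val}

@[fun_prop] theorem corePp_poly (hf : PolyTime f) : PolyTime fun v => corePp (f v) := by
  unfold corePp; fun_prop
@[fun_prop] theorem coreSk_poly (hf : PolyTime f) : PolyTime fun v => coreSk (f v) := by
  unfold coreSk; fun_prop
@[fun_prop] theorem corePk_poly (hf : PolyTime f) : PolyTime fun v => corePk (f v) := by
  unfold corePk; fun_prop
@[fun_prop] theorem coreDb_poly (hf : PolyTime f) : PolyTime fun v => coreDb (f v) := by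
  unfold coreDb; fun_prop
@[fun_prop] theorem coreNid_poly (hf : PolyTime f) : PolyTime fun v => coreNid (f v) := by
  unfold coreNid; fun_prop
@[fun_prop] theorem coreCards_poly (hf : PolyTime f) : PolyTime fun v => coreCards (f v) := by
  unfold coreCards; fun_prop
@[fun_prop] theorem coreRec₀_poly (hf : PolyTime f) : PolyTime fun v => coreRec₀ (f v) := by
  unfold coreRec₀; fun_prop
@[fun_prop] theorem coreRec₁_poly (hf : PolyTime f) : PolyTime fun v => coreRec₁ (f v) := by
  unfold coreRec₁; fun_prop
@[fun_prop] theorem corePhase_poly (hf : PolyTime f) : PolyTime fun v => corePhase (f v) := by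
  unfold corePhase; fun_prop

end CorePoly

def setDb (c d : Val) : Val :=
  coreMk (corePp c) (coreSk c) (corePk c) d (coreNid c) (coreCards c) (coreRec₀ c) (coreRec₁ c)
    (corePhase c)

def setPhase (c p : Val) : Val :=
  coreMk (corePp c) (coreSk c) (corePk c) (coreDb c) (coreNid c) (coreCards c) (coreRec₀ c)
    (coreRec₁ c) p

@[fun_prop] theorem setDb_poly {f g : Val → Val} (hf : PolyTime f) (hg : PolyTime g) :
    PolyTime fun v => setDb (f v) (g v) := by
  unfold setDb coreMk; fun_prop

@[fun_prop] theorem setPhase_poly {f g : Val → Val} (hf : PolyTime f) (hg : PolyTime g) :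
    PolyTime fun v => setPhase (f v) (g v) := by
  unfold setPhase coreMk; fun_prop

/-- The core after an aborted transaction. -/
def closeVal (c : Val) : Val :=
  if (corePhase c).fst = .nat 1 ∨ (corePhase c).fst = .nat 3 then
    setPhase c (.pair (.nat 5) (.nat 0))
  else c

@[fun_prop] theorem closeVal_poly {f : Val → Val} (hf : PolyTime f) :
    PolyTime fun v => closeVal (f v) := by
  unfold closeVal; fun_prop

/-- The phase after a payment; the input is `(phase, (price, ε))`. -/
def payPhaseVal (v : Val) : Val :=
  if v.fst.fst = .nat 1 then
    if v.fst.snd.snd.snd = v.snd then .pair (.nat 2) v.fst.snd else .pair (.nat 5) (.nat 0)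
  else if v.fst.fst = .nat 3 then
    if v.fst.snd.snd.snd = v.snd then .pair (.nat 4) (.nat 0) else .pair (.nat 5) (.nat 0)
  else v.fst

/-- Records; the input is `(1^ℓ, (price, r))`. -/
def payRecVal (v : Val) : Val :=
  .pair (.nat (v.snd.snd.fst.num - v.snd.fst.num)) (.nat ((v.snd.snd.snd.num + 1) % (v.fst.num + 1)))

def payBlockVal (v : Val) : Val :=
  .nat ((v.snd.snd.fst.num - v.snd.fst.num) * (v.fst.num + 1) +
    (v.snd.snd.snd.num + 1) % (v.fst.num + 1) % (v.fst.num + 1))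

/-- The record of the household `i` in the table `T`. -/
def recVal (i T : Val) : Val := (lookupVal i T).snd

@[fun_prop] theorem recVal_poly {f g : Val → Val} (hf : PolyTime f) (hg : PolyTime g) :
    PolyTime fun v => recVal (f v) (g v) := by
  unfold recVal; fun_prop

@[fun_prop] theorem payRecVal_poly {f : Val → Val} (hf : PolyTime f) :
    PolyTime fun v => payRecVal (f v) := by
  unfold payRecVal; fun_prop

@[fun_prop] theorem payBlockVal_poly {f : Val → Val} (hf : PolyTime f) :
    PolyTime fun v => payBlockVal (f v) := by
  unfold payBlockVal; fun_prop

@[fun_prop] theorem payPhaseVal_poly {f : Val → Val} (hf : PolyTime f) :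
    PolyTime fun v => payPhaseVal (f v) := by
  unfold payPhaseVal; fun_prop

/-- The core after a payment; the input is `(1^ℓ, (core, (i₀, (i₁, (price, ε)))))`. -/
def payVal (v : Val) : Val :=
  coreMk (corePp v.snd.fst) (coreSk v.snd.fst) (corePk v.snd.fst) (coreDb v.snd.fst)
    (coreNid v.snd.fst) (coreCards v.snd.fst)
    (.pair (.pair v.snd.snd.fst (payRecVal (.pair v.fst (.pair v.snd.snd.snd.snd.fst
      (recVal v.snd.snd.fst (coreRec₀ v.snd.fst)))))) (coreRec₀ v.snd.fst))
    (.pair (.pair v.snd.snd.snd.fst (payRecVal (.pair v.fst (.pair v.snd.snd.snd.snd.fst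
      (recVal v.snd.snd.snd.fst (coreRec₁ v.snd.fst)))))) (coreRec₁ v.snd.fst))
    (payPhaseVal (.pair (corePhase v.snd.fst) (.pair v.snd.snd.snd.snd.fst v.snd.snd.snd.snd.snd)))

@[fun_prop] theorem payVal_poly {f : Val → Val} (hf : PolyTime f) :
    PolyTime fun v => payVal (f v) := by
  unfold payVal coreMk; fun_prop

/-- The core after a registration; the input is `(core, (ids, (bud, db)))`. -/
def enrollVal (v : Val) : Val :=
  coreMk (corePp v.fst) (coreSk v.fst) (corePk v.fst) v.snd.snd.snd
    (.nat ((coreNid v.fst).num + 1))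
    (assignFold (coreNid v.fst) v.snd.fst (coreCards v.fst)).snd.fst
    (.pair (.pair (coreNid v.fst) (.pair v.snd.snd.fst (.nat 0))) (coreRec₀ v.fst))
    (.pair (.pair (coreNid v.fst) (.pair v.snd.snd.fst (.nat 0))) (coreRec₁ v.fst))
    (corePhase v.fst)

@[fun_prop] theorem enrollVal_poly {f : Val → Val} (hf : PolyTime f) :
    PolyTime fun v => enrollVal (f v) := by
  unfold enrollVal coreMk; fun_prop

/-! Moves of the machine. -/

/-- Control states: 1 and 10 for the setup, 2 between messages of the adversary, 3 to 5 for a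
registration (randomness, signature, honest write access), 6 for the read access of a payment, 7 and
8 for its randomness, 9 for its write access, 11 while waiting for the token, 12 after breaking off
an access, 13 after the guess. -/
def machineState (tag : ℕ) (c x : Val) : Val := .pair (.nat tag) (.pair c x)

def goUp (c x m : Val) : Val := .pair (machineState 2 c x) (.pair (.nat 0) m)

def goRand (tag : ℕ) (c x n : Val) : Val :=
  .pair (machineState tag c x) (.pair (.nat 1) (.pair (.nat 0) n))

def goDown (tag : ℕ) (c x d : Val) : Val := .pair (machineState tag c x) (.pair (.nat 1) d)

section Go
variable {f g h : Val → Val}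

@[fun_prop] theorem goUp_poly (hf : PolyTime f) (hg : PolyTime g) (hh : PolyTime h) :
    PolyTime fun v => goUp (f v) (g v) (h v) := by
  unfold goUp machineState; fun_prop

@[fun_prop] theorem goRand_poly (t : ℕ) (hf : PolyTime f) (hg : PolyTime g) (hh : PolyTime h) :
    PolyTime fun v => goRand t (f v) (g v) (h v) := by
  unfold goRand machineState; fun_prop

@[fun_prop] theorem goDown_poly (t : ℕ) (hf : PolyTime f) (hg : PolyTime g) (hh : PolyTime h) :
    PolyTime fun v => goDown t (f v) (g v) (h v) := by
  unfold goDown machineState; fun_prop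

end Go

/-- The order of the group, computed from the public parameters. -/
noncomputable def Pedersen.qFn (C : Pedersen) : Val → Val := C.q_poly.choose

@[fun_prop] theorem Pedersen.qFn_poly (C : Pedersen) : PolyTime C.qFn := C.q_poly.choose_spec.1

theorem Pedersen.qFn_eq (C : Pedersen) {ℓ : ℕ} {pp : Val}
    (h : pp ∈ (C.gen.sample ℓ (.nat 0)).support) : C.qFn pp = .nat (C.q pp) :=
  C.q_poly.choose_spec.2 ℓ pp h

noncomputable def Pedersen.commitFn (C : Pedersen) : Val → Val := C.commit_poly.choose

@[fun_prop] theorem Pedersen.commitFn_poly (C : Pedersen) : PolyTime C.commitFn :=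
  C.commit_poly.choose_spec.1

theorem Pedersen.commitFn_eq (C : Pedersen) {ℓ : ℕ} {pp : Val}
    (h : pp ∈ (C.gen.sample ℓ (.nat 0)).support) (m r : ℕ) :
    C.commitFn (.pair pp (.pair (.nat m) (.nat r))) = C.commit pp m r :=
  C.commit_poly.choose_spec.2 ℓ pp h m r

/-- Append a value to a list of at most two values. -/
def snocVal (l x : Val) : Val :=
  if l.IsNat then .pair x (.nat 0)
  else if l.snd.IsNat then .pair l.fst (.pair x (.nat 0))
  else .pair l.fst (.pair l.snd.fst (.pair x (.nat 0)))

@[fun_prop] theorem snocVal_poly {f g : Val → Val} (hf : PolyTime f) (hg : PolyTime g) :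
    PolyTime fun v => snocVal (f v) (g v) := by
  unfold snocVal; fun_prop

theorem snocVal_eq {l : List Val} (hl : l.length ≤ 2) (x : Val) :
    snocVal (Val.list l) x = Val.list (l ++ [x]) := by
  rcases l with _ | ⟨a, _ | ⟨b, _ | ⟨c, l⟩⟩⟩
  · simp [snocVal]
  · simp [snocVal]
  · simp [snocVal]
  · simp at hl

section Handlers
variable (Y : System N) (b : Bool)

/-! The handlers take `(1^ℓ, (core, (ext, message)))`. -/

def FreePhaseVal (p : Val) : Prop := p.fst = .nat 0 ∨ p.fst = .nat 2 ∨ p.fst = .nat 4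

/-- Whether a household may be used in the phase; the input is `(phase, i)`. -/
def AllowsVal (v : Val) : Prop :=
  v.fst.fst = .nat 2 → v.snd ≠ v.fst.snd.fst ∧ v.snd ≠ v.fst.snd.snd.fst

instance (p : Val) : Decidable (FreePhaseVal p) := by unfold FreePhaseVal; infer_instance
instance (v : Val) : Decidable (AllowsVal v) := by unfold AllowsVal; infer_instance

noncomputable def registerVal (v : Val) : Val :=
  if FreePhaseVal (corePhase v.snd.fst) ∧ (coreNid v.snd.fst).num < Y.oram.cap v.fst ∧
      v.snd.snd.snd.snd.snd.num < v.fst.num + 1 then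
    goRand 3 v.snd.fst v.snd.snd.snd.snd (.nat ((Y.com.qFn (corePp v.snd.fst)).num - 1))
  else goUp v.snd.fst (.nat 0) (.nat 0)

def startVal (v : Val) : Val :=
  if ¬(lookupVal v.snd.snd.snd.snd (coreCards v.snd.fst)).IsNat ∧
      FreePhaseVal (corePhase v.snd.fst) ∧
      AllowsVal (.pair (corePhase v.snd.fst)
        (lookupVal v.snd.snd.snd.snd (coreCards v.snd.fst)).snd) then
    goUp v.snd.fst (.pair (lookupVal v.snd.snd.snd.snd (coreCards v.snd.fst)).snd
      (.pair (lookupVal v.snd.snd.snd.snd (coreCards v.snd.fst)).snd (.nat 0))) (.nat 1)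
  else goUp v.snd.fst (.nat 0) (.nat 0)

def announceVal (v : Val) : Val :=
  if (corePhase v.snd.fst).fst = .nat 0 then
    if ¬(lookupVal v.snd.snd.snd.snd.fst (coreCards v.snd.fst)).IsNat ∧
        ¬(lookupVal v.snd.snd.snd.snd.snd.fst (coreCards v.snd.fst)).IsNat then
      goUp (setPhase v.snd.fst (.pair (.nat 1)
          (.pair (lookupVal v.snd.snd.snd.snd.fst (coreCards v.snd.fst)).snd
            (.pair (lookupVal v.snd.snd.snd.snd.snd.fst (coreCards v.snd.fst)).snd
              v.snd.snd.snd.snd.snd.snd))))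
        (.pair (lookupVal v.snd.snd.snd.snd.fst (coreCards v.snd.fst)).snd
          (.pair (lookupVal v.snd.snd.snd.snd.snd.fst (coreCards v.snd.fst)).snd (.nat 0)))
        (.nat 1)
    else goUp (setPhase v.snd.fst (.pair (.nat 5) (.nat 0))) (.nat 0) (.nat 0)
  else goUp v.snd.fst (.nat 0) (.nat 0)

def secondVal (v : Val) : Val :=
  if (corePhase v.snd.fst).fst = .nat 2 then
    goUp (setPhase v.snd.fst (.pair (.nat 3) (corePhase v.snd.fst).snd))
      (.pair (corePhase v.snd.fst).snd.snd.fst (.pair (corePhase v.snd.fst).snd.fst (.nat 0)))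
      (.nat 1)
  else goUp v.snd.fst (.nat 0) (.nat 0)

def guessVal (v : Val) : Val :=
  if (corePhase v.snd.fst).fst = .nat 4 then
    goDown 13 (setPhase v.snd.fst (.pair (.nat 5) (.nat 0))) (.nat 0)
      (.pair (.nat 3) v.snd.snd.snd.snd)
  else goUp v.snd.fst (.nat 0) (.nat 0)

/-- Messages outside a transaction. -/
noncomputable def freeVal (v : Val) : Val :=
  if v.snd.snd.snd.fst = .nat 1 ∧ ¬v.snd.snd.snd.snd.IsNat ∧ v.snd.snd.snd.snd.snd.IsNat then
    registerVal Y v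
  else if v.snd.snd.snd.fst = .nat 2 ∧ v.snd.snd.snd.snd.IsNat then startVal v
  else if v.snd.snd.snd.fst = .nat 3 ∧ v.snd.snd.snd.snd.fst.IsNat ∧
      v.snd.snd.snd.snd.snd.fst.IsNat ∧ ¬v.snd.snd.snd.snd.snd.snd.IsNat ∧
      v.snd.snd.snd.snd.snd.snd.fst.IsNat ∧ v.snd.snd.snd.snd.snd.snd.snd.IsNat then announceVal v
  else if v.snd.snd.snd.fst = .nat 5 then secondVal v
  else if v.snd.snd.snd.fst = .nat 6 ∧ v.snd.snd.snd.snd.IsNat then guessVal v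
  else goUp v.snd.fst (.nat 0) (.nat 0)

/-- Messages in a transaction; `ext` is `(i₀, (i₁, stage))`. -/
def cardVal (v : Val) : Val :=
  if v.snd.snd.fst.snd.snd.IsNat then
    if v.snd.snd.snd.fst = .nat 4 ∧ ¬v.snd.snd.snd.snd.IsNat ∧ v.snd.snd.snd.snd.fst.IsNat ∧
        v.snd.snd.snd.snd.snd.IsNat then
      goDown 6 v.snd.fst (.pair v.snd.snd.fst.fst (.pair v.snd.snd.fst.snd.fst
          (.pair v.snd.snd.snd.snd.fst (.pair v.snd.snd.snd.snd.snd (coreDb v.snd.fst)))))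
        (.pair (.nat 1) (.pair v.snd.snd.fst.fst v.snd.snd.fst.snd.fst))
    else goUp (closeVal v.snd.fst) (.nat 0) (.pair (.nat 3) (.nat 0))
  else if v.snd.snd.snd.fst = .nat 4 then
    if v.snd.snd.fst.snd.snd.fst = .nat 1 then
      goDown 6 v.snd.fst (.pair v.snd.snd.fst.fst (.pair v.snd.snd.fst.snd.fst
        v.snd.snd.fst.snd.snd.snd)) v.snd.snd.snd
    else
      goDown 9 v.snd.fst (.pair (.nat 0) (.pair v.snd.snd.fst.fst (.pair v.snd.snd.fst.snd.fst
        v.snd.snd.fst.snd.snd.snd))) v.snd.snd.snd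
  else goDown 12 v.snd.fst (.nat 0) (.pair (.nat 5) (.nat 0))

/-- The signature of the registration; `ext` is `((ids, bud), r)`. -/
noncomputable def enrollSign (v : Val) : Val :=
  if Y.ds.verif (.pair v.fst (.pair (corePk v.snd.fst) (.pair v.snd.snd.fst.snd
      (Y.ds.sign.run (.pair v.fst (.pair (.pair (coreSk v.snd.fst) v.snd.snd.fst.snd)
        v.snd.snd.snd)))))) ≠ .nat 0 then
    goDown 5 v.snd.fst (.pair v.snd.snd.fst.fst (.pair (coreDb v.snd.fst) (.nat 0)))
      (.pair (.nat 2) (.pair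
        (.pair (coreNid v.snd.fst) (.nat (v.snd.snd.fst.fst.snd.num * (v.fst.num + 1))))
        (.pair (coreNid v.snd.fst) (.nat (v.snd.snd.fst.fst.snd.num * (v.fst.num + 1))))))
  else goUp v.snd.fst (.nat 0) (.pair (.nat 0)
    (.pair (coreNid v.snd.fst) (.pair (coreSk v.snd.fst) (.nat 0))))

/-- The write access of the registration; `ext` is `((ids, bud), (db, transcript))`, the transcript
in reverse order. -/
noncomputable def enrollWrite (v : Val) : Val :=
  if v.snd.snd.snd.IsNat then
    goUp v.snd.fst (.nat 0) (.pair (.nat 0) (.pair (coreNid v.snd.fst) (.pair (coreSk v.snd.fst)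
      (.pair v.snd.snd.fst.fst.snd (Val.list v.snd.snd.fst.snd.snd.toList.reverse)))))
  else if v.snd.snd.snd.fst = .nat 1 then
    goDown 5 v.snd.fst (.pair v.snd.snd.fst.fst (.pair
        (Y.oram.serve (.pair v.fst (.pair v.snd.snd.fst.snd.fst v.snd.snd.snd.snd))).fst
        (.pair (Y.oram.serve (.pair v.fst (.pair v.snd.snd.fst.snd.fst v.snd.snd.snd.snd))).snd
          (.pair v.snd.snd.snd.snd v.snd.snd.fst.snd.snd))))
      (.pair (.nat 4)
        (Y.oram.serve (.pair v.fst (.pair v.snd.snd.fst.snd.fst v.snd.snd.snd.snd))).snd)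
  else
    goUp (enrollVal (.pair v.snd.fst (.pair v.snd.snd.fst.fst.fst (.pair v.snd.snd.fst.fst.snd
        (Y.oram.serve (.pair v.fst (.pair v.snd.snd.fst.snd.fst v.snd.snd.snd.snd))).fst))))
      (.nat 0) (.pair (.nat 1) (.pair
        (Val.list (assignFold (coreNid v.snd.fst) v.snd.snd.fst.fst.fst
          (coreCards v.snd.fst)).snd.snd.toList.reverse)
        (.pair (coreNid v.snd.fst) (.pair (coreSk v.snd.fst) (.pair v.snd.snd.fst.fst.snd
          (Val.list (Val.pair v.snd.snd.snd.snd v.snd.snd.fst.snd.snd).toList.reverse))))))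

/-- The read access of a payment; `ext` is `(i₀, (i₁, (price, (ε, db))))`. -/
noncomputable def payRead (v : Val) : Val :=
  if v.snd.snd.snd.IsNat then goUp (closeVal v.snd.fst) (.nat 0) (.pair (.nat 3) (.nat 0))
  else if v.snd.snd.snd.fst = .nat 1 then
    goUp v.snd.fst (.pair v.snd.snd.fst.fst (.pair v.snd.snd.fst.snd.fst (.pair (.nat 1)
        (.pair v.snd.snd.fst.snd.snd.fst (.pair v.snd.snd.fst.snd.snd.snd.fst
          (Y.oram.serve (.pair v.fst (.pair v.snd.snd.fst.snd.snd.snd.snd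
            v.snd.snd.snd.snd))).fst)))))
      (.pair (.nat 1) (.pair v.snd.snd.snd.snd (.nat 0)))
  else if (bif b then recVal v.snd.snd.fst.snd.fst (coreRec₁ v.snd.fst)
      else recVal v.snd.snd.fst.fst (coreRec₀ v.snd.fst)).fst.num <
      v.snd.snd.fst.snd.snd.fst.num then
    goUp (closeVal (setDb v.snd.fst (Y.oram.serve (.pair v.fst (.pair v.snd.snd.fst.snd.snd.snd.snd
        v.snd.snd.snd.snd))).fst)) (.nat 0)
      (.pair (.nat 3) (.pair v.snd.snd.snd.snd (.nat 0)))
  else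
    goRand 7 (setDb v.snd.fst (Y.oram.serve (.pair v.fst (.pair v.snd.snd.fst.snd.snd.snd.snd
        v.snd.snd.snd.snd))).fst)
      (.pair (.pair v.snd.snd.snd.snd (.nat 0)) (.pair v.snd.snd.fst.fst
        (.pair v.snd.snd.fst.snd.fst (.pair v.snd.snd.fst.snd.snd.fst
          v.snd.snd.fst.snd.snd.snd.fst))))
      (.nat ((Y.com.qFn (corePp v.snd.fst)).num - 1))

/-- The start of the write access of a payment; `ext` is
`((pre, (i₀, (i₁, (price, ε)))), r)`. -/
def payBegin (v : Val) : Val :=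
  goDown 9 v.snd.fst (.pair v.snd.snd.fst.fst.fst (.pair v.snd.snd.fst.fst.snd.fst
      (.pair v.snd.snd.fst.fst.snd.snd.fst (.pair v.snd.snd.fst.fst.snd.snd.snd.fst
        (.pair v.snd.snd.fst.fst.snd.snd.snd.snd (.pair v.snd.snd.fst.snd
          (.pair v.snd.snd.snd (coreDb v.snd.fst))))))))
    (.pair (.nat 2) (.pair
      (.pair v.snd.snd.fst.fst.snd.fst (payBlockVal (.pair v.fst
        (.pair v.snd.snd.fst.fst.snd.snd.snd.fst
          (recVal v.snd.snd.fst.fst.snd.fst (coreRec₀ v.snd.fst))))))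
      (.pair v.snd.snd.fst.fst.snd.snd.fst (payBlockVal (.pair v.fst
        (.pair v.snd.snd.fst.fst.snd.snd.snd.fst
          (recVal v.snd.snd.fst.fst.snd.snd.fst (coreRec₁ v.snd.fst))))))))

/-- The write access of a payment; `ext` is
`(pre, (i₀, (i₁, (price, (ε, (r, (coin, db)))))))`. -/
noncomputable def payWrite (v : Val) : Val :=
  if v.snd.snd.snd.IsNat then
    goUp (closeVal v.snd.fst) (.nat 0) (.pair (.nat 3) v.snd.snd.fst.fst)
  else if v.snd.snd.snd.fst = .nat 1 then
    goUp v.snd.fst (.pair v.snd.snd.fst.snd.fst (.pair v.snd.snd.fst.snd.snd.fst (.pair (.nat 2)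
        (.pair v.snd.snd.fst.snd.snd.snd.fst (.pair v.snd.snd.fst.snd.snd.snd.snd.fst
          (.pair v.snd.snd.fst.snd.snd.snd.snd.snd.fst
            (.pair v.snd.snd.fst.snd.snd.snd.snd.snd.snd.fst
              (Y.oram.serve (.pair v.fst (.pair v.snd.snd.fst.snd.snd.snd.snd.snd.snd.snd
                v.snd.snd.snd.snd))).fst)))))))
      (.pair (.nat 1) (snocVal v.snd.snd.fst.fst v.snd.snd.snd.snd))
  else
    goDown 11 (setDb v.snd.fst (Y.oram.serve (.pair v.fst
        (.pair v.snd.snd.fst.snd.snd.snd.snd.snd.snd.snd v.snd.snd.snd.snd))).fst)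
      (.pair (snocVal v.snd.snd.fst.fst v.snd.snd.snd.snd) v.snd.snd.fst.snd)
      (.pair (.nat 7) (.pair
        (.pair v.snd.snd.fst.snd.fst (.nat (((recVal v.snd.snd.fst.snd.fst
          (coreRec₀ v.snd.fst)).snd.num + 1) % (v.fst.num + 1))))
        (.pair v.snd.snd.fst.snd.snd.fst (.nat (((recVal v.snd.snd.fst.snd.snd.fst
          (coreRec₁ v.snd.fst)).snd.num + 1) % (v.fst.num + 1))))))

/-- The proof of payment; the input is `(1^ℓ, ((pp, sk), (τ, (price, (ε, (r, (coin, _)))))))`. -/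
noncomputable def proofVal (v : Val) : Val :=
  .pair (Y.ds.sign.run (.pair v.fst (.pair (.pair v.snd.fst.snd (.pair v.snd.snd.fst
      (.pair v.snd.snd.snd.snd.fst (Y.com.commitFn (.pair v.snd.fst.fst
        (.pair v.snd.snd.snd.fst v.snd.snd.snd.snd.snd.fst))))))
      v.snd.snd.snd.snd.snd.snd.fst)))
    (.pair v.snd.snd.fst (.pair (Y.com.commitFn (.pair v.snd.fst.fst
      (.pair v.snd.snd.snd.fst v.snd.snd.snd.snd.snd.fst)))
      (.pair v.snd.snd.snd.snd.snd.fst (.nat 0))))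

/-- The end of a payment; `ext` is `(msgs, (i₀, (i₁, (price, (ε, (r, (coin, db)))))))`. -/
noncomputable def payEnd (v : Val) : Val :=
  goUp (payVal (.pair v.fst (.pair v.snd.fst (.pair v.snd.snd.fst.snd.fst
      (.pair v.snd.snd.fst.snd.snd.fst (.pair v.snd.snd.fst.snd.snd.snd.fst
        v.snd.snd.fst.snd.snd.snd.snd.fst)))))) (.nat 0)
    (.pair (.nat 2) (snocVal v.snd.snd.fst.fst (proofVal Y (.pair v.fst
      (.pair (.pair (corePp v.snd.fst) (coreSk v.snd.fst)) (.pair v.snd.snd.snd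
        v.snd.snd.fst.snd.snd.snd))))))

/-- The last step of the setup; `ext` is `(pp, db)`. -/
noncomputable def setupEnd (v : Val) : Val :=
  goUp (coreMk v.snd.snd.fst.fst
      (Y.ds.keygen.run (.pair v.fst (.pair (.nat 0) v.snd.snd.snd))).fst
      (Y.ds.keygen.run (.pair v.fst (.pair (.nat 0) v.snd.snd.snd))).snd
      v.snd.snd.fst.snd (.nat 0) (.nat 0) (.nat 0) (.nat 0) (.pair (.nat 0) (.nat 0))) (.nat 0)
    (.pair v.snd.snd.fst.fst
      (.pair (Y.ds.keygen.run (.pair v.fst (.pair (.nat 0) v.snd.snd.snd))).fst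
        (.pair (Y.ds.keygen.run (.pair v.fst (.pair (.nat 0) v.snd.snd.snd))).snd
          v.snd.snd.fst.snd)))

/-- The handler for the control state `tag`. -/
noncomputable def handleVal (tag : Val) (v : Val) : Val :=
  if tag = .nat 2 then if v.snd.snd.fst.IsNat then freeVal Y v else cardVal v
  else if tag = .nat 1 then
    goRand 10 (.nat 0) (.pair (Y.com.gen.run (.pair v.fst (.pair (.nat 0) v.snd.snd.snd)))
      v.snd.snd.fst) (Y.ds.keygen.coins_poly.fn v.fst)
  else if tag = .nat 10 then setupEnd Y v
  else if tag = .nat 3 then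
    goRand 4 v.snd.fst (.pair v.snd.snd.fst v.snd.snd.snd) (Y.ds.sign.coins_poly.fn v.fst)
  else if tag = .nat 4 then enrollSign Y v
  else if tag = .nat 5 then enrollWrite Y v
  else if tag = .nat 6 then payRead Y b v
  else if tag = .nat 7 then
    goRand 8 v.snd.fst (.pair v.snd.snd.fst v.snd.snd.snd) (Y.ds.sign.coins_poly.fn v.fst)
  else if tag = .nat 8 then payBegin v
  else if tag = .nat 9 then payWrite Y v
  else if tag = .nat 11 then payEnd Y v
  else if tag = .nat 12 then goUp (closeVal v.snd.fst) (.nat 0) (.pair (.nat 3) (.nat 0))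
  else goUp v.snd.fst (.nat 0) (.nat 0)

/-- The machine. -/
noncomputable def walletVal (v : Val) : Val :=
  if v.snd.fst.IsNat then
    goRand 1 (.nat 0) v.snd.snd.snd (Y.com.gen.coins_poly.fn v.fst)
  else handleVal Y b v.snd.fst.fst
    (.pair v.fst (.pair v.snd.fst.snd.fst (.pair v.snd.fst.snd.snd v.snd.snd.snd)))

theorem walletVal_poly : PolyTime (walletVal Y b) := by
  have g₁ := Y.com.gen.run_poly
  have g₂ := Y.ds.keygen.run_poly
  have g₃ := Y.ds.sign.run_poly
  have g₄ := Y.ds.verif_poly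
  have g₅ := Y.oram.serve_poly
  have h₁ : PolyTime (registerVal Y) := by unfold registerVal FreePhaseVal; fun_prop
  have h₂ : PolyTime startVal := by
    unfold startVal FreePhaseVal AllowsVal
    -- The closure rules know negation and disjunction but not implication.
    simp only [imp_iff_not_or, ne_eq]
    fun_prop
  have h₃ : PolyTime announceVal := by unfold announceVal; fun_prop
  have h₄ : PolyTime secondVal := by unfold secondVal; fun_prop
  have h₅ : PolyTime guessVal := by unfold guessVal; fun_prop
  have h₆ : PolyTime (freeVal Y) := by unfold freeVal; fun_prop
  have h₇ : PolyTime cardVal := by unfold cardVal; fun_prop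
  have h₈ : PolyTime (enrollSign Y) := by unfold enrollSign; fun_prop
  have h₉ : PolyTime (enrollWrite Y) := by unfold enrollWrite; fun_prop
  have h₁₀ : PolyTime (payRead Y b) := by
    unfold payRead
    cases b <;> simp only [cond_true, cond_false] <;> fun_prop
  have h₁₁ : PolyTime payBegin := by unfold payBegin; fun_prop
  have h₁₂ : PolyTime (payWrite Y) := by unfold payWrite; fun_prop
  have h₁₃ : PolyTime (proofVal Y) := by unfold proofVal; fun_prop
  have h₁₄ : PolyTime (payEnd Y) := by unfold payEnd; fun_prop
  have h₁₅ : PolyTime (setupEnd Y) := by unfold setupEnd coreMk; fun_prop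
  unfold walletVal handleVal
  fun_prop

end Handlers

/-! ### The states of the machine -/

def recEnc (x : ℕ × ℕ) : Val := .pair (.nat x.1) (.nat x.2)

def phaseVal : WPhase → Val
  | .before => .pair (.nat 0) (.nat 0)
  | .first i₀ i₁ price ε =>
    .pair (.nat 1) (.pair (.nat i₀) (.pair (.nat i₁) (.pair (.nat price) (.nat ε))))
  | .between i₀ i₁ price ε =>
    .pair (.nat 2) (.pair (.nat i₀) (.pair (.nat i₁) (.pair (.nat price) (.nat ε))))
  | .second i₀ i₁ price ε =>
    .pair (.nat 3) (.pair (.nat i₀) (.pair (.nat i₁) (.pair (.nat price) (.nat ε))))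
  | .after => .pair (.nat 4) (.nat 0)
  | .over _ => .pair (.nat 5) (.nat 0)

def coreVal (w : Wallet) (db : Val) : Val :=
  coreMk w.pp w.skRS w.pkRS db (.nat w.nextId) (assocVal Val.nat w.cards)
    (assocVal recEnc w.rec₀) (assocVal recEnc w.rec₁) (phaseVal w.phase)

section CoreVal
variable (w : Wallet) (db : Val)

@[simp] theorem corePp_coreVal : corePp (coreVal w db) = w.pp := rfl
@[simp] theorem coreSk_coreVal : coreSk (coreVal w db) = w.skRS := rfl
@[simp] theorem corePk_coreVal : corePk (coreVal w db) = w.pkRS := rfl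
@[simp] theorem coreDb_coreVal : coreDb (coreVal w db) = db := rfl
@[simp] theorem coreNid_coreVal : coreNid (coreVal w db) = .nat w.nextId := rfl
@[simp] theorem coreCards_coreVal : coreCards (coreVal w db) = assocVal Val.nat w.cards := rfl
@[simp] theorem coreRec₀_coreVal : coreRec₀ (coreVal w db) = assocVal recEnc w.rec₀ := rfl
@[simp] theorem coreRec₁_coreVal : coreRec₁ (coreVal w db) = assocVal recEnc w.rec₁ := rfl
@[simp] theorem corePhase_coreVal : corePhase (coreVal w db) = phaseVal w.phase := rfl

end CoreVal

/-- `cur` is the honest database within the current access. The machine sees the client's messages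
and can follow the honest server along; it needs the resulting database because it serves later
registrations itself. -/
def wSessionVal (cur : Val) : Option WSession → Val
  | none => .nat 0
  | some ⟨i₀, i₁, .start⟩ => .pair (.nat i₀) (.pair (.nat i₁) (.nat 0))
  | some ⟨i₀, i₁, .reading price ε⟩ => .pair (.nat i₀) (.pair (.nat i₁) (.pair (.nat 1)
      (.pair (.nat price) (.pair (.nat ε) cur))))
  | some ⟨i₀, i₁, .writing price ε r coin⟩ => .pair (.nat i₀) (.pair (.nat i₁) (.pair (.nat 2)
      (.pair (.nat price) (.pair (.nat ε) (.pair (.nat r) (.pair (.nat coin) cur))))))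

/-- The database that an honest server would have after the last message of the client. -/
def ORAM.curDb (O : ORAM N) (ℓ : ℕ) (o : ORAMState) : Val :=
  match o.session with
  | some (a, c) => O.nextDB ℓ a.db c
  | none => .nat 0

/-- The state of the machine between two messages of the adversary. -/
def idleVal (O : ORAM N) (ℓ : ℕ) (w : Wallet) (o : ORAMState) : Val :=
  machineState 2 (coreVal w o.store.db) (wSessionVal (O.curDb ℓ o) w.session)

theorem setDb_coreVal (w : Wallet) (db d : Val) : setDb (coreVal w db) d = coreVal w d := rfl

theorem coreVal_session (w : Wallet) (db : Val) (s : Option WSession) :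
    coreVal { w with session := s } db = coreVal w db := rfl

theorem closeVal_coreVal (w : Wallet) (db : Val) :
    closeVal (coreVal w db) = coreVal (w.close none) db := by
  rcases w with ⟨pp, sk, pk, nid, cards, r₀, r₁, ph, s⟩
  cases ph <;> simp [closeVal, coreVal, Wallet.close, WPhase.next, phaseVal, setPhase]

theorem recVal_fst (T : List (ℕ × (ℕ × ℕ))) (i : ℕ) :
    (recVal (.nat i) (assocVal recEnc T)).fst.num = (getRec T i).1 := by
  unfold recVal getRec
  rw [lookupVal_assoc]
  rcases T.lookup i with _ | x <;> simp [recEnc]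

theorem recVal_snd (T : List (ℕ × (ℕ × ℕ))) (i : ℕ) :
    (recVal (.nat i) (assocVal recEnc T)).snd.num = (getRec T i).2 := by
  unfold recVal getRec
  rw [lookupVal_assoc]
  rcases T.lookup i with _ | x <;> simp [recEnc]

theorem payRecVal_eq (ℓ price : ℕ) (T : List (ℕ × (ℕ × ℕ))) (i : ℕ) :
    payRecVal (.pair (ones ℓ) (.pair (.nat price) (recVal (.nat i) (assocVal recEnc T)))) =
      recEnc (payRec ℓ price (getRec T i)) := by
  simp [payRecVal, recVal_fst, recVal_snd, ones_num_succ, recEnc, payRec]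

theorem payBlockVal_eq (ℓ price : ℕ) (T : List (ℕ × (ℕ × ℕ))) (i : ℕ) :
    payBlockVal (.pair (ones ℓ) (.pair (.nat price) (recVal (.nat i) (assocVal recEnc T)))) =
      .nat (payBlock ℓ price (getRec T i)) := by
  simp [payBlockVal, recVal_fst, recVal_snd, ones_num_succ, payRec, payBlock, record]

theorem payPhaseVal_eq (ph : WPhase) (price ε : ℕ) :
    payPhaseVal (.pair (phaseVal ph) (.pair (.nat price) (.nat ε))) =
      phaseVal (ph.next (some (price, ε))) := by
  cases ph with
  | first i₀ i₁ p e =>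
    by_cases h : p = price ∧ e = ε
    · simp [payPhaseVal, phaseVal, WPhase.next, h]
    · have : ¬(price = p ∧ ε = e) := fun h' => h ⟨h'.1.symm, h'.2.symm⟩
      simp [payPhaseVal, phaseVal, WPhase.next, h, this]
  | second i₀ i₁ p e =>
    by_cases h : p = price ∧ e = ε
    · simp [payPhaseVal, phaseVal, WPhase.next, h]
    · have : ¬(price = p ∧ ε = e) := fun h' => h ⟨h'.1.symm, h'.2.symm⟩
      simp [payPhaseVal, phaseVal, WPhase.next, h, this]
  | _ => simp [payPhaseVal, phaseVal, WPhase.next]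

theorem payVal_coreVal (ℓ : ℕ) (w : Wallet) (db : Val) (i₀ i₁ price ε : ℕ) :
    payVal (.pair (ones ℓ) (.pair (coreVal w db) (.pair (.nat i₀) (.pair (.nat i₁)
      (.pair (.nat price) (.nat ε)))))) = coreVal (w.pay ℓ i₀ i₁ price ε) db := by
  unfold payVal coreVal
  simp only [Val.snd_pair, Val.fst_pair, corePp_mk, coreSk_mk, corePk_mk, coreDb_mk, coreNid_mk,
    coreCards_mk, coreRec₀_mk, coreRec₁_mk, corePhase_mk, payRecVal_eq, payPhaseVal_eq,
    Wallet.pay, assocVal_cons]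

/-- The wallets after a registration. -/
def Wallet.enroll (w : Wallet) (ids : List ℕ) (bud : ℕ) : Wallet :=
  { w with
    nextId := w.nextId + 1
    cards := (assignCards w.nextId ids w.cards).1
    rec₀ := (w.nextId, (bud, 0)) :: w.rec₀
    rec₁ := (w.nextId, (bud, 0)) :: w.rec₁ }

theorem enrollVal_coreVal (w : Wallet) (db db' ids : Val) (bud : ℕ) :
    enrollVal (.pair (coreVal w db) (.pair ids (.pair (.nat bud) db'))) =
      coreVal (w.enroll ids.toNats bud) db' := by
  unfold enrollVal coreVal
  simp only [Val.snd_pair, Val.fst_pair, corePp_mk, coreSk_mk, corePk_mk, coreNid_mk,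
    coreCards_mk, coreRec₀_mk, coreRec₁_mk, corePhase_mk, Wallet.enroll, assocVal_cons,
    assignFold_eq, Val.num_nat, recEnc]

theorem freePhaseVal_iff (ph : WPhase) : FreePhaseVal (phaseVal ph) ↔ ph.isFree = true := by
  cases ph <;> simp [FreePhaseVal, phaseVal, WPhase.isFree]

theorem allowsVal_iff (ph : WPhase) (i : ℕ) :
    AllowsVal (.pair (phaseVal ph) (.nat i)) ↔ ph.allows i = true := by
  cases ph <;> simp [AllowsVal, phaseVal, WPhase.allows]

/-! ### Invariants of the wallets -/

theorem lookup_mem {α : Type} {T : List (ℕ × α)} {k : ℕ} {v : α} (h : T.lookup k = some v) :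
    (k, v) ∈ T := by
  induction T with
  | nil => simp at h
  | cons p T ih =>
    rw [List.lookup_cons] at h
    by_cases hk : k = p.1
    · subst hk
      simp only [beq_self_eq_true] at h
      obtain rfl : p.2 = v := by simpa using h
      simp
    · have : (k == p.1) = false := by simpa using hk
      rw [this] at h
      exact List.mem_cons_of_mem _ (ih h)

theorem toNats_length (v : Val) : v.toNats.length ≤ v.size := by
  induction v with
  | nat n => simp [Val.toNats]
  | pair a b _ ih =>
    cases a with
    | nat n => simp [Val.toNats]; omega
    | pair x y => simp [Val.toNats]

theorem toNats_size {v : Val} {t : ℕ} (h : t ∈ v.toNats) : (Val.nat t).size ≤ v.size := by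
  induction v with
  | nat n => simp [Val.toNats] at h
  | pair a b _ ih =>
    cases a with
    | nat n =>
      simp only [Val.toNats, List.mem_cons] at h
      rcases h with rfl | h
      · simp only [Val.size_pair]; omega
      · have := ih h
        simp only [Val.size_pair]; omega
    | pair x y => simp [Val.toNats] at h

theorem assignCards_mem (i : ℕ) (l : List ℕ) (T : List (ℕ × ℕ)) {p : ℕ × ℕ}
    (h : p ∈ (assignCards i l T).1) : p ∈ T ∨ p.2 = i := by
  induction l generalizing T with
  | nil => exact Or.inl h
  | cons t l ih =>
    unfold assignCards at h
    split at h
    · exact ih _ h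
    · rcases ih _ h with h | h
      · rcases List.mem_cons.1 h with rfl | h
        · exact Or.inr rfl
        · exact Or.inl h
      · exact Or.inr h

theorem assignCards_size (i : ℕ) {l : List ℕ} {s : ℕ} (hl : ∀ t ∈ l, (Val.nat t).size ≤ s)
    (hi : (Val.nat i).size ≤ s) (T : List (ℕ × ℕ)) :
    (assocVal Val.nat (assignCards i l T).1).size ≤
      (assocVal Val.nat T).size + l.length * (2 * s + 2) := by
  induction l generalizing T with
  | nil => simp [assignCards]
  | cons t l ih =>
    have ht := hl t (by simp)
    have hl' : ∀ t ∈ l, (Val.nat t).size ≤ s := fun x hx => hl x (by simp [hx])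
    rw [List.length_cons, Nat.succ_mul]
    unfold assignCards
    split
    · have := ih hl' T
      omega
    · have := ih hl' ((t, i) :: T)
      rw [assocVal_cons] at this
      simp only [Val.size_pair] at this
      dsimp only
      omega

theorem assignCards_out_size (i : ℕ) {l : List ℕ} {s : ℕ} (hl : ∀ t ∈ l, (Val.nat t).size ≤ s)
    (T : List (ℕ × ℕ)) :
    (Val.list (assignCards i l T).2).size ≤ 1 + l.length * (1 + s) := by
  induction l generalizing T with
  | nil => simp [assignCards]
  | cons t l ih =>
    have ht := hl t (by simp)
    have hl' : ∀ t ∈ l, (Val.nat t).size ≤ s := fun x hx => hl x (by simp [hx])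
    rw [List.length_cons, Nat.succ_mul]
    unfold assignCards
    split
    · have := ih hl' T
      omega
    · have := ih hl' ((t, i) :: T)
      simp only [Val.list_cons, Val.size_pair]
      omega

/-- The households of a phase are registered, and its numbers are short. -/
def WPhase.Bdd (n S : ℕ) : WPhase → Prop
  | .first i₀ i₁ price ε => i₀ < n ∧ i₁ < n ∧ (Val.nat price).size ≤ S ∧ (Val.nat ε).size ≤ S
  | .between i₀ i₁ price ε => i₀ < n ∧ i₁ < n ∧ (Val.nat price).size ≤ S ∧ (Val.nat ε).size ≤ S
  | .second i₀ i₁ price ε => i₀ < n ∧ i₁ < n ∧ (Val.nat price).size ≤ S ∧ (Val.nat ε).size ≤ S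
  | _ => True

def WStage.Bdd (Y : System N) (ℓ S : ℕ) : WStage → Prop
  | .start => True
  | .reading price ε => (Val.nat price).size ≤ S ∧ (Val.nat ε).size ≤ S
  | .writing price ε r coin => (Val.nat price).size ≤ S ∧ (Val.nat ε).size ≤ S ∧
    (Val.nat r).size ≤ S ∧ coin ≤ Y.ds.sign.coins ℓ

/-- The state of the wallets after `i` messages of length at most `S`. -/
structure Wallet.Inv (Y : System N) (ℓ S i : ℕ) (w : Wallet) : Prop where
  pp : w.pp ∈ (Y.com.gen.sample ℓ (.nat 0)).support
  sk : w.skRS.size ≤ S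
  pk : w.pkRS.size ≤ S
  nid : w.nextId ≤ N ℓ
  cards : ∀ p ∈ w.cards, p.2 < w.nextId
  cards_size : (assocVal Val.nat w.cards).size ≤ 1 + i * (S * (2 * S + 2))
  rec_lt : ∀ β, ∀ p ∈ w.recs β, p.2.1 < 2 ^ ℓ ∧ p.2.2 < 2 ^ ℓ
  rec_size : ∀ β, (assocVal recEnc (w.recs β)).size ≤ 1 + i * (3 * S + 3)
  phase : w.phase.Bdd w.nextId S
  session : ∀ s, w.session = some s → s.i₀ < w.nextId ∧ s.i₁ < w.nextId ∧ s.stage.Bdd Y ℓ S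

theorem WPhase.Bdd.next {n S : ℕ} {ph : WPhase} (h : ph.Bdd n S) (ok : Option (ℕ × ℕ)) :
    (ph.next ok).Bdd n S := by
  cases ph <;> simp only [WPhase.next] <;> try exact h
  all_goals
    split_ifs
    · first | exact h | trivial
    · trivial

theorem WPhase.Bdd.mono {n n' S : ℕ} {ph : WPhase} (h : ph.Bdd n S) (hn : n ≤ n') :
    ph.Bdd n' S := by
  cases ph <;> first | trivial | exact ⟨h.1.trans_le hn, h.2.1.trans_le hn, h.2.2⟩

section Inv
variable {Y : System N} {ℓ S i : ℕ} {w : Wallet}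

theorem Wallet.Inv.mono (h : w.Inv Y ℓ S i) {j : ℕ} (hj : i ≤ j) : w.Inv Y ℓ S j :=
  { h with
    cards_size := h.cards_size.trans (Nat.add_le_add_left (Nat.mul_le_mul_right _ hj) 1)
    rec_size := fun β => (h.rec_size β).trans (Nat.add_le_add_left (Nat.mul_le_mul_right _ hj) 1) }

theorem Wallet.Inv.close (h : w.Inv Y ℓ S i) (ok : Option (ℕ × ℕ)) : (w.close ok).Inv Y ℓ S i :=
  { h with
    phase := h.phase.next ok
    session := by simp [Wallet.close] }

theorem Wallet.Inv.set_session (h : w.Inv Y ℓ S i) {s : WSession} (h₀ : s.i₀ < w.nextId)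
    (h₁ : s.i₁ < w.nextId) (hs : s.stage.Bdd Y ℓ S) :
    ({ w with session := some s } : Wallet).Inv Y ℓ S i :=
  { h with
    session := by
      rintro s' h'
      simp only [Option.some.injEq] at h'
      exact h' ▸ ⟨h₀, h₁, hs⟩ }

theorem Wallet.Inv.set_phase (h : w.Inv Y ℓ S i) {ph : WPhase} (hp : ph.Bdd w.nextId S) :
    ({ w with phase := ph } : Wallet).Inv Y ℓ S i :=
  { h with phase := hp }

theorem Wallet.Inv.getRec_lt (h : w.Inv Y ℓ S i) (β : Bool) (j : ℕ) :
    (getRec (w.recs β) j).1 < 2 ^ ℓ ∧ (getRec (w.recs β) j).2 < 2 ^ ℓ := by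
  unfold getRec
  rcases hl : (w.recs β).lookup j with _ | x
  · simp
  · exact h.rec_lt β _ (lookup_mem hl)

theorem payRec_lt {price : ℕ} {x : ℕ × ℕ} (h : x.1 < 2 ^ ℓ) :
    (payRec ℓ price x).1 < 2 ^ ℓ ∧ (payRec ℓ price x).2 < 2 ^ ℓ :=
  ⟨(Nat.sub_le _ _).trans_lt h, Nat.mod_lt _ (Nat.two_pow_pos ℓ)⟩

/-- Records of legitimate balances fit into a block, so the ORAM challenger accepts the write
requests made for them. -/
theorem record_lt {bal ctr : ℕ} (h : bal < 2 ^ ℓ) : record ℓ bal ctr < 2 ^ (2 * ℓ) := by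
  have h₁ := Nat.mod_lt ctr (Nat.two_pow_pos ℓ)
  have h₂ : (bal + 1) * 2 ^ ℓ ≤ 2 ^ ℓ * 2 ^ ℓ := Nat.mul_le_mul_right _ h
  rw [two_mul, pow_add]
  unfold record
  rw [add_mul] at h₂
  omega

/-- A payment or a registration adds one entry to each table, consisting of three short numbers.
Payments shadow the old entry instead of replacing it, so the length is bounded by the number of
messages. -/
theorem Wallet.Inv.recs_cons (h : w.Inv Y ℓ S i) (hS : (Val.nat (2 ^ ℓ)).size ≤ S)
    (hN : (Val.nat (N ℓ)).size ≤ S) (β : Bool) {j : ℕ} {x : ℕ × ℕ} (hj : j < N ℓ)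
    (hx : x.1 < 2 ^ ℓ ∧ x.2 < 2 ^ ℓ) :
    (∀ p ∈ (j, x) :: w.recs β, p.2.1 < 2 ^ ℓ ∧ p.2.2 < 2 ^ ℓ) ∧
      (assocVal recEnc ((j, x) :: w.recs β)).size ≤ 1 + (i + 1) * (3 * S + 3) := by
  constructor
  · intro p hp
    rcases List.mem_cons.1 hp with rfl | hp
    · exact hx
    · exact h.rec_lt β p hp
  · have h₁ := h.rec_size β
    have h₂ := nat_size_mono hx.1.le
    have h₃ := nat_size_mono hx.2.le
    have h₄ := nat_size_mono hj.le
    rw [assocVal_cons, add_mul]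
    simp only [recEnc, Val.size_pair]
    omega

theorem Wallet.Inv.pay (h : w.Inv Y ℓ S i) (hS : (Val.nat (2 ^ ℓ)).size ≤ S)
    (hN : (Val.nat (N ℓ)).size ≤ S) {i₀ i₁ : ℕ} (h₀ : i₀ < w.nextId) (h₁ : i₁ < w.nextId)
    (price ε : ℕ) : (w.pay ℓ i₀ i₁ price ε).Inv Y ℓ S (i + 1) := by
  have hm := h.mono (Nat.le_succ i)
  have k : ∀ β, (∀ p ∈ (w.pay ℓ i₀ i₁ price ε).recs β, p.2.1 < 2 ^ ℓ ∧ p.2.2 < 2 ^ ℓ) ∧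
      (assocVal recEnc ((w.pay ℓ i₀ i₁ price ε).recs β)).size ≤ 1 + (i + 1) * (3 * S + 3) := by
    intro β
    cases β
    · exact h.recs_cons hS hN false (h₀.trans_le h.nid) (payRec_lt (h.getRec_lt false i₀).1)
    · exact h.recs_cons hS hN true (h₁.trans_le h.nid) (payRec_lt (h.getRec_lt true i₁).1)
  exact { hm with
    rec_lt := fun β => (k β).1
    rec_size := fun β => (k β).2
    phase := h.phase.next _
    session := by simp [Wallet.pay] }

theorem Wallet.Inv.enroll (h : w.Inv Y ℓ S i) (hS : (Val.nat (2 ^ ℓ)).size ≤ S)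
    (hN : (Val.nat (N ℓ)).size ≤ S) {ids : Val} {bud : ℕ} (hids : ids.size ≤ S)
    (hn : w.nextId < N ℓ) (hb : bud < 2 ^ ℓ) :
    (w.enroll ids.toNats bud).Inv Y ℓ S (i + 1) := by
  have hm := h.mono (Nat.le_succ i)
  have k : ∀ β, (∀ p ∈ (w.enroll ids.toNats bud).recs β, p.2.1 < 2 ^ ℓ ∧ p.2.2 < 2 ^ ℓ) ∧
      (assocVal recEnc ((w.enroll ids.toNats bud).recs β)).size ≤ 1 + (i + 1) * (3 * S + 3) := by
    intro β
    cases β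
    · exact h.recs_cons hS hN false hn ⟨hb, Nat.two_pow_pos ℓ⟩
    · exact h.recs_cons hS hN true hn ⟨hb, Nat.two_pow_pos ℓ⟩
  exact { hm with
    nid := hn
    cards := by
      intro p hp
      rcases assignCards_mem _ _ _ hp with hp | hp
      · exact (h.cards p hp).trans (Nat.lt_succ_self _)
      · exact hp ▸ Nat.lt_succ_self _
    cards_size := by
      refine (assignCards_size w.nextId (s := S) (fun t ht => (toNats_size ht).trans hids)
        ((nat_size_mono hn.le).trans hN) w.cards).trans ?_
      have h₁ := h.cards_size
      have h₂ := Nat.mul_le_mul_right (2 * S + 2) ((toNats_length ids).trans hids)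
      rw [add_mul]
      omega
    rec_lt := fun β => (k β).1
    rec_size := fun β => (k β).2
    phase := h.phase.mono (Nat.le_succ _)
    session := fun s hs => ⟨(h.session s hs).1.trans (Nat.lt_succ_self _),
      (h.session s hs).2.1.trans (Nat.lt_succ_self _), (h.session s hs).2.2⟩ }

theorem Wallet.Inv.coreVal_size (h : w.Inv Y ℓ S i) (hN : (Val.nat (N ℓ)).size ≤ S)
    (hpp : w.pp.size ≤ S) {db : Val} (hdb : db.size ≤ S) :
    (coreVal w db).size ≤ 30 + 9 * S + i * (S * (2 * S + 2)) + 2 * (i * (3 * S + 3)) := by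
  have h₁ := h.sk
  have h₂ := h.pk
  have h₃ := nat_size_mono h.nid
  have h₄ := h.cards_size
  have h₅ := h.rec_size false
  have h₆ := h.rec_size true
  have h₇ : (phaseVal w.phase).size ≤ 10 + 4 * S := by
    have h2s : Nat.size 2 = 2 := by decide
    have h3s : Nat.size 3 = 2 := by decide
    have h4s : Nat.size 4 = 3 := by decide
    have h5s : Nat.size 5 = 3 := by decide
    have hp := h.phase
    have hn : ∀ {j}, j < w.nextId → (Val.nat j).size ≤ S := fun hj =>
      (nat_size_mono (hj.le.trans h.nid)).trans hN
    revert hp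
    cases w.phase <;> intro hp
    case first i₀ i₁ price ε | between i₀ i₁ price ε | second i₀ i₁ price ε =>
      obtain ⟨k₁, k₂, k₃, k₄⟩ := hp
      have := hn k₁
      have := hn k₂
      simp [phaseVal] at *
      omega
    all_goals simp [phaseVal, h4s, h5s]; omega
  simp only [Wallet.recs, cond_true, cond_false] at h₅ h₆
  simp only [coreVal, coreMk, Val.size_pair]
  omega

end Inv

/-! ### The machine and the experiment with ideal memory -/

/-- `S` bounds the lengths of messages and keys, `Z` those of the states of the machine, and `D` the
number and lengths of its activations. -/
structure WalletBound (Y : System N) (ℓ Q S Z D : ℕ) : Prop where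
  msg : Q ≤ S
  pp : ∀ pp ∈ (Y.com.gen.sample ℓ (.nat 0)).support, pp.size ≤ S ∧ (Val.nat (Y.com.q pp)).size ≤ S
  gen_coins : (Val.nat (Y.com.gen.coins ℓ)).size ≤ S
  key_coins : (Val.nat (Y.ds.keygen.coins ℓ)).size ≤ S
  sign_coins : (Val.nat (Y.ds.sign.coins ℓ)).size ≤ S
  key : ∀ r ≤ Y.ds.keygen.coins ℓ, (Y.ds.keygen.out ℓ (.nat 0) r).size ≤ S
  oram : polyBound Y.oram.deg ℓ ≤ S
  two : (Val.nat (2 ^ ℓ)).size ≤ S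
  block : (Val.nat (2 ^ (2 * ℓ))).size ≤ S
  cap : (Val.nat (N ℓ)).size ≤ S
  tok : (Val.nat (2 ^ Y.prf.outLen ℓ)).size ≤ S
  reply : ∀ db c, db.size ≤ polyBound Y.oram.deg ℓ → c.size ≤ polyBound Y.oram.deg ℓ →
    (Y.oram.reply ℓ db c).size ≤ S
  proof : ∀ (w : Wallet) (price ε r coin : ℕ) (τ : Val),
    w.pp ∈ (Y.com.gen.sample ℓ (.nat 0)).support → w.skRS.size ≤ S → τ.size ≤ S →
    (Val.nat price).size ≤ S → (Val.nat ε).size ≤ S → (Val.nat r).size ≤ S →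
    coin ≤ Y.ds.sign.coins ℓ → (Y.payProof ℓ w price ε r coin τ).size ≤ Z
  core : 100 + 30 * S + Q * (S * (2 * S + 2)) + 2 * (Q * (3 * S + 3)) + (2 * S + 2) * (1 + S) ≤ Z
  deg : 60 * Z ≤ D

/-- The machine. -/
noncomputable def walletMachine (Y : System N) (b : Bool) (e : ℕ) : Adversary :=
  ⟨walletVal Y b, walletVal_poly Y b, e⟩

/-- An ORAM access of the transaction is under way. -/
def Wallet.accessing (w : Wallet) : Bool :=
  match w.session with
  | some ⟨_, _, .start⟩ => false
  | some _ => true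
  | none => false

/-- The ORAM challenger has an access under way exactly while the card is reading or writing. A
recorded guess makes the ORAM challenger ignore all requests; this does no harm, as by then the
experiment is over and no transaction is open. -/
structure Linked (O : ORAM N) (ℓ : ℕ) (w : Wallet) (o : ORAMState) : Prop where
  db : o.store.db.size ≤ polyBound O.deg ℓ
  none_of : w.accessing = false → o.session = none
  some_of : w.accessing = true → ∃ a c, o.session = some (a, c) ∧
    a.db.size ≤ polyBound O.deg ℓ ∧ c.size ≤ polyBound O.deg ℓ
  guess : o.guess = none ∨ (w.session = none ∧ ∃ r, w.phase = .over r)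

/-- The machine is in the state that belongs to the wallets. -/
def WalletRel (Y : System N) (PB : PRFState → Prop) (ℓ S i : ℕ)
    (x : Wallet × (ORAMState × PRFState)) (y : Val × (ORAMState × PRFState)) : Prop :=
  x.1.Inv Y ℓ S i ∧ Linked Y.oram ℓ x.1 x.2.1 ∧ PB x.2.2 ∧ y = (idleVal Y.oram ℓ x.1 x.2.1, x.2)

/-- The tokens are short. -/
def TokenBdd (Y : System N) (ℓ : ℕ) (tok : PRFState → Val → PMF (PRFState × Val))
    (PB : PRFState → Prop) : Prop :=
  ∀ p x, PB p → ∀ q ∈ (tok p x).support, PB q.1 ∧ q.2.size ≤ (Val.nat (2 ^ Y.prf.outLen ℓ)).size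

theorem machineState_size {t : ℕ} (ht : t < 16) (c x : Val) :
    (machineState t c x).size ≤ 7 + c.size + x.size := by
  have : Nat.size t ≤ 4 := Nat.size_le.2 ht
  simp only [machineState, Val.size_pair, Val.size_nat]
  omega

theorem ORAM.move_fail {O : ORAM N} {ℓ : ℕ} {sk : Val} {a : Access} {t : Bool}
    (h : O.move ℓ sk a = .fail t) : t = a.tampered := by
  unfold ORAM.move at h
  split_ifs at h
  · injection h with h; exact h.symm
  · split at h
    · cases h
    · cases h
    · injection h with h; exact h.symm

/-! ### Turns of the machine: payments and honest registrations -/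

section Drive
variable {Y : System N} {b β : Bool} {ℓ Q S Z e i k : ℕ}
  {tok : PRFState → Val → PMF (PRFState × Val)} {PB : PRFState → Prop} {w : Wallet} {o : ORAMState}
  {p : PRFState}

theorem walletMachine_step (t s : ℕ) (c x m : Val) :
    (walletMachine Y b e).step (.pair (ones ℓ) (.pair (machineState t c x) (.pair (.nat s) m))) =
      handleVal Y b (.nat t) (.pair (ones ℓ) (.pair c (.pair x m))) := by
  simp [walletMachine, walletVal, machineState]

theorem comboGame_respond {a : Val} (h : a.fst ≠ .nat 7) :
    (comboGame Y.oram Y.prf tok β ℓ).respond (o, p) a =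
      (Y.oram.answer β ℓ o a).map fun x => ((x.1, p), x.2) := by
  exact if_neg h

theorem comboGame_respond_token {x₀ x₁ : Val} :
    (comboGame Y.oram Y.prf tok β ℓ).respond (o, p) (.pair (.nat 7) (.pair x₀ x₁)) =
      (tok p (bif β then x₁ else x₀)).map fun x => ((o, x.1), x.2) := by
  simp

theorem Linked.curDb_size {O : ORAM N} (h : Linked O ℓ w o) :
    (O.curDb ℓ o).size ≤ polyBound O.deg ℓ := by
  unfold ORAM.curDb
  rcases hs : o.session with _ | ⟨a, c⟩
  · simpa using Nat.succ_le_of_lt (polyBound_pos O.deg ℓ)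
  · rcases hw : w.accessing with _ | _
    · simp [h.none_of hw] at hs
    · obtain ⟨a', c', h₁, h₂, h₃⟩ := h.some_of hw
      rw [h₁] at hs
      obtain ⟨rfl, rfl⟩ : a' = a ∧ c' = c := by simpa using hs
      exact O.nextDB_size h₂ h₃

theorem Wallet.Inv.wSessionVal_size (h : w.Inv Y ℓ S i) (hB : WalletBound Y ℓ Q S Z (polyBound e ℓ))
    {cur : Val} (hcur : cur.size ≤ S) : (wSessionVal cur w.session).size ≤ 20 + 7 * S := by
  have h2s : Nat.size 2 = 2 := by decide
  have hn : ∀ {j}, j < w.nextId → (Val.nat j).size ≤ S := fun hj =>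
    (nat_size_mono (hj.le.trans h.nid)).trans hB.cap
  rcases hs : w.session with _ | ⟨i₀, i₁, stage⟩
  · simp [wSessionVal]; omega
  · obtain ⟨h₀, h₁, h₂⟩ := h.session _ hs
    have k₀ := hn h₀
    have k₁ := hn h₁
    cases stage with
    | start => simp [wSessionVal] at *; omega
    | reading price ε =>
      obtain ⟨h₃, h₄⟩ := h₂
      simp [wSessionVal] at *; omega
    | writing price ε r coin =>
      obtain ⟨h₃, h₄, h₅, h₆⟩ := h₂
      have h₇ := (nat_size_mono h₆).trans hB.sign_coins
      simp [wSessionVal, h2s] at *; omega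

theorem Wallet.Inv.core_size (h : w.Inv Y ℓ S i) (hB : WalletBound Y ℓ Q S Z (polyBound e ℓ))
    (hi : i ≤ Q) {db : Val} (hdb : db.size ≤ polyBound Y.oram.deg ℓ) :
    (coreVal w db).size ≤ Z := by
  have h₁ := (h.mono hi).coreVal_size hB.cap (hB.pp _ h.pp).1 (hdb.trans hB.oram)
  have h₂ := hB.core
  omega

theorem WalletBound.le (hB : WalletBound Y ℓ Q S Z (polyBound e ℓ)) : 100 + 30 * S ≤ Z := by
  have h₂ := hB.core
  omega

/-- The machine ends its turn in the state that belongs to the wallets. -/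
theorem drive_goUp (hB : WalletBound Y ℓ Q S Z (polyBound e ℓ)) {st msg m : Val}
    (hstep : (walletMachine Y b e).step (.pair (ones ℓ) (.pair st msg)) =
      goUp (coreVal w o.store.db) (wSessionVal (Y.oram.curDb ℓ o) w.session) m)
    (hw : w.Inv Y ℓ S i) (hi : i ≤ Q) (hl : Linked Y.oram ℓ w o) (hp : PB p)
    (hm : m.size ≤ 10 * Z) :
    Coupled (fun x y => WalletRel Y PB ℓ S i x.1 y.1 ∧ x.2 = y.2) (PMF.pure ((w, (o, p)), m))
      ((comboGame Y.oram Y.prf tok β ℓ).drive (walletMachine Y b e) ℓ (k + 1) st (o, p) msg) := by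
  have h₁ := hw.core_size hB hi hl.db
  have h₂ := hw.wSessionVal_size hB (hl.curDb_size.trans hB.oram)
  have h₃ := hB.le
  have h₄ := hB.deg
  have h₅ := machineState_size (t := 2) (by omega) (coreVal w o.store.db)
    (wSessionVal (Y.oram.curDb ℓ o) w.session)
  rw [Game.drive_up (R := walletMachine Y b e) hstep (by
    change _ ≤ polyBound e ℓ
    simp only [Val.size_pair, Val.size_nat, Nat.size_zero]
    omega)]
  exact Coupled.pure ⟨⟨hw, hl, hp, rfl⟩, rfl⟩

theorem drive_goRand (hB : WalletBound Y ℓ Q S Z (polyBound e ℓ)) {G : Game} {s : G.State}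
    {st msg c x : Val} {t n : ℕ} (ht : t < 16)
    (hstep : (walletMachine Y b e).step (.pair (ones ℓ) (.pair st msg)) = goRand t c x (.nat n))
    (hc : c.size ≤ Z) (hx : x.size ≤ 30 * Z) (hn : (Val.nat n).size ≤ Z) :
    G.drive (walletMachine Y b e) ℓ (k + 1) st s msg = (unif n).bind fun y =>
      G.drive (walletMachine Y b e) ℓ k (machineState t c x) s (.pair (.nat 1) (.nat y)) := by
  have h₃ := hB.le
  have h₄ := hB.deg
  have h₅ := machineState_size ht c x
  refine Game.drive_rand (R := walletMachine Y b e) hstep ?_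
  change _ ≤ polyBound e ℓ
  simp only [Val.size_pair, Val.size_nat, Nat.size_zero, Nat.size_one] at *
  omega

theorem drive_goDown (hB : WalletBound Y ℓ Q S Z (polyBound e ℓ)) {G : Game} {s : G.State}
    {st msg c x d : Val} {t : ℕ} (ht : t < 16)
    (hstep : (walletMachine Y b e).step (.pair (ones ℓ) (.pair st msg)) = goDown t c x d)
    (hd : d.fst ≠ .nat 0) (hc : c.size ≤ Z) (hx : x.size ≤ 30 * Z) (hds : d.size ≤ 20 * Z) :
    G.drive (walletMachine Y b e) ℓ (k + 1) st s msg = (G.respond s d).bind fun q =>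
      G.drive (walletMachine Y b e) ℓ k (machineState t c x) q.1 (.pair (.nat 1) q.2) := by
  have h₃ := hB.le
  have h₄ := hB.deg
  have h₅ := machineState_size ht c x
  refine Game.drive_down (R := walletMachine Y b e) hstep ?_ ?_
  · rw [Val.isRand_iff]
    rintro ⟨m, rfl⟩
    exact hd rfl
  · change _ ≤ polyBound e ℓ
    simp only [Val.size_pair, Val.size_nat, Nat.size_one] at *
    omega

theorem Linked.of_session_none (hdb : o.store.db.size ≤ polyBound Y.oram.deg ℓ)
    (hs : o.session = none) (hw : w.session = none) (hg : o.guess = none) :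
    Linked Y.oram ℓ w o :=
  ⟨hdb, fun _ => hs, fun h => by simp [Wallet.accessing, hw] at h, Or.inl hg⟩

theorem proofVal_eq (hpp : w.pp ∈ (Y.com.gen.sample ℓ (.nat 0)).support) (price ε r coin : ℕ)
    (τ z : Val) :
    proofVal Y (.pair (ones ℓ) (.pair (.pair w.pp w.skRS) (.pair τ (.pair (.nat price)
      (.pair (.nat ε) (.pair (.nat r) (.pair (.nat coin) z))))))) =
      Y.payProof ℓ w price ε r coin τ := by
  simp [proofVal, System.payProof, Y.com.commitFn_eq hpp, RandAlg.out]

/-- The write access of a payment, and the token. -/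
theorem drive_payWrite (hB : WalletBound Y ℓ Q S Z (polyBound e ℓ)) (htok : TokenBdd Y ℓ tok PB)
    (hw : w.Inv Y ℓ S i) (hi : i < Q) (hg : o.guess = none)
    (hdb : o.store.db.size ≤ polyBound Y.oram.deg ℓ) (hp : PB p) {a : Access} {sk : Val} {op : Op}
    (ha : a.db.size ≤ polyBound Y.oram.deg ℓ) {i₀ i₁ price ε r coin : ℕ} {pre : List Val}
    (hpre : pre.length ≤ 1) (hpre' : (Val.list pre).size ≤ 2 + S)
    (h₀ : i₀ < w.nextId) (h₁ : i₁ < w.nextId)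
    (hst : (WStage.writing price ε r coin).Bdd Y ℓ S) :
    Coupled (fun x y => WalletRel Y PB ℓ S (i + 1) x.1 y.1 ∧ x.2 = y.2)
      (Y.finish tok β ℓ p
        (cardWrite w o op i₀ i₁ price ε r coin pre (Y.oram.move ℓ sk a)))
      ((comboGame Y.oram Y.prf tok β ℓ).drive (walletMachine Y b e) ℓ (k + 2)
        (machineState 9 (coreVal w o.store.db) (.pair (Val.list pre) (.pair (.nat i₀)
          (.pair (.nat i₁) (.pair (.nat price) (.pair (.nat ε) (.pair (.nat r) (.pair (.nat coin)
            a.db))))))))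
        ((o.after op (Y.oram.move ℓ sk a)).1, p)
        (.pair (.nat 1) (o.after op (Y.oram.move ℓ sk a)).2)) := by
  have hn : ∀ {j}, j < w.nextId → (Val.nat j).size ≤ S := fun hj =>
    (nat_size_mono (hj.le.trans hw.nid)).trans hB.cap
  have k₀ := hn h₀
  have k₁ := hn h₁
  have hZ := hB.le
  have hSP := hB.oram
  have hw' := hw.mono (Nat.le_succ i)
  have hsnoc : ∀ x, snocVal (Val.list pre) x = Val.list (pre ++ [x]) := snocVal_eq (by omega)
  have h1s : Nat.size 1 = 1 := Nat.size_one
  have h2s : Nat.size 2 = 2 := by decide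
  have h3s : Nat.size 3 = 2 := by decide
  have h7s : Nat.size 7 = 3 := by decide
  have hsz : ∀ x, (Val.list (pre ++ [x])).size ≤ 4 + S + x.size := by
    intro x
    rcases pre with _ | ⟨y, _ | ⟨z, l⟩⟩
    · simp; omega
    · simp at hpre' ⊢; omega
    · simp at hpre
  have hsz2 : ∀ x z, (Val.list ((pre ++ [x]) ++ [z])).size ≤ 6 + S + x.size + z.size := by
    intro x z
    rcases pre with _ | ⟨y, _ | ⟨z, l⟩⟩
    · simp; omega
    · simp at hpre' ⊢; omega
    · simp at hpre
  rcases hm : Y.oram.move ℓ sk a with ⟨a', c⟩ | ⟨db, c, out, t⟩ | t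
  · obtain ⟨hc, rfl⟩ := ORAM.size_of_move_wait hm
    have hcs := hsz c
    refine drive_goUp hB (w := { w with session := some ⟨i₀, i₁, .writing price ε r coin⟩ })
      (o := (o.after op (.wait a' c)).1) ?_ (hw'.set_session h₀ h₁ hst) hi
      ⟨hdb, by simp [Wallet.accessing], fun _ => ⟨a', c, rfl, ha, hc⟩, Or.inl hg⟩ hp (by
        simp only [Val.size_pair, Val.size_nat, h1s]; omega)
    rw [walletMachine_step]
    simp [handleVal, payWrite, ORAMState.after, hsnoc, wSessionVal, ORAM.curDb, coreVal_session,
      ORAM.nextDB]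
  · obtain ⟨hc, rfl, rfl⟩ := ORAM.size_of_move_done hm
    have hcs := hsz c
    have hdb' := Y.oram.nextDB_size ha hc
    have hcore := hw.core_size hB hi.le hdb'
    have hq : ∀ x : ℕ × ℕ, (Val.nat ((x.2 + 1) % 2 ^ ℓ)).size ≤ S := fun x =>
      (nat_size_mono (Nat.mod_lt _ (Nat.two_pow_pos ℓ)).le).trans hB.two
    have hq₀ := hq (getRec w.rec₀ i₀)
    have hq₁ := hq (getRec w.rec₁ i₁)
    obtain ⟨t₁, t₂, t₃, t₄⟩ := hst
    have t₅ := (nat_size_mono t₄).trans hB.sign_coins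
    -- The write access is complete. The machine submits the token inputs of both worlds, and the
    -- oracle answers for world `β`, which the machine does not know.
    rw [drive_goDown hB (t := 11) (c := coreVal w (Y.oram.nextDB ℓ a.db c))
      (x := .pair (Val.list (pre ++ [c])) (.pair (.nat i₀)
          (.pair (.nat i₁) (.pair (.nat price) (.pair (.nat ε) (.pair (.nat r) (.pair (.nat coin)
            a.db)))))))
      (d := .pair (.nat 7) (.pair (tokenInput ℓ i₀ (getRec w.rec₀ i₀))
        (tokenInput ℓ i₁ (getRec w.rec₁ i₁)))) (by omega) (by
        rw [walletMachine_step]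
        simp [handleVal, payWrite, ORAMState.after, hsnoc, setDb_coreVal, tokenInput,
          ← ones_num_succ, ORAM.nextDB, recVal_snd]) (by simp) hcore (by
        simp only [Val.size_pair]; omega) (by
        simp only [Val.size_pair, tokenInput, Val.size_nat, h7s] at *; omega),
      comboGame_respond_token, PMF.bind_map]
    refine (Coupled.bind_same _ fun q hq => ?_)
    obtain ⟨hq₁, hq₂⟩ := htok _ _ hp _ hq
    have hpf := hB.proof w price ε r coin q.2 hw.pp hw.sk (hq₂.trans hB.tok) t₁ t₂ t₃ t₄
    have hpf' := hsz2 c (Y.payProof ℓ w price ε r coin q.2)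
    refine drive_goUp hB (w := w.pay ℓ i₀ i₁ price ε)
      (o := (o.after op (.done (Y.oram.nextDB ℓ a.db c) c out a.tampered)).1) ?_
      (hw.pay hB.two hB.cap h₀ h₁ price ε) hi (Linked.of_session_none hdb' rfl rfl hg) hq₁ (by
        simp only [Val.size_pair, Val.size_nat, h2s]; omega)
    rw [walletMachine_step]
    have hpv := proofVal_eq hw.pp price ε r coin q.2 a.db
    have hps := snocVal_eq (l := pre ++ [c]) (by simp; omega) (Y.payProof ℓ w price ε r coin q.2)
    simp [handleVal, payEnd, payVal_coreVal, hpv, hps]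
    rfl
  · refine drive_goUp hB (w := w.close none) (o := (o.after op (.fail t)).1) ?_ (hw'.close none) hi
      (Linked.of_session_none hdb rfl rfl hg) hp (by
        simp only [Val.size_pair, Val.size_nat, h3s]; omega)
    rw [walletMachine_step]
    simp [handleVal, payWrite, ORAMState.after, closeVal_coreVal]
    rfl

end Drive

section Drive
variable {Y : System N} {b β : Bool} {ℓ Q S Z e i k : ℕ}
  {tok : PRFState → Val → PMF (PRFState × Val)} {PB : PRFState → Prop} {w : Wallet} {o : ORAMState}
  {p : PRFState}

/-- The read access of a payment. -/
theorem drive_payRead (hB : WalletBound Y ℓ Q S Z (polyBound e ℓ)) (htok : TokenBdd Y ℓ tok PB)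
    (hw : w.Inv Y ℓ S i) (hi : i < Q) (hg : o.guess = none)
    (hdb : o.store.db.size ≤ polyBound Y.oram.deg ℓ) (hp : PB p) {a : Access} {op : Op}
    (ha : a.db.size ≤ polyBound Y.oram.deg ℓ) {i₀ i₁ price ε : ℕ}
    (h₀ : i₀ < w.nextId) (h₁ : i₁ < w.nextId) (hst : (WStage.reading price ε).Bdd Y ℓ S) :
    Coupled (fun x y => WalletRel Y PB ℓ S (i + 1) x.1 y.1 ∧ x.2 = y.2)
      ((Y.cardRead b β ℓ w o op i₀ i₁ price ε (Y.oram.move ℓ o.sk a)).bind (Y.finish tok β ℓ p))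
      ((comboGame Y.oram Y.prf tok β ℓ).drive (walletMachine Y b e) ℓ (k + 5)
        (machineState 6 (coreVal w o.store.db) (.pair (.nat i₀)
          (.pair (.nat i₁) (.pair (.nat price) (.pair (.nat ε) a.db)))))
        ((o.after op (Y.oram.move ℓ o.sk a)).1, p)
        (.pair (.nat 1) (o.after op (Y.oram.move ℓ o.sk a)).2)) := by
  have hn : ∀ {j}, j < w.nextId → (Val.nat j).size ≤ S := fun hj =>
    (nat_size_mono (hj.le.trans hw.nid)).trans hB.cap
  have k₀ := hn h₀
  have k₁ := hn h₁
  have hZ := hB.le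
  have hSP := hB.oram
  have hw' := hw.mono (Nat.le_succ i)
  have h1s : Nat.size 1 = 1 := Nat.size_one
  have h2s : Nat.size 2 = 2 := by decide
  have h3s : Nat.size 3 = 2 := by decide
  rcases hm : Y.oram.move ℓ o.sk a with ⟨a', c⟩ | ⟨db, c, out, t⟩ | t
  · obtain ⟨hc, rfl⟩ := ORAM.size_of_move_wait hm
    rw [System.cardRead, PMF.pure_bind]
    refine drive_goUp hB (w := { w with session := some ⟨i₀, i₁, .reading price ε⟩ })
      (o := (o.after op (.wait a' c)).1) ?_ (hw'.set_session h₀ h₁ hst) hi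
      ⟨hdb, by simp [Wallet.accessing], fun _ => ⟨a', c, rfl, ha, hc⟩, Or.inl hg⟩ hp (by
        simp only [Val.list_cons, Val.list_nil, Val.size_pair, Val.size_nat, h1s, Nat.size_zero]
        omega)
    rw [walletMachine_step]
    simp [handleVal, payRead, ORAMState.after, wSessionVal, ORAM.curDb, coreVal_session,
      ORAM.nextDB]
  · obtain ⟨hc, rfl, rfl⟩ := ORAM.size_of_move_done hm
    have hdb' := Y.oram.nextDB_size ha hc
    have hcore := hw.core_size hB hi.le hdb'
    obtain ⟨t₁, t₂⟩ := hst
    have hbal : (bif b then recVal (.nat i₁) (assocVal recEnc w.rec₁)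
        else recVal (.nat i₀) (assocVal recEnc w.rec₀)).fst.num =
        (getRec (w.recs b) (bif b then i₁ else i₀)).1 := by
      cases b <;> simp [recVal_fst, Wallet.recs]
    have hqs : (Val.nat (Y.com.q w.pp - 1)).size ≤ S :=
      (nat_size_mono (Nat.sub_le _ _)).trans (hB.pp _ hw.pp).2
    rw [System.cardRead]
    split_ifs with hlt
    · rw [PMF.pure_bind]
      refine drive_goUp hB (w := w.close none)
        (o := (o.after op (.done (Y.oram.nextDB ℓ a.db c) c out a.tampered)).1) ?_ (hw'.close none)
        hi (Linked.of_session_none hdb' rfl rfl hg) hp (by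
          simp only [Val.list_cons, Val.list_nil, Val.size_pair, Val.size_nat, h3s, Nat.size_zero]
          omega)
      rw [walletMachine_step]
      simp [handleVal, payRead, ORAMState.after, hbal, hlt, setDb_coreVal, closeVal_coreVal]
      rfl
    · rw [drive_goRand hB (t := 7) (n := Y.com.q w.pp - 1)
        (c := coreVal w (Y.oram.nextDB ℓ a.db c)) (x := .pair (.pair c (.nat 0)) (.pair (.nat i₀)
          (.pair (.nat i₁) (.pair (.nat price) (.nat ε))))) (by omega) (by
          rw [walletMachine_step]
          simp [handleVal, payRead, ORAMState.after, hbal, hlt, setDb_coreVal,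
            Y.com.qFn_eq hw.pp]
          rfl) hcore (by
          simp only [Val.size_pair, Val.size_nat, Nat.size_zero] at *; omega)
        (by omega), PMF.bind_bind]
      refine Coupled.bind_same _ fun r hr => ?_
      have hr' := (nat_size_mono (unif_support hr)).trans hqs
      rw [drive_goRand hB (t := 8) (n := Y.ds.sign.coins ℓ)
        (c := coreVal w (Y.oram.nextDB ℓ a.db c))
        (x := .pair (.pair (.pair c (.nat 0)) (.pair (.nat i₀)
          (.pair (.nat i₁) (.pair (.nat price) (.nat ε))))) (.nat r)) (by omega) (by
          rw [walletMachine_step]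
          simp [handleVal]) hcore (by
          simp only [Val.size_pair, Val.size_nat, Nat.size_zero] at *; omega)
        (hB.sign_coins.trans (by omega)), PMF.bind_bind]
      refine Coupled.bind_same _ fun coin hcoin => ?_
      have hcoin' := unif_support hcoin
      have hcoin'' := (nat_size_mono hcoin').trans hB.sign_coins
      have hv₀ : payBlock ℓ price (getRec w.rec₀ i₀) < 2 ^ (2 * ℓ) :=
        record_lt (payRec_lt (hw.getRec_lt false i₀).1).1
      have hv₁ : payBlock ℓ price (getRec w.rec₁ i₁) < 2 ^ (2 * ℓ) :=
        record_lt (payRec_lt (hw.getRec_lt true i₁).1).1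
      have hs₀ := (nat_size_mono hv₀.le).trans hB.block
      have hs₁ := (nat_size_mono hv₁.le).trans hB.block
      -- The blocks of both worlds are offered as a pair of writes; both are within the range that
      -- the ORAM challenger insists on.
      rw [drive_goDown hB (t := 9) (c := coreVal w (Y.oram.nextDB ℓ a.db c))
        (x := .pair (Val.list [c]) (.pair (.nat i₀) (.pair (.nat i₁) (.pair (.nat price)
          (.pair (.nat ε) (.pair (.nat r) (.pair (.nat coin) (Y.oram.nextDB ℓ a.db c))))))))
        (d := .pair (.nat 2) (.pair
          (.pair (.nat i₀) (.nat (payBlock ℓ price (getRec w.rec₀ i₀))))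
          (.pair (.nat i₁) (.nat (payBlock ℓ price (getRec w.rec₁ i₁)))))) (by omega) (by
          rw [walletMachine_step]
          simp [handleVal, payBegin, payBlockVal_eq]) (by simp) hcore (by
          simp only [Val.size_pair, Val.list_cons, Val.list_nil, Val.size_nat, Nat.size_zero] at *
          omega) (by simp only [Val.size_pair, Val.size_nat, h2s] at *; omega),
        comboGame_respond (by simp), ORAM.answer_write (by exact hg) rfl
          (h₀.trans_le hw.nid) (h₁.trans_le hw.nid) (by simpa [validBlock] using hv₀)
          (by simpa [validBlock] using hv₁), ORAM.begin, PMF.map_comp, PMF.bind_map, PMF.bind_map]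
      refine Coupled.bind_same _ fun x hx => ?_
      exact drive_payWrite hB htok hw hi
        (o := (o.after op (.done (Y.oram.nextDB ℓ a.db c) c out a.tampered)).1) hg hdb' hp
        (a := Access.new (payOp ℓ w β i₀ i₁ price) x
          (o.after op (.done (Y.oram.nextDB ℓ a.db c) c out a.tampered)).1.store)
        (op := payOp ℓ w β i₀ i₁ price) hdb' (pre := [c]) (by simp)
        (by simp only [Val.list_cons, Val.list_nil, Val.size_pair, Val.size_nat, Nat.size_zero]
            omega) h₀ h₁ ⟨t₁, t₂, hr', hcoin'⟩
  · rw [System.cardRead, PMF.pure_bind]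
    refine drive_goUp hB (w := w.close none) (o := (o.after op (.fail t)).1) ?_ (hw'.close none) hi
      (Linked.of_session_none hdb rfl rfl hg) hp (by
        simp only [Val.list_nil, Val.size_pair, Val.size_nat, h3s, Nat.size_zero]; omega)
    rw [walletMachine_step]
    simp [handleVal, payRead, ORAMState.after, closeVal_coreVal]
    rfl

/-- The outcome of the honest write access in a registration. -/
def Wallet.enrolled (w : Wallet) (o : ORAMState) (ℓ : ℕ) (ids : Val) (bud : ℕ) (tr : List Val)
    (db : Option Val) : Out :=
  match db with
  | some db => .done (w.enroll ids.toNats bud) (o.afterHonest w.nextId (record ℓ bud 0) (some db))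
      (.pair (.nat 1) (.pair (Val.list (assignCards w.nextId ids.toNats w.cards).2)
        (Val.list (.nat w.nextId :: w.skRS :: .nat bud :: tr))))
  | none => .done w (o.afterHonest w.nextId (record ℓ bud 0) none)
      (.pair (.nat 0) (Val.list (.nat w.nextId :: w.skRS :: .nat bud :: tr)))

theorem Val.size_list_reverse (l : List Val) : (Val.list l.reverse).size = (Val.list l).size := by
  rw [Val.size_list, Val.size_list]
  simp

theorem ORAM.honestRun_fail (O : ORAM N) (ℓ : ℕ) (sk : Val) (n : ℕ) (t : Bool) :
    O.honestRun ℓ sk n (.fail t) = (none, []) := by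
  cases n <;> rfl

theorem ORAM.honestRun_done (O : ORAM N) (ℓ : ℕ) (sk : Val) (n : ℕ) (db c out : Val) (t : Bool) :
    O.honestRun ℓ sk n (.done db c out t) = (some db, [c]) := by
  cases n <;> rfl

theorem ORAM.honestRun_wait (O : ORAM N) (ℓ : ℕ) (sk : Val) (n : ℕ) (a : Access) (c : Val) :
    O.honestRun ℓ sk (n + 1) (.wait a c) =
      ((O.honestRun ℓ sk n (O.receive ℓ sk a c (O.reply ℓ a.db c))).1,
        c :: O.reply ℓ a.db c :: (O.honestRun ℓ sk n (O.receive ℓ sk a c (O.reply ℓ a.db c))).2) :=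
  rfl

theorem ORAMState.after_fail_honest {o : ORAMState} (hs : o.session = none) (op : Op) (j d : ℕ) :
    o.after op (.fail false) = (o.afterHonest j d none, .nat 0) := by
  obtain ⟨sk, store, mem, session, rewound, broken, wrong, guess⟩ := o
  simp only at hs
  subst hs
  simp [ORAMState.after, ORAMState.afterHonest]

theorem ORAMState.after_done_honest {o : ORAMState} (hs : o.session = none) (j d : ℕ)
    (db c out : Val) : o.after (.write j d) (.done db c out false) =
      (o.afterHonest j d (some db), .pair (.nat 2) c) := by
  obtain ⟨sk, store, mem, session, rewound, broken, wrong, guess⟩ := o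
  simp only at hs
  subst hs
  simp [ORAMState.after, ORAMState.afterHonest]

/-- While the client waits, the bookkeeping has changed only the session, which the next move
overwrites. So the intermediate states of an honestly served access leave no trace. -/
theorem ORAMState.after_wait_after (o : ORAMState) (op : Op) (a : Access) (c : Val)
    (r : AccessResult) {x : Bool} (hx : x = false) :
    ({ (o.after op (.wait a c)).1 with rewound := (o.after op (.wait a c)).1.rewound || x }).after op
      r = o.after op r := by
  subst hx
  rw [Bool.or_false]
  cases r <;> rfl

/-- The write access of a registration. -/
theorem drive_enroll (hB : WalletBound Y ℓ Q S Z (polyBound e ℓ))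
    (hw : w.Inv Y ℓ S i) (hi : i < Q) (hg : o.guess = none) (hs : o.session = none)
    (hses : w.session = none)
    (hdb : o.store.db.size ≤ polyBound Y.oram.deg ℓ) (hp : PB p) {ids : Val} {bud : ℕ}
    (hids : ids.size ≤ S) (hbud : bud < 2 ^ ℓ) (hnid : w.nextId < N ℓ) (n : ℕ) :
    ∀ (a : Access) (tr : List Val), a.tampered = false →
    a.op = .write w.nextId (record ℓ bud 0) → a.db.size ≤ polyBound Y.oram.deg ℓ →
    a.replies.length + n = polyBound Y.oram.deg ℓ → tr.length + 2 * n ≤ 2 * S →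
    (∀ x ∈ tr, x.size ≤ S) →
    Coupled (fun x y => WalletRel Y PB ℓ S (i + 1) x.1 y.1 ∧ x.2 = y.2)
      (Y.finish tok β ℓ p (w.enrolled o ℓ ids bud
        (tr ++ (Y.oram.honestRun ℓ o.sk n (Y.oram.move ℓ o.sk a)).2)
        (Y.oram.honestRun ℓ o.sk n (Y.oram.move ℓ o.sk a)).1))
      ((comboGame Y.oram Y.prf tok β ℓ).drive (walletMachine Y b e) ℓ (k + n + 1)
        (machineState 5 (coreVal w o.store.db) (.pair (.pair ids (.nat bud))
          (.pair a.db (Val.list tr.reverse))))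
        ((o.after a.op (Y.oram.move ℓ o.sk a)).1, p)
        (.pair (.nat 1) (o.after a.op (Y.oram.move ℓ o.sk a)).2)) := by
  have hZ := hB.le
  have hSP := hB.oram
  have hSZ := hB.core
  have hw' := hw.mono (Nat.le_succ i)
  have h1s : Nat.size 1 = 1 := Nat.size_one
  have h4s : Nat.size 4 = 3 := by decide
  have hns : (Val.nat w.nextId).size ≤ S := (nat_size_mono hw.nid).trans hB.cap
  have hbs : (Val.nat bud).size ≤ S := (nat_size_mono hbud.le).trans hB.two
  have hsk := hw.sk
  have htr : ∀ tr : List Val, tr.length ≤ 2 * S + 1 → (∀ x ∈ tr, x.size ≤ S) →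
      (Val.list tr).size ≤ 1 + (2 * S + 1) * (1 + S) := fun tr h h' =>
    (Val.size_list_le h').trans (Nat.add_le_add_left (Nat.mul_le_mul_right _ h) 1)
  have hmul : (2 * S + 2) * (1 + S) = (2 * S + 1) * (1 + S) + (1 + S) := by ring
  -- An honestly served access that the client refuses. It occurs at any point of the access, and
  -- also when the number of replies has reached its limit.
  have hfail : ∀ (n k : ℕ) (a : Access) (tr : List Val), Y.oram.move ℓ o.sk a = .fail false →
      tr.length ≤ 2 * S → (∀ x ∈ tr, x.size ≤ S) →
      Coupled (fun x y => WalletRel Y PB ℓ S (i + 1) x.1 y.1 ∧ x.2 = y.2)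
        (Y.finish tok β ℓ p (w.enrolled o ℓ ids bud
          (tr ++ (Y.oram.honestRun ℓ o.sk n (Y.oram.move ℓ o.sk a)).2)
          (Y.oram.honestRun ℓ o.sk n (Y.oram.move ℓ o.sk a)).1))
        ((comboGame Y.oram Y.prf tok β ℓ).drive (walletMachine Y b e) ℓ (k + 1)
          (machineState 5 (coreVal w o.store.db) (.pair (.pair ids (.nat bud))
            (.pair a.db (Val.list tr.reverse))))
          ((o.after a.op (Y.oram.move ℓ o.sk a)).1, p)
          (.pair (.nat 1) (o.after a.op (Y.oram.move ℓ o.sk a)).2)) := by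
    intro n k a tr hm htl hts
    have hsz := htr tr (by omega) hts
    rw [hm, ORAM.honestRun_fail, ORAMState.after_fail_honest hs a.op w.nextId (record ℓ bud 0)]
    simp only [Wallet.enrolled, List.append_nil, System.finish]
    refine drive_goUp hB (w := w) ?_ hw' hi (Linked.of_session_none hdb hs hses hg) hp (by
      simp only [Val.list_cons, Val.size_pair, Val.size_nat, Nat.size_zero] at *; omega)
    rw [walletMachine_step, hses]
    simp [handleVal, enrollWrite, wSessionVal]
    rfl
  induction n generalizing k with
  | zero =>
    intro a tr ht hop ha hr htl hts
    -- At this number of replies the client stops by itself, so the fuel of `ORAM.honestRun` never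
    -- runs out while the client is waiting.
    exact hfail 0 k a tr (by
      unfold ORAM.move
      rw [if_pos (by omega), ht]) (by omega) hts
  | succ n ih =>
    intro a tr ht hop ha hr htl hts
    rcases hm : Y.oram.move ℓ o.sk a with ⟨a', c⟩ | ⟨db, c, out, t⟩ | t
    · obtain ⟨hc, rfl⟩ := ORAM.size_of_move_wait hm
      have hre := hB.reply _ _ ha hc
      have hdb' := Y.oram.nextDB_size ha hc
      have hcore := hw.core_size hB hi.le hdb
      have hsz := htr (tr ++ [c, Y.oram.reply ℓ a'.db c]) (by simp; omega) (by
        intro x hx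
        simp only [List.mem_append, List.mem_cons, List.not_mem_nil, or_false] at hx
        rcases hx with hx | rfl | rfl
        · exact hts x hx
        · omega
        · exact hre)
      rw [← Val.size_list_reverse] at hsz
      have hrw : Y.oram.rewinds ℓ a' c (Y.oram.reply ℓ a'.db c) = false := by
        simp [ORAM.rewinds]
      rw [show k + (n + 1) + 1 = (k + n + 1) + 1 by omega, drive_goDown hB (t := 5)
        (c := coreVal w o.store.db) (x := .pair (.pair ids (.nat bud))
          (.pair (Y.oram.nextDB ℓ a'.db c)
            (Val.list (tr ++ [c, Y.oram.reply ℓ a'.db c]).reverse)))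
        (d := .pair (.nat 4) (Y.oram.reply ℓ a'.db c)) (by omega) (by
          rw [walletMachine_step]
          simp [handleVal, enrollWrite, ORAMState.after, ORAM.nextDB, ORAM.reply]) (by simp) hcore
        (by simp only [Val.size_pair] at *; omega)
        (by simp only [Val.size_pair, Val.size_nat, h4s] at *; omega),
        comboGame_respond (by simp), ORAM.answer_reply
          (s := (o.after a'.op (.wait a' c)).1) (a := a') (c := c) (by exact hg) rfl, PMF.pure_map,
        PMF.pure_bind]
      have h := ih (k := k)
        { a' with
          replies := Y.oram.reply ℓ a'.db c :: a'.replies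
          db := Y.oram.nextDB ℓ a'.db c
          stale := a'.stale.map fun d => Y.oram.nextDB ℓ d c
          tampered := a'.tampered || Y.oram.reply ℓ a'.db c != Y.oram.reply ℓ a'.db c }
        (tr ++ [c, Y.oram.reply ℓ a'.db c]) (by simp [ht]) hop hdb'
        (by simp only [List.length_cons]; omega) (by simp; omega) (by
          intro x hx
          simp only [List.mem_append, List.mem_cons, List.not_mem_nil, or_false] at hx
          rcases hx with hx | rfl | rfl
          · exact hts x hx
          · omega
          · exact hre)
      rw [ORAM.honestRun_wait, ORAMState.after_wait_after _ _ _ _ _ hrw]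
      simp only [List.append_assoc, List.cons_append, List.nil_append] at h
      exact h
    · obtain ⟨hc, rfl, rfl⟩ := ORAM.size_of_move_done hm
      have hdb' := Y.oram.nextDB_size ha hc
      have hsz := htr (tr ++ [c]) (by simp; omega) (by
        intro x hx
        simp only [List.mem_append, List.mem_cons, List.not_mem_nil, or_false] at hx
        rcases hx with hx | rfl
        · exact hts x hx
        · omega)
      have hout := assignCards_out_size w.nextId (s := S)
        (fun t ht => (toNats_size ht).trans hids) w.cards
      have hlen := Nat.mul_le_mul_right (1 + S) ((toNats_length ids).trans hids)
      have hSm : S * (1 + S) ≤ (2 * S + 1) * (1 + S) := Nat.mul_le_mul_right _ (by omega)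
      rw [ORAM.honestRun_done, hop, ht, ORAMState.after_done_honest hs]
      simp only [Wallet.enrolled, System.finish]
      refine drive_goUp hB (w := w.enroll ids.toNats bud)
        ?_ (hw.enroll hB.two hB.cap hids hnid hbud) hi
        (Linked.of_session_none hdb' hs hses hg) hp (by
          simp only [Val.list_cons, Val.size_pair, Val.size_nat, h1s] at *; omega)
      rw [walletMachine_step]
      have hses' : (w.enroll ids.toNats bud).session = none := hses
      rw [hses']
      simp [handleVal, enrollWrite, enrollVal_coreVal, wSessionVal, assignFold_eq]
      rfl
    · obtain rfl := ORAM.move_fail hm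
      rw [ht] at hm ⊢
      have := hfail (n + 1) (k + (n + 1)) a tr hm (by omega) hts
      rwa [hm] at this

end Drive

theorem Val.IsNat.exists {v : Val} (h : v.IsNat) : ∃ n, v = .nat n := ⟨_, h.eq⟩

theorem Val.exists_pair {v : Val} (h : ¬v.IsNat) : ∃ x y, v = .pair x y := by
  cases v with
  | nat n => simp at h
  | pair x y => exact ⟨x, y, rfl⟩

/-- The machine recognizes messages by projections. If one of its tests succeeded, the message would
have the corresponding form. -/
theorem freeVal_default (Y : System N) {L c x a : Val}
    (h₁ : ∀ ids bud, a = .pair (.nat 1) (.pair ids (.nat bud)) → False)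
    (h₂ : ∀ tid, a = .pair (.nat 2) (.nat tid) → False)
    (h₃ : ∀ t₀ t₁ price ε, a = .pair (.nat 3) (.pair (.nat t₀) (.pair (.nat t₁)
      (.pair (.nat price) (.nat ε)))) → False)
    (h₅ : ∀ y, a = .pair (.nat 5) y → False)
    (h₆ : ∀ g, a = .pair (.nat 6) (.nat g) → False) :
    freeVal Y (.pair L (.pair c (.pair x a))) = goUp c (.nat 0) (.nat 0) := by
  unfold freeVal
  refine (if_neg ?_).trans ((if_neg ?_).trans ((if_neg ?_).trans ((if_neg ?_).trans (if_neg ?_))))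
    <;> simp only [Val.snd_pair]
  · rintro ⟨k, k₁, k₂⟩
    have ha := Val.eq_pair_of_fst k
    obtain ⟨y, z, hyz⟩ := Val.exists_pair k₁
    rw [hyz] at k₂ ha
    obtain ⟨n, hn⟩ := k₂.exists
    simp only [Val.snd_pair] at hn
    exact h₁ y n (by rw [ha, hn])
  · rintro ⟨k, k'⟩
    obtain ⟨g, hg⟩ := k'.exists
    exact h₂ g (by rw [← hg]; exact Val.eq_pair_of_fst k)
  · rintro ⟨k, k₁, k₂, k₃, k₄, k₅⟩
    have ha := Val.eq_pair_of_fst k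
    generalize a.snd = s at *
    rcases s with _ | ⟨t₀, s⟩
    · simp at k₃
    · rcases s with _ | ⟨t₁, s⟩
      · simp at k₃
      · rcases s with _ | ⟨t₂, s⟩
        · simp at k₃
        · simp only [Val.fst_pair, Val.snd_pair] at k₁ k₂ k₄ k₅
          exact h₃ _ _ _ _ (by rw [ha, k₁.eq, k₂.eq, k₄.eq, k₅.eq])
  · intro k
    exact h₅ _ (Val.eq_pair_of_fst k)
  · rintro ⟨k, k'⟩
    obtain ⟨g, hg⟩ := k'.exists
    exact h₆ g (by rw [← hg]; exact Val.eq_pair_of_fst k)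

/-! ### Turns of the machine on registrations -/

section Drive
variable {Y : System N} {b β : Bool} {ℓ Q S Z e i k : ℕ}
  {tok : PRFState → Val → PMF (PRFState × Val)} {PB : PRFState → Prop} {w : Wallet} {o : ORAMState}
  {p : PRFState}

/-- The relation between the answers. -/
abbrev AnswerRel (Y : System N) (PB : PRFState → Prop) (ℓ S i : ℕ)
    (x : (Wallet × (ORAMState × PRFState)) × Val) (y : (Val × (ORAMState × PRFState)) × Val) : Prop :=
  WalletRel Y PB ℓ S i x.1 y.1 ∧ x.2 = y.2

/-- Three activations lead to the write request: two for random numbers and one for the request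
itself. The honest access then takes at most `polyBound Y.oram.deg ℓ + 1` more, with the machine
playing the honest server. -/
theorem drive_register (hB : WalletBound Y ℓ Q S Z (polyBound e ℓ))
    (hw : w.Inv Y ℓ S i) (hi : i < Q) (hl : Linked Y.oram ℓ w o) (hp : PB p)
    (hses : w.session = none) (hg : o.guess = none) (hfree : w.phase.isFree = true) {ids : Val}
    {bud : ℕ} (hids : ids.size ≤ S) (hbs : (Val.nat bud).size ≤ S) :
    Coupled (AnswerRel Y PB ℓ S (i + 1))
      ((Y.walletRegister ℓ w o ids.toNats bud).bind (Y.finish tok β ℓ p))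
      ((comboGame Y.oram Y.prf tok β ℓ).drive (walletMachine Y b e) ℓ
        (k + polyBound Y.oram.deg ℓ + 4) (idleVal Y.oram ℓ w o) (o, p)
        (.pair (.nat 0) (.pair (.nat 1) (.pair ids (.nat bud))))) := by
  have hZ := hB.le
  have hSP := hB.oram
  have hs : o.session = none := hl.none_of (by simp [Wallet.accessing, hses])
  have hw' := hw.mono (Nat.le_succ i)
  have hcore := hw.core_size hB hi.le hl.db
  have hns : (Val.nat w.nextId).size ≤ S := (nat_size_mono hw.nid).trans hB.cap
  have hsk := hw.sk
  have h2s : Nat.size 2 = 2 := by decide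
  unfold System.walletRegister
  by_cases h : w.nextId < N ℓ ∧ bud < 2 ^ ℓ
  · have hqs : (Val.nat (Y.com.q w.pp - 1)).size ≤ S :=
      (nat_size_mono (Nat.sub_le _ _)).trans (hB.pp _ hw.pp).2
    rw [if_pos h, PMF.bind_bind, drive_goRand hB (t := 3) (n := Y.com.q w.pp - 1)
      (c := coreVal w o.store.db) (x := .pair ids (.nat bud)) (by omega) (by
        rw [idleVal, walletMachine_step, hses]
        simp [handleVal, freeVal, wSessionVal, registerVal, ones_num_succ, freePhaseVal_iff, hfree,
          h.1, h.2, Y.com.qFn_eq hw.pp]) hcore (by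
        simp only [Val.size_pair]; omega) (by omega)]
    refine Coupled.bind_same _ fun r hr => ?_
    have hr' := (nat_size_mono (unif_support hr)).trans hqs
    rw [PMF.bind_bind, drive_goRand hB (t := 4) (n := Y.ds.sign.coins ℓ)
      (c := coreVal w o.store.db) (x := .pair (.pair ids (.nat bud)) (.nat r)) (by omega) (by
        rw [walletMachine_step]
        simp [handleVal]) hcore (by simp only [Val.size_pair]; omega)
      (hB.sign_coins.trans (by omega))]
    refine Coupled.bind_same _ fun coin hcoin => ?_
    by_cases hacc : Y.ds.accepts ℓ w.pkRS (.nat r) (Y.ds.sign.out ℓ (.pair w.skRS (.nat r)) coin)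
    · have hacc' : Y.ds.verif (.pair (ones ℓ) (.pair w.pkRS (.pair (.nat r) (Y.ds.sign.run
          (.pair (ones ℓ) (.pair (.pair w.skRS (.nat r)) (.nat coin))))))) ≠ .nat 0 := by
        simpa [SignatureScheme.accepts, RandAlg.out] using hacc
      have hv : record ℓ bud 0 < 2 ^ (2 * ℓ) := record_lt h.2
      have hv' := (nat_size_mono hv.le).trans hB.block
      rw [if_pos hacc, drive_goDown hB (t := 5) (c := coreVal w o.store.db)
        (x := .pair (.pair ids (.nat bud)) (.pair o.store.db (.nat 0)))
        (d := .pair (.nat 2) (.pair (.pair (.nat w.nextId) (.nat (record ℓ bud 0)))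
          (.pair (.nat w.nextId) (.nat (record ℓ bud 0))))) (by omega) (by
          rw [walletMachine_step]
          simp [handleVal, enrollSign, hacc', ones_num_succ, record]) (by simp) hcore (by
          have := hl.db
          simp only [Val.size_pair, Val.size_nat, Nat.size_zero] at *; omega) (by
          simp only [Val.size_pair, Val.size_nat, h2s] at *; omega),
        comboGame_respond (by simp), ORAM.answer_write hg hs h.1 h.1 (by simpa [validBlock] using hv)
          (by simpa [validBlock] using hv), ORAM.begin, PMF.map_comp, PMF.bind_map, PMF.bind_map]
      refine Coupled.bind_same _ fun x hx => ?_
      have := drive_enroll (tok := tok) (β := β) (b := b) (k := k) hB hw hi hg hs hses hl.db hp hids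
        h.2 h.1 (polyBound Y.oram.deg ℓ)
        (Access.new (.write w.nextId (record ℓ bud 0)) x o.store) [] rfl rfl hl.db
        (by simp [Access.new]) (by simpa using hSP) (by simp)
      convert this using 1
      · simp only [Function.comp_apply, List.nil_append]
        rcases (Y.oram.honestRun ℓ o.sk (polyBound Y.oram.deg ℓ) (Y.oram.move ℓ o.sk
          (Access.new (.write w.nextId (record ℓ bud 0)) x o.store))).1 with _ | db <;> rfl
      · cases β <;> rfl
    · have hacc' : Y.ds.verif (.pair (ones ℓ) (.pair w.pkRS (.pair (.nat r) (Y.ds.sign.run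
          (.pair (ones ℓ) (.pair (.pair w.skRS (.nat r)) (.nat coin))))))) = .nat 0 := by
        simpa [SignatureScheme.accepts, RandAlg.out] using hacc
      rw [if_neg hacc, PMF.pure_bind]
      refine drive_goUp hB (w := w) ?_ hw' hi hl hp (by
        simp only [Val.list_cons, Val.list_nil, Val.size_pair, Val.size_nat, Nat.size_zero] at *
        omega)
      rw [walletMachine_step, hses]
      simp [handleVal, enrollSign, hacc', wSessionVal]
  · rw [if_neg h, PMF.pure_bind]
    refine drive_goUp hB (w := w) ?_ hw' hi hl hp (by
      simp only [Val.size_nat, Nat.size_zero]; omega)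
    rw [idleVal, walletMachine_step, hses]
    simp only [handleVal, freeVal, wSessionVal, registerVal, Val.snd_pair, Val.fst_pair, if_true,
      Val.isNat_nat, Val.not_isNat_pair, not_false_eq_true, and_self, coreNid_coreVal, Val.num_nat,
      ones_num_succ, ORAM.cap_ones, h, and_false, if_false]

end Drive

/-! ### Turns of the machine on arbitrary messages of the adversary -/

section Drive
variable {Y : System N} {b β : Bool} {ℓ Q S Z e i k : ℕ}
  {tok : PRFState → Val → PMF (PRFState × Val)} {PB : PRFState → Prop} {w : Wallet} {o : ORAMState}
  {p : PRFState}

/-- Apart from registrations and the guess, messages outside a transaction change only the tables,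
and the machine answers them at once without consulting the challenger. -/
theorem drive_free (hB : WalletBound Y ℓ Q S Z (polyBound e ℓ))
    (hw : w.Inv Y ℓ S i) (hi : i < Q) (hl : Linked Y.oram ℓ w o) (hp : PB p)
    (hses : w.session = none) {a : Val} (ha : a.size ≤ S) :
    Coupled (AnswerRel Y PB ℓ S (i + 1))
      ((Y.walletFree ℓ w o a).bind (Y.finish tok β ℓ p))
      ((comboGame Y.oram Y.prf tok β ℓ).drive (walletMachine Y b e) ℓ
        (k + polyBound Y.oram.deg ℓ + 4) (idleVal Y.oram ℓ w o) (o, p) (.pair (.nat 0) a)) := by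
  have hZ := hB.le
  have hs : o.session = none := hl.none_of (by simp [Wallet.accessing, hses])
  have hw' := hw.mono (Nat.le_succ i)
  have hcore := hw.core_size hB hi.le hl.db
  have h3s : Nat.size 3 = 2 := by decide
  have h6s : Nat.size 6 = 3 := by decide
  have hgo : ∀ {w' : Wallet} {m : Val}, w'.Inv Y ℓ S i → (w'.accessing = false) →
      (o.guess = none ∨ w'.session = none ∧ ∃ r, w'.phase = .over r) → m.size ≤ 2 →
      freeVal Y (.pair (ones ℓ) (.pair (coreVal w o.store.db) (.pair (.nat 0) a))) =
        goUp (coreVal w' o.store.db) (wSessionVal (Y.oram.curDb ℓ o) w'.session) m →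
      Coupled (AnswerRel Y PB ℓ S (i + 1)) (PMF.pure ((w', (o, p)), m))
        ((comboGame Y.oram Y.prf tok β ℓ).drive (walletMachine Y b e) ℓ
          (k + polyBound Y.oram.deg ℓ + 4) (idleVal Y.oram ℓ w o) (o, p) (.pair (.nat 0) a)) := by
    intro w' m hi' hacc hg hm hstep
    refine drive_goUp hB ?_ (hi'.mono (Nat.le_succ i)) hi
      ⟨hl.db, fun _ => hs, fun h => by simp [hacc] at h, hg⟩ hp (by omega)
    rw [← hstep, idleVal, walletMachine_step, hses]
    simp [handleVal, wSessionVal]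
  have hstay : freeVal Y (.pair (ones ℓ) (.pair (coreVal w o.store.db) (.pair (.nat 0) a))) =
        goUp (coreVal w o.store.db) (.nat 0) (.nat 0) →
      Coupled (AnswerRel Y PB ℓ S (i + 1)) (PMF.pure ((w, (o, p)), .nat 0))
        ((comboGame Y.oram Y.prf tok β ℓ).drive (walletMachine Y b e) ℓ
          (k + polyBound Y.oram.deg ℓ + 4) (idleVal Y.oram ℓ w o) (o, p) (.pair (.nat 0) a)) :=
    fun h => hgo hw (by simp [Wallet.accessing, hses]) hl.guess (by simp) (by
      rw [h, hses]; rfl)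
  -- In every phase in which the machine still sends requests, the experiment is not over, so the
  -- ORAM challenger still listens.
  have hguess : (∀ r, w.phase ≠ .over r) → o.guess = none := fun h =>
    hl.guess.resolve_right fun h' => by
      obtain ⟨-, r, hr⟩ := h'
      exact h r hr
  have hcard : ∀ {t j : ℕ}, w.cards.lookup t = some j → j < w.nextId := fun h =>
    hw.cards _ (lookup_mem h)
  unfold System.walletFree
  split
  · rename_i ids bud
    simp only [Val.size_pair] at ha
    by_cases hf : w.phase.isFree = true
    · rw [if_pos hf]
      exact drive_register hB hw hi hl hp hses
        (hguess (by intro r hr; rw [hr] at hf; simp [WPhase.isFree] at hf)) hf (by omega) (by omega)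
    · rw [if_neg hf, PMF.pure_bind]
      refine hstay ?_
      simp [freeVal, registerVal, freePhaseVal_iff, hf]
  · rename_i tid
    have hlk := lookupVal_assoc Val.nat w.cards tid
    rcases hc : w.cards.lookup tid with _ | j
    · simp only [hc] at hlk
      simp only [PMF.pure_bind]
      refine hstay ?_
      simp [freeVal, startVal, hlk]
    · simp only [hc] at hlk
      by_cases hf : (w.phase.isFree && w.phase.allows j) = true
      · simp only [hf, if_true, PMF.pure_bind]
        simp only [Bool.and_eq_true] at hf
        refine hgo (hw.set_session (s := ⟨j, j, .start⟩) (hcard hc) (hcard hc) trivial) (by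
          simp [Wallet.accessing])
          (Or.inl (hguess (by intro r hr; simp [hr, WPhase.isFree] at hf))) (by simp) ?_
        simp [freeVal, startVal, hlk, freePhaseVal_iff, allowsVal_iff, hf.1, hf.2, wSessionVal,
          coreVal_session]
      · simp only [if_neg hf, PMF.pure_bind]
        refine hstay ?_
        simp only [Bool.and_eq_true] at hf
        simp [freeVal, startVal, hlk, freePhaseVal_iff, allowsVal_iff, hf]
  · rename_i t₀ t₁ price ε
    simp only [Val.size_pair] at ha
    have hlk₀ := lookupVal_assoc Val.nat w.cards t₀
    have hlk₁ := lookupVal_assoc Val.nat w.cards t₁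
    split
    · rename_i hph
      have hg := hguess (by simp [hph])
      have hover := fun h => hgo (w' := { w with phase := .over none }) (m := .nat 0)
        (hw.set_phase trivial) (by simp [Wallet.accessing, hses]) (Or.inl hg) (by simp) h
      rcases hc₀ : w.cards.lookup t₀ with _ | i₀
      · simp only [hc₀] at hlk₀
        simp only [PMF.pure_bind]
        refine hover ?_
        simp [freeVal, announceVal, hlk₀, hph, phaseVal, hses, wSessionVal]
        rfl
      · rcases hc₁ : w.cards.lookup t₁ with _ | i₁
        · simp only [hc₁] at hlk₁
          simp only [PMF.pure_bind]
          refine hover ?_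
          simp [freeVal, announceVal, hlk₁, hph, phaseVal, hses, wSessionVal]
          rfl
        · simp only [hc₀] at hlk₀
          simp only [hc₁] at hlk₁
          simp only [PMF.pure_bind]
          refine hgo (w' := { w with
              phase := .first i₀ i₁ price ε
              session := some ⟨i₀, i₁, .start⟩ }) ((hw.set_phase (ph := .first i₀ i₁ price ε)
                ⟨hcard hc₀, hcard hc₁, by omega, by omega⟩).set_session (hcard hc₀) (hcard hc₁)
                trivial) (by simp [Wallet.accessing]) (Or.inl hg) (by simp) ?_
          simp [freeVal, announceVal, hlk₀, hlk₁, hph, phaseVal, wSessionVal]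
          rfl
    · rename_i hph
      rw [PMF.pure_bind]
      refine hstay ?_
      have : (phaseVal w.phase).fst ≠ .nat 0 := by
        cases hq : w.phase <;> simp [phaseVal, hq] at hph ⊢
      simp [freeVal, announceVal, this]
  · split
    · rename_i i₀ i₁ price ε hph
      have hb := hw.phase
      rw [hph] at hb
      obtain ⟨b₀, b₁, b₂, b₃⟩ := hb
      simp only [PMF.pure_bind]
      refine hgo (w' := { w with
          phase := .second i₀ i₁ price ε
          session := some ⟨i₁, i₀, .start⟩ }) ((hw.set_phase (ph := .second i₀ i₁ price ε)
            ⟨b₀, b₁, b₂, b₃⟩).set_session b₁ b₀ trivial) (by simp [Wallet.accessing])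
            (Or.inl (hguess (by simp [hph]))) (by simp) ?_
      simp [freeVal, secondVal, hph, phaseVal, wSessionVal]
      rfl
    · rename_i hph
      rw [PMF.pure_bind]
      refine hstay ?_
      have : (phaseVal w.phase).fst ≠ .nat 2 := by
        rcases hq : w.phase with _ | _ | ⟨i₀, i₁, pr, ε⟩ | _ | _ | _ <;>
          first | exact (hph _ _ _ _ hq).elim | simp [phaseVal]
      simp [freeVal, secondVal, this]
  · rename_i g
    simp only [Val.size_pair] at ha
    split
    · rename_i hph
      have hg := hguess (by simp [hph])
      have hwo := hw'.set_phase (ph := .over (some (g != 0))) trivial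
      have hcore' := hwo.core_size hB hi hl.db
      -- The guess is passed on to the ORAM challenger, because the events compared along the chain
      -- are stated in terms of its guess.
      rw [show k + polyBound Y.oram.deg ℓ + 4 = (k + polyBound Y.oram.deg ℓ + 2) + 1 + 1 by omega,
        drive_goDown hB (t := 13)
        (c := coreVal { w with phase := .over (some (g != 0)) } o.store.db) (x := .nat 0)
        (d := .pair (.nat 3) (.nat g)) (by omega) (by
          rw [idleVal, walletMachine_step, hses]
          simp [handleVal, wSessionVal, freeVal, guessVal, hph, phaseVal]
          rfl) (by simp) hcore' (by simp; omega) (by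
          simp only [Val.size_pair, Val.size_nat, h3s] at *; omega),
        comboGame_respond (by simp), ORAM.answer_guess hg hs, PMF.pure_map, PMF.pure_bind,
        PMF.pure_bind]
      refine drive_goUp hB (w := { w with phase := .over (some (g != 0)) })
        (o := { o with guess := some (g != 0) }) ?_ hwo hi
        ⟨hl.db, fun _ => hs, fun h => by simp [Wallet.accessing, hses] at h,
          Or.inr ⟨hses, _, rfl⟩⟩ hp (by simp; omega)
      rw [walletMachine_step]
      simp [handleVal, hses, wSessionVal]
    · rename_i hph
      rw [PMF.pure_bind]
      refine hstay ?_
      have : (phaseVal w.phase).fst ≠ .nat 4 := by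
        cases hq : w.phase <;> simp [phaseVal, hq] at hph ⊢
      simp [freeVal, guessVal, this]
  · rename_i h₁ h₂ h₃ h₅ h₆
    rw [PMF.pure_bind]
    exact hstay (freeVal_default Y h₁ h₂ h₃ h₅ h₆)

/-- The six activations are one for passing on the message or opening the read access, three for the
randomness and the write request, and two for the token request and the answer. -/
theorem drive_card (hB : WalletBound Y ℓ Q S Z (polyBound e ℓ)) (htok : TokenBdd Y ℓ tok PB)
    (hw : w.Inv Y ℓ S i) (hi : i < Q) (hl : Linked Y.oram ℓ w o) (hp : PB p)
    {s : WSession} (hses : w.session = some s) {a : Val} (ha : a.size ≤ S) :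
    Coupled (AnswerRel Y PB ℓ S (i + 1))
      ((Y.walletStep b β ℓ w o a).bind (Y.finish tok β ℓ p))
      ((comboGame Y.oram Y.prf tok β ℓ).drive (walletMachine Y b e) ℓ
        (k + 6) (idleVal Y.oram ℓ w o) (o, p) (.pair (.nat 0) a)) := by
  have hZ := hB.le
  have hSP := hB.oram
  have hw' := hw.mono (Nat.le_succ i)
  have hcore := hw.core_size hB hi.le hl.db
  have h1s : Nat.size 1 = 1 := Nat.size_one
  have h3s : Nat.size 3 = 2 := by decide
  have h5s : Nat.size 5 = 3 := by decide
  have hg : o.guess = none := hl.guess.resolve_right (by simp [hses])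
  obtain ⟨i₀, i₁, stage⟩ := s
  obtain ⟨b₀, b₁, hst⟩ := hw.session _ hses
  simp only at b₀ b₁ hst
  have hn : ∀ {j}, j < w.nextId → (Val.nat j).size ≤ S := fun hj =>
    (nat_size_mono (hj.le.trans hw.nid)).trans hB.cap
  have k₀ := hn b₀
  have k₁ := hn b₁
  have hcur := hl.curDb_size
  have hidle : ∀ m, (walletMachine Y b e).step
      (.pair (ones ℓ) (.pair (idleVal Y.oram ℓ w o) (.pair (.nat 0) m))) =
      cardVal (.pair (ones ℓ) (.pair (coreVal w o.store.db)
        (.pair (wSessionVal (Y.oram.curDb ℓ o) w.session) m))) := by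
    intro m
    rw [idleVal, walletMachine_step, hses]
    cases stage <;> simp [handleVal, wSessionVal]
  have hclose : o.session = none →
      cardVal (.pair (ones ℓ) (.pair (coreVal w o.store.db)
        (.pair (wSessionVal (Y.oram.curDb ℓ o) w.session) a))) =
        goUp (closeVal (coreVal w o.store.db)) (.nat 0) (.pair (.nat 3) (.nat 0)) →
      Coupled (AnswerRel Y PB ℓ S (i + 1)) (PMF.pure ((w.close none,
        ({ o with session := none }, p)), .pair (.nat 3) (.nat 0)))
        ((comboGame Y.oram Y.prf tok β ℓ).drive (walletMachine Y b e) ℓ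
          (k + 6) (idleVal Y.oram ℓ w o) (o, p) (.pair (.nat 0) a)) := by
    intro hs h
    have ho : ({ o with session := none } : ORAMState) = o := by
      obtain ⟨sk, store, mem, session, rewound, broken, wrong, guess⟩ := o
      simp only at hs
      subst hs
      rfl
    rw [ho]
    refine drive_goUp hB ?_ (hw'.close none) hi (Linked.of_session_none hl.db hs rfl hg) hp (by
      simp only [Val.size_pair, Val.size_nat, h3s, Nat.size_zero]; omega)
    rw [hidle, h, closeVal_coreVal]
    rfl
  by_cases h4 : ∃ m, a = .pair (.nat 4) m
  · obtain ⟨m, rfl⟩ := h4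
    simp only [System.walletStep, hses]
    simp only [Val.size_pair] at ha
    cases stage with
    | start =>
      have hs : o.session = none := hl.none_of (by simp [Wallet.accessing, hses])
      by_cases hm : ∃ price ε, m = .pair (.nat price) (.nat ε)
      · obtain ⟨price, ε, rfl⟩ := hm
        simp only [Val.size_pair] at ha
        simp only [System.walletCard]
        rw [PMF.bind_bind, drive_goDown hB (t := 6) (c := coreVal w o.store.db)
          (x := .pair (.nat i₀) (.pair (.nat i₁) (.pair (.nat price) (.pair (.nat ε) o.store.db))))
          (d := .pair (.nat 1) (.pair (.nat i₀) (.nat i₁))) (by omega) (by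
            rw [hidle, hses]
            simp [cardVal, wSessionVal]) (by simp) hcore (by
            have := hl.db
            simp only [Val.size_pair]; omega) (by
            simp only [Val.size_pair, Val.size_nat, h1s] at *; omega),
          comboGame_respond (by simp), ORAM.answer_read hg hs (b₀.trans_le hw.nid)
            (b₁.trans_le hw.nid), ORAM.begin, PMF.map_comp, PMF.bind_map]
        refine Coupled.bind_same _ fun x hx => ?_
        exact drive_payRead hB htok hw hi hg hl.db hp
          (a := Access.new (.read (bif β then i₁ else i₀)) x o.store) hl.db b₀ b₁
          ⟨by omega, by omega⟩
      · have : Y.walletCard b β ℓ w o ⟨i₀, i₁, .start⟩ m = PMF.pure (.done (w.close none)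
            { o with session := none } (.pair (.nat 3) (Val.list []))) := by
          unfold System.walletCard
          split <;> simp_all
        rw [this, PMF.pure_bind]
        refine hclose hs ?_
        have hm' : ¬(¬m.IsNat ∧ m.fst.IsNat ∧ m.snd.IsNat) := by
          rintro ⟨m₁, m₂, m₃⟩
          obtain ⟨x, y, rfl⟩ := Val.exists_pair m₁
          exact hm ⟨x.num, y.num, by
            simp only [Val.fst_pair, Val.snd_pair] at m₂ m₃
            rw [← m₂.eq, ← m₃.eq]⟩
        rw [hses]
        simp [cardVal, wSessionVal, hm']
    | reading price ε =>
      obtain ⟨ac, c, hs, hac, hc⟩ := hl.some_of (by simp [Wallet.accessing, hses])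
      obtain ⟨t₁, t₂⟩ := id hst
      simp only [System.walletCard, hs]
      have hcd : Y.oram.curDb ℓ o = Y.oram.nextDB ℓ ac.db c := by simp [ORAM.curDb, hs]
      rw [hcd] at hcur
      rw [drive_goDown hB (t := 6) (c := coreVal w o.store.db)
        (x := .pair (.nat i₀) (.pair (.nat i₁) (.pair (.nat price) (.pair (.nat ε)
          (Y.oram.nextDB ℓ ac.db c)))))
        (d := .pair (.nat 4) m) (by omega) (by
          rw [hidle, hses, hcd]
          simp [cardVal, wSessionVal]) (by simp) hcore (by
          simp only [Val.size_pair]; omega) (by simp only [Val.size_pair]; omega),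
        comboGame_respond (by simp), ORAM.answer_reply hg hs, PMF.pure_map, PMF.pure_bind]
      exact drive_payRead hB htok hw hi
        (o := { o with rewound := o.rewound || Y.oram.rewinds ℓ ac c m }) hg hl.db hp
        (op := ac.op) (a := { ac with
          replies := m :: ac.replies
          db := Y.oram.nextDB ℓ ac.db c
          stale := ac.stale.map fun d => Y.oram.nextDB ℓ d c
          tampered := ac.tampered || m != Y.oram.reply ℓ ac.db c }) hcur b₀ b₁ hst
    | writing price ε r coin =>
      obtain ⟨ac, c, hs, hac, hc⟩ := hl.some_of (by simp [Wallet.accessing, hses])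
      obtain ⟨t₁, t₂, t₃, t₄⟩ := id hst
      have t₅ := (nat_size_mono t₄).trans hB.sign_coins
      simp only [System.walletCard, hs, PMF.pure_bind]
      have hcd : Y.oram.curDb ℓ o = Y.oram.nextDB ℓ ac.db c := by simp [ORAM.curDb, hs]
      rw [hcd] at hcur
      rw [drive_goDown hB (t := 9) (c := coreVal w o.store.db)
        (x := .pair (Val.list []) (.pair (.nat i₀) (.pair (.nat i₁) (.pair (.nat price)
          (.pair (.nat ε) (.pair (.nat r) (.pair (.nat coin) (Y.oram.nextDB ℓ ac.db c))))))))
        (d := .pair (.nat 4) m) (by omega) (by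
          rw [hidle, hses, hcd]
          simp [cardVal, wSessionVal]) (by simp) hcore (by
          simp only [Val.list_nil, Val.size_pair, Val.size_nat, Nat.size_zero] at *; omega)
        (by simp only [Val.size_pair]; omega),
        comboGame_respond (by simp), ORAM.answer_reply hg hs, PMF.pure_map, PMF.pure_bind]
      exact drive_payWrite hB htok hw hi
        (o := { o with rewound := o.rewound || Y.oram.rewinds ℓ ac c m }) hg hl.db hp
        (op := ac.op) (a := { ac with
          replies := m :: ac.replies
          db := Y.oram.nextDB ℓ ac.db c
          stale := ac.stale.map fun d => Y.oram.nextDB ℓ d c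
          tampered := ac.tampered || m != Y.oram.reply ℓ ac.db c }) hcur (pre := []) (by simp)
        (by simp; omega) b₀ b₁ hst
  · have hstep : Y.walletStep b β ℓ w o a = PMF.pure (.done (w.close none)
        { o with session := none } (.pair (.nat 3) (Val.list []))) := by
      unfold System.walletStep
      simp only [hses]
      split
      · exact (h4 ⟨_, rfl⟩).elim
      · rfl
    have h4' : a.fst ≠ .nat 4 := fun h => h4 ⟨_, Val.eq_pair_of_fst h⟩
    rw [hstep, PMF.pure_bind]
    -- Before the price is named no access is under way, and breaking off concerns only the card.
    -- Otherwise the access has to be broken off in the ORAM game as well.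
    by_cases hstart : stage = .start
    · subst hstart
      refine hclose (hl.none_of (by simp [Wallet.accessing, hses])) ?_
      rw [hses]
      simp [cardVal, wSessionVal, h4']
    · obtain ⟨ac, c, hs, hac, hc⟩ := hl.some_of (by
        cases stage <;> simp [Wallet.accessing, hses] at hstart ⊢)
      rw [drive_goDown hB (t := 12) (c := coreVal w o.store.db) (x := .nat 0)
        (d := .pair (.nat 5) (.nat 0)) (by omega) (by
          rw [hidle, hses]
          cases stage <;> simp [cardVal, wSessionVal, h4'] at hstart ⊢) (by simp) hcore
        (by simp; omega) (by simp [h5s]; omega),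
        comboGame_respond (by simp), ORAM.answer_break hg hs (by simp), PMF.pure_map, PMF.pure_bind]
      refine drive_goUp hB (w := w.close none) (o := { o with session := none }) ?_ (hw'.close none)
        hi (Linked.of_session_none hl.db rfl rfl hg) hp (by
          simp only [Val.list_nil, Val.size_pair, Val.size_nat, h3s, Nat.size_zero]; omega)
      rw [walletMachine_step]
      simp [handleVal, closeVal_coreVal]
      rfl

end Drive

/-! ### The experiment with ideal memory is played by a machine in the ORAM game -/

theorem exists_walletBound (Y : System N) (d : ℕ) :
    ∃ (S Z : ℕ → ℕ) (e : ℕ), ∀ ℓ,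
      WalletBound Y ℓ (polyBound d ℓ) (S ℓ) (Z ℓ) (polyBound e ℓ) := by
  obtain ⟨b₁, hb₁, h₁⟩ := Y.com.gen.coins_poly.exists_bound
  obtain ⟨b₂, hb₂, h₂⟩ := Y.ds.keygen.coins_poly.exists_bound
  obtain ⟨b₃, hb₃, h₃⟩ := Y.ds.sign.coins_poly.exists_bound
  obtain ⟨b₄, hb₄, h₄⟩ := Y.com.gen.exists_bound (PolyBdd.const 1)
  obtain ⟨b₅, hb₅, h₅⟩ := Y.ds.keygen.exists_bound (PolyBdd.const 1)
  obtain ⟨b₆, hb₆, h₆⟩ := Y.oram.cap_poly.exists_bound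
  obtain ⟨b₇, hb₇, h₇⟩ := Y.prf.outLen_poly.exists_bound
  obtain ⟨d₁, hd₁⟩ := Y.com.qFn_poly.size_le
  obtain ⟨d₂, hd₂⟩ := Y.com.commitFn_poly.size_le
  obtain ⟨d₃, hd₃⟩ := Y.oram.serve_poly.size_le
  have hQ := PolyBdd.id.polyBound d
  have hP := PolyBdd.id.polyBound Y.oram.deg
  let P : ℕ → ℕ := fun ℓ => polyBound Y.oram.deg ℓ
  let S : ℕ → ℕ := fun ℓ => polyBound d ℓ + P ℓ + b₁ ℓ + b₂ ℓ + b₃ ℓ + b₄ ℓ + b₅ ℓ + b₆ ℓ + b₇ ℓ +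
    polyBound d₁ (b₄ ℓ) + polyBound d₃ (3 + ℓ + (P ℓ + P ℓ)) + (ℓ + ℓ) + 2
  have hS : PolyBdd S := (((((((((((hQ.add hP).add hb₁).add hb₂).add hb₃).add hb₄).add hb₅).add
    hb₆).add hb₇).add (hb₄.polyBound d₁)).add
    ((((PolyBdd.const 3).add .id).add (hP.add hP)).polyBound d₃)).add (.add .id .id)).add (.const 2)
  let C : ℕ → ℕ := fun ℓ => polyBound d₂ (2 + 3 * S ℓ)
  have hC : PolyBdd C := ((PolyBdd.const 2).add ((PolyBdd.const 3).mul hS)).polyBound d₂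
  -- The bounds are built in layers: `S` for keys, numbers and messages, then `C` for commitments to
  -- numbers of that length, then `b₈` for signatures on tokens and such commitments.
  obtain ⟨b₈, hb₈, h₈⟩ := Y.ds.sign.exists_bound (((PolyBdd.const 3).mul hS).add (hC.add (.const 3)))
  let Z : ℕ → ℕ := fun ℓ => (100 + 30 * S ℓ + polyBound d ℓ * (S ℓ * (2 * S ℓ + 2)) +
    2 * (polyBound d ℓ * (3 * S ℓ + 3)) + (2 * S ℓ + 2) * (1 + S ℓ)) + (b₈ ℓ + C ℓ)
  have hZ : PolyBdd Z := by
    have h2 := (((PolyBdd.const 2).mul hS).add (.const 2))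
    exact (((((PolyBdd.const 100).add ((PolyBdd.const 30).mul hS)).add (hQ.mul (hS.mul h2))).add
      ((PolyBdd.const 2).mul (hQ.mul (((PolyBdd.const 3).mul hS).add (.const 3))))).add
      (h2.mul ((PolyBdd.const 1).add hS))).add (hb₈.add hC)
  obtain ⟨e, he⟩ := (PolyBdd.const 60).mul hZ
  refine ⟨S, Z, e, fun ℓ => ?_⟩
  have k₁ := h₁ ℓ
  have k₂ := h₂ ℓ
  have k₃ := h₃ ℓ
  have k₆ : 1 + N ℓ ≤ b₆ ℓ := by rw [← size_ones]; exact h₆ ℓ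
  have k₇ := h₇ ℓ
  have hSℓ : S ℓ = polyBound d ℓ + P ℓ + b₁ ℓ + b₂ ℓ + b₃ ℓ + b₄ ℓ + b₅ ℓ + b₆ ℓ + b₇ ℓ +
    polyBound d₁ (b₄ ℓ) + polyBound d₃ (3 + ℓ + (P ℓ + P ℓ)) + (ℓ + ℓ) + 2 := rfl
  have hN : Nat.size (N ℓ) ≤ N ℓ := Nat.size_le.2 Nat.lt_two_pow_self
  have hZℓ : 100 + 30 * S ℓ + (b₈ ℓ + C ℓ) ≤ Z ℓ := by simp only [Z]; omega
  refine ⟨by omega, fun pp hpp => ?_, by omega, by omega, by omega, fun r hr => ?_, ?_, ?_, ?_, ?_,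
    by omega, fun db c hdb hc => ?_, ?_, Nat.le_add_right _ _, he ℓ⟩
  · obtain ⟨r, hr, rfl⟩ := RandAlg.mem_support hpp
    have k₄ := h₄ ℓ (.nat 0) r (by simp) hr
    rw [← Y.com.qFn_eq hpp]
    have := (hd₁ (Y.com.gen.out ℓ (.nat 0) r)).trans (polyBound_mono _ k₄)
    omega
  · have := h₅ ℓ (.nat 0) r (by simp) hr
    omega
  · change P ℓ ≤ _
    omega
  · rw [Val.size_nat, Nat.size_pow]
    omega
  · rw [Val.size_nat, Nat.size_pow]
    omega
  · rw [Val.size_nat]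
    omega
  · have k : (Val.pair (ones ℓ) (.pair db c)).size ≤ 3 + ℓ + (P ℓ + P ℓ) := by
      simp only [Val.size_pair, size_ones, P]
      omega
    have := (Val.size_snd_le _).trans ((hd₃ _).trans (polyBound_mono d₃ k))
    unfold ORAM.reply
    omega
  · intro w price ε r coin τ hpp hsk hτ hpr hε hr hco
    have kc : (Y.com.commit w.pp price r).size ≤ C ℓ := by
      rw [← Y.com.commitFn_eq hpp]
      refine (hd₂ _).trans (polyBound_mono d₂ ?_)
      have : w.pp.size ≤ S ℓ := by
        obtain ⟨r, hr, h⟩ := RandAlg.mem_support hpp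
        have k₄ := h₄ ℓ (.nat 0) r (by simp) hr
        rw [h]
        omega
      simp only [Val.size_pair]
      omega
    have := h₈ ℓ (.pair w.skRS (.pair τ (.pair (.nat ε) (Y.com.commit w.pp price r)))) coin (by
      simp only [Val.size_pair]
      omega) hco
    simp only [System.payProof, Val.list_cons, Val.list_nil, Val.size_pair, Val.size_nat,
      Nat.size_zero] at *
    omega

theorem Wallet.Inv.initial {Y : System N} {ℓ S : ℕ} {pp sk pk : Val}
    (hpp : pp ∈ (Y.com.gen.sample ℓ (.nat 0)).support) (hsk : sk.size ≤ S) (hpk : pk.size ≤ S) :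
    (⟨pp, sk, pk, 0, [], [], [], .before, none⟩ : Wallet).Inv Y ℓ S 0 where
  pp := hpp
  sk := hsk
  pk := hpk
  nid := Nat.zero_le _
  cards := by simp
  cards_size := by simp [assocVal]
  rec_lt := by simp [Wallet.recs]
  rec_size := by simp [Wallet.recs, assocVal]
  phase := trivial
  session := by simp

/-- The setup, done by the machine. -/
theorem reduce_start {Y : System N} {b β : Bool} {ℓ Q S Z e : ℕ}
    {tok : PRFState → Val → PMF (PRFState × Val)} {PB : PRFState → Prop}
    (hB : WalletBound Y ℓ Q S Z (polyBound e ℓ)) (hPB : ∀ K, PB ⟨K, fun _ => none, none⟩) :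
    Coupled (AnswerRel Y PB ℓ S 0) (Y.walletGame tok b β ℓ).start
      ((comboGame Y.oram Y.prf tok β ℓ).reduce (walletMachine Y b e) ℓ).start := by
  have hZ := hB.le
  have hD := hB.deg
  have hP := hB.oram
  change Coupled _ (PMF.bind _ _) (PMF.bind (PMF.bind _ _) _)
  rw [PMF.bind_bind]
  refine Coupled.bind_same _ fun v hv => ?_
  have hv' := (Val.size_snd_le v).trans (Y.oram.init_bound ℓ v hv)
  rw [PMF.bind_map]
  refine Coupled.bind_same _ fun K _ => ?_
  simp only [Function.comp_apply]
  obtain ⟨k, hk⟩ : ∃ k, polyBound (walletMachine Y b e).deg ℓ = k + 1 + 1 + 1 :=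
    ⟨polyBound e ℓ - 3, by change polyBound e ℓ = _; omega⟩
  rw [hk, drive_goRand hB (t := 1) (c := .nat 0) (x := v.snd) (n := Y.com.gen.coins ℓ) (by omega)
    (by simp [walletMachine, walletVal]) (by simp; omega) (by omega)
    (by have := hB.gen_coins; omega)]
  unfold RandAlg.sample
  rw [PMF.bind_map]
  refine Coupled.bind_same _ fun r hr => ?_
  have hpp : Y.com.gen.out ℓ (.nat 0) r ∈ (Y.com.gen.sample ℓ (.nat 0)).support := by
    unfold RandAlg.sample
    rw [PMF.support_map]
    exact ⟨r, hr, rfl⟩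
  have hpp' := (hB.pp _ hpp).1
  simp only [Function.comp_apply]
  rw [drive_goRand hB (t := 10) (c := .nat 0) (x := .pair (Y.com.gen.out ℓ (.nat 0) r) v.snd)
    (n := Y.ds.keygen.coins ℓ) (by omega)
    (by rw [walletMachine_step]; simp [handleVal, RandAlg.out]) (by simp; omega)
    (by simp only [Val.size_pair]; omega) (by have := hB.key_coins; omega), PMF.map_comp]
  refine Coupled.bind_same _ fun s hs => ?_
  have hkey := hB.key s (unif_support hs)
  have hk₁ := (Val.size_fst_le _).trans hkey
  have hk₂ := (Val.size_snd_le _).trans hkey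
  refine drive_goUp hB ?_ (Wallet.Inv.initial hpp hk₁ hk₂) (Nat.zero_le _)
    (Linked.of_session_none hv' rfl rfl rfl) (hPB K) (by simp only [Val.size_pair]; omega)
  rw [walletMachine_step]
  simp [handleVal, setupEnd, RandAlg.out, coreVal, ORAMState.init, wSessionVal, assocVal, phaseVal]

/-- An adversary in the ORAM game with tokens that plays the experiment with ideal memory. -/
theorem exists_wallet_adversary (Y : System N) (b : Bool) (A : Adversary) :
    ∃ B : Adversary, ∀ tok (PB : PRFState → Prop) β ℓ (E : ORAMState → Bool),
      TokenBdd Y ℓ tok PB → (∀ K, PB ⟨K, fun _ => none, none⟩) →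
      (Y.walletGame tok b β ℓ).prob A ℓ (fun s => E s.2.1) =
        (comboGame Y.oram Y.prf tok β ℓ).prob B ℓ (fun s => E s.1) := by
  obtain ⟨S, Z, e, h⟩ := exists_walletBound Y A.deg
  -- The machine knows `b`, by whose table it decides, but neither `β` nor the token oracle: it
  -- always submits the data of both worlds. Hence one adversary serves for all of them.
  refine ⟨A.comp (walletMachine Y b e), fun tok PB β ℓ E htok hPB => ?_⟩
  have hB := h ℓ
  have hZ := hB.le
  have hD := hB.deg
  have hP := hB.oram
  rw [Game.prob_comp, Game.prob_eq_pr, Game.prob_eq_pr]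
  refine (Game.run_coupled (D := fun _ _ => False) (R := WalletRel Y PB ℓ (S ℓ))
    (reduce_start hB hPB) (fun _ _ h => h.elim) ?_ ?_).pr_eq ?_
  · rintro i s t ⟨h₁, h₂, h₃, h₄⟩
    exact ⟨h₁.mono (Nat.le_succ i), h₂, h₃, h₄⟩
  · rintro i ⟨w, o, p⟩ t a hi ⟨hw, hl, hp, rfl⟩ ha -
    have ha' := ha.trans hB.msg
    obtain ⟨k, hk⟩ : ∃ k, polyBound (walletMachine Y b e).deg ℓ =
      k + 2 + polyBound Y.oram.deg ℓ + 4 :=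
      ⟨polyBound e ℓ - polyBound Y.oram.deg ℓ - 6, by change polyBound e ℓ = _; omega⟩
    refine Coupled.mono (R := AnswerRel Y PB ℓ (S ℓ) (i + 1)) ?_ fun _ _ h => Or.inl h
    change Coupled _ ((Y.walletStep b β ℓ w o a).bind (Y.finish tok β ℓ p))
      ((comboGame Y.oram Y.prf tok β ℓ).drive (walletMachine Y b e) ℓ
        (polyBound (walletMachine Y b e).deg ℓ) (idleVal Y.oram ℓ w o) (o, p) (.pair (.nat 0) a))
    rw [hk]
    rcases hs : w.session with _ | s
    · simp only [System.walletStep, hs]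
      exact drive_free hB hw hi hl hp hs ha'
    · rw [show k + 2 + polyBound Y.oram.deg ℓ + 4 = (k + polyBound Y.oram.deg ℓ) + 6 by omega]
      exact drive_card hB htok hw hi hl hp hs ha'
  · rintro s t (⟨-, -, -, rfl⟩ | h)
    · rfl
    · exact h.elim

theorem tokenBdd_answer (Y : System N) (ideal : Bool) (ℓ : ℕ) :
    TokenBdd Y ℓ (Y.prf.answer ideal ℓ) (PRFState.Bdd Y.prf ℓ) :=
  fun _ _ hp _ hq => PRF.answer_bdd hp hq

theorem tokenBdd_fresh (Y : System N) (ℓ : ℕ) :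
    TokenBdd Y ℓ (Y.prf.fresh ℓ) (PRFState.Bdd Y.prf ℓ) := by
  intro p x hp q hq
  unfold PRF.fresh at hq
  rw [PMF.support_map] at hq
  obtain ⟨y, hy, rfl⟩ := hq
  exact ⟨hp, nat_size_mono ((unif_support hy).trans (Nat.sub_le _ _))⟩

theorem PRFState.Bdd.initial (F : PRF) (ℓ : ℕ) (K : Val) :
    PRFState.Bdd F ℓ ⟨K, fun _ => none, none⟩ :=
  ⟨rfl, by simp⟩

/-! ### The moves of the wallets -/

/-- The stage of a transaction is consistent with the price `p`. -/
def WStage.Pays (p : ℕ) : WStage → Prop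
  | .start => True
  | .reading p' _ => p' = p
  | .writing p' _ _ _ => p' = p

def WStage.IsWriting : WStage → Prop
  | .writing _ _ _ _ => True
  | _ => False

/-- The record that decides about a transaction. -/
def Wallet.payer (b : Bool) (w : Wallet) (s : WSession) : ℕ × ℕ :=
  getRec (w.recs b) (bif b then s.i₁ else s.i₀)

/-- A transaction at price `p` passes the check of the balance or has passed it. -/
def Wallet.Passes (b : Bool) (w : Wallet) (s : WSession) (p : ℕ) : Prop :=
  s.stage.Pays p ∧ (s.stage.IsWriting ∨ p ≤ (w.payer b s).1)

/-- The moves of the wallets other than payments. -/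
inductive Wallet.Move (b : Bool) (w : Wallet) : Wallet → Prop
  | refl : Move b w w
  | enroll (ids : List ℕ) (bud : ℕ) : w.session = none → w.phase.isFree = true →
      Move b w (w.enroll ids bud)
  | openCard {t i : ℕ} : w.session = none → w.cards.lookup t = some i → w.phase.isFree = true →
      w.phase.allows i = true → Move b w { w with session := some ⟨i, i, .start⟩ }
  | announce {t₀ t₁ i₀ i₁ : ℕ} (price ε : ℕ) : w.session = none → w.phase = .before →
      w.cards.lookup t₀ = some i₀ → w.cards.lookup t₁ = some i₁ →
      Move b w { w with phase := .first i₀ i₁ price ε, session := some ⟨i₀, i₁, .start⟩ }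
  | giveUp : w.session = none → w.phase = .before → Move b w { w with phase := .over none }
  | second {i₀ i₁ price ε : ℕ} : w.session = none → w.phase = .between i₀ i₁ price ε →
      Move b w { w with phase := .second i₀ i₁ price ε, session := some ⟨i₁, i₀, .start⟩ }
  | guess (g : Bool) : w.session = none → w.phase = .after →
      Move b w { w with phase := .over (some g) }
  | close {s : WSession} : w.session = some s → Move b w (w.close none)
  | read {s : WSession} {p : ℕ} (ε : ℕ) : w.session = some s → s.stage.Pays p →
      ¬s.stage.IsWriting → Move b w { w with session := some ⟨s.i₀, s.i₁, .reading p ε⟩ }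
  | write {s : WSession} {p : ℕ} (ε r coin : ℕ) : w.session = some s → w.Passes b s p →
      Move b w { w with session := some ⟨s.i₀, s.i₁, .writing p ε r coin⟩ }

/-- What comes out of a step from the wallets `w` and the ORAM challenger `o`. -/
def Out.From (b : Bool) (w : Wallet) (o : ORAMState) : Out → Prop
  | .done w' o' _ => Wallet.Move b w w' ∧
      (o'.guess = o.guess ∨ ∃ g, o'.guess = some g ∧ w'.phase = .over (some g))
  | .pay w' o' i₀ i₁ p _ _ _ _ => w' = w ∧ o'.guess = o.guess ∧
      ∃ s, w.session = some s ∧ s.i₀ = i₀ ∧ s.i₁ = i₁ ∧ w.Passes b s p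

/-- What comes out of a step of the transaction `s` at price `p`. -/
def Out.FromSession (b : Bool) (w : Wallet) (o : ORAMState) (s : WSession) (p : ℕ) : Out → Prop
  | .done w' o' _ => o'.guess = o.guess ∧ (w' = w.close none ∨
      (¬s.stage.IsWriting ∧ ∃ ε, w' = { w with session := some ⟨s.i₀, s.i₁, .reading p ε⟩ }) ∨
      (w.Passes b s p ∧ ∃ ε r coin,
        w' = { w with session := some ⟨s.i₀, s.i₁, .writing p ε r coin⟩ }))
  | .pay w' o' i₀ i₁ p' _ _ _ _ =>
      w' = w ∧ o'.guess = o.guess ∧ s.i₀ = i₀ ∧ s.i₁ = i₁ ∧ p' = p ∧ w.Passes b s p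

section Moves
variable {Y : System N} {b β : Bool} {ℓ : ℕ} {w : Wallet} {o : ORAMState}

theorem Out.FromSession.from {s : WSession} {p : ℕ} (hs : w.session = some s)
    (hp : s.stage.Pays p) {out : Out} (h : out.FromSession b w o s p) : out.From b w o := by
  rcases out with ⟨w', o', m⟩ | ⟨w', o', i₀, i₁, price, ε, r, coin, msgs⟩
  · obtain ⟨hg, rfl | ⟨hw, ε, rfl⟩ | ⟨hw, ε, r, coin, rfl⟩⟩ := h
    · exact ⟨.close hs, Or.inl hg⟩
    · exact ⟨.read ε hs hp hw, Or.inl hg⟩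
    · exact ⟨.write ε r coin hs hw, Or.inl hg⟩
  · obtain ⟨h₁, h₂, h₃, h₄, rfl, h₅⟩ := h
    exact ⟨h₁, h₂, s, hs, h₃, h₄, h₅⟩

theorem cardWrite_from {o' : ORAMState} {s : WSession} {p ε r coin : ℕ}
    (hp : w.Passes b s p) (ho : o'.guess = o.guess) (op : Op) (pre : List Val)
    (res : AccessResult) :
    (cardWrite w o' op s.i₀ s.i₁ p ε r coin pre res).FromSession b w o s p := by
  have hg := (o'.after_guess op res).trans ho
  cases res with
  | wait a c => exact ⟨hg, Or.inr (Or.inr ⟨hp, ε, r, coin, rfl⟩)⟩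
  | done db c out t => exact ⟨rfl, hg, rfl, rfl, rfl, hp⟩
  | fail t => exact ⟨hg, Or.inl rfl⟩

theorem cardRead_from {o' : ORAMState} {s : WSession} {p ε : ℕ}
    (hp : s.stage.Pays p) (hw : ¬s.stage.IsWriting) (ho : o'.guess = o.guess) (op : Op)
    (res : AccessResult) {out : Out}
    (hout : out ∈ (Y.cardRead b β ℓ w o' op s.i₀ s.i₁ p ε res).support) :
    out.FromSession b w o s p := by
  have hg := (o'.after_guess op res).trans ho
  cases res with
  | wait a c =>
    simp only [System.cardRead, PMF.support_pure, Set.mem_singleton_iff] at hout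
    subst hout
    exact ⟨hg, Or.inr (Or.inl ⟨hw, ε, rfl⟩)⟩
  | done db c v t =>
    simp only [System.cardRead] at hout
    split_ifs at hout with hlt
    · simp only [PMF.support_pure, Set.mem_singleton_iff] at hout
      subst hout
      exact ⟨hg, Or.inl rfl⟩
    · simp only [PMF.mem_support_bind_iff, PMF.mem_support_map_iff] at hout
      obtain ⟨r, -, coin, -, x, -, rfl⟩ := hout
      exact cardWrite_from ⟨hp, Or.inr (not_lt.1 hlt)⟩ hg _ _ _
  | fail t =>
    simp only [System.cardRead, PMF.support_pure, Set.mem_singleton_iff] at hout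
    subst hout
    exact ⟨hg, Or.inl rfl⟩

theorem walletRegister_from {ids : List ℕ} {bud : ℕ} (hs : w.session = none)
    (hf : w.phase.isFree = true) {out : Out}
    (hout : out ∈ (Y.walletRegister ℓ w o ids bud).support) : out.From b w o := by
  have hstay : ∀ m, out = .done w o m → out.From b w o := by
    rintro m rfl
    exact ⟨.refl, Or.inl rfl⟩
  unfold System.walletRegister at hout
  split_ifs at hout with h
  · simp only [PMF.mem_support_bind_iff] at hout
    obtain ⟨r, -, coin, -, hout⟩ := hout
    split_ifs at hout
    · simp only [PMF.mem_support_map_iff] at hout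
      obtain ⟨x, -, rfl⟩ := hout
      split
      · exact ⟨.enroll ids bud hs hf, Or.inl rfl⟩
      · exact ⟨.refl, Or.inl rfl⟩
    · exact hstay _ (by simpa using hout)
  · exact hstay _ (by simpa using hout)

theorem walletFree_from (hs : w.session = none) {msg : Val} {out : Out}
    (hout : out ∈ (Y.walletFree ℓ w o msg).support) : out.From b w o := by
  have hstay : ∀ m, out = .done w o m → out.From b w o := by
    rintro m rfl
    exact ⟨.refl, Or.inl rfl⟩
  unfold System.walletFree at hout
  split at hout
  · split_ifs at hout with hf
    · exact walletRegister_from hs hf hout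
    · exact hstay _ (by simpa using hout)
  · split at hout
    · rename_i i hi
      split_ifs at hout with hf
      · simp only [PMF.support_pure, Set.mem_singleton_iff] at hout
        subst hout
        simp only [Bool.and_eq_true] at hf
        exact ⟨.openCard hs hi hf.1 hf.2, Or.inl rfl⟩
      · exact hstay _ (by simpa using hout)
    · exact hstay _ (by simpa using hout)
  · split at hout
    · rename_i hph
      split at hout
      · rename_i h₀ h₁
        simp only [PMF.support_pure, Set.mem_singleton_iff] at hout
        subst hout
        exact ⟨.announce _ _ hs hph h₀ h₁, Or.inl rfl⟩
      · simp only [PMF.support_pure, Set.mem_singleton_iff] at hout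
        subst hout
        exact ⟨.giveUp hs hph, Or.inl rfl⟩
    · exact hstay _ (by simpa using hout)
  · split at hout
    · rename_i hph
      simp only [PMF.support_pure, Set.mem_singleton_iff] at hout
      subst hout
      exact ⟨.second hs hph, Or.inl rfl⟩
    · exact hstay _ (by simpa using hout)
  · split at hout
    · rename_i hph
      simp only [PMF.support_pure, Set.mem_singleton_iff] at hout
      subst hout
      exact ⟨.guess _ hs hph, Or.inr ⟨_, rfl, rfl⟩⟩
    · exact hstay _ (by simpa using hout)
  · exact hstay _ (by simpa using hout)

/-- Reduces the protocol to a short list of moves of the tables and payments. The later invariants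
about counters, doomed challenges and twin worlds are checked on this list only. -/
theorem walletStep_from {msg : Val} {out : Out}
    (hout : out ∈ (Y.walletStep b β ℓ w o msg).support) : out.From b w o := by
  unfold System.walletStep at hout
  split at hout
  · rename_i hs
    exact walletFree_from hs hout
  · rename_i s hs
    have hclose : ∀ m, out = .done (w.close none) { o with session := none } m →
        out.From b w o := by
      rintro m rfl
      exact ⟨.close hs, Or.inl rfl⟩
    split at hout
    · unfold System.walletCard at hout
      split at hout
      · rename_i price ε hst
        rw [PMF.mem_support_bind_iff] at hout
        obtain ⟨x, -, hout⟩ := hout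
        have hp : s.stage.Pays price := by simp [hst, WStage.Pays]
        refine Out.FromSession.from hs hp (cardRead_from hp ?_ ?_ _ _ hout)
        · simp [hst, WStage.IsWriting]
        · rfl
      · rename_i price ε a c hst _
        have hp : s.stage.Pays price := by simp [hst, WStage.Pays]
        refine Out.FromSession.from (o := o) hs hp (cardRead_from hp ?_ ?_ _ _ hout)
        · simp [hst, WStage.IsWriting]
        · rfl
      · rename_i price ε r coin a c hst _
        have hp : s.stage.Pays price := by simp [hst, WStage.Pays]
        simp only [PMF.support_pure, Set.mem_singleton_iff] at hout
        subst hout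
        refine Out.FromSession.from hs hp (cardWrite_from ⟨hp, Or.inl ?_⟩ ?_ _ _ _)
        · simp [hst, WStage.IsWriting]
        · rfl
      · exact hclose _ (by simpa using hout)
    · exact hclose _ (by simpa using hout)

end Moves

theorem getRec_cons (i : ℕ) (x : ℕ × ℕ) (T : List (ℕ × (ℕ × ℕ))) (j : ℕ) :
    getRec ((i, x) :: T) j = if j = i then x else getRec T j := by
  unfold getRec
  rw [List.lookup_cons]
  by_cases h : j = i
  · simp [h]
  · have : (j == i) = false := by simpa using h
    simp [this, h]

/-- The household that pays in world `b`. -/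
def WSession.household (b : Bool) (s : WSession) : ℕ := bif b then s.i₁ else s.i₀

theorem Wallet.recs_pay (ℓ : ℕ) (w : Wallet) (b : Bool) (s : WSession) (p ε : ℕ) :
    (w.pay ℓ s.i₀ s.i₁ p ε).recs b = (s.household b, payRec ℓ p (w.payer b s)) :: w.recs b := by
  cases b <;> rfl

theorem Wallet.recs_enroll (w : Wallet) (b : Bool) (ids : List ℕ) (bud : ℕ) :
    (w.enroll ids bud).recs b = (w.nextId, (bud, 0)) :: w.recs b := by
  cases b <;> rfl

/-- The households of a phase are registered. -/
def WPhase.Below (n : ℕ) : WPhase → Prop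
  | .first i₀ i₁ _ _ => i₀ < n ∧ i₁ < n
  | .between i₀ i₁ _ _ => i₀ < n ∧ i₁ < n
  | .second i₀ i₁ _ _ => i₀ < n ∧ i₁ < n
  | _ => True

theorem WPhase.Below.next {n : ℕ} {ph : WPhase} (h : ph.Below n) (ok : Option (ℕ × ℕ)) :
    (ph.next ok).Below n := by
  cases ph <;> simp only [WPhase.next] <;> try exact h
  all_goals
    split_ifs
    · first | exact h | trivial
    · trivial

/-- All households in use are registered. -/
structure Wallet.Registered (w : Wallet) : Prop where
  cards : ∀ p ∈ w.cards, p.2 < w.nextId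
  phase : w.phase.Below w.nextId
  session : ∀ s, w.session = some s → s.i₀ < w.nextId ∧ s.i₁ < w.nextId

theorem Wallet.Registered.initial (pp sk pk : Val) :
    (⟨pp, sk, pk, 0, [], [], [], .before, none⟩ : Wallet).Registered :=
  ⟨by simp, trivial, by simp⟩

theorem Wallet.Registered.pay {w : Wallet} (h : w.Registered) (ℓ i₀ i₁ p ε : ℕ) :
    (w.pay ℓ i₀ i₁ p ε).Registered :=
  ⟨h.cards, h.phase.next _, by simp [Wallet.pay]⟩

theorem Wallet.Registered.move {b : Bool} {w w' : Wallet} (h : w.Registered)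
    (hm : Wallet.Move b w w') : w'.Registered := by
  cases hm with
  | refl => exact h
  | enroll ids bud hs hf =>
    refine ⟨fun p hp => ?_, ?_, by simp [Wallet.enroll, hs]⟩
    · rcases assignCards_mem _ _ _ hp with hp | hp
      · exact (h.cards p hp).trans (Nat.lt_succ_self _)
      · rw [hp]
        exact Nat.lt_succ_self _
    · have := h.phase
      change w.phase.Below (w.nextId + 1)
      cases hq : w.phase <;> rw [hq] at this <;>
        first | trivial | exact ⟨this.1.trans (Nat.lt_succ_self _), this.2.trans (Nat.lt_succ_self _)⟩
  | openCard hs hi hf ha =>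
    have := h.cards _ (lookup_mem hi)
    exact ⟨h.cards, h.phase, by rintro s ⟨⟩; exact ⟨this, this⟩⟩
  | announce p ε hs hph h₀ h₁ =>
    have k₀ := h.cards _ (lookup_mem h₀)
    have k₁ := h.cards _ (lookup_mem h₁)
    exact ⟨h.cards, ⟨k₀, k₁⟩, by rintro s ⟨⟩; exact ⟨k₀, k₁⟩⟩
  | giveUp hs hph => exact ⟨h.cards, trivial, by simp [hs]⟩
  | second hs hph =>
    have := h.phase
    rw [hph] at this
    exact ⟨h.cards, this, by rintro s ⟨⟩; exact ⟨this.2, this.1⟩⟩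
  | guess g hs hph => exact ⟨h.cards, trivial, by simp [hs]⟩
  | close hs => exact ⟨h.cards, h.phase.next _, by simp [Wallet.close]⟩
  | read ε hs _ _ =>
    have := h.session _ hs
    exact ⟨h.cards, h.phase, by rintro s ⟨⟩; exact this⟩
  | write ε r coin hs _ =>
    have := h.session _ hs
    exact ⟨h.cards, h.phase, by rintro s ⟨⟩; exact this⟩

/-- Moves other than payments do not change the records of registered households. -/
theorem Wallet.Move.recs {b : Bool} {w w' : Wallet} (hm : Wallet.Move b w w') (β : Bool) :
    w'.recs β = w.recs β ∧ w'.nextId = w.nextId ∨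
      ∃ bud, w'.recs β = (w.nextId, (bud, 0)) :: w.recs β ∧ w'.nextId = w.nextId + 1 := by
  cases hm with
  | enroll ids bud hs hf => exact Or.inr ⟨bud, w.recs_enroll β ids bud, rfl⟩
  | _ => cases β <;> exact Or.inl ⟨rfl, rfl⟩

/-! ### Tokens are never asked for twice -/

/-- After `i` messages: no counter exceeds `i`, and the table holds only tokens that have been
used. -/
structure CounterInv (β : Bool) (i : ℕ) (w : Wallet) (p : PRFState) : Prop where
  reg : w.Registered
  ctr : ∀ j, (getRec (w.recs β) j).2 ≤ i
  table : ∀ x y, p.table x = some y → ∃ j k, x = .pair (.nat j) (.nat k) ∧ j < w.nextId ∧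
    k ≤ (getRec (w.recs β) j).2

theorem CounterInv.move {b β : Bool} {i : ℕ} {w w' : Wallet} {p : PRFState}
    (h : CounterInv β i w p) (hm : Wallet.Move b w w') : CounterInv β i w' p := by
  refine ⟨h.reg.move hm, fun j => ?_, fun x y hxy => ?_⟩
  · rcases hm.recs β with ⟨h₁, h₂⟩ | ⟨bud, h₁, h₂⟩
    · rw [h₁]; exact h.ctr j
    · rw [h₁, getRec_cons]
      split_ifs
      · exact Nat.zero_le _
      · exact h.ctr j
  · obtain ⟨j, k, hx, hj, hk⟩ := h.table x y hxy
    refine ⟨j, k, hx, ?_⟩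
    rcases hm.recs β with ⟨h₁, h₂⟩ | ⟨bud, h₁, h₂⟩
    · rw [h₁, h₂]; exact ⟨hj, hk⟩
    · rw [h₁, h₂, getRec_cons, if_neg (by omega)]
      exact ⟨by omega, hk⟩

theorem CounterInv.mono {β : Bool} {i j : ℕ} {w : Wallet} {p : PRFState} (h : CounterInv β i w p)
    (hij : i ≤ j) : CounterInv β j w p :=
  { h with ctr := fun k => (h.ctr k).trans hij }

theorem tokenInput_payer (ℓ : ℕ) (β : Bool) (w : Wallet) (s : WSession) :
    (bif β then tokenInput ℓ s.i₁ (getRec w.rec₁ s.i₁)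
      else tokenInput ℓ s.i₀ (getRec w.rec₀ s.i₀)) = tokenInput ℓ (s.household β) (w.payer β s) := by
  cases β <;> rfl

theorem WSession.household_lt {w : Wallet} (h : w.Registered) {s : WSession} (hs : w.session = some s)
    (β : Bool) : s.household β < w.nextId := by
  cases β
  · exact (h.session s hs).1
  · exact (h.session s hs).2

/-- Counters do not exceed the number `i` of messages so far, so the next value does not wrap around
modulo `2 ^ ℓ`. It exceeds every counter value of this household for which a token was drawn. -/
theorem CounterInv.fresh {β : Bool} {ℓ i : ℕ} {w : Wallet} {p : PRFState} (h : CounterInv β i w p)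
    (hi : i + 1 < 2 ^ ℓ) (s : WSession) :
    p.table (tokenInput ℓ (s.household β) (w.payer β s)) = none := by
  rcases ht : p.table (tokenInput ℓ (s.household β) (w.payer β s)) with _ | y
  · rfl
  · obtain ⟨j, k, hx, -, hk⟩ := h.table _ _ ht
    have hc : (w.payer β s).2 ≤ i := h.ctr _
    unfold tokenInput at hx
    rw [Nat.mod_eq_of_lt (by omega)] at hx
    simp only [Val.pair.injEq, Val.nat.injEq] at hx
    obtain ⟨rfl, rfl⟩ := hx
    have : w.payer β s = getRec (w.recs β) (s.household β) := rfl
    rw [← this] at hk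
    omega

/-- The input added to the table of tokens carries exactly the counter that the payment stores, so
the table again contains nothing above the current counters. -/
theorem CounterInv.pay {β : Bool} {ℓ i : ℕ} {w : Wallet} {p : PRFState} (h : CounterInv β i w p)
    (hi : i + 1 < 2 ^ ℓ) {s : WSession} (hs : w.session = some s) (price ε : ℕ) (y : Val) :
    CounterInv β (i + 1) (w.pay ℓ s.i₀ s.i₁ price ε)
      ⟨p.key, Function.update p.table (tokenInput ℓ (s.household β) (w.payer β s)) (some y),
        p.guess⟩ := by
  have hc : (w.payer β s).2 ≤ i := h.ctr _
  have hmod : ((w.payer β s).2 + 1) % 2 ^ ℓ = (w.payer β s).2 + 1 := Nat.mod_eq_of_lt (by omega)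
  refine ⟨h.reg.pay _ _ _ _ _, fun j => ?_, fun x z hxz => ?_⟩
  · rw [w.recs_pay, getRec_cons]
    split_ifs
    · simp only [payRec, hmod]
      omega
    · exact (h.ctr j).trans (Nat.le_succ i)
  · have hpay : w.payer β s = getRec (w.recs β) (s.household β) := rfl
    by_cases hx : x = tokenInput ℓ (s.household β) (w.payer β s)
    · refine ⟨_, _, hx, WSession.household_lt h.reg hs β, ?_⟩
      rw [w.recs_pay, getRec_cons, if_pos rfl]
      exact le_rfl
    · simp only [Function.update_of_ne hx] at hxz
      obtain ⟨j, k, hx, hj, hk⟩ := h.table x z hxz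
      refine ⟨j, k, hx, hj, ?_⟩
      rw [w.recs_pay, getRec_cons]
      split_ifs with hjs
      · subst hjs
        simp only [payRec, hmod]
        rw [← hpay] at hk
        omega
      · exact hk

/-- With fewer messages than values of the counter, the random function gives fresh tokens. -/
theorem walletGame_ideal_eq_fresh (Y : System N) (b β : Bool) (A : Adversary) {ℓ : ℕ}
    (hℓ : polyBound A.deg ℓ < 2 ^ ℓ) (E : ORAMState → Bool) :
    (Y.walletGame (Y.prf.answer true ℓ) b β ℓ).prob A ℓ (fun s => E s.2.1) =
      (Y.walletGame (Y.prf.fresh ℓ) b β ℓ).prob A ℓ (fun s => E s.2.1) := by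
  rw [Game.prob_eq_pr, Game.prob_eq_pr]
  refine (Game.run_coupled (D := fun _ _ => False)
    (R := fun i (s t : Wallet × (ORAMState × PRFState)) =>
      s.1 = t.1 ∧ s.2.1 = t.2.1 ∧ CounterInv β i s.1 s.2.2)
    ?_ (fun _ _ h => h.elim) (fun i s t h => ⟨h.1, h.2.1, h.2.2.mono (Nat.le_succ i)⟩) ?_).pr_eq ?_
  · refine Coupled.bind_same _ fun v _ => Coupled.bind_same _ fun K _ =>
      Coupled.bind_same _ fun pp _ => Coupled.map_same _ fun k _ => ?_
    exact ⟨⟨rfl, rfl, .initial _ _ _, by cases β <;> simp [Wallet.recs, getRec], by simp⟩, rfl⟩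
  · rintro i ⟨w, o, p⟩ ⟨w', o', p'⟩ a hi ⟨hw, ho, hI⟩ - -
    dsimp only at hw ho hI
    subst hw ho
    refine Coupled.bind_same _ fun out hout => ?_
    have hfrom := walletStep_from hout
    rcases out with ⟨w', o', m⟩ | ⟨w', o', i₀, i₁, price, ε, r, coin, msgs⟩
    · exact Coupled.pure (Or.inl ⟨⟨rfl, rfl, (hI.move hfrom.1).mono (Nat.le_succ i)⟩, rfl⟩)
    · obtain ⟨rfl, -, s, hs, rfl, rfl, -⟩ := hfrom
      simp only [System.finish, tokenInput_payer]
      -- The run has at most `polyBound A.deg ℓ < 2 ^ ℓ` activations, which supplies `i + 1 < 2 ^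
      -- ℓ`.
      have hnone := hI.fresh (ℓ := ℓ) (by omega) s
      simp only [PRF.answer, PRF.fresh, hnone, if_true, PMF.map_comp]
      refine Coupled.map_same _ fun y _ => Or.inl ⟨⟨rfl, rfl, ?_⟩, rfl⟩
      exact hI.pay (ℓ := ℓ) (by omega) hs price ε (.nat y)
  · rintro s t (⟨-, h, -⟩ | h)
    · rw [h]
    · exact h.elim

/-! ### The two orders of the challenge transactions, with the same accesses -/

/-- The experiment will not reach a guess: the price is wrong, or a balance is too low, in one of
the challenge transactions. -/
def Wallet.Doomed (b : Bool) (w : Wallet) : Prop :=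
  match w.phase with
  | .over none => w.session = none
  | .first i₀ i₁ price _ => ∃ s, w.session = some s ∧ s.i₀ = i₀ ∧ s.i₁ = i₁ ∧
      (s.stage.Pays price →
        (¬s.stage.IsWriting ∧ (getRec (w.recs b) (bif b then i₁ else i₀)).1 < price) ∨
        (i₀ ≠ i₁ ∧ (getRec (w.recs b) (bif b then i₀ else i₁)).1 < price))
  | .between i₀ i₁ price _ =>
      i₀ ≠ i₁ ∧ (getRec (w.recs b) (bif b then i₀ else i₁)).1 < price ∧
      ∀ s, w.session = some s → s.household b ≠ (bif b then i₀ else i₁)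
  | .second i₀ i₁ price _ => ∃ s, w.session = some s ∧ s.i₀ = i₁ ∧ s.i₁ = i₀ ∧
      (s.stage.Pays price →
        ¬s.stage.IsWriting ∧ (getRec (w.recs b) (bif b then i₀ else i₁)).1 < price)
  | _ => False

theorem Wallet.payer_eq (b : Bool) (w : Wallet) (s : WSession) :
    w.payer b s = getRec (w.recs b) (s.household b) := rfl

theorem Wallet.recs_phase_session (w : Wallet) (b : Bool) (ph : WPhase) (s : Option WSession) :
    ({ w with phase := ph, session := s } : Wallet).recs b = w.recs b := by
  cases b <;> rfl

/-- Nothing but a payment changes the record of a registered household, and between the challenge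
transactions the challenge households cannot be used. So a household that is too poor stays so until
its check, where the transaction aborts and the experiment ends with `⊥`; the same happens if the
price differs from the announced one. -/
theorem Wallet.Doomed.move {b : Bool} {w w' : Wallet} (h : w.Doomed b) (hr : w.Registered)
    (hm : Wallet.Move b w w') : w'.Doomed b := by
  unfold Wallet.Doomed at h
  have hph := hr.phase
  cases hq : w.phase with
  | before => simp [hq] at h
  | after => simp [hq] at h
  | first i₀ i₁ price ε₀ =>
    simp only [hq] at h
    obtain ⟨s, hs, rfl, rfl, h⟩ := h
    cases hm with
    | refl => simp only [Wallet.Doomed, hq]; exact ⟨s, hs, rfl, rfl, h⟩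
    | close hs' => simp [Wallet.Doomed, Wallet.close, hq, WPhase.next]
    | read ε hs' hp hw =>
      obtain rfl : s = _ := Option.some.inj (hs.symm.trans hs')
      simp only [Wallet.Doomed, hq]
      refine ⟨_, rfl, rfl, rfl, fun hpr => ?_⟩
      obtain rfl := hpr
      rcases h hp with h | h
      · exact Or.inl ⟨fun h => h, h.2⟩
      · exact Or.inr h
    | write ε r coin hs' hp =>
      obtain rfl : s = _ := Option.some.inj (hs.symm.trans hs')
      simp only [Wallet.Doomed, hq]
      refine ⟨_, rfl, rfl, rfl, fun hpr => ?_⟩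
      obtain rfl := hpr
      rcases h hp.1 with h | h
      · exact absurd h.2 (not_lt.2 (hp.2.resolve_left h.1))
      · exact Or.inr h
    | _ => simp_all
  | between i₀ i₁ price ε₀ =>
    simp only [hq] at h
    obtain ⟨hne, hlow, hses⟩ := h
    rw [hq] at hph
    cases hm with
    | refl => simp only [Wallet.Doomed, hq]; exact ⟨hne, hlow, hses⟩
    | enroll ids bud hs hf =>
      have : (w.enroll ids bud).phase = .between i₀ i₁ price ε₀ := hq
      simp only [Wallet.Doomed, this, Wallet.recs_enroll, getRec_cons]
      -- The new household gets a number above those of the challenge households, so the low balance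
      -- is untouched.
      rw [if_neg (by obtain ⟨h₀, h₁⟩ := hph; cases b <;> simp <;> omega)]
      exact ⟨hne, hlow, hses⟩
    | openCard hs hi hf ha =>
      simp only [Wallet.Doomed, hq]
      refine ⟨hne, hlow, ?_⟩
      rintro s ⟨⟩
      simp only [hq, WPhase.allows, Bool.and_eq_true, bne_iff_ne] at ha
      cases b
      · exact ha.2
      · exact ha.1
    | second hs hph' =>
      obtain ⟨rfl, rfl, rfl, rfl⟩ : i₀ = _ ∧ i₁ = _ ∧ price = _ ∧ ε₀ = _ := by
        simpa using hq.symm.trans hph'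
      simp only [Wallet.Doomed, Wallet.recs_phase_session]
      exact ⟨_, rfl, rfl, rfl, fun _ => ⟨fun h => h, hlow⟩⟩
    | close hs' =>
      have : (w.close none).phase = .between i₀ i₁ price ε₀ := by
        simp [Wallet.close, hq, WPhase.next]
      simp only [Wallet.Doomed, this]
      exact ⟨hne, by cases b <;> exact hlow, by simp [Wallet.close]⟩
    | read ε hs' hp hw =>
      simp only [Wallet.Doomed, hq]
      refine ⟨hne, hlow, ?_⟩
      have := hses _ hs'
      rintro s ⟨⟩
      exact this
    | write ε r coin hs' hp =>
      simp only [Wallet.Doomed, hq]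
      refine ⟨hne, hlow, ?_⟩
      have := hses _ hs'
      rintro s ⟨⟩
      exact this
    | _ => simp_all
  | second i₀ i₁ price ε₀ =>
    simp only [hq] at h
    obtain ⟨s, hs, rfl, rfl, h⟩ := h
    cases hm with
    | refl => simp only [Wallet.Doomed, hq]; exact ⟨s, hs, rfl, rfl, h⟩
    | close hs' => simp [Wallet.Doomed, Wallet.close, hq, WPhase.next]
    | read ε hs' hp hw =>
      obtain rfl : s = _ := Option.some.inj (hs.symm.trans hs')
      simp only [Wallet.Doomed, hq]
      refine ⟨_, rfl, rfl, rfl, fun hpr => ?_⟩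
      obtain rfl := hpr
      exact ⟨fun h => h, (h hp).2⟩
    | write ε r coin hs' hp =>
      obtain rfl : s = _ := Option.some.inj (hs.symm.trans hs')
      simp only [Wallet.Doomed, hq]
      refine ⟨_, rfl, rfl, rfl, fun hpr => ?_⟩
      obtain rfl := hpr
      have h := h hp.1
      exact absurd h.2 (not_lt.2 (hp.2.resolve_left h.1))
    | _ => simp_all
  | _ =>
    rename_i r
    cases r with
    | some g => simp [hq] at h
    | none =>
      simp only [hq] at h
      cases hm <;> simp_all [Wallet.Doomed, WPhase.isFree]

theorem Wallet.pay_phase (ℓ : ℕ) (w : Wallet) (i₀ i₁ p ε : ℕ) :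
    (w.pay ℓ i₀ i₁ p ε).phase = w.phase.next (some (p, ε)) := rfl

theorem Wallet.pay_session (ℓ : ℕ) (w : Wallet) (i₀ i₁ p ε : ℕ) :
    (w.pay ℓ i₀ i₁ p ε).session = none := rfl

/-- A completed payment has passed its check, so the running transaction was not the one with too
low a balance. Either it pays something other than announced and ends the experiment, or the other
challenge household is too poor and its record is not the one that changes. -/
theorem Wallet.Doomed.pay {b : Bool} {w : Wallet} (h : w.Doomed b) {s : WSession}
    (hs : w.session = some s) {p : ℕ} (hp : w.Passes b s p) (ℓ ε : ℕ) :
    (w.pay ℓ s.i₀ s.i₁ p ε).Doomed b := by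
  unfold Wallet.Doomed at h
  cases hq : w.phase with
  | before => simp [hq] at h
  | after => simp [hq] at h
  | first i₀ i₁ price ε₀ =>
    simp only [hq] at h
    obtain ⟨s', hs', rfl, rfl, h⟩ := h
    obtain rfl : s = s' := Option.some.inj (hs.symm.trans hs')
    simp only [Wallet.Doomed, Wallet.pay_phase, hq, WPhase.next]
    split_ifs with hpe
    · simp only [Option.some.injEq, Prod.mk.injEq] at hpe
      obtain ⟨rfl, rfl⟩ := hpe
      rcases h hp.1 with h | h
      · exact absurd h.2 (not_lt.2 (hp.2.resolve_left h.1))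
      · refine ⟨h.1, ?_, by simp [Wallet.pay]⟩
        rw [Wallet.recs_pay, getRec_cons, if_neg]
        · exact h.2
        · have := h.1
          cases b
          · exact this.symm
          · exact this
    · rfl
  | between i₀ i₁ price ε₀ =>
    simp only [hq] at h
    obtain ⟨hne, hlow, hses⟩ := h
    simp only [Wallet.Doomed, Wallet.pay_phase, hq, WPhase.next]
    refine ⟨hne, ?_, by simp [Wallet.pay]⟩
    rw [Wallet.recs_pay, getRec_cons, if_neg (hses s hs).symm]
    exact hlow
  | second i₀ i₁ price ε₀ =>
    simp only [hq] at h
    obtain ⟨s', hs', rfl, rfl, h⟩ := h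
    obtain rfl : s = s' := Option.some.inj (hs.symm.trans hs')
    simp only [Wallet.Doomed, Wallet.pay_phase, hq, WPhase.next]
    split_ifs with hpe
    · simp only [Option.some.injEq, Prod.mk.injEq] at hpe
      obtain ⟨rfl, rfl⟩ := hpe
      have h := h hp.1
      exact absurd h.2 (not_lt.2 (hp.2.resolve_left h.1))
    · rfl
  | _ =>
    rename_i r
    cases r with
    | some g => simp [hq] at h
    | none =>
      simp only [hq] at h
      simp [h] at hs

/-- In world `0` household `i₀`, and in world `1` household `i₁`, has paid once more. -/
def Wallet.Split (ℓ i₀ i₁ price : ℕ) (w : Wallet) : Prop :=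
  ∃ f : ℕ → ℕ × ℕ, price ≤ (f i₀).1 ∧ price ≤ (f i₁).1 ∧
    (∀ j, getRec w.rec₀ j = if j = i₀ then payRec ℓ price (f j) else f j) ∧
    ∀ j, getRec w.rec₁ j = if j = i₁ then payRec ℓ price (f j) else f j

/-- The records of the two worlds differ at most by the first challenge transaction, and the
challenge has not been spoilt yet. -/
def Wallet.Twin (ℓ : ℕ) (w : Wallet) : Prop :=
  match w.phase with
  | .first i₀ i₁ price _ => (∀ j, getRec w.rec₀ j = getRec w.rec₁ j) ∧
      price ≤ (getRec w.rec₁ i₀).1 ∧ price ≤ (getRec w.rec₁ i₁).1 ∧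
      ∃ s, w.session = some s ∧ s.i₀ = i₀ ∧ s.i₁ = i₁ ∧ s.stage.Pays price
  | .between i₀ i₁ price _ => w.Split ℓ i₀ i₁ price ∧
      ∀ s, w.session = some s → s.i₀ = s.i₁ ∧ s.i₀ ≠ i₀ ∧ s.i₀ ≠ i₁
  | .second i₀ i₁ price _ => w.Split ℓ i₀ i₁ price ∧
      ∃ s, w.session = some s ∧ s.i₀ = i₁ ∧ s.i₁ = i₀ ∧ s.stage.Pays price
  | .over _ => w.session = none
  | _ => (∀ j, getRec w.rec₀ j = getRec w.rec₁ j) ∧ ∀ s, w.session = some s → s.i₀ = s.i₁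

theorem Wallet.doomed_of_over {w : Wallet} (h : w.phase = .over none) (hs : w.session = none)
    (b : Bool) : w.Doomed b := by
  unfold Wallet.Doomed
  simp only [h]
  exact hs

theorem Wallet.doomed_close {w : Wallet} (h : w.phase.next none = .over none) (b : Bool) :
    (w.close none).Doomed b :=
  Wallet.doomed_of_over h rfl b

/-- The price `p` is not the one announced. -/
def Wallet.OffPrice (w : Wallet) (p : ℕ) : Prop :=
  match w.phase with
  | .first _ _ price _ => p ≠ price
  | .second _ _ price _ => p ≠ price
  | _ => False

theorem Wallet.OffPrice.next {w : Wallet} {p : ℕ} (h : w.OffPrice p) (ok : Option (ℕ × ℕ))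
    (hok : ∀ x, ok = some x → x.1 = p) : w.phase.next ok = .over none := by
  unfold Wallet.OffPrice at h
  cases hq : w.phase <;> simp only [hq] at h
  all_goals
    refine if_neg ?_
    rintro rfl
    exact h (hok _ rfl).symm

theorem Wallet.OffPrice.doomed_pay {w : Wallet} {p : ℕ} (h : w.OffPrice p) (b : Bool)
    (ℓ i₀ i₁ ε : ℕ) : (w.pay ℓ i₀ i₁ p ε).Doomed b :=
  Wallet.doomed_of_over (h.next _ (by rintro x ⟨⟩; rfl)) rfl b

/-- A challenge transaction at the wrong price can only end in `⊥`, so the clauses of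
`Wallet.Doomed` about the announced price hold vacuously. -/
theorem Wallet.OffPrice.doomed_session {w : Wallet} {p : ℕ} {ℓ : ℕ} (h : w.OffPrice p)
    (ht : w.Twin ℓ) {s : WSession} (hs : w.session = some s) {stage : WStage}
    (hst : ∀ price, stage.Pays price → price = p) (b : Bool) :
    ({ w with session := some ⟨s.i₀, s.i₁, stage⟩ } : Wallet).Doomed b := by
  unfold Wallet.OffPrice at h
  unfold Wallet.Twin at ht
  cases hq : w.phase <;> simp only [hq] at h ht
  · obtain ⟨-, -, -, s', hs', h₀, h₁, -⟩ := ht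
    obtain rfl : s = s' := Option.some.inj (hs.symm.trans hs')
    simp only [Wallet.Doomed]
    exact ⟨_, rfl, h₀, h₁, fun hp => absurd (hst _ hp).symm h⟩
  · obtain ⟨-, s', hs', h₀, h₁, -⟩ := ht
    obtain rfl : s = s' := Option.some.inj (hs.symm.trans hs')
    simp only [Wallet.Doomed]
    exact ⟨_, rfl, h₀, h₁, fun hp => absurd (hst _ hp).symm h⟩

/-- The checks of the balance agree, unless the price is wrong. -/
theorem Wallet.Twin.check {ℓ : ℕ} {w : Wallet} (h : w.Twin ℓ) {s : WSession}
    (hs : w.session = some s) (p : ℕ) :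
    ((w.payer false s).1 < p ↔ (w.payer true s).1 < p) ∨ w.OffPrice p := by
  have key : w.payer false s = getRec w.rec₀ s.i₀ ∧ w.payer true s = getRec w.rec₁ s.i₁ :=
    ⟨rfl, rfl⟩
  rw [key.1, key.2]
  unfold Wallet.Twin at h
  unfold Wallet.OffPrice
  cases hq : w.phase <;> simp only [hq] at h ⊢
  · rw [h.1, h.2 s hs]; simp
  · rename_i price ε
    obtain ⟨h, h₀, h₁, s', hs', rfl, rfl, -⟩ := h
    obtain rfl : s = s' := Option.some.inj (hs.symm.trans hs')
    rw [h]
    by_cases hp : p = price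
    · subst hp
      left
      -- At the announced price both balances are known to suffice, so neither check fails.
      constructor <;> intro <;> omega
    · exact Or.inr hp
  · obtain ⟨⟨f, -, -, h₀, h₁⟩, h⟩ := h
    obtain ⟨k₀, k₁, k₂⟩ := h s hs
    rw [h₀, if_neg k₁, h₁, ← k₀, if_neg k₂]
    simp
  · rename_i price ε
    obtain ⟨⟨f, k₀, k₁, h₀, h₁⟩, s', hs', rfl, rfl, -⟩ := h
    obtain rfl : s = s' := Option.some.inj (hs.symm.trans hs')
    by_cases hp : p = price
    · left
      subst hp
      rw [h₀, h₁]
      by_cases he : s.i₀ = s.i₁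
      · simp [he]
      · rw [if_neg he, if_neg (Ne.symm he)]
        constructor <;> intro <;> omega
    · exact Or.inr hp
  · rw [h.1, h.2 s hs]; simp
  · simp [h] at hs

/-- Moves other than payments act on both tables alike. The pair of worlds is lost in three
situations: at an announcement with too low a balance, when a challenge transaction is closed
unsuccessfully, and when a challenge card is given a wrong price; each dooms both orders. -/
theorem Wallet.Twin.move {ℓ : ℕ} {b : Bool} {w w' : Wallet} (h : w.Twin ℓ) (hr : w.Registered)
    (hm : Wallet.Move b w w') : w'.Twin ℓ ∨ ∀ c, w'.Doomed c := by
  have hph := hr.phase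
  have h' := h
  unfold Wallet.Twin at h
  cases hm with
  | refl => exact Or.inl h'
  | enroll ids bud hs hf =>
    have hq' : (w.enroll ids bud).phase = w.phase := rfl
    have hs' : (w.enroll ids bud).session = none := hs
    have e₀ : (w.enroll ids bud).rec₀ = (w.nextId, (bud, 0)) :: w.rec₀ := rfl
    have e₁ : (w.enroll ids bud).rec₁ = (w.nextId, (bud, 0)) :: w.rec₁ := rfl
    left
    unfold Wallet.Twin
    rw [hq']
    cases hq : w.phase <;> simp only [hq] at h hph ⊢ <;> try simp [hq, WPhase.isFree] at hf
    · refine ⟨fun j => ?_, by simp [hs']⟩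
      rw [e₀, e₁, getRec_cons, getRec_cons, h.1]
    · refine ⟨?_, by simp [hs']⟩
      obtain ⟨⟨f, k₀, k₁, h₀, h₁⟩, -⟩ := h
      obtain ⟨l₀, l₁⟩ := hph
      -- The common records `f` are extended by the new household, which has paid in neither world;
      -- the challenge households have smaller numbers and keep their values.
      refine ⟨fun j => if j = w.nextId then (bud, 0) else f j, ?_, ?_, fun j => ?_, fun j => ?_⟩
      · dsimp only
        rwa [if_neg (by omega)]
      · dsimp only
        rwa [if_neg (by omega)]
      · dsimp only
        rw [e₀, getRec_cons, h₀]
        split_ifs <;> first | rfl | omega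
      · dsimp only
        rw [e₁, getRec_cons, h₁]
        split_ifs <;> first | rfl | omega
    · refine ⟨fun j => ?_, by simp [hs']⟩
      rw [e₀, e₁, getRec_cons, getRec_cons, h.1]
  | openCard hs hi hf ha =>
    left
    unfold Wallet.Twin
    cases hq : w.phase <;> simp only [hq] at h ⊢ <;> try simp [hq, WPhase.isFree] at hf
    · exact ⟨h.1, by rintro s ⟨⟩; rfl⟩
    · simp only [hq, WPhase.allows, Bool.and_eq_true, bne_iff_ne] at ha
      exact ⟨h.1, by rintro s ⟨⟩; exact ⟨rfl, ha⟩⟩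
    · exact ⟨h.1, by rintro s ⟨⟩; rfl⟩
  | announce price ε hs hq h₀ h₁ =>
    rename_i t₀ t₁ i₀ i₁
    simp only [hq] at h
    by_cases hlow : price ≤ (getRec w.rec₁ i₀).1 ∧ price ≤ (getRec w.rec₁ i₁).1
    · exact Or.inl ⟨h.1, hlow.1, hlow.2, _, rfl, rfl, rfl, trivial⟩
    -- Some challenge household cannot pay. In one order its transaction comes first and fails at
    -- once, in the other order it comes second and fails then: the games may diverge, but neither
    -- reaches a guess. If both cards belong to one household, the first transaction fails in either
    -- order.
    · right
      intro c
      refine ⟨_, rfl, rfl, rfl, fun _ => ?_⟩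
      have hrec : ∀ j, getRec (w.recs c) j = getRec w.rec₁ j := by
        intro j
        cases c
        · exact h.1 j
        · rfl
      rw [Wallet.recs_phase_session, hrec, hrec]
      by_cases he : i₀ = i₁
      · subst he
        left
        simp only [and_self, not_le] at hlow
        refine ⟨fun h => h, ?_⟩
        cases c <;> exact hlow
      · rw [not_and_or, not_le, not_le] at hlow
        cases c <;> rcases hlow with hlow | hlow
        · exact Or.inl ⟨fun h => h, hlow⟩
        · exact Or.inr ⟨he, hlow⟩
        · exact Or.inr ⟨he, hlow⟩
        · exact Or.inl ⟨fun h => h, hlow⟩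
  | giveUp hs hq => exact Or.inl hs
  | second hs hq =>
    simp only [hq] at h
    exact Or.inl ⟨h.1, _, rfl, rfl, rfl, trivial⟩
  | guess g hs hq => exact Or.inl hs
  | close hs =>
    have hq' : (w.close none).phase = w.phase.next none := rfl
    have hs' : (w.close none).session = none := rfl
    cases hq : w.phase <;> simp only [hq] at h
    · left
      simp only [Wallet.Twin, hq', hq, WPhase.next]
      exact ⟨h.1, by simp [hs']⟩
    · exact Or.inr fun c => Wallet.doomed_close (by simp [hq, WPhase.next]) c
    · left
      simp only [Wallet.Twin, hq', hq, WPhase.next]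
      exact ⟨h.1, by simp [hs']⟩
    · exact Or.inr fun c => Wallet.doomed_close (by simp [hq, WPhase.next]) c
    · left
      simp only [Wallet.Twin, hq', hq, WPhase.next]
      exact ⟨h.1, by simp [hs']⟩
    · simp [h] at hs
  | read ε hs hp hw =>
    rename_i s p
    by_cases ho : w.OffPrice p
    · exact Or.inr fun c => ho.doomed_session h' hs (stage := .reading p ε) (fun _ h => Eq.symm h) c
    · left
      unfold Wallet.OffPrice at ho
      unfold Wallet.Twin
      cases hq : w.phase <;> simp only [hq, ne_eq, not_not] at h ho ⊢
      · exact ⟨h.1, by have := h.2 s hs; rintro s ⟨⟩; exact this⟩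
      · obtain ⟨k₁, k₂, k₃, s', hs', h₀, h₁, -⟩ := h
        obtain rfl : s = s' := Option.some.inj (hs.symm.trans hs')
        exact ⟨k₁, k₂, k₃, _, rfl, h₀, h₁, ho⟩
      · exact ⟨h.1, by have := h.2 s hs; rintro s ⟨⟩; exact this⟩
      · obtain ⟨k₁, s', hs', h₀, h₁, -⟩ := h
        obtain rfl : s = s' := Option.some.inj (hs.symm.trans hs')
        exact ⟨k₁, _, rfl, h₀, h₁, ho⟩
      · exact ⟨h.1, by have := h.2 s hs; rintro s ⟨⟩; exact this⟩
      · simp [h] at hs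
  | write ε r coin hs hp =>
    rename_i s p
    by_cases ho : w.OffPrice p
    · exact Or.inr fun c => ho.doomed_session h' hs (stage := .writing p ε r coin)
        (fun _ h => Eq.symm h) c
    · left
      unfold Wallet.OffPrice at ho
      unfold Wallet.Twin
      cases hq : w.phase <;> simp only [hq, ne_eq, not_not] at h ho ⊢
      · exact ⟨h.1, by have := h.2 s hs; rintro s ⟨⟩; exact this⟩
      · obtain ⟨k₁, k₂, k₃, s', hs', h₀, h₁, -⟩ := h
        obtain rfl : s = s' := Option.some.inj (hs.symm.trans hs')
        exact ⟨k₁, k₂, k₃, _, rfl, h₀, h₁, ho⟩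
      · exact ⟨h.1, by have := h.2 s hs; rintro s ⟨⟩; exact this⟩
      · obtain ⟨k₁, s', hs', h₀, h₁, -⟩ := h
        obtain rfl : s = s' := Option.some.inj (hs.symm.trans hs')
        exact ⟨k₁, _, rfl, h₀, h₁, ho⟩
      · exact ⟨h.1, by have := h.2 s hs; rintro s ⟨⟩; exact this⟩
      · simp [h] at hs

/-- Outside the challenge the same household pays in both worlds. The first challenge payment splits
the tables, and the second makes them equal again, because each challenge household has then paid
the same amount and advanced its counter once in either world (twice, if they are the same
household). -/
theorem Wallet.Twin.pay {ℓ : ℕ} {w : Wallet} (h : w.Twin ℓ) {s : WSession}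
    (hs : w.session = some s) (p ε : ℕ) :
    (w.pay ℓ s.i₀ s.i₁ p ε).Twin ℓ ∨ ∀ c, (w.pay ℓ s.i₀ s.i₁ p ε).Doomed c := by
  have hs' := w.pay_session ℓ s.i₀ s.i₁ p ε
  have e₀ : (w.pay ℓ s.i₀ s.i₁ p ε).rec₀ = (s.i₀, payRec ℓ p (getRec w.rec₀ s.i₀)) :: w.rec₀ := rfl
  have e₁ : (w.pay ℓ s.i₀ s.i₁ p ε).rec₁ = (s.i₁, payRec ℓ p (getRec w.rec₁ s.i₁)) :: w.rec₁ := rfl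
  have hlost : w.phase.next (some (p, ε)) = .over none →
      ∀ c, (w.pay ℓ s.i₀ s.i₁ p ε).Doomed c := by
    exact fun h c => Wallet.doomed_of_over h hs' c
  have hsame : (∀ j, getRec w.rec₀ j = getRec w.rec₁ j) → s.i₀ = s.i₁ → ∀ j,
      getRec (w.pay ℓ s.i₀ s.i₁ p ε).rec₀ j = getRec (w.pay ℓ s.i₀ s.i₁ p ε).rec₁ j := by
    intro h hi j
    rw [e₀, e₁, getRec_cons, getRec_cons, h, h, hi]
  unfold Wallet.Twin at h
  cases hq : w.phase with
  | before =>
    simp only [hq] at h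
    left
    simp only [Wallet.Twin, Wallet.pay_phase, hq, WPhase.next]
    exact ⟨hsame h.1 (h.2 s hs), by simp [hs']⟩
  | after =>
    simp only [hq] at h
    left
    simp only [Wallet.Twin, Wallet.pay_phase, hq, WPhase.next]
    exact ⟨hsame h.1 (h.2 s hs), by simp [hs']⟩
  | first i₀ i₁ price ε₀ =>
    simp only [hq] at h
    obtain ⟨k₁, k₂, k₃, s', hs'', rfl, rfl, -⟩ := h
    obtain rfl : s = s' := Option.some.inj (hs.symm.trans hs'')
    by_cases hpe : some (p, ε) = some (price, ε₀)
    · left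
      simp only [Wallet.Twin, Wallet.pay_phase, hq, WPhase.next, if_pos hpe]
      simp only [Option.some.injEq, Prod.mk.injEq] at hpe
      obtain ⟨rfl, rfl⟩ := hpe
      -- The common records are those before the first challenge transaction, where the two tables
      -- agree.
      refine ⟨⟨getRec w.rec₁, k₂, k₃, fun j => ?_, fun j => ?_⟩, by simp [hs']⟩
      · rw [e₀, getRec_cons, k₁, k₁]
        split_ifs with hj
        · rw [hj]
        · rfl
      · rw [e₁, getRec_cons]
        split_ifs with hj
        · rw [hj]
        · rfl
    · exact Or.inr (hlost (by simp only [hq, WPhase.next, if_neg hpe]))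
  | between i₀ i₁ price ε₀ =>
    simp only [hq] at h
    obtain ⟨⟨f, k₀, k₁, h₀, h₁⟩, h⟩ := h
    obtain ⟨l₀, l₁, l₂⟩ := h s hs
    left
    simp only [Wallet.Twin, Wallet.pay_phase, hq, WPhase.next]
    -- A third household pays. Its payment is the same in both worlds and commutes with those of the
    -- challenge households, so it can be made in the common records.
    refine ⟨⟨fun j => if j = s.i₀ then payRec ℓ p (f j) else f j, ?_, ?_, fun j => ?_, fun j => ?_⟩,
      by simp [hs']⟩
    · dsimp only
      rwa [if_neg l₁.symm]
    · dsimp only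
      rwa [if_neg l₂.symm]
    · rw [e₀, getRec_cons, h₀, h₀, if_neg l₁]
      by_cases hj : j = s.i₀
      · simp [hj, l₁]
      · simp [hj]
    · rw [e₁, getRec_cons, h₁, h₁, ← l₀, if_neg l₂]
      by_cases hj : j = s.i₀
      · simp [hj, l₂]
      · simp [hj]
  | second i₀ i₁ price ε₀ =>
    simp only [hq] at h
    obtain ⟨⟨f, k₀, k₁, h₀, h₁⟩, s', hs'', rfl, rfl, -⟩ := h
    obtain rfl : s = s' := Option.some.inj (hs.symm.trans hs'')
    by_cases hpe : some (p, ε) = some (price, ε₀)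
    · left
      simp only [Wallet.Twin, Wallet.pay_phase, hq, WPhase.next, if_pos hpe]
      simp only [Option.some.injEq, Prod.mk.injEq] at hpe
      obtain ⟨rfl, rfl⟩ := hpe
      refine ⟨fun j => ?_, by simp [hs']⟩
      rw [e₀, e₁, getRec_cons, getRec_cons, h₀, h₀, h₁, h₁]
      -- With one household for both cards the tables agree even between the transactions; otherwise
      -- each world now adds the payment that the other one had already seen.
      by_cases hi : s.i₀ = s.i₁
      · simp [hi]
      · by_cases hj₀ : j = s.i₀
        · subst hj₀
          simp [hi]
        · by_cases hj₁ : j = s.i₁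
          · subst hj₁
            simp [Ne.symm hi]
          · simp [hj₀, hj₁]
    · exact Or.inr (hlost (by simp only [hq, WPhase.next, if_neg hpe]))
  | _ =>
    simp only [hq] at h
    simp [h] at hs

/-- A guess ends the experiment. -/
def GuessEnds (w : Wallet) (o : ORAMState) : Prop :=
  ∀ g, o.guess = some g → w.phase = .over (some g)

theorem Wallet.Move.phase_over {b : Bool} {w w' : Wallet} (hm : Wallet.Move b w w')
    {r : Option Bool} (h : w.phase = .over r) : w'.phase = .over r := by
  cases hm <;> simp_all [WPhase.isFree, Wallet.close, WPhase.next]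

theorem GuessEnds.done {b : Bool} {w w' : Wallet} {o o' : ORAMState} {m : Val}
    (h : GuessEnds w o) (hm : (Out.done w' o' m).From b w o) : GuessEnds w' o' := by
  intro g hg
  obtain ⟨hm, h' | ⟨g', h₁, h₂⟩⟩ := hm
  · exact hm.phase_over (h g (h'.symm.trans hg))
  · obtain rfl : g' = g := Option.some.inj (h₁.symm.trans hg)
    exact h₂

theorem GuessEnds.pay {w : Wallet} {o o' : ORAMState} (h : GuessEnds w o)
    (ho : o'.guess = o.guess) (ℓ i₀ i₁ p ε : ℕ) : GuessEnds (w.pay ℓ i₀ i₁ p ε) o' := by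
  intro g hg
  rw [Wallet.pay_phase, h g (ho.symm.trans hg)]
  rfl

/-- The experiment will not reach a guess. -/
def DoomedState (b : Bool) (s : Wallet × (ORAMState × PRFState)) : Prop :=
  s.1.Doomed b ∧ s.1.Registered ∧ GuessEnds s.1 s.2.1

/-- A recorded guess would put the experiment into the phase that ends with a guess, which
`Wallet.Doomed` excludes. -/
theorem DoomedState.guess {b : Bool} {s : Wallet × (ORAMState × PRFState)} (h : DoomedState b s) :
    s.2.1.guess ≠ some true := by
  intro hg
  have := h.2.2 _ hg
  have hd := h.1
  simp [Wallet.Doomed, this] at hd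

/-! ### One message in the games that differ only in the deciding table -/

section Step
variable {Y : System N} {b β : Bool} {ℓ : ℕ} {tok : PRFState → Val → PMF (PRFState × Val)}
  {w : Wallet} {o : ORAMState} {p : PRFState}

theorem DoomedState.finish {out : Out} (hr : w.Registered) (hg : GuessEnds w o)
    (hfrom : out.From b w o)
    (hdone : ∀ w' o' m, out = .done w' o' m → w'.Doomed b)
    (hpay : ∀ s p ε, w.session = some s → w.Passes b s p → (∃ o' r coin msgs,
      out = .pay w o' s.i₀ s.i₁ p ε r coin msgs) → (w.pay ℓ s.i₀ s.i₁ p ε).Doomed b)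
    {x : (Wallet × (ORAMState × PRFState)) × Val}
    (hx : x ∈ (Y.finish tok β ℓ p out).support) : DoomedState b x.1 := by
  rcases out with ⟨w', o', m⟩ | ⟨w', o', i₀, i₁, price, ε, r, coin, msgs⟩
  · simp only [System.finish, PMF.support_pure, Set.mem_singleton_iff] at hx
    subst hx
    exact ⟨hdone _ _ _ rfl, hr.move hfrom.1, hg.done hfrom⟩
  · obtain ⟨rfl, hgu, s, hs, rfl, rfl, hp⟩ := hfrom
    simp only [System.finish, PMF.mem_support_map_iff] at hx
    obtain ⟨t, -, rfl⟩ := hx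
    exact ⟨hpay s price ε hs hp ⟨_, _, _, _, rfl⟩, hr.pay _ _ _ _ _, hg.pay hgu _ _ _ _ _⟩

/-- Doomed states are absorbing, whatever the adversary sends. This permits them as the lost pairs
of the coupling, with the two sides running independently. -/
theorem DoomedState.respond {s : Wallet × (ORAMState × PRFState)} (h : DoomedState b s) (a : Val)
    {x : (Wallet × (ORAMState × PRFState)) × Val}
    (hx : x ∈ ((Y.walletGame tok b β ℓ).respond s a).support) : DoomedState b x.1 := by
  obtain ⟨w, o, p⟩ := s
  obtain ⟨hd, hr, hg⟩ := h
  obtain ⟨out, hout, hx⟩ := (PMF.mem_support_bind_iff _ _ _).1 hx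
  have hfrom := walletStep_from hout
  refine DoomedState.finish hr hg hfrom ?_ (fun s p ε hs hp _ => hd.pay hs hp ℓ ε) hx
  rintro w' o' m rfl
  exact hd.move hr hfrom.1

/-- At a wrong price every outcome of the step, be it an abort, a continued access or even a
completed payment, leaves the challenge without hope. -/
theorem DoomedState.of_offPrice {s : WSession} {price : ℕ} (ht : w.Twin ℓ) (hr : w.Registered)
    (hg : GuessEnds w o) (hs : w.session = some s) (ho : w.OffPrice price)
    (hst : s.stage.Pays price) {out : Out}
    (hout : out.FromSession b w o s price) {x : (Wallet × (ORAMState × PRFState)) × Val}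
    (hx : x ∈ (Y.finish tok β ℓ p out).support) : DoomedState b x.1 := by
  refine DoomedState.finish hr hg (hout.from hs hst) ?_ ?_ hx
  · rintro w' o' m rfl
    obtain ⟨-, rfl | ⟨-, ε, rfl⟩ | ⟨-, ε, r, coin, rfl⟩⟩ := hout
    · exact Wallet.doomed_close (ho.next none (by simp)) b
    · exact ho.doomed_session ht hs (stage := .reading price ε) (fun _ h => Eq.symm h) b
    · exact ho.doomed_session ht hs (stage := .writing price ε r coin) (fun _ h => Eq.symm h) b
  · rintro s' p' ε hs' - ⟨o', r, coin, msgs, rfl⟩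
    obtain ⟨-, -, -, -, rfl, -⟩ := hout
    exact ho.doomed_pay b ℓ _ _ ε

/-- The states stay equal, or both experiments are lost. -/
def TwinRel (ℓ : ℕ) (s t : Wallet × (ORAMState × PRFState)) : Prop :=
  s = t ∧ s.1.Twin ℓ ∧ s.1.Registered ∧ GuessEnds s.1 s.2.1

def TwinAnswer (ℓ : ℕ) (x y : (Wallet × (ORAMState × PRFState)) × Val) : Prop :=
  (TwinRel ℓ x.1 y.1 ∧ x.2 = y.2) ∨ (DoomedState false x.1 ∧ DoomedState true y.1)

/-- Once the outcome of the step is the same in both games, so is the new state and the answer; it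
remains to see that the state is again twin or is doomed for both orders. -/
theorem twin_finish {out : Out} (ht : w.Twin ℓ) (hr : w.Registered) (hg : GuessEnds w o)
    (hfrom : out.From b w o) :
    Coupled (TwinAnswer ℓ) (Y.finish tok β ℓ p out) (Y.finish tok β ℓ p out) := by
  rcases out with ⟨w', o', m⟩ | ⟨w', o', i₀, i₁, price, ε, r, coin, msgs⟩
  · have hr' := hr.move hfrom.1
    have hg' := hg.done hfrom
    refine Coupled.pure ?_
    rcases ht.move hr hfrom.1 with h | h
    · exact Or.inl ⟨⟨rfl, h, hr', hg'⟩, rfl⟩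
    · exact Or.inr ⟨⟨h _, hr', hg'⟩, ⟨h _, hr', hg'⟩⟩
  · obtain ⟨rfl, hgu, s, hs, rfl, rfl, hp⟩ := hfrom
    have hr' := hr.pay ℓ s.i₀ s.i₁ price ε
    have hg' := hg.pay hgu ℓ s.i₀ s.i₁ price ε
    refine Coupled.map_same _ fun t _ => ?_
    rcases ht.pay hs price ε with h | h
    · exact Or.inl ⟨⟨rfl, h, hr', hg'⟩, rfl⟩
    · exact Or.inr ⟨⟨h _, hr', hg'⟩, ⟨h _, hr', hg'⟩⟩

/-- The deciding table enters only through the comparison of the balance with the price. If the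
comparisons agree, the two steps are literally the same distribution. -/
theorem twin_cardRead {s : WSession} {price ε : ℕ} (ht : w.Twin ℓ) (hr : w.Registered)
    (hg : GuessEnds w o) (hs : w.session = some s) (hp : s.stage.Pays price)
    (hw : ¬s.stage.IsWriting) {o' : ORAMState} (ho' : o'.guess = o.guess) (op : Op)
    (res : AccessResult) :
    Coupled (TwinAnswer ℓ)
      ((Y.cardRead false β ℓ w o' op s.i₀ s.i₁ price ε res).bind (Y.finish tok β ℓ p))
      ((Y.cardRead true β ℓ w o' op s.i₀ s.i₁ price ε res).bind (Y.finish tok β ℓ p)) := by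
  rcases ht.check hs price with h | h
  · have : Y.cardRead false β ℓ w o' op s.i₀ s.i₁ price ε res =
        Y.cardRead true β ℓ w o' op s.i₀ s.i₁ price ε res := by
      cases res with
      | wait a c => rfl
      | fail t => rfl
      | done db c out t =>
        simp only [System.cardRead]
        by_cases hlt : (w.payer false s).1 < price
        · exact (if_pos hlt).trans (if_pos (h.1 hlt)).symm
        · exact (if_neg hlt).trans (if_neg fun h' => hlt (h.2 h')).symm
    rw [this]
    exact Coupled.bind_same _ fun out hout =>
      twin_finish ht hr hg ((cardRead_from hp hw ho' _ _ hout).from hs hp)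
  -- At a wrong price one card may go on while the other aborts, so the answers can differ. Both
  -- games are lost by this step, and nothing has to be matched.
  · refine Coupled.prod fun x hx y hy => Or.inr ⟨?_, ?_⟩
    · obtain ⟨out, hout, hx⟩ := (PMF.mem_support_bind_iff _ _ _).1 hx
      exact DoomedState.of_offPrice ht hr hg hs h hp (cardRead_from hp hw ho' _ _ hout) hx
    · obtain ⟨out, hout, hy⟩ := (PMF.mem_support_bind_iff _ _ _).1 hy
      exact DoomedState.of_offPrice ht hr hg hs h hp (cardRead_from hp hw ho' _ _ hout) hy

/-- Only the end of a read access consults the deciding table. All other messages are answered by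
the same function in both games. -/
theorem twin_respond (ht : w.Twin ℓ) (hr : w.Registered) (hg : GuessEnds w o) (a : Val) :
    Coupled (TwinAnswer ℓ)
      ((Y.walletStep false β ℓ w o a).bind (Y.finish tok β ℓ p))
      ((Y.walletStep true β ℓ w o a).bind (Y.finish tok β ℓ p)) := by
  have hsame : Y.walletStep false β ℓ w o a = Y.walletStep true β ℓ w o a → Coupled (TwinAnswer ℓ)
      ((Y.walletStep false β ℓ w o a).bind (Y.finish tok β ℓ p))
      ((Y.walletStep true β ℓ w o a).bind (Y.finish tok β ℓ p)) := by
    intro h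
    rw [h]
    exact Coupled.bind_same _ fun out hout => twin_finish ht hr hg (walletStep_from hout)
  rcases hs : w.session with _ | s
  · exact hsame (by simp only [System.walletStep, hs])
  · by_cases ha : ∃ m, a = .pair (.nat 4) m
    · obtain ⟨m, rfl⟩ := ha
      rcases s with ⟨i₀, i₁, stage⟩
      cases stage with
      | start =>
        by_cases hm : ∃ price ε, m = .pair (.nat price) (.nat ε)
        · obtain ⟨price, ε, rfl⟩ := hm
          simp only [System.walletStep, hs, System.walletCard, PMF.bind_bind]
          exact Coupled.bind_same _ fun x _ =>
            twin_cardRead ht hr hg hs trivial (fun h => h) rfl _ _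
        · refine hsame ?_
          simp only [System.walletStep, hs, System.walletCard]
          split
          · exact (hm ⟨_, _, rfl⟩).elim
          all_goals simp_all
      | reading price ε =>
        rcases hso : o.session with _ | ⟨acc, c⟩
        · exact hsame (by simp only [System.walletStep, hs, System.walletCard, hso])
        · simp only [System.walletStep, hs, System.walletCard, hso]
          refine twin_cardRead ht hr hg hs rfl (fun h => h) ?_ _ _
          rfl
      | writing price ε r coin =>
        refine hsame ?_
        rcases hso : o.session with _ | ⟨acc, c⟩ <;>
          simp only [System.walletStep, hs, System.walletCard, hso]
    · refine hsame ?_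
      simp only [System.walletStep, hs]
      split
      · exact (ha ⟨_, rfl⟩).elim
      · rfl

end Step

/-- With the same accesses, the order of the challenge transactions makes no difference. -/
theorem walletGame_order (Y : System N) (tok : PRFState → Val → PMF (PRFState × Val)) (β : Bool)
    (A : Adversary) (ℓ : ℕ) :
    (Y.walletGame tok false β ℓ).prob A ℓ (fun s => s.2.1.guess == some true && !s.2.1.rewound) =
      (Y.walletGame tok true β ℓ).prob A ℓ
        (fun s => s.2.1.guess == some true && !s.2.1.rewound) := by
  rw [Game.prob_eq_pr, Game.prob_eq_pr]
  refine (Game.run_coupled (D := fun s t => DoomedState false s ∧ DoomedState true t)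
    (R := fun _ => TwinRel ℓ) ?_ ?_ (fun _ _ _ h => h) ?_).pr_eq ?_
  · refine Coupled.bind_same _ fun v _ => Coupled.bind_same _ fun K _ =>
      Coupled.bind_same _ fun pp _ => Coupled.map_same _ fun k _ => ⟨⟨rfl, ?_, .initial _ _ _, ?_⟩, rfl⟩
    · exact ⟨fun _ => rfl, by simp⟩
    · intro g hg
      simp [ORAMState.init] at hg
  · exact fun s t h a => ⟨fun x hx => ⟨h.1.respond a hx, h.2⟩, fun y hy => ⟨h.1, h.2.respond a hy⟩⟩
  · rintro i ⟨w, o, p⟩ t a hi ⟨rfl, ht, hr, hg⟩ - -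
    exact twin_respond ht hr hg a
  · rintro s t (⟨rfl, -⟩ | ⟨h₁, h₂⟩)
    · rfl
    · have k₁ : (s.2.1.guess == some true) = false := by simpa using h₁.guess
      have k₂ : (t.2.1.guess == some true) = false := by simpa using h₂.guess
      rw [k₁, k₂, Bool.false_and, Bool.false_and]

/-! ### The experiment and the experiment with ideal memory -/

/-- The events that the ORAM challenger has noted are kept. -/
structure ORAMState.FlagsLe (o o' : ORAMState) : Prop where
  wrong : o.wrong = true → o'.wrong = true
  broken : o.broken = true → o'.broken = true
  rewound : o.rewound = true → o'.rewound = true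

theorem ORAMState.FlagsLe.refl (o : ORAMState) : o.FlagsLe o := ⟨id, id, id⟩

theorem ORAMState.FlagsLe.trans {o o' o'' : ORAMState} (h : o.FlagsLe o') (h' : o'.FlagsLe o'') :
    o.FlagsLe o'' :=
  ⟨h'.wrong ∘ h.wrong, h'.broken ∘ h.broken, h'.rewound ∘ h.rewound⟩

theorem ORAMState.flagsLe_after (o : ORAMState) (op : Op) (res : AccessResult) :
    o.FlagsLe (o.after op res).1 := by
  cases res with
  | wait a c => exact ⟨id, id, id⟩
  | done db c out t => exact ⟨fun h => by simp [ORAMState.after, h],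
      fun h => by simp [ORAMState.after, h], fun h => h⟩
  | fail t => exact ⟨fun h => by simp [ORAMState.after, h], fun h => h, fun h => h⟩

theorem ORAMState.flagsLe_rewound (o : ORAMState) (r : Bool) :
    o.FlagsLe { o with rewound := o.rewound || r } :=
  ⟨fun h => h, fun h => h, fun h => by simp [h]⟩

/-- The state of the ORAM challenger after a step. -/
def Out.oram : Out → ORAMState
  | .done _ o _ => o
  | .pay _ o _ _ _ _ _ _ _ => o

section Flags
variable {Y : System N} {b β : Bool} {ℓ : ℕ} {w : Wallet} {o : ORAMState}

theorem finish_oram {tok : PRFState → Val → PMF (PRFState × Val)} {p : PRFState} {out : Out}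
    {x : (Wallet × (ORAMState × PRFState)) × Val} (hx : x ∈ (Y.finish tok β ℓ p out).support) :
    x.1.2.1 = out.oram := by
  rcases out with ⟨w', o', m⟩ | ⟨w', o', i₀, i₁, price, ε, r, coin, msgs⟩
  · simp only [System.finish, PMF.support_pure, Set.mem_singleton_iff] at hx
    rw [hx]; rfl
  · simp only [System.finish, PMF.mem_support_map_iff] at hx
    obtain ⟨t, -, rfl⟩ := hx
    rfl

theorem cardWrite_oram (w : Wallet) (o : ORAMState) (op : Op) (i₀ i₁ p ε r coin : ℕ)
    (pre : List Val) (res : AccessResult) :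
    (cardWrite w o op i₀ i₁ p ε r coin pre res).oram = (o.after op res).1 := by
  cases res <;> rfl

theorem cardRead_flags {op : Op} {i₀ i₁ p ε : ℕ} {res : AccessResult} {out : Out}
    (hout : out ∈ (Y.cardRead b β ℓ w o op i₀ i₁ p ε res).support) :
    (o.after op res).1.FlagsLe out.oram := by
  cases res with
  | wait a c =>
    simp only [System.cardRead, PMF.support_pure, Set.mem_singleton_iff] at hout
    rw [hout]
    exact .refl _
  | done db c v t =>
    simp only [System.cardRead] at hout
    split_ifs at hout with hlt
    · simp only [PMF.support_pure, Set.mem_singleton_iff] at hout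
      rw [hout]
      exact .refl _
    · simp only [PMF.mem_support_bind_iff, PMF.mem_support_map_iff] at hout
      obtain ⟨r, -, coin, -, x, -, rfl⟩ := hout
      rw [cardWrite_oram]
      exact ORAMState.flagsLe_after _ _ _
  | fail t =>
    simp only [System.cardRead, PMF.support_pure, Set.mem_singleton_iff] at hout
    rw [hout]
    exact .refl _

theorem ORAMState.flagsLe_afterHonest (o : ORAMState) (i d : ℕ) (r : Option Val) :
    o.FlagsLe (o.afterHonest i d r) := by
  cases r with
  | none => exact ⟨fun h => by simp [ORAMState.afterHonest, h], fun h => h, fun h => h⟩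
  | some db => exact ⟨id, id, id⟩

theorem walletFree_flags {msg : Val} {out : Out}
    (hout : out ∈ (Y.walletFree ℓ w o msg).support) : o.FlagsLe out.oram := by
  have hstay : ∀ w' o' m, out ∈ (PMF.pure (Out.done w' o' m)).support → o'.wrong = o.wrong →
      o'.broken = o.broken → o'.rewound = o.rewound → o.FlagsLe out.oram := by
    intro w' o' m hout h₁ h₂ h₃
    rw [PMF.support_pure, Set.mem_singleton_iff] at hout
    subst hout
    exact ⟨h₁.trans, h₂.trans, h₃.trans⟩
  unfold System.walletFree System.walletRegister at hout
  split at hout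
  · split_ifs at hout with hf
    · simp only [PMF.mem_support_bind_iff] at hout
      obtain ⟨r, -, coin, -, hout⟩ := hout
      split_ifs at hout
      · simp only [PMF.mem_support_map_iff] at hout
        obtain ⟨x, -, rfl⟩ := hout
        split
        · exact o.flagsLe_afterHonest _ _ (some _)
        · exact o.flagsLe_afterHonest w.nextId 0 none
      · exact hstay _ _ _ hout rfl rfl rfl
    · exact hstay _ _ _ hout rfl rfl rfl
    · exact hstay _ _ _ hout rfl rfl rfl
  · split at hout
    · split_ifs at hout <;> exact hstay _ _ _ hout rfl rfl rfl
    · exact hstay _ _ _ hout rfl rfl rfl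
  · split at hout
    · split at hout <;> exact hstay _ _ _ hout rfl rfl rfl
    · exact hstay _ _ _ hout rfl rfl rfl
  · split at hout <;> exact hstay _ _ _ hout rfl rfl rfl
  · split at hout
    · exact hstay _ _ _ hout rfl rfl rfl
    · exact hstay _ _ _ hout rfl rfl rfl
  · exact hstay _ _ _ hout rfl rfl rfl

/-- Makes ORAM failures and rewinding permanent, so that pairs of runs lost because of them stay
lost. -/
theorem walletStep_flags {msg : Val} {out : Out}
    (hout : out ∈ (Y.walletStep b β ℓ w o msg).support) : o.FlagsLe out.oram := by
  unfold System.walletStep at hout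
  split at hout
  · exact walletFree_flags hout
  · have hclose : ∀ w' m, out = .done w' { o with session := none } m → o.FlagsLe out.oram := by
      rintro w' m rfl
      exact ⟨id, id, id⟩
    split at hout
    · unfold System.walletCard at hout
      split at hout
      · rw [PMF.mem_support_bind_iff] at hout
        obtain ⟨x, -, hout⟩ := hout
        exact (o.flagsLe_after _ _).trans (cardRead_flags hout)
      · exact (o.flagsLe_rewound _).trans
          ((ORAMState.flagsLe_after _ _ _).trans (cardRead_flags hout))
      · rw [PMF.support_pure, Set.mem_singleton_iff] at hout
        rw [hout, cardWrite_oram]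
        exact (o.flagsLe_rewound _).trans (ORAMState.flagsLe_after _ _ _)
      · rw [PMF.support_pure, Set.mem_singleton_iff] at hout
        exact hclose _ _ hout
    · rw [PMF.support_pure, Set.mem_singleton_iff] at hout
      exact hclose _ _ hout

theorem walletGame_flags {tok : PRFState → Val → PMF (PRFState × Val)}
    {s : Wallet × (ORAMState × PRFState)} {a : Val}
    {x : (Wallet × (ORAMState × PRFState)) × Val}
    (hx : x ∈ ((Y.walletGame tok b β ℓ).respond s a).support) : s.2.1.FlagsLe x.1.2.1 := by
  obtain ⟨out, hout, hx⟩ := (PMF.mem_support_bind_iff _ _ _).1 hx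
  rw [finish_oram hx]
  exact walletStep_flags hout

end Flags

/-! ### The answers of the experiment, case by case -/

section Experiment
variable {Y : System N} {b : Bool} {ℓ : ℕ} {s : ExpState}

/-- The answers of the experiment. -/
noncomputable def System.answer (Y : System N) (b : Bool) (ℓ : ℕ) (s : ExpState) (a : Val) :
    PMF (ExpState × Val) := (Y.experiment b ℓ).respond s a

/-- The experiment with its fields made visible. -/
@[reducible] noncomputable def System.openExperiment (Y : System N) (b : Bool) (ℓ : ℕ) : Game where
  State := ExpState
  start := (Y.setup ℓ).map fun s => (s, .pair s.pp (.pair s.skRS (.pair s.pkRS s.store.db)))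
  respond := Y.answer b ℓ

theorem answer_card {st : CardState} {g : Stage} {m : Val} (hs : s.session = some (st, g)) :
    Y.answer b ℓ s (.pair (.nat 4) m) = (Y.spend ℓ s.pp st s.store g m).map
      (({ s with rewound := s.rewound || Y.rewinds ℓ g m }).afterCard st) := by
  simp only [System.answer, System.experiment, hs]

theorem answer_break {st : CardState} {g : Stage} {a : Val} (hs : s.session = some (st, g))
    (ha : ∀ m, a ≠ .pair (.nat 4) m) :
    Y.answer b ℓ s a = PMF.pure (s.afterCard st (.abort s.store [])) := by
  simp only [System.answer, System.experiment, hs]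

theorem answer_register {ids : Val} {bud : ℕ} (hs : s.session = none) :
    Y.answer b ℓ s (.pair (.nat 1) (.pair ids (.nat bud))) =
      if s.phase.isFree then Y.register ℓ s ids.toNats bud else PMF.pure (s, .nat 0) := by
  simp only [System.answer, System.experiment, hs]

theorem answer_open {tid : ℕ} (hs : s.session = none) :
    Y.answer b ℓ s (.pair (.nat 2) (.nat tid)) =
      match s.cards tid with
      | some st =>
        if s.phase.isFree && s.phase.allows st then
          PMF.pure ({ s with session := some (st, .start) }, .nat 1)
        else PMF.pure (s, .nat 0)
      | none => PMF.pure (s, .nat 0) := by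
  simp only [System.answer, System.experiment, hs]

theorem answer_announce {t₀ t₁ price ε : ℕ} (hs : s.session = none) :
    Y.answer b ℓ s
      (.pair (.nat 3) (.pair (.nat t₀) (.pair (.nat t₁) (.pair (.nat price) (.nat ε))))) =
      match s.phase with
      | .before =>
        match s.cards t₀, s.cards t₁ with
        | some st₀, some st₁ =>
          PMF.pure ({ s with
            phase := .first ⟨st₀, st₁, price, ε⟩
            session := some (bif b then st₁ else st₀, .start) }, .nat 1)
        | _, _ => PMF.pure ({ s with phase := .over none }, .nat 0)
      | _ => PMF.pure (s, .nat 0) := by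
  simp only [System.answer, System.experiment, hs]

theorem answer_second {x : Val} (hs : s.session = none) :
    Y.answer b ℓ s (.pair (.nat 5) x) =
      match s.phase with
      | .between c =>
        PMF.pure ({ s with
          phase := .second c
          session := some (bif b then c.st₀ else c.st₁, .start) }, .nat 1)
      | _ => PMF.pure (s, .nat 0) := by
  simp only [System.answer, System.experiment, hs]

theorem answer_guess {g : ℕ} (hs : s.session = none) :
    Y.answer b ℓ s (.pair (.nat 6) (.nat g)) =
      match s.phase with
      | .after => PMF.pure ({ s with phase := .over (some (g != 0)) }, .nat 0)
      | _ => PMF.pure (s, .nat 0) := by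
  simp only [System.answer, System.experiment, hs]

theorem answer_other {a : Val} (hs : s.session = none)
    (h₁ : ∀ ids bud, a ≠ .pair (.nat 1) (.pair ids (.nat bud)))
    (h₂ : ∀ tid, a ≠ .pair (.nat 2) (.nat tid))
    (h₃ : ∀ t₀ t₁ price ε,
      a ≠ .pair (.nat 3) (.pair (.nat t₀) (.pair (.nat t₁) (.pair (.nat price) (.nat ε)))))
    (h₅ : ∀ x, a ≠ .pair (.nat 5) x) (h₆ : ∀ g, a ≠ .pair (.nat 6) (.nat g)) :
    Y.answer b ℓ s a = PMF.pure (s, .nat 0) := by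
  simp only [System.answer, System.experiment, hs]

theorem afterCard_rewound (s : ExpState) (st : CardState) (mv : CardMove) :
    (s.afterCard st mv).1.rewound = s.rewound := by
  cases mv <;> rfl

/-- The experiment does not forget that the database has been rewound. -/
theorem answer_rewound {a : Val} {x : ExpState × Val} (hx : x ∈ (Y.answer b ℓ s a).support)
    (h : s.rewound = true) : x.1.rewound = true := by
  have hstay : ∀ y : ExpState × Val, x ∈ (PMF.pure y).support → y.1.rewound = s.rewound →
      x.1.rewound = true := by
    intro y hx hy
    rw [PMF.support_pure, Set.mem_singleton_iff] at hx
    rw [hx, hy, h]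
  simp only [System.answer, System.experiment] at hx
  split at hx
  · rw [PMF.mem_support_map_iff] at hx
    obtain ⟨mv, -, rfl⟩ := hx
    rw [afterCard_rewound]
    simp [h]
  · exact hstay _ hx (afterCard_rewound _ _ _)
  · split_ifs at hx
    · unfold System.register at hx
      split_ifs at hx
      · simp only [PMF.mem_support_bind_iff] at hx
        obtain ⟨r, -, σ, -, hx⟩ := hx
        split_ifs at hx
        · rw [PMF.mem_support_map_iff] at hx
          obtain ⟨c, -, rfl⟩ := hx
          split <;> exact h
        · exact hstay _ hx rfl
      · exact hstay _ hx rfl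
    · exact hstay _ hx rfl
  · split at hx
    · split_ifs at hx
      · exact hstay _ hx rfl
      · exact hstay _ hx rfl
    · exact hstay _ hx rfl
  · split at hx
    · split at hx
      · exact hstay _ hx rfl
      · exact hstay _ hx rfl
    · exact hstay _ hx rfl
  · split at hx
    · exact hstay _ hx rfl
    · exact hstay _ hx rfl
  · split at hx
    · exact hstay _ hx rfl
    · exact hstay _ hx rfl
  · exact hstay _ hx rfl

end Experiment

/-! ### The state of the experiment as a function of the state with ideal memory -/

def WPhase.real (st : ℕ → CardState) : WPhase → Phase
  | .before => .before
  | .first i₀ i₁ price ε => .first ⟨st i₀, st i₁, price, ε⟩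
  | .between i₀ i₁ price ε => .between ⟨st i₀, st i₁, price, ε⟩
  | .second i₀ i₁ price ε => .second ⟨st i₀, st i₁, price, ε⟩
  | .after => .after
  | .over r => .over r

/-- The state of the cards of household `i`. -/
def cardOf (w : Wallet) (o : ORAMState) (p : PRFState) (i : ℕ) : CardState :=
  ⟨w.skRS, w.pkRS, o.sk, p.key, i⟩

/-- The stage of a transaction of the experiment. -/
def System.realStage (Y : System N) (b : Bool) (ℓ : ℕ) (w : Wallet) (o : ORAMState) (p : PRFState)
    (s : WSession) : Stage :=
  match s.stage, o.session with
  | .reading price ε, some (a, c) => .reading price ε a c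
  | .writing price ε r coin, some (a, c) => .writing price ε (Y.payProof ℓ w price ε r coin
      (Y.prf.apply ℓ p.key (tokenInput ℓ (s.household b) (w.payer b s)))) a c
  | _, _ => .start

/-- The state of the experiment that belongs to a state of the experiment with ideal memory. -/
def System.real (Y : System N) (b : Bool) (ℓ : ℕ) (w : Wallet) (o : ORAMState) (p : PRFState) :
    ExpState where
  pp := w.pp
  skRS := w.skRS
  pkRS := w.pkRS
  skT := o.sk
  K := p.key
  store := o.store
  nextId := w.nextId
  cards t := (w.cards.lookup t).map (cardOf w o p)
  phase := w.phase.real (cardOf w o p)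
  session := w.session.map fun s => (cardOf w o p (s.household b), Y.realStage b ℓ w o p s)
  rewound := o.rewound

def WPhase.result : WPhase → Option Bool
  | .over r => r
  | _ => none

/-- The ORAM access that belongs to a stage. -/
def Wallet.Expects (b : Bool) (ℓ : ℕ) (w : Wallet) (o : ORAMState) (s : WSession) : Prop :=
  match s.stage with
  | .start => True
  | .reading _ _ => ∃ a c, o.session = some (a, c) ∧ a.op = .read (s.household b)
  | .writing price _ _ _ => ∃ a c, o.session = some (a, c) ∧
      a.op = .write (s.household b) (payBlock ℓ price (w.payer b s))

/-- The ORAM has worked so far, and its blocks hold the records. -/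
structure MemInv (b : Bool) (ℓ : ℕ) (w : Wallet) (o : ORAMState) : Prop where
  reg : w.Registered
  wrong : o.wrong = false
  broken : o.broken = false
  rewound : o.rewound = false
  mem : ∀ j < w.nextId,
    o.mem j = some (record ℓ (getRec (w.recs b) j).1 (getRec (w.recs b) j).2)
  ctr : ∀ j, (getRec (w.recs b) j).2 < 2 ^ ℓ
  guess : o.guess = w.phase.result

/-- The state of the experiment is determined by the simulated one. In particular, the proof that a
real card prepares before writing is recovered from the stored randomness and the token for the
current record. -/
def RealRel (Y : System N) (b : Bool) (ℓ : ℕ) (s : ExpState)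
    (t : Wallet × (ORAMState × PRFState)) : Prop :=
  s = Y.real b ℓ t.1 t.2.1 t.2.2 ∧ MemInv b ℓ t.1 t.2.1 ∧
    ∀ u, t.1.session = some u → t.1.Expects b ℓ t.2.1 u

/-- The ORAM has failed, or the database has been rewound in both games. -/
def RealLost (s : ExpState) (t : Wallet × (ORAMState × PRFState)) : Prop :=
  t.2.1.wrong = true ∨ t.2.1.broken = true ∨ (s.rewound = true ∧ t.2.1.rewound = true)

def RealAnswer (Y : System N) (b : Bool) (ℓ : ℕ) (x : ExpState × Val)
    (y : (Wallet × (ORAMState × PRFState)) × Val) : Prop :=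
  (RealRel Y b ℓ x.1 y.1 ∧ x.2 = y.2) ∨ RealLost x.1 y.1

theorem WPhase.real_next (st : ℕ → CardState) (ph : WPhase) (ok : Option (ℕ × ℕ)) :
    (ph.next ok).real st = (ph.real st).next ok := by
  cases ph <;> simp only [WPhase.next, WPhase.real, Phase.next] <;> split_ifs <;> rfl

theorem WPhase.result_next {ph : WPhase} (ok : Option (ℕ × ℕ)) :
    (ph.next ok).result = ph.result := by
  cases ph <;> simp only [WPhase.next] <;> split_ifs <;> rfl

theorem WPhase.real_isFree (st : ℕ → CardState) (ph : WPhase) :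
    (ph.real st).isFree = ph.isFree := by
  cases ph <;> rfl

theorem WPhase.real_allows (w : Wallet) (o : ORAMState) (p : PRFState) (ph : WPhase) (i : ℕ) :
    (ph.real (cardOf w o p)).allows (cardOf w o p i) = ph.allows i := by
  cases ph <;> rfl

theorem assignIds_eq (st : ℕ → CardState) (i : ℕ) (ids : List ℕ) (T : List (ℕ × ℕ)) :
    assignIds (st i) ids (fun t => (T.lookup t).map st) =
      (fun t => ((assignCards i ids T).1.lookup t).map st, (assignCards i ids T).2) := by
  induction ids generalizing T with
  | nil => rfl
  | cons t ids ih =>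
    unfold assignIds assignCards
    rcases h : T.lookup t with _ | j
    · have : Function.update (fun t => (T.lookup t).map st) t (some (st i)) =
          fun t' => (((t, i) :: T).lookup t').map st := by
        funext t'
        rw [List.lookup_cons]
        by_cases ht : t' = t
        · simp [ht]
        · have : (t' == t) = false := by simpa using ht
          simp [ht, this]
      simp only [h, Option.map_none, this, ih]
    · simp only [h, Option.map_some, ih]

theorem record_div {ℓ : ℕ} (x y : ℕ) : record ℓ x y / 2 ^ ℓ = x := by
  unfold record
  rw [mul_comm, Nat.mul_add_div (Nat.two_pow_pos ℓ), Nat.div_eq_of_lt (Nat.mod_lt _ (Nat.two_pow_pos ℓ)),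
    add_zero]

/-- The card recovers the counter only if it fits its field; the invariant keeps all counters below
`2 ^ ℓ` for this reason. -/
theorem record_mod {ℓ x y : ℕ} (h : y < 2 ^ ℓ) : record ℓ x y % 2 ^ ℓ = y := by
  unfold record
  rw [mul_comm, Nat.mul_add_mod, Nat.mod_mod, Nat.mod_eq_of_lt h]

def CardMove.prependAll (pre : List Val) (m : CardMove) : CardMove := pre.foldr CardMove.prepend m

@[simp] theorem CardMove.prependAll_running (pre : List Val) (g : Stage) (S : Store)
    (l : List Val) :
    (CardMove.running g S l).prependAll pre = .running g S (pre ++ l) := by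
  induction pre with
  | nil => rfl
  | cons c pre ih => simpa [prependAll, prepend] using congrArg (CardMove.prepend c) ih

@[simp] theorem CardMove.prependAll_success (pre : List Val) (p ε : ℕ) (S : Store)
    (l : List Val) :
    (CardMove.success p ε S l).prependAll pre = .success p ε S (pre ++ l) := by
  induction pre with
  | nil => rfl
  | cons c pre ih => simpa [prependAll, prepend] using congrArg (CardMove.prepend c) ih

@[simp] theorem CardMove.prependAll_abort (pre : List Val) (S : Store) (l : List Val) :
    (CardMove.abort S l).prependAll pre = .abort S (pre ++ l) := by
  induction pre with
  | nil => rfl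
  | cons c pre ih => simpa [prependAll, prepend] using congrArg (CardMove.prepend c) ih

/-! ### One message in the experiment and with ideal memory -/

section Step
variable {Y : System N} {b : Bool} {ℓ : ℕ} {w : Wallet} {o : ORAMState} {p : PRFState}

theorem MemInv.close (h : MemInv b ℓ w o) (o' : ORAMState) (h₁ : o'.wrong = false)
    (h₂ : o'.broken = false) (h₃ : o'.rewound = o.rewound) (h₄ : o'.mem = o.mem)
    (h₅ : o'.guess = o.guess) (ok : Option (ℕ × ℕ)) : MemInv b ℓ (w.close ok) o' where
  reg := ⟨h.reg.cards, h.reg.phase.next _, by simp [Wallet.close]⟩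
  wrong := h₁
  broken := h₂
  rewound := h₃.trans h.rewound
  mem := by rw [h₄]; cases b <;> exact h.mem
  ctr := by cases b <;> exact h.ctr
  guess := by rw [h₅, h.guess]; exact (WPhase.result_next ok).symm

theorem MemInv.set_session (h : MemInv b ℓ w o) {s s' : WSession} (hs : w.session = some s)
    (hi : s'.i₀ = s.i₀) (hi' : s'.i₁ = s.i₁) (x : Option (Access × Val)) :
    MemInv b ℓ { w with session := some s' } { o with session := x } where
  reg := by
    refine ⟨h.reg.cards, h.reg.phase, ?_⟩
    have := h.reg.session s hs
    rintro t ⟨⟩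
    rwa [hi, hi']
  wrong := h.wrong
  broken := h.broken
  rewound := h.rewound
  mem := by cases b <;> exact h.mem
  ctr := by cases b <;> exact h.ctr
  guess := h.guess

theorem real_close (w : Wallet) (o : ORAMState) (p : PRFState) (o' : ORAMState) (hsk : o'.sk = o.sk)
    (hr : o'.rewound = o.rewound) (ok : Option (ℕ × ℕ)) :
    Y.real b ℓ (w.close ok) o' p = { Y.real b ℓ w o p with
      store := o'.store
      session := none
      phase := (Y.real b ℓ w o p).phase.next ok } := by
  have hc : cardOf (w.close ok) o' p = cardOf w o p := by
    funext i
    simp [cardOf, hsk, Wallet.close]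
  unfold System.real
  rw [hc]
  simp [Wallet.close, WPhase.real_next, hsk, hr]

theorem real_pay (w : Wallet) (o : ORAMState) (p : PRFState) (o' : ORAMState) (hsk : o'.sk = o.sk)
    (hr : o'.rewound = o.rewound) (i₀ i₁ price ε : ℕ) :
    Y.real b ℓ (w.pay ℓ i₀ i₁ price ε) o' p = { Y.real b ℓ w o p with
      store := o'.store
      session := none
      phase := (Y.real b ℓ w o p).phase.next (some (price, ε)) } := by
  have hc : cardOf (w.pay ℓ i₀ i₁ price ε) o' p = cardOf w o p := by
    funext i
    simp [cardOf, hsk, Wallet.pay]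
  unfold System.real
  rw [hc]
  simp [Wallet.pay, WPhase.real_next, hsk, hr]

/-- The block written by the card is the encoding of the new record, so memory and table are changed
in the same place by the same value. -/
theorem MemInv.pay (h : MemInv b ℓ w o) (o' : ORAMState) (s : WSession) {price : ℕ}
    (h₁ : o'.wrong = false) (h₂ : o'.broken = false) (h₃ : o'.rewound = o.rewound)
    (h₄ : o'.mem = Function.update o.mem (s.household b)
      (some (payBlock ℓ price (w.payer b s))))
    (h₅ : o'.guess = o.guess) (ε : ℕ) : MemInv b ℓ (w.pay ℓ s.i₀ s.i₁ price ε) o' where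
  reg := h.reg.pay _ _ _ _ _
  wrong := h₁
  broken := h₂
  rewound := h₃.trans h.rewound
  mem j hj := by
    rw [h₄, Wallet.recs_pay, getRec_cons]
    by_cases hji : j = s.household b
    · rw [if_pos hji, hji, Function.update_self]
      rfl
    · rw [if_neg hji, Function.update_of_ne hji]
      exact h.mem j hj
  ctr j := by
    rw [Wallet.recs_pay, getRec_cons]
    split_ifs
    · exact Nat.mod_lt _ (Nat.two_pow_pos ℓ)
    · exact h.ctr j
  guess := by rw [h₅, h.guess]; exact (WPhase.result_next _).symm

end Step

section Step
variable {Y : System N} {b : Bool} {ℓ : ℕ} {w : Wallet} {o : ORAMState} {p : PRFState}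

/-- The proof prepared by the real card is the one that the simulator forms at the end, because the
keyed function is deterministic and the record of the payer is unchanged until then. `S₀` and `x₀`
are arbitrary, since the end of the step overwrites store and session. -/
theorem real_cardWrite (h : MemInv b ℓ w o) {s : WSession} (hs : w.session = some s)
    {price ε r coin : ℕ} {op : Op}
    (hop : op = .write (s.household b) (payBlock ℓ price (w.payer b s))) {res : AccessResult}
    (hres : ∀ a c, res = .wait a c → a.op = op) (pre : List Val) (S₀ : Store)
    (x₀ : Option (CardState × Stage)) :
    Coupled (RealAnswer Y b ℓ)
      (PMF.pure (({ Y.real b ℓ w o p with store := S₀, session := x₀ } : ExpState).afterCard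
        (cardOf w o p (s.household b))
        ((afterWrite price ε (Y.payProof ℓ w price ε r coin
          (Y.prf.apply ℓ p.key (tokenInput ℓ (s.household b) (w.payer b s)))) o.store
            res).prependAll pre)))
      (Y.finish (Y.prf.answer false ℓ) b ℓ p
        (cardWrite w o op s.i₀ s.i₁ price ε r coin pre res)) := by
  cases res with
  | wait a c =>
    refine Coupled.pure (Or.inl ⟨⟨?_, ?_, ?_⟩, ?_⟩)
    · simp only [afterWrite, CardMove.prependAll_running, ExpState.afterCard, ORAMState.after]
      cases b <;> rfl
    · exact h.set_session (s' := ⟨s.i₀, s.i₁, .writing price ε r coin⟩) hs rfl rfl (some (a, c))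
    · rintro u ⟨⟩
      exact ⟨a, c, rfl, (hres a c rfl).trans (by rw [hop]; cases b <;> rfl)⟩
    · simp only [afterWrite, CardMove.prependAll_running, ExpState.afterCard]
  | fail t =>
    refine Coupled.pure ?_
    cases t with
    | false =>
      -- A refusal although all replies were honest is a failure of correctness; the pair of runs is
      -- given up. After a tampered reply a refusal is legitimate and aborts both transactions.
      refine Or.inr (Or.inl ?_)
      simp [ORAMState.after, h.rewound, h.broken]
    | true =>
      refine Or.inl ⟨⟨?_, ?_, by simp [Wallet.close]⟩, ?_⟩
      · dsimp only
        rw [real_close w o p _ (by rfl) (by rfl)]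
        simp only [afterWrite, CardMove.prependAll_abort, ExpState.afterCard]
        rfl
      · exact h.close (o.after op (.fail true)).1 (by simp [ORAMState.after, h.wrong]) h.broken
          rfl rfl rfl none
      · simp [afterWrite, ExpState.afterCard]
  | done db c out t =>
    simp only [System.finish, cardWrite, PRF.answer, Bool.false_eq_true, if_false, PMF.pure_map,
      tokenInput_payer]
    refine Coupled.pure ?_
    cases t with
    | true =>
      -- The client has accepted an access with a tampered reply, which is a failure of integrity.
      refine Or.inr (Or.inr (Or.inl ?_))
      simp [ORAMState.after, h.rewound]
    | false =>
      refine Or.inl ⟨⟨?_, ?_, by simp [Wallet.pay]⟩, ?_⟩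
      · dsimp only
        rw [real_pay w o p _ (by rfl) (by rfl)]
        simp only [afterWrite, CardMove.prependAll_success, ExpState.afterCard]
        rfl
      · refine h.pay (o.after op (.done db c out false)).1 s ?_ ?_ rfl ?_ rfl ε
        · simp [ORAMState.after, h.wrong, hop]
        · simp [ORAMState.after, h.broken]
        · simp [ORAMState.after, hop]
      · simp [afterWrite, ExpState.afterCard]

theorem payOp_eq (w : Wallet) (s : WSession) (price : ℕ) :
    payOp ℓ w b s.i₀ s.i₁ price =
      .write (s.household b) (payBlock ℓ price (w.payer b s)) := by
  cases b <;> rfl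

/-- An untampered read of the right value raises no flag, and reads do not change the memory. -/
theorem MemInv.after_read (h : MemInv b ℓ w o) {db c out : Val} {i : ℕ} {t : Bool}
    (ht : t = false) {d : ℕ} (hd : o.mem i = some d) (hout : out = .nat d) :
    MemInv b ℓ w (o.after (.read i) (.done db c out t)).1 where
  reg := h.reg
  wrong := by simp [ORAMState.after, h.wrong, hd, hout]
  broken := by simp [ORAMState.after, h.broken, ht]
  rewound := h.rewound
  mem := h.mem
  ctr := h.ctr
  guess := h.guess

/-- A transaction, from the moves of the client in the read access on. -/
theorem real_cardRead (h : MemInv b ℓ w o) {s : WSession} (hs : w.session = some s)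
    {price ε : ℕ} {op : Op} (hop : op = .read (s.household b)) {res : AccessResult}
    (hres : ∀ a c, res = .wait a c → a.op = op) :
    Coupled (RealAnswer Y b ℓ)
      ((Y.afterRead ℓ w.pp (cardOf w o p (s.household b)) price ε o.store res).map
        ((Y.real b ℓ w o p).afterCard (cardOf w o p (s.household b))))
      ((Y.cardRead b b ℓ w o op s.i₀ s.i₁ price ε res).bind
        (Y.finish (Y.prf.answer false ℓ) b ℓ p)) := by
  cases res with
  | wait a c =>
    simp only [System.afterRead, System.cardRead, PMF.pure_map, PMF.pure_bind]
    refine Coupled.pure (Or.inl ⟨⟨?_, ?_, ?_⟩, rfl⟩)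
    · simp only [ExpState.afterCard, ORAMState.after]
      cases b <;> rfl
    · exact h.set_session (s' := ⟨s.i₀, s.i₁, .reading price ε⟩) hs rfl rfl (some (a, c))
    · rintro u ⟨⟩
      exact ⟨a, c, rfl, (hres a c rfl).trans hop⟩
  | fail t =>
    simp only [System.afterRead, System.cardRead, PMF.pure_map, PMF.pure_bind]
    refine Coupled.pure ?_
    cases t with
    | false =>
      refine Or.inr (Or.inl ?_)
      simp [ORAMState.after, h.rewound, h.broken]
    | true =>
      refine Or.inl ⟨⟨?_, ?_, by simp [Wallet.close]⟩, rfl⟩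
      · dsimp only
        rw [real_close w o p _ (by rfl) (by rfl)]
        rfl
      · exact h.close (o.after op (.fail true)).1 (by simp [ORAMState.after, h.wrong]) h.broken
          rfl rfl rfl none
  | done db c out t =>
    -- If the end of the read access raises a flag, the rest of the step cannot lower it, so
    -- whatever the two cards do next, the pair is lost. This covers tampering as well as wrong
    -- values; in the remaining case the card has read exactly the record in the table.
    have hlost : (o.after op (.done db c out t)).1.wrong = true ∨
        (o.after op (.done db c out t)).1.broken = true →
        Coupled (RealAnswer Y b ℓ)
          ((Y.afterRead ℓ w.pp (cardOf w o p (s.household b)) price ε o.store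
            (.done db c out t)).map
            ((Y.real b ℓ w o p).afterCard (cardOf w o p (s.household b))))
          ((Y.cardRead b b ℓ w o op s.i₀ s.i₁ price ε (.done db c out t)).bind
            (Y.finish (Y.prf.answer false ℓ) b ℓ p)) := by
      intro hl
      refine Coupled.prod fun x _ y hy => Or.inr ?_
      obtain ⟨o', ho', hy⟩ := (PMF.mem_support_bind_iff _ _ _).1 hy
      have hf := cardRead_flags ho'
      rw [← finish_oram hy] at hf
      rcases hl with hl | hl
      · exact Or.inl (hf.wrong hl)
      · exact Or.inr (Or.inl (hf.broken hl))
    have hmem := h.mem _ (WSession.household_lt h.reg hs b)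
    subst hop
    rcases t.eq_false_or_eq_true with ht | ht
    · exact hlost (Or.inr (by simp [ORAMState.after, h.rewound, ht]))
    · by_cases hout : out = .nat (record ℓ (getRec (w.recs b) (s.household b)).1
          (getRec (w.recs b) (s.household b)).2)
      · have hI := h.after_read (db := db) (c := c) ht hmem hout
        rw [← Wallet.payer_eq] at hout
        have hctr : (w.payer b s).2 < 2 ^ ℓ := h.ctr _
        have hcheck : getRec (w.recs b) (bif b then s.i₁ else s.i₀) = w.payer b s := rfl
        subst hout
        simp only [System.afterRead, System.cardRead, record_div, record_mod hctr, hcheck]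
        split_ifs with hlt
        · rw [PMF.pure_map, PMF.pure_bind]
          refine Coupled.pure (Or.inl ⟨⟨?_, ?_, by simp [Wallet.close]⟩, rfl⟩)
          · dsimp only
            rw [real_close w o p _ (by rfl) (by rfl)]
            rfl
          · exact hI.close _ hI.wrong hI.broken rfl rfl rfl none
        -- Both sides draw the commitment randomness, the coin of the signature and the coin of the
        -- client in this order. Postponing the token costs nothing, as the keyed token involves no
        -- sampling.
        · simp only [PMF.map_bind, PMF.bind_bind]
          refine Coupled.bind_same _ fun r _ => ?_
          unfold RandAlg.sample
          rw [PMF.bind_map]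
          refine Coupled.bind_same _ fun coin _ => ?_
          simp only [Function.comp_apply]
          rw [PMF.map_comp, PMF.bind_map]
          refine Coupled.bind_same _ fun x _ => ?_
          rw [payOp_eq]
          exact real_cardWrite (Y := Y) (p := p) (ε := ε) (r := r) (coin := coin) hI hs
            (price := price) rfl
            (res := Y.oram.move ℓ o.sk (Access.new (.write (s.household b)
              (payBlock ℓ price (w.payer b s))) x (o.store.commit db)))
            (fun a c ha => by rw [(ORAM.size_of_move_wait ha).2]; rfl) [c] o.store
            (Y.real b ℓ w o p).session
      · refine hlost (Or.inl ?_)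
        simp [ORAMState.after, h.rewound, h.broken, ht, hmem, hout]

end Step

section Step
variable {Y : System N} {b : Bool} {ℓ : ℕ} {w : Wallet} {o : ORAMState} {p : PRFState}

theorem MemInv.enroll (h : MemInv b ℓ w o) (hs : w.session = none) (hf : w.phase.isFree = true)
    (ids : List ℕ) (bud : ℕ) (db : Val) :
    MemInv b ℓ (w.enroll ids bud) (o.afterHonest w.nextId (record ℓ bud 0) (some db)) where
  reg := h.reg.move (b := b) (.enroll ids bud hs hf)
  wrong := h.wrong
  broken := h.broken
  rewound := h.rewound
  mem j hj := by
    rw [Wallet.recs_enroll, getRec_cons]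
    simp only [ORAMState.afterHonest]
    by_cases hji : j = w.nextId
    · rw [if_pos hji, hji, Function.update_self]
    · rw [if_neg hji, Function.update_of_ne hji]
      exact h.mem j (by have : j < w.nextId + 1 := hj; omega)
  ctr j := by
    rw [Wallet.recs_enroll, getRec_cons]
    split_ifs
    · exact Nat.two_pow_pos ℓ
    · exact h.ctr j
  guess := h.guess

theorem MemInv.expects_none (hs : w.session = none) :
    ∀ u, w.session = some u → w.Expects b ℓ o u := by
  simp [hs]

/-- Registrations are served honestly. A failing write is therefore already a failure of
correctness, and a successful one puts the announced budget into block and table alike. -/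
theorem real_register (h : MemInv b ℓ w o) (hs : w.session = none) (hf : w.phase.isFree = true)
    (ids : List ℕ) (bud : ℕ) :
    Coupled (RealAnswer Y b ℓ) (Y.register ℓ (Y.real b ℓ w o p) ids bud)
      ((Y.walletRegister ℓ w o ids bud).bind (Y.finish (Y.prf.answer false ℓ) b ℓ p)) := by
  have hstay : ∀ m, Coupled (RealAnswer Y b ℓ) (PMF.pure (Y.real b ℓ w o p, m))
      ((PMF.pure (Out.done w o m)).bind (Y.finish (Y.prf.answer false ℓ) b ℓ p)) := by
    intro m
    rw [PMF.pure_bind]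
    exact Coupled.pure (Or.inl ⟨⟨rfl, h, MemInv.expects_none hs⟩, rfl⟩)
  unfold System.register System.walletRegister
  by_cases hc : w.nextId < N ℓ ∧ bud < 2 ^ ℓ
  · refine (if_pos hc).symm ▸ ?_
    rw [if_pos hc, PMF.bind_bind]
    refine Coupled.bind_same _ fun r _ => ?_
    unfold RandAlg.sample
    rw [PMF.bind_map, PMF.bind_bind]
    refine Coupled.bind_same _ fun coin _ => ?_
    simp only [Function.comp_apply]
    by_cases hacc : Y.ds.accepts ℓ w.pkRS (.nat r)
        (Y.ds.sign.out ℓ (.pair w.skRS (.nat r)) coin) = true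
    · refine (if_pos hacc).symm ▸ ?_
      rw [if_pos hacc, PMF.bind_map]
      refine Coupled.bind_same _ fun x _ => ?_
      simp only [Function.comp_apply]
      change Coupled _ (PMF.pure (match (Y.oram.honestRun ℓ o.sk (polyBound Y.oram.deg ℓ)
        (Y.oram.move ℓ o.sk
          (Access.new (.write w.nextId (record ℓ bud 0)) x o.store))).1 with
        | some db => _
        | none => _)) _
      rcases hrun : (Y.oram.honestRun ℓ o.sk (polyBound Y.oram.deg ℓ)
        (Y.oram.move ℓ o.sk
          (Access.new (.write w.nextId (record ℓ bud 0)) x o.store))).1 with _ | db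
      -- The honest write access has failed, which the bookkeeping counts as `wrong`.
      · refine Coupled.pure (Or.inr (Or.inl ?_))
        simp [ORAMState.afterHonest, h.rewound, h.broken]
      · refine Coupled.pure (Or.inl ⟨⟨?_, h.enroll hs hf ids bud db, MemInv.expects_none hs⟩, ?_⟩)
        · refine (congrArg (fun q : (ℕ → Option CardState) × List Val =>
            ({ Y.real b ℓ w o p with
              store := o.store.commit db
              nextId := w.nextId + 1
              cards := q.1 } : ExpState))
            (assignIds_eq (cardOf w o p) w.nextId ids w.cards)).trans ?_
          simp only [System.real, ORAMState.afterHonest, hs, Option.map_none]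
          rfl
        · exact congrArg (fun q : (ℕ → Option CardState) × List Val =>
            Val.pair (.nat 1) (.pair (Val.list q.2) (Val.list (.nat w.nextId :: w.skRS :: .nat bud ::
              (Y.oram.honestRun ℓ o.sk (polyBound Y.oram.deg ℓ) (Y.oram.move ℓ o.sk
                (Access.new (.write w.nextId (record ℓ bud 0)) x o.store))).2))))
            (assignIds_eq (cardOf w o p) w.nextId ids w.cards)
    · refine (if_neg hacc).symm ▸ ?_
      rw [if_neg hacc]
      exact hstay _
  · refine (if_neg hc).symm ▸ ?_
    rw [if_neg hc]
    exact hstay _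

theorem MemInv.set_phase (h : MemInv b ℓ w o) {w' : Wallet} (hreg : w'.Registered)
    (hrec : w'.recs b = w.recs b) (hn : w'.nextId = w.nextId) (hg : w'.phase.result = none)
    (hg' : o.guess = none) : MemInv b ℓ w' o where
  reg := hreg
  wrong := h.wrong
  broken := h.broken
  rewound := h.rewound
  mem := by rw [hrec, hn]; exact h.mem
  ctr := by rw [hrec]; exact h.ctr
  guess := hg'.trans hg.symm

/-- A message outside a transaction. -/
theorem real_free (h : MemInv b ℓ w o) (hs : w.session = none) (a : Val) :
    Coupled (RealAnswer Y b ℓ) (Y.answer b ℓ (Y.real b ℓ w o p) a)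
      ((Y.walletFree ℓ w o a).bind (Y.finish (Y.prf.answer false ℓ) b ℓ p)) := by
  have hses : (Y.real b ℓ w o p).session = none := by simp [System.real, hs]
  have hcards : ∀ t, (Y.real b ℓ w o p).cards t = (w.cards.lookup t).map (cardOf w o p) :=
    fun _ => rfl
  have hphase : (Y.real b ℓ w o p).phase = w.phase.real (cardOf w o p) := rfl
  have hstay : Coupled (RealAnswer Y b ℓ) (PMF.pure (Y.real b ℓ w o p, .nat 0))
      ((PMF.pure (Out.done w o (.nat 0))).bind (Y.finish (Y.prf.answer false ℓ) b ℓ p)) := by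
    rw [PMF.pure_bind]
    exact Coupled.pure (Or.inl ⟨⟨rfl, h, MemInv.expects_none hs⟩, rfl⟩)
  have hgo : ∀ {w' : Wallet} {s' : ExpState} {m : Val}, Wallet.Move b w w' →
      w'.recs b = w.recs b → w'.nextId = w.nextId → w'.phase.result = none → o.guess = none →
      s' = Y.real b ℓ w' o p → (∀ u, w'.session = some u → u.stage = .start) →
      Coupled (RealAnswer Y b ℓ) (PMF.pure (s', m))
        ((PMF.pure (Out.done w' o m)).bind (Y.finish (Y.prf.answer false ℓ) b ℓ p)) := by
    intro w' s' m h₁ h₂ h₃ h₄ h₅ h₆ h₇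
    rw [PMF.pure_bind]
    refine Coupled.pure (Or.inl ⟨⟨h₆, h.set_phase (h.reg.move h₁) h₂ h₃ h₄ h₅, fun u hu => ?_⟩, rfl⟩)
    simp [Wallet.Expects, h₇ u hu]
  unfold System.walletFree
  split
  · rw [answer_register hses, hphase, WPhase.real_isFree]
    split_ifs with hf
    · exact real_register h hs hf _ _
    · exact hstay
  · rename_i tid
    rw [answer_open hses, hcards]
    rcases hl : w.cards.lookup tid with _ | i
    · exact hstay
    · simp only [Option.map_some, hphase, WPhase.real_isFree, WPhase.real_allows]
      split_ifs with hf
      · have hf' : w.phase.isFree = true ∧ w.phase.allows i = true := by simpa using hf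
        have hres : w.phase.result = none := by
          cases hq : w.phase <;> first | rfl | simp [hq, WPhase.isFree] at hf'
        refine hgo (w' := { w with session := some ⟨i, i, .start⟩ })
          (.openCard hs hl hf'.1 hf'.2) (by cases b <;> rfl) rfl hres (h.guess.trans hres) ?_ ?_
        · cases b <;> rfl
        · rintro u ⟨⟩; rfl
      · exact hstay
  · rename_i t₀ t₁ price ε
    rw [answer_announce hses, hphase]
    cases hq : w.phase <;> try exact hstay
    have hg : o.guess = none := by rw [h.guess, hq]; rfl
    simp only [WPhase.real, hcards]
    rcases hl₀ : w.cards.lookup t₀ with _ | i₀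
    · refine hgo (w' := { w with phase := .over none }) (.giveUp hs hq) (by cases b <;> rfl) rfl rfl hg
        ?_ (by simp [hs])
      simp only [System.real, hs, Option.map_none]
      rfl
    · rcases hl₁ : w.cards.lookup t₁ with _ | i₁
      · refine hgo (w' := { w with phase := .over none }) (.giveUp hs hq) (by cases b <;> rfl) rfl rfl
          hg ?_ (by simp [hs])
        simp only [System.real, hs, Option.map_none]
        rfl
      · refine hgo (w' := { w with
            phase := .first i₀ i₁ price ε
            session := some ⟨i₀, i₁, .start⟩ }) (.announce price ε hs hq hl₀ hl₁)
            (by cases b <;> rfl) rfl rfl hg ?_ ?_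
        · cases b <;> rfl
        · rintro u ⟨⟩; rfl
  · rw [answer_second hses, hphase]
    cases hq : w.phase <;> try exact hstay
    rename_i i₀ i₁ price ε
    have hg : o.guess = none := by rw [h.guess, hq]; rfl
    refine hgo (w' := { w with
            phase := .second i₀ i₁ price ε
            session := some ⟨i₁, i₀, .start⟩ }) (.second hs hq)
            (by cases b <;> rfl) rfl rfl hg ?_ ?_
    · cases b <;> rfl
    · rintro u ⟨⟩; rfl
  · rename_i g
    rw [answer_guess hses, hphase]
    cases hq : w.phase <;> try exact hstay
    rw [PMF.pure_bind]
    refine Coupled.pure (Or.inl ⟨⟨?_, ?_, by simp [hs]⟩, rfl⟩)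
    · simp only [System.real, hs, Option.map_none]
      rfl
    · exact ⟨h.reg.move (b := b) (.guess _ hs hq), h.wrong, h.broken, h.rewound,
        by cases b <;> exact h.mem, by cases b <;> exact h.ctr, rfl⟩
  · rename_i h₁ h₂ h₃ h₅ h₆
    rw [answer_other hses]
    · exact hstay
    all_goals assumption

/-- A reply that rewinds is seen at the same moment in both games, since they hold the same access.
From then on neither correctness nor integrity promises anything, and the pair is given up. -/
theorem real_lost {D : PMF (ExpState × Val)}
    {out : PMF Out} (h₁ : ∀ x ∈ D.support, x.1.rewound = true)
    (h₂ : ∀ x ∈ out.support, x.oram.rewound = true) :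
    Coupled (RealAnswer Y b ℓ) D (out.bind (Y.finish (Y.prf.answer false ℓ) b ℓ p)) := by
  refine Coupled.prod fun x hx y hy => Or.inr (Or.inr (Or.inr ⟨h₁ x hx, ?_⟩))
  obtain ⟨q, hq, hy⟩ := (PMF.mem_support_bind_iff _ _ _).1 hy
  rw [finish_oram hy]
  exact h₂ q hq

/-- Replies that rewind lose the pair; all others are handled by the comparison of the read or of
the write access. `Wallet.Expects` ensures that the ORAM challenger has the access which the real
card is executing. -/
theorem real_step (h : MemInv b ℓ w o) (he : ∀ u, w.session = some u → w.Expects b ℓ o u)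
    (a : Val) :
    Coupled (RealAnswer Y b ℓ) (Y.answer b ℓ (Y.real b ℓ w o p) a)
      ((Y.walletStep b b ℓ w o a).bind (Y.finish (Y.prf.answer false ℓ) b ℓ p)) := by
  rcases hs : w.session with _ | s
  · simp only [System.walletStep, hs]
    exact real_free h hs a
  have hses : (Y.real b ℓ w o p).session =
      some (cardOf w o p (s.household b), Y.realStage b ℓ w o p s) := by simp [System.real, hs]
  have habort : Coupled (RealAnswer Y b ℓ)
      (PMF.pure ((Y.real b ℓ w o p).afterCard (cardOf w o p (s.household b)) (.abort o.store [])))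
      ((PMF.pure (Out.done (w.close none) { o with session := none }
        (.pair (.nat 3) (Val.list [])))).bind (Y.finish (Y.prf.answer false ℓ) b ℓ p)) := by
    rw [PMF.pure_bind]
    refine Coupled.pure (Or.inl ⟨⟨?_, h.close { o with session := none } h.wrong h.broken rfl rfl rfl none,
      by simp [Wallet.close]⟩, rfl⟩)
    dsimp only
    rw [real_close w o p _ (by rfl) (by rfl)]
    rfl
  have he' := he s hs
  by_cases ha : ∃ m, a = .pair (.nat 4) m
  · obtain ⟨m, rfl⟩ := ha
    rw [answer_card hses]
    simp only [System.walletStep, hs]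
    -- Without rewinding the update of the flag changes neither state, so the lemmas about single
    -- accesses apply to the original states.
    have hrw : ∀ r : Bool, r = false → ({ o with rewound := o.rewound || r } : ORAMState) = o ∧
        ({ Y.real b ℓ w o p with rewound := (Y.real b ℓ w o p).rewound || r } : ExpState) =
          Y.real b ℓ w o p := by
      rintro r rfl
      constructor
      · cases o; simp
      · simp [System.real]
    rcases hst : s.stage with _ | ⟨price, ε⟩ | ⟨price, ε, r, coin⟩
    · have hrs : Y.realStage b ℓ w o p s = .start := by simp [System.realStage, hst]
      simp only [hrs, System.rewinds]
      rw [(hrw false rfl).2]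
      by_cases hm : ∃ price ε, m = .pair (.nat price) (.nat ε)
      · obtain ⟨price, ε, rfl⟩ := hm
        simp only [System.walletCard, hst, System.spend, PMF.map_bind, PMF.bind_bind]
        refine Coupled.bind_same _ fun x _ => ?_
        exact real_cardRead h hs rfl fun a c ha => by rw [(ORAM.size_of_move_wait ha).2]; rfl
      · have hsp : Y.spend ℓ (Y.real b ℓ w o p).pp (cardOf w o p (s.household b))
            (Y.real b ℓ w o p).store .start m = PMF.pure (.abort o.store []) := by
          unfold System.spend
          split
          · exact (hm ⟨_, _, rfl⟩).elim
          · rfl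
          all_goals simp_all
        have hwc : Y.walletCard b b ℓ w o s m = PMF.pure (.done (w.close none)
            { o with session := none } (.pair (.nat 3) (Val.list []))) := by
          unfold System.walletCard
          split
          · exact (hm ⟨_, _, rfl⟩).elim
          all_goals simp_all
        rw [hsp, hwc, PMF.pure_map]
        exact habort
    · simp only [Wallet.Expects, hst] at he'
      obtain ⟨acc, c, hos, hop⟩ := he'
      have hrs : Y.realStage b ℓ w o p s = .reading price ε acc c := by
        simp [System.realStage, hst, hos]
      simp only [hrs, System.rewinds, System.walletCard, hst, hos, System.spend]
      rcases hr : Y.oram.rewinds ℓ acc c m with _ | _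
      · rw [← hos, (hrw _ rfl).1, (hrw _ rfl).2, hop]
        exact real_cardRead h hs rfl fun a c ha => by rw [(ORAM.size_of_move_wait ha).2]; exact hop
      · refine real_lost ?_ ?_
        · intro x hx
          obtain ⟨mv, -, rfl⟩ := (PMF.mem_support_map_iff _ _ _).1 hx
          rw [afterCard_rewound]
          simp
        · intro x hx
          refine (cardRead_flags hx).rewound ((ORAMState.flagsLe_after _ _ _).rewound ?_)
          simp
    · simp only [Wallet.Expects, hst] at he'
      obtain ⟨acc, c, hos, hop⟩ := he'
      have hrs : Y.realStage b ℓ w o p s = .writing price ε (Y.payProof ℓ w price ε r coin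
          (Y.prf.apply ℓ p.key (tokenInput ℓ (s.household b) (w.payer b s)))) acc c := by
        simp [System.realStage, hst, hos]
      simp only [hrs, System.rewinds, System.walletCard, hst, hos, System.spend]
      rcases hr : Y.oram.rewinds ℓ acc c m with _ | _
      · rw [← hos, (hrw _ rfl).1, (hrw _ rfl).2, hop, PMF.pure_map, PMF.pure_bind]
        exact real_cardWrite h hs rfl (fun a c ha => by
          rw [(ORAM.size_of_move_wait ha).2]; exact hop) [] o.store (Y.real b ℓ w o p).session
      · refine real_lost ?_ ?_
        · intro x hx
          obtain ⟨mv, -, rfl⟩ := (PMF.mem_support_map_iff _ _ _).1 hx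
          rw [afterCard_rewound]
          simp
        · intro x hx
          rw [PMF.support_pure, Set.mem_singleton_iff] at hx
          rw [hx, cardWrite_oram]
          refine (ORAMState.flagsLe_after _ _ _).rewound ?_
          simp
  · rw [answer_break hses (fun m hm => ha ⟨m, hm⟩)]
    simp only [System.walletStep, hs]
    split
    · exact (ha ⟨_, rfl⟩).elim
    · exact habort

end Step

theorem RealRel.initial (Y : System N) (b : Bool) (ℓ : ℕ) (pp v K k : Val) :
    RealRel Y b ℓ
      ⟨pp, k.fst, k.snd, v.fst, K, ⟨v.snd, []⟩, 0, fun _ => none, .before, none, false⟩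
      (⟨pp, k.fst, k.snd, 0, [], [], [], .before, none⟩,
        (ORAMState.init v, ⟨K, fun _ => none, none⟩)) := by
  refine ⟨rfl, ⟨.initial _ _ _, rfl, rfl, rfl, fun j hj => absurd hj (Nat.not_lt_zero j), ?_, rfl⟩,
    by simp⟩
  intro j
  cases b <;> simp [Wallet.recs, getRec]

theorem RealRel.guessOne {Y : System N} {b : Bool} {ℓ : ℕ} {s : ExpState}
    {t : Wallet × (ORAMState × PRFState)} (h : RealRel Y b ℓ s t) :
    s.guessOne = (t.2.1.guess == some true) := by
  obtain ⟨rfl, h, -⟩ := h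
  rw [h.guess]
  unfold ExpState.guessOne System.real
  cases t.1.phase <;> try rfl
  rename_i r
  rcases r with _ | _ | _ <;> rfl

/-- The experiment and the experiment with ideal memory differ only if the ORAM fails. -/
theorem experiment_sub_walletGame_le (Y : System N) (b : Bool) (A : Adversary) (ℓ : ℕ) :
    |(Y.experiment b ℓ).prob A ℓ (fun s => s.guessOne && !s.rewound) -
      (Y.walletGame (Y.prf.answer false ℓ) b b ℓ).prob A ℓ
        (fun s => s.2.1.guess == some true && !s.2.1.rewound)| ≤
    (Y.walletGame (Y.prf.answer false ℓ) b b ℓ).prob A ℓ (fun s => s.2.1.wrong) +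
      (Y.walletGame (Y.prf.answer false ℓ) b b ℓ).prob A ℓ (fun s => s.2.1.broken) := by
  change |(Y.openExperiment b ℓ).prob A ℓ _ - _| ≤ _
  simp only [Game.prob_eq_pr]
  refine le_trans ?_ (pr_or_le _ _ _)
  refine (Game.run_coupled (X := Y.openExperiment b ℓ) (D := RealLost) (R := fun _ => RealRel Y b ℓ)
    ?_ ?_ (fun _ _ _ h => h) ?_).abs_pr_sub_le ?_
  · simp only [System.setup, PMF.map_bind, PMF.map_comp]
    -- The setup of the experiment draws the group before ORAM and PRF keys, the game with ideal
    -- memory after them; independent draws commute.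
    rw [PMF.bind_comm]
    refine Coupled.bind_same _ fun v _ => ?_
    rw [PMF.bind_comm]
    exact Coupled.bind_same _ fun K _ => Coupled.bind_same _ fun pp _ =>
      Coupled.map_same _ fun k _ => ⟨RealRel.initial Y b ℓ pp v K k, rfl⟩
  · rintro s t h a
    refine ⟨fun x hx => ?_, fun y hy => ?_⟩
    · exact h.imp_right (Or.imp_right fun h => ⟨answer_rewound hx h.1, h.2⟩)
    · have hf := walletGame_flags hy
      exact h.imp hf.wrong (Or.imp hf.broken (And.imp_right hf.rewound))
  · rintro i s ⟨w, o, p⟩ a - ⟨rfl, h, he⟩ - -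
    exact real_step h he a
  · rintro s t (h | h | h | h)
    · left
      rw [h.guessOne, h.1]
      rfl
    · simp [h]
    · simp [h]
    · simp [h.1, h.2]

/-! ### Negligible functions and the hops between the games -/

theorem Negligible.add {f g : ℕ → ℝ} (hf : Negligible f) (hg : Negligible g) :
    Negligible fun ℓ => f ℓ + g ℓ :=
  Asymptotics.SuperpolynomialDecay.add hf hg

theorem Negligible.of_le {f g : ℕ → ℝ} (hg : Negligible g) (hf : ∀ ℓ, 0 ≤ f ℓ)
    (h : ∀ᶠ ℓ in Filter.atTop, f ℓ ≤ g ℓ) : Negligible f := by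
  refine Asymptotics.SuperpolynomialDecay.trans_eventually_abs_le hg ?_
  filter_upwards [h] with ℓ hℓ
  simp only [Function.comp_apply]
  rw [abs_of_nonneg (hf ℓ)]
  exact hℓ.trans (le_abs_self _)

/-- For large `ℓ` the additive constant `d` is absorbed by one more factor, `ℓ ^ d + d ≤ ℓ ^ (d +
1)`, and any power is eventually below `2 ^ ℓ`. So counters do not wrap for almost all `ℓ`. -/
theorem eventually_polyBound_lt_two_pow (d : ℕ) :
    ∀ᶠ ℓ in Filter.atTop, polyBound d ℓ < 2 ^ ℓ := by
  have h := tendsto_pow_const_div_const_pow_of_one_lt (d + 1) (one_lt_two (α := ℝ))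
  filter_upwards [h.eventually (gt_mem_nhds one_pos), Filter.eventually_ge_atTop (d + 2)]
    with ℓ hℓ hd
  rw [div_lt_one (by positivity)] at hℓ
  have hℓ' : ℓ ^ (d + 1) < 2 ^ ℓ := by exact_mod_cast hℓ
  have h₁ : 1 ≤ ℓ ^ d := Nat.one_le_pow _ _ (by omega)
  unfold polyBound
  rw [pow_succ] at hℓ'
  nlinarith

/-- The probability that the adversary guesses `1` in the experiment with ideal memory, without
rewinding. -/
@[reducible] noncomputable def System.walletProb (Y : System N)
    (tok : ℕ → PRFState → Val → PMF (PRFState × Val)) (b β : Bool) (A : Adversary) (ℓ : ℕ) : ℝ :=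
  (Y.walletGame (tok ℓ) b β ℓ).prob A ℓ (fun s => s.2.1.guess == some true && !s.2.1.rewound)

section Hops
variable {Y : System N} (b β : Bool) (A : Adversary)

/-- The two machines turn `A` into an adversary of the ORAM game with bit `b`. It may know this bit
and produce keyed tokens itself, because correctness and integrity are promised for each bit
separately. -/
theorem negligible_walletGame_failure (hInt : Y.oram.HasIntegrity) (hCorr : Y.oram.Correct) :
    Negligible fun ℓ =>
      (Y.walletGame (Y.prf.answer false ℓ) b b ℓ).prob A ℓ (fun s => s.2.1.wrong) +
      (Y.walletGame (Y.prf.answer false ℓ) b b ℓ).prob A ℓ (fun s => s.2.1.broken) := by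
  obtain ⟨B, hB⟩ := exists_wallet_adversary Y b A
  obtain ⟨C, hC⟩ := exists_token_adversary Y.oram Y.prf false b B
  have h : ∀ ℓ (E : ORAMState → Bool),
      (Y.walletGame (Y.prf.answer false ℓ) b b ℓ).prob A ℓ (fun s => E s.2.1) =
        (Y.oram.game b ℓ).prob C ℓ E := fun ℓ E =>
    (hB _ _ _ _ _ (tokenBdd_answer Y false ℓ) (PRFState.Bdd.initial Y.prf ℓ)).trans
      (hC b (fun _ => rfl) ℓ E)
  simp only [h _ fun o => o.wrong, h _ fun o => o.broken]
  exact Negligible.add (hCorr C b) (hInt C b)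

/-- The condition of not having rewound is first added to the event, at the price of the probability
of rewinding in the experiment; after that only ORAM failures separate the two games. -/
theorem negligible_experiment_sub_walletGame (hInt : Y.oram.HasIntegrity)
    (hCorr : Y.oram.Correct) (hA : Y.NonRewinding A) :
    Negligible fun ℓ => |(Y.experiment b ℓ).prob A ℓ ExpState.guessOne -
      Y.walletProb (Y.prf.answer false) b b A ℓ| := by
  refine (Negligible.add (hA b) (negligible_walletGame_failure b A hInt hCorr)).of_le
    (fun _ => abs_nonneg _) (Filter.Eventually.of_forall fun ℓ => ?_)
  refine (abs_sub_le _ ((Y.experiment b ℓ).prob A ℓ (fun s => s.guessOne && !s.rewound)) _).trans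
    (add_le_add ?_ (experiment_sub_walletGame_le Y b A ℓ))
  refine (Coupled.refl _).abs_pr_sub_le ?_
  rintro s _ ⟨rfl, -⟩
  cases s.rewound <;> simp

/-- The adversary against the PRF plays both the wallets and the ORAM challenger. It meets the
random function with its memory, which for almost all `ℓ` is the same as fresh tokens. -/
theorem negligible_walletProb_prf (hPRF : Y.prf.Secure) :
    Negligible fun ℓ => |Y.walletProb (Y.prf.answer false) b β A ℓ -
      Y.walletProb (Y.prf.fresh) b β A ℓ| := by
  obtain ⟨B, hB⟩ := exists_wallet_adversary Y b A
  obtain ⟨C, hC⟩ := exists_prf_adversary Y.oram Y.prf β B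
  have h : ∀ ideal ℓ, Y.walletProb (Y.prf.answer ideal) b β A ℓ =
      (Y.prf.game ideal ℓ).prob C ℓ (fun s => s.guess == some true) := fun ideal ℓ =>
    (hB _ _ _ _ (fun o => o.guess == some true && !o.rewound) (tokenBdd_answer Y ideal ℓ)
      (PRFState.Bdd.initial Y.prf ℓ)).trans (hC ideal ℓ)
  refine (hPRF C).of_le (fun _ => abs_nonneg _) ?_
  filter_upwards [eventually_polyBound_lt_two_pow A.deg] with ℓ hℓ
  rw [← h false, ← h true]
  exact (congrArg (fun x => |_ - x|) (walletGame_ideal_eq_fresh Y b β A hℓ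
    fun o => o.guess == some true && !o.rewound).symm).le

/-- Fresh tokens are drawn without looking at either input, so the composed adversary is the same
for both values of `β` and need not know it. Obliviousness applies to it directly. -/
theorem negligible_walletProb_oblivious (hORAM : Y.oram.Oblivious) :
    Negligible fun ℓ => |Y.walletProb (Y.prf.fresh) b false A ℓ -
      Y.walletProb (Y.prf.fresh) b true A ℓ| := by
  obtain ⟨B, hB⟩ := exists_wallet_adversary Y b A
  obtain ⟨C, hC⟩ := exists_token_adversary Y.oram Y.prf true false B
  have h : ∀ β ℓ, Y.walletProb (Y.prf.fresh) b β A ℓ =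
      (Y.oram.game β ℓ).prob C ℓ (fun o => o.guess == some true && !o.rewound) := fun β ℓ =>
    (hB _ _ _ _ (fun o => o.guess == some true && !o.rewound) (tokenBdd_fresh Y ℓ)
      (PRFState.Bdd.initial Y.prf ℓ)).trans (hC β (fun h => by cases h) ℓ
      fun o => o.guess == some true && !o.rewound)
  simp only [h]
  exact hORAM C

end Hops

end AidWallet

theorem mainTheorem3 (N : ℕ → ℕ) (Y : AidWallet.System N)
    (hORAM : Y.oram.Oblivious) (hInt : Y.oram.HasIntegrity) (hCorr : Y.oram.Correct)
    (hPRF : Y.prf.Secure)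
    (A : AidWallet.Adversary) (hA : Y.NonRewinding A) :
    AidWallet.Negligible (fun ℓ => Y.advantage A ℓ) := by
  have h₁ := fun b => AidWallet.negligible_experiment_sub_walletGame b A hInt hCorr hA
  have h₂ := fun b => AidWallet.negligible_walletProb_prf b b A hPRF
  -- The accesses are switched while the cards still decide by the table of world `0`.
  have h₃ := AidWallet.negligible_walletProb_oblivious false A hORAM
  refine (((((h₁ false).add (h₂ false)).add h₃).add (h₂ true)).add (h₁ true)).of_le
    (fun _ => abs_nonneg _) (Filter.Eventually.of_forall fun ℓ => ?_)
  -- With the accesses of world `1` on both sides, the deciding table can be exchanged at no cost.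
  have h₄ : Y.walletProb Y.prf.fresh false true A ℓ = Y.walletProb Y.prf.fresh true true A ℓ :=
    AidWallet.walletGame_order Y (Y.prf.fresh ℓ) true A ℓ
  -- The last two distances are traversed backwards, from fresh tokens to the experiment with bit
  -- `true`, hence the reversed differences.
  have h₅ : ∀ x u f g v y : ℝ, |x - y| ≤ |x - u| + |u - f| + |f - g| + |v - g| + |y - v| := by
    intro x u f g v y
    rw [abs_sub_comm v, abs_sub_comm y]
    linarith [abs_sub_le x u y, abs_sub_le u f y, abs_sub_le f g y, abs_sub_le g v y]
  rw [h₄]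
  exact h₅ _ _ _ _ _ _
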